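/- Let $\omega$ be the Fubini–Study form on $\mathbb{CP}^2$, in the affine coordinates $x_j=z_j/z_0$ ($j=1,2$) equal to $\tfrac{i}{2}\partial\bar\partial\log(1+|x_1|^2+|x_2|^2)$. For $\epsilon>0$ let $b:\mathbb R\to\mathbb R$ be a smooth function with $b\ge 0$, $b(a)+b(-a)=1$ for all $a$, and $b(a)=0$ for $a\le-\epsilon$. Write $r_j=|x_j|$ and $$\rho_1=r_1^{\,b(\log r_1)},\qquad \rho_2=r_2^{\,b(\log r_2)},\qquad \rho_0=r_1\Bigl(\frac{r_2}{r_1}\Bigr)^{b(\log (r_2/r_1))}$$ (extended by their limits where some $r_j=0$: $\rho_j=1$ if $r_j=0$, and $\rho_0=r_2$ if $r_1=0$, $\rho_0=r_1$ if $r_2=0$), and for $t\in[0,1]$ let $$\mathcal F_t(x_1,x_2)=\Bigl(\Bigl(\frac{\rho_2}{\rho_0}\Bigr)^t x_1,\ \Bigl(\frac{\rho_1}{\rho_0}\Bigr)^t x_2\Bigr).$$ In homogeneous coordinates this is $\mathcal F_t[z_0:z_1:z_2]=[z_0M(|z_1|,|z_2|)^t: z_1M(|z_0|,|z_2|)^t: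 z_2M(|z_0|,|z_1|)^t]$ with $M(u,v)=u(v/u)^{b(\log(v/u))}$ for $u,v>0$, $M(0,v)=v$, $M(u,0)=u$, which defines $\mathcal F_t$ also at infinity, on all of $\mathbb{CP}^2$ except the three coordinate vertices. Let $S_0=\{z_0^5+z_1^5+z_2^5=0\}\subset\mathbb{CP}^2$ be the projective closure of $x_1^5+x_2^5+1=0$, and $S_t=\mathcal F_t(S_0)$ (for $t=0$ this is $S_0$ itself). For every constant $C$ there is $\epsilon_0>0$, depending only on $C$, such that the following holds for every $0<\epsilon<\epsilon_0$ and every $b$ as above with $|b(a)+a\,b'(a)|\le C$ for all $a$. (1) $S_t$ is symplectic for all $t\in[0,1]$, and $S_0$ is symplectically isotopic to $S_1$ via the family $S_t$: $S_0$ carries the structure of a smooth surface for which $(t,p)\mapsto\mathcal F_t(p)$ is smooth on $[0,1]\times S_0$, each $\mathcal F_t:S_0\to\mathbb{CP}^2$ is a smooth embedding, and $\omega$ is nondegenerate on its image $S_t$. (2) For every open neighborhood $U$ of $\bigcup_{t\in[0,1]}S_t$ there is a smooth Hamiltonian isotopy $h_t$ of $(\mathbb{CP}^2,\omega)$ (the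 flow, starting at $h_0=\mathrm{id}$, of the Hamiltonian vector fields of a smooth time-dependent function) such that for all $t\in[0,1]$: $h_t(S_0)=S_t$, $h_t$ is the identity outside $U$, and $h_t$ maps each of the three coordinate lines $\{z_k=0\}\cong\mathbb{CP}^1$ onto itself. -/

import Mathlib

open Set
open scoped Manifold ContDiff ComplexConjugate Topology

noncomputable section

namespace QuinticSmoothing

/-! ### The complex projective plane as a smooth real 4-manifold -/

/-- The complex projective plane. -/
abbrev CP2 : Type := Projectivization ℂ (Fin 3 → ℂ)

/-- The quotient topology of `ℂ³ ∖ {0} → CP²`. -/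
instance : TopologicalSpace CP2 :=
  TopologicalSpace.coinduced (fun v : {v : Fin 3 → ℂ // v ≠ 0} => Projectivization.mk ℂ v.1 v.2)
    inferInstance

/-- The projection `ℂ³ ∖ {0} → CP²`. -/
def proj (v : {v : Fin 3 → ℂ // v ≠ 0}) : CP2 := Projectivization.mk ℂ v.1 v.2

lemma isQuotientMap_proj : Topology.IsQuotientMap proj :=
  ⟨⟨rfl⟩, fun p => ⟨⟨p.rep, p.rep_nonzero⟩, p.mk_rep⟩⟩

lemma exists_rep_mk (v : Fin 3 → ℂ) (hv : v ≠ 0) :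
    ∃ a : ℂ, a ≠ 0 ∧ ∀ i, (Projectivization.mk ℂ v hv).rep i = a * v i := by
  obtain ⟨a, ha⟩ := Projectivization.exists_smul_eq_mk_rep ℂ v hv
  refine ⟨a, a.ne_zero, fun i => ?_⟩
  rw [← ha]
  rfl

lemma rep_mk_ne_zero_iff (v : Fin 3 → ℂ) (hv : v ≠ 0) (i : Fin 3) :
    (Projectivization.mk ℂ v hv).rep i ≠ 0 ↔ v i ≠ 0 := by
  obtain ⟨a, ha, h⟩ := exists_rep_mk v hv
  rw [h i]
  simp [ha]

/-- The affine coordinates `z_j / z_k` (`j ≠ k`, in increasing order) of a point of `CP²`. -/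
def affCoord (k : Fin 3) (p : CP2) : Fin 2 → ℂ := fun j => p.rep (k.succAbove j) / p.rep k

lemma affCoord_mk (k : Fin 3) (v : Fin 3 → ℂ) (hv : v ≠ 0) :
    affCoord k (Projectivization.mk ℂ v hv) = fun j => v (k.succAbove j) / v k := by
  obtain ⟨a, ha, h⟩ := exists_rep_mk v hv
  funext j
  simp only [affCoord, h]
  rw [mul_div_mul_left _ _ ha]

lemma insertNth_one_ne_zero (k : Fin 3) (x : Fin 2 → ℂ) :
    (k.insertNth (1 : ℂ) x : Fin 3 → ℂ) ≠ 0 := by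
  intro h
  have := congrFun h k
  simp at this

lemma isOpen_source (k : Fin 3) : IsOpen {p : CP2 | p.rep k ≠ 0} := by
  rw [← isQuotientMap_proj.isOpen_preimage]
  have : proj ⁻¹' {p : CP2 | p.rep k ≠ 0} = {v | v.1 k ≠ 0} := by
    ext v
    exact rep_mk_ne_zero_iff v.1 v.2 k
  rw [this]
  exact isOpen_ne_fun ((continuous_apply k).comp continuous_subtype_val) continuous_const

/-- The standard affine chart `{z_k ≠ 0} → ℂ²`, with inverse
`x ↦ [.. : 1 : ..]` (`1` in position `k`). -/
def affChart (k : Fin 3) : OpenPartialHomeomorph CP2 (Fin 2 → ℂ) where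
  toFun := affCoord k
  invFun x := Projectivization.mk ℂ (k.insertNth (1 : ℂ) x) (insertNth_one_ne_zero k x)
  source := {p | p.rep k ≠ 0}
  target := univ
  map_source' _ _ := mem_univ _
  map_target' x _ := by
    refine (rep_mk_ne_zero_iff _ (insertNth_one_ne_zero k x) k).2 ?_
    simp
  left_inv' p hp := by
    rw [← p.mk_rep, Projectivization.mk_eq_mk_iff']
    refine ⟨(p.rep k)⁻¹, ?_⟩
    have hp' : p.rep k ≠ 0 := hp
    funext i
    rcases Fin.eq_self_or_eq_succAbove k i with rfl | ⟨j, rfl⟩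
    · simp [hp']
    · simp [affCoord, div_eq_inv_mul]
  right_inv' x _ := by
    rw [affCoord_mk]
    funext j
    simp
  open_source := isOpen_source k
  open_target := isOpen_univ
  continuousOn_toFun := by
    rw [isQuotientMap_proj.continuousOn_isOpen_iff (isOpen_source k)]
    have h : ∀ v : {v : Fin 3 → ℂ // v ≠ 0},
        (affCoord k ∘ proj) v = fun j => v.1 (k.succAbove j) / v.1 k :=
      fun v => affCoord_mk k v.1 v.2
    refine ContinuousOn.congr (f := fun v : {v : Fin 3 → ℂ // v ≠ 0} =>
      fun j => v.1 (k.succAbove j) / v.1 k) ?_ (fun v _ => h v)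
    refine continuousOn_pi.2 fun j => ContinuousOn.div ?_ ?_ ?_
    · exact ((continuous_apply _).comp continuous_subtype_val).continuousOn
    · exact ((continuous_apply _).comp continuous_subtype_val).continuousOn
    · intro v hv
      exact (rep_mk_ne_zero_iff v.1 v.2 k).1 hv
  continuousOn_invFun := by
    have h1 : Continuous fun x : Fin 2 → ℂ =>
        (⟨k.insertNth (1 : ℂ) x, insertNth_one_ne_zero k x⟩ : {v : Fin 3 → ℂ // v ≠ 0}) :=
      Continuous.subtype_mk (Continuous.finInsertNth (A := fun _ => ℂ) k continuous_const
        continuous_id) _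
    exact (isQuotientMap_proj.continuous.comp h1).continuousOn

/-- The index of an affine chart around `p`: the first nonvanishing homogeneous coordinate. -/
def chartIndex (p : CP2) : Fin 3 :=
  open Classical in if p.rep 0 ≠ 0 then 0 else if p.rep 1 ≠ 0 then 1 else 2

lemma rep_chartIndex_ne_zero (p : CP2) : p.rep (chartIndex p) ≠ 0 := by
  unfold chartIndex
  split_ifs with h0 h1
  · exact h0
  · exact h1
  · intro h2
    push Not at h0 h1
    refine p.rep_nonzero ?_
    funext i
    fin_cases i
    exacts [h0, h1, h2]

/-- `CP²` with the atlas of the three affine charts; the preferred chart at a point with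
`z₀ ≠ 0` is the one with coordinates `x₁ = z₁ / z₀`, `x₂ = z₂ / z₀`. -/
instance : ChartedSpace (Fin 2 → ℂ) CP2 where
  atlas := range affChart
  chartAt p := affChart (chartIndex p)
  mem_chart_source p := rep_chartIndex_ne_zero p
  chart_mem_atlas _ := mem_range_self _

/-- The model of `CP²` as a real manifold. -/
abbrev I4 : ModelWithCorners ℝ (Fin 2 → ℂ) (Fin 2 → ℂ) := 𝓘(ℝ, Fin 2 → ℂ)

instance : IsManifold I4 ∞ CP2 := by
  refine isManifold_of_contDiffOn _ _ _ ?_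
  rintro _ _ ⟨k, rfl⟩ ⟨l, rfl⟩
  have hins : ∀ i : Fin 3, ContDiff ℝ ∞
      (fun x : Fin 2 → ℂ => (k.insertNth (1 : ℂ) x : Fin 3 → ℂ) i) := by
    intro i
    rcases Fin.eq_self_or_eq_succAbove k i with rfl | ⟨j, rfl⟩
    · simpa using contDiff_const
    · simpa using contDiff_apply ℝ ℂ j
  have key : ∀ x : Fin 2 → ℂ, affChart l ((affChart k).symm x) = fun j =>
      (k.insertNth (1 : ℂ) x : Fin 3 → ℂ) (l.succAbove j) /
        (k.insertNth (1 : ℂ) x : Fin 3 → ℂ) l :=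
    fun x => affCoord_mk l _ (insertNth_one_ne_zero k x)
  refine ContDiffOn.congr (f := fun x : Fin 2 → ℂ => fun j =>
      (k.insertNth (1 : ℂ) x : Fin 3 → ℂ) (l.succAbove j) *
        ((k.insertNth (1 : ℂ) x : Fin 3 → ℂ) l)⁻¹) ?_ ?_
  · refine contDiffOn_pi.2 fun j => (hins _).contDiffOn.mul ((hins l).contDiffOn.inv ?_)
    intro x hx
    have h2 : ((affChart k).symm x).rep l ≠ 0 := by
      have := hx.1
      simp only [mfld_simps] at this
      exact this.2
    exact (rep_mk_ne_zero_iff _ (insertNth_one_ne_zero k x) l).1 h2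
  · intro x _
    simpa [div_eq_mul_inv] using key x

/-! ### The Fubini–Study form -/

/-- The value of `dx_j ∧ dx̄_k` on a pair of vectors of `ℂ²`. -/
def dWedge (j k : Fin 2) (u v : Fin 2 → ℂ) : ℂ := u j * conj (v k) - v j * conj (u k)

/-- The Fubini–Study form of `ℂ²` at `x`, that is
`(i/2) [(1+|x₂|²) dx₁∧dx̄₁ + (1+|x₁|²) dx₂∧dx̄₂ - x̄₁x₂ dx₁∧dx̄₂ - x̄₂x₁ dx₂∧dx̄₁] / (1+|x|²)²`,
which is `(i/2) ∂∂̄ log (1+|x|²)`. The expression is real. (Lean indexes `x₁, x₂` as `x 0, x 1`.) -/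
def fsCoord (x u v : Fin 2 → ℂ) : ℝ :=
  ((Complex.I / 2) *
    (((1 + ‖x 1‖ ^ 2 : ℝ) * dWedge 0 0 u v + (1 + ‖x 0‖ ^ 2 : ℝ) * dWedge 1 1 u v
      - conj (x 0) * x 1 * dWedge 0 1 u v - conj (x 1) * x 0 * dWedge 1 0 u v) /
      ((1 + ‖x 0‖ ^ 2 + ‖x 1‖ ^ 2 : ℝ) : ℂ) ^ 2)).re

/-- The Fubini–Study symplectic form of `CP²`. In each of the three affine charts it is
given by the same formula `fsCoord`; vectors of the tangent space at `p` are, in Mathlib, written in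
the preferred chart at `p`. -/
def fsForm (p : CP2) (u v : TangentSpace I4 p) : ℝ :=
  fsCoord (chartAt (Fin 2 → ℂ) p p) u v

/-! ### The quintic curve and its deformation -/

/-- The Fermat quintic `z₀⁵ + z₁⁵ + z₂⁵ = 0`, the projective closure of `x₁⁵ + x₂⁵ + 1 = 0`. -/
def fermatQuintic : Set CP2 := {p | p.rep 0 ^ 5 + p.rep 1 ^ 5 + p.rep 2 ^ 5 = 0}

/-- The coordinate line `z_k = 0`. -/
def coordLine (k : Fin 3) : Set CP2 := {p | p.rep k = 0}

/-- `b` is a smooth transition function from `0` to `1` on the scale `ε`. -/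
structure IsTransition (b : ℝ → ℝ) (ε : ℝ) : Prop where
  smooth : ContDiff ℝ ∞ b
  nonneg : ∀ a, 0 ≤ b a
  add_neg : ∀ a, b a + b (-a) = 1
  vanish : ∀ a, a ≤ -ε → b a = 0

/-- The smoothing `u (v/u)^{b(log(v/u))}` of `max(u, v)` for `u, v > 0`, with its limit values
`v` for `u = 0` and `u` for `v = 0`. -/
def softMax (b : ℝ → ℝ) (u v : ℝ) : ℝ :=
  if u = 0 then v else if v = 0 then u else u * (v / u) ^ b (Real.log (v / u))

/-- The deformation in homogeneous coordinates:
`(z₀ M(|z₁|,|z₂|)^t, z₁ M(|z₀|,|z₂|)^t, z₂ M(|z₀|,|z₁|)^t)` with `M = softMax b`. -/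
def deformVec (b : ℝ → ℝ) (t : ℝ) (z : Fin 3 → ℂ) : Fin 3 → ℂ :=
  ![z 0 * ((softMax b ‖z 1‖ ‖z 2‖ ^ t : ℝ) : ℂ),
    z 1 * ((softMax b ‖z 0‖ ‖z 2‖ ^ t : ℝ) : ℂ),
    z 2 * ((softMax b ‖z 0‖ ‖z 1‖ ^ t : ℝ) : ℂ)]

/-- The deformation `𝓕_t` as a map of `CP²`. The second case is a junk value which
can occur only at the three points `[1:0:0]`, `[0:1:0]`, `[0:0:1]`, and these are not on the quintic.
The lemma `deform_affine` below is the expression in the affine coordinates `x₁, x₂`. -/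
def deform (b : ℝ → ℝ) (t : ℝ) (p : CP2) : CP2 :=
  open Classical in
  if h : deformVec b t p.rep ≠ 0 then Projectivization.mk ℂ (deformVec b t p.rep) h else p

/-- The family `S_t = 𝓕_t(S_0)`, where `S_0` is the quintic. -/
def smoothedFamily (b : ℝ → ℝ) (t : ℝ) : Set CP2 := deform b t '' fermatQuintic

lemma softMax_nonneg (b : ℝ → ℝ) {u v : ℝ} (hu : 0 ≤ u) (hv : 0 ≤ v) : 0 ≤ softMax b u v := by
  unfold softMax
  split_ifs <;> positivity

lemma softMax_pos (b : ℝ → ℝ) {u v : ℝ} (hu : 0 ≤ u) (hv : 0 ≤ v) (h : u ≠ 0 ∨ v ≠ 0) :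
    0 < softMax b u v := by
  unfold softMax
  split_ifs with h1 h2
  · exact lt_of_le_of_ne hv (Ne.symm (by tauto))
  · exact lt_of_le_of_ne hu (Ne.symm h1)
  · have := lt_of_le_of_ne hu (Ne.symm h1)
    have := lt_of_le_of_ne hv (Ne.symm h2)
    positivity

lemma softMax_mul (b : ℝ → ℝ) {c : ℝ} (hc : 0 < c) (u v : ℝ) :
    softMax b (c * u) (c * v) = c * softMax b u v := by
  unfold softMax
  simp only [mul_eq_zero, hc.ne', false_or, mul_div_mul_left _ _ hc.ne']
  split_ifs <;> ring

lemma deformVec_smul (b : ℝ → ℝ) (t : ℝ) {a : ℂ} (ha : a ≠ 0) (z : Fin 3 → ℂ) :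
    deformVec b t (fun i => a * z i) = (a * ((‖a‖ ^ t : ℝ) : ℂ)) • deformVec b t z := by
  have hpos : 0 < ‖a‖ := norm_pos_iff.2 ha
  have key : ∀ i j, softMax b ‖a * z i‖ ‖a * z j‖ ^ t
      = ‖a‖ ^ t * softMax b ‖z i‖ ‖z j‖ ^ t := fun i j => by
    rw [norm_mul, norm_mul, softMax_mul b hpos, Real.mul_rpow hpos.le
      (softMax_nonneg b (norm_nonneg _) (norm_nonneg _))]
  simp only [deformVec, key, Complex.ofReal_mul]
  funext i
  fin_cases i <;> simp <;> ring

/-- `deform` is computed by `deformVec` on any homogeneous coordinates. -/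
lemma deform_mk (b : ℝ → ℝ) (t : ℝ) (z : Fin 3 → ℂ) (hz : z ≠ 0) (h : deformVec b t z ≠ 0) :
    deform b t (Projectivization.mk ℂ z hz) = Projectivization.mk ℂ (deformVec b t z) h := by
  obtain ⟨a, ha, hrep⟩ := exists_rep_mk z hz
  have e : deformVec b t (Projectivization.mk ℂ z hz).rep
      = (a * ((‖a‖ ^ t : ℝ) : ℂ)) • deformVec b t z := by
    rw [← deformVec_smul b t ha]
    exact congrArg _ (funext hrep)
  have hc : a * ((‖a‖ ^ t : ℝ) : ℂ) ≠ 0 := by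
    have : (0 : ℝ) < ‖a‖ ^ t := Real.rpow_pos_of_pos (norm_pos_iff.2 ha) t
    exact mul_ne_zero ha (by exact_mod_cast this.ne')
  have hne : deformVec b t (Projectivization.mk ℂ z hz).rep ≠ 0 := by
    rw [e]
    exact smul_ne_zero hc h
  rw [deform, dif_pos hne, Projectivization.mk_eq_mk_iff']
  exact ⟨_, e.symm⟩

/-- In affine coordinates `𝓕_t(x₁, x₂) = ((ρ₂/ρ₀)^t x₁, (ρ₁/ρ₀)^t x₂)`, where `ρ_j` is the smoothing
`r_j^{b(log r_j)}` of `max(1, r_j)` and `ρ₀` the smoothing `r₁ (r₂/r₁)^{b(log(r₂/r₁))}` of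
`max(r₁, r₂)`. -/
lemma deform_affine (b : ℝ → ℝ) (t : ℝ) (x₁ x₂ : ℂ) (hx : x₁ ≠ 0 ∨ x₂ ≠ 0) :
    deform b t (Projectivization.mk ℂ ![1, x₁, x₂] (fun h => one_ne_zero (congrFun h 0))) =
      Projectivization.mk ℂ
        ![1, (((softMax b 1 ‖x₂‖ / softMax b ‖x₁‖ ‖x₂‖) ^ t : ℝ) : ℂ) * x₁,
          (((softMax b 1 ‖x₁‖ / softMax b ‖x₁‖ ‖x₂‖) ^ t : ℝ) : ℂ) * x₂]
        (fun h => one_ne_zero (congrFun h 0)) := by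
  have h0 : 0 < softMax b ‖x₁‖ ‖x₂‖ :=
    softMax_pos b (norm_nonneg _) (norm_nonneg _) (by simpa using hx)
  have h0t : 0 < softMax b ‖x₁‖ ‖x₂‖ ^ t := Real.rpow_pos_of_pos h0 t
  have h0c : ((softMax b ‖x₁‖ ‖x₂‖ ^ t : ℝ) : ℂ) ≠ 0 := by exact_mod_cast h0t.ne'
  have hne : deformVec b t ![1, x₁, x₂] ≠ 0 := fun h => by
    have := congrFun h 0
    simp only [deformVec, Matrix.cons_val_zero, Matrix.cons_val_one, Matrix.cons_val, one_mul,
      Pi.zero_apply] at this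
    exact h0c this
  rw [deform_mk b t _ _ hne, Projectivization.mk_eq_mk_iff']
  refine ⟨((softMax b ‖x₁‖ ‖x₂‖ ^ t : ℝ) : ℂ), ?_⟩
  have hd : ∀ y, 0 ≤ y → ((softMax b 1 y / softMax b ‖x₁‖ ‖x₂‖) ^ t : ℝ)
      = softMax b 1 y ^ t / softMax b ‖x₁‖ ‖x₂‖ ^ t := fun y hy =>
    Real.div_rpow (softMax_nonneg b zero_le_one hy) h0.le t
  funext i
  fin_cases i
  · simp [deformVec]
  · simp only [deformVec, hd _ (norm_nonneg _), Complex.ofReal_div]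
    simp
    field_simp
  · simp only [deformVec, hd _ (norm_nonneg _), Complex.ofReal_div]
    simp
    field_simp

lemma deform_zero (b : ℝ → ℝ) (p : CP2) : deform b 0 p = p := by
  have e : deformVec b 0 p.rep = p.rep := by
    funext i
    fin_cases i <;> simp [deformVec]
  have h : deformVec b 0 p.rep ≠ 0 := by
    rw [e]
    exact p.rep_nonzero
  rw [deform, dif_pos h]
  conv_rhs => rw [← p.mk_rep]
  congr 1

/-- `S_0` is the quintic itself. -/
lemma smoothedFamily_zero (b : ℝ → ℝ) : smoothedFamily b 0 = fermatQuintic := by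
  have : deform b 0 = id := funext (deform_zero b)
  rw [smoothedFamily, this, image_id]

/-! ### Symplectic isotopies and Hamiltonian isotopies -/

/-- `Φ : [0,1] × S → CP²` is a symplectic isotopy of the surface `S`: a smooth family of smooth
embeddings such that the Fubini–Study form is nondegenerate on each image `Φ_t(S)`.
(Surfaces are modelled on `ℂ` as a real vector space.) -/
structure IsSymplecticIsotopy {S : Type} [TopologicalSpace S] [ChartedSpace ℂ S]
    (Φ : ℝ → S → CP2) : Prop where
  smooth : ContMDiffOn (𝓘(ℝ, ℝ).prod 𝓘(ℝ, ℂ)) I4 ∞ (fun q : ℝ × S => Φ q.1 q.2)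
    (Icc (0 : ℝ) 1 ×ˢ univ)
  embedding : ∀ t ∈ Icc (0 : ℝ) 1, Manifold.IsSmoothEmbedding 𝓘(ℝ, ℂ) I4 ∞ (Φ t)
  symplectic : ∀ t ∈ Icc (0 : ℝ) 1, ∀ (x : S) (v : TangentSpace 𝓘(ℝ, ℂ) x), v ≠ 0 →
    ∃ w : TangentSpace 𝓘(ℝ, ℂ) x,
      fsForm (Φ t x) (mfderiv 𝓘(ℝ, ℂ) I4 (Φ t) x v) (mfderiv 𝓘(ℝ, ℂ) I4 (Φ t) x w) ≠ 0

/-- `h_t` is a Hamiltonian isotopy of `(CP², ω)`: it starts at the identity, is smooth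
in `(t, p)`, and is the flow of the vector fields `V_t` with `ω(V_t, ·) = dH_t` for a smooth
time-dependent function `H_t`. Each `h_t` is then a Hamiltonian diffeomorphism. -/
structure IsHamiltonianIsotopy (h : ℝ → CP2 ≃ₘ⟮I4, I4⟯ CP2) : Prop where
  smooth : ContMDiff (𝓘(ℝ, ℝ).prod I4) I4 ∞ (fun q : ℝ × CP2 => h q.1 q.2)
  start : ∀ p, h 0 p = p
  flow : ∃ H : ℝ → CP2 → ℝ,
    ContMDiff (𝓘(ℝ, ℝ).prod I4) 𝓘(ℝ, ℝ) ∞ (fun q : ℝ × CP2 => H q.1 q.2) ∧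
    ∀ t p, ∃ V : TangentSpace I4 (h t p),
      HasMFDerivAt 𝓘(ℝ, ℝ) I4 (fun s => h s p) t (ContinuousLinearMap.toSpanSingleton ℝ V) ∧
      ∀ w : TangentSpace I4 (h t p), fsForm (h t p) V w = mfderiv I4 𝓘(ℝ, ℝ) (H t) (h t p) w

end QuinticSmoothing

end

/-! Everything is computed on the cone over the quintic in ℂ³ ∖ {0}, with the pullback `fsHom` of ω,
whose kernel is the radial complex line. There the deformation multiplies each coordinate by the
t-th power of a smoothed maximum of the other two moduli.

Symplecticity. For a tangent vector w put η_i = w_i / z_i. The equations Σ z_i⁵ = 0 and Σ z_i⁵ η_i =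
0 make the differences of the η_i a common multiple of the fifth powers, up to sign, so the area of
the deformed tangent plane is explicit. For a true maximum it is a sum of nonnegative terms. The
smoothing adds terms with coefficient `slope b`, bounded by C; they occur only where the logarithms
of two moduli differ by at most ε, and there each carries a further factor O(ε). They are absorbed
when ε is small against 1/C, because the two largest |z_i⁵| differ by a factor of at most 2
(`area_form_pos`, `fsHom_dDeform_pos`). Positivity also shows that the deformation is an immersion.

Injectivity (`deform_injOn`). After rescaling, points with the same image satisfy z'_i = l_i z_i
with l_i > 0. If the z_i⁵ are not on one real line, the relation Σ l_i⁵ z_i⁵ = 0 forces the l_i to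
be equal. Otherwise the points lie on a real segment, where a logarithmic ratio of coordinates of
the image is strictly monotone (`strictMonoOn_segment`). Compactness turns the injective immersion
into an embedding.

Hamiltonian isotopy. The velocity of the family is normalized to be symplectically orthogonal to the
curve. In tubular coordinates (t, x, n) the function ω(V, N n) vanishes on the curve and has V as
Hamiltonian vector there. At a point of a coordinate line the deformation velocity is a multiple of
log|1 + x⁵|, and N can be taken along the line; then the function and its differential vanish on the
line (`pairing_axis`, `fderiv_pairing_axis`). A partition of unity glues these functions
(`exists_isDeformHam`), since all of them vanish on the curve and on the lines. The Hamiltonian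
field is lifted horizontally to ℂ³ and integrated; the flow descends to the projective plane.
Uniqueness of integral curves shows that it carries the curves into each other
(`toCP_mem_smoothedFamily`), and it fixes the lines and the complement of U pointwise. -/

open scoped ContDiff Topology

noncomputable section

open Filter

/-! ### Smooth flows of vector fields, from the implicit function theorem in C([0, 1], F). -/

namespace SmoothFlow

section Superposition

variable {K : Type} [TopologicalSpace K] [CompactSpace K]

/-- Pointwise application of a continuous family of operators to a continuous function. -/
def pointwiseApply (K F G : Type) [TopologicalSpace K] [CompactSpace K] [NormedAddCommGroup F]
    [NormedSpace ℝ F] [NormedAddCommGroup G] [NormedSpace ℝ G] :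
    C(K, F →L[ℝ] G) →L[ℝ] C(K, F) →L[ℝ] C(K, G) :=
  LinearMap.mkContinuous₂
    (LinearMap.mk₂ ℝ (fun (A : C(K, F →L[ℝ] G)) (α : C(K, F)) =>
        (⟨fun s => A s (α s), A.continuous.clm_apply α.continuous⟩ : C(K, G)))
      (fun _ _ _ => by ext; simp) (fun _ _ _ => by ext; simp)
      (fun _ _ _ => by ext; simp) (fun _ _ _ => by ext; simp)) 1
    (fun A α => by
      rw [one_mul, ContinuousMap.norm_le _ (by positivity)]
      intro s
      exact ((A s).le_opNorm _).trans
        (mul_le_mul (A.norm_coe_le_norm s) (α.norm_coe_le_norm s) (norm_nonneg _)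
          (norm_nonneg (E := C(K, F →L[ℝ] G)) A)))

@[simp] lemma pointwiseApply_apply {F G : Type} [NormedAddCommGroup F]
    [NormedSpace ℝ F] [NormedAddCommGroup G] [NormedSpace ℝ G]
    (A : C(K, F →L[ℝ] G)) (α : C(K, F)) (s : K) : pointwiseApply K F G A α s = A s (α s) := rfl

/-- The derivative acts pointwise. The mean value estimate is uniform over K because postcomposition
with `f'` is continuous in the sup norm. -/
lemma hasFDerivAt_superposition {F G : Type} [NormedAddCommGroup F]
    [NormedSpace ℝ F] [NormedAddCommGroup G] [NormedSpace ℝ G] (f : C(F, G)) (f' : C(F, F →L[ℝ] G))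
    (hf : ∀ x, HasFDerivAt f (f' x) x) (α : C(K, F)) :
    HasFDerivAt (fun β : C(K, F) => f.comp β) (pointwiseApply K F G (f'.comp α)) α := by
  refine HasFDerivAt.of_isLittleO (Asymptotics.isLittleO_iff.2 fun c hc => ?_)
  have hcont : ContinuousAt (fun β : C(K, F) => f'.comp β) α :=
    (ContinuousMap.continuous_postcomp f').continuousAt
  obtain ⟨δ, hδ, h⟩ := (Metric.continuousAt_iff (α := C(K, F)) (β := C(K, F →L[ℝ] G))).1 hcont c hc
  filter_upwards [Metric.ball_mem_nhds α hδ] with β hβ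
  rw [ContinuousMap.norm_le _ (by positivity)]
  intro s
  have hz : ∀ z ∈ Metric.ball (α s) δ, ‖f' z - f' (α s)‖ ≤ c := by
    intro z hz
    -- Translating `α` by the constant `z - α s` expresses a bound at the single point `z` through
    -- continuity in the sup norm, so one `δ` serves every `s`.
    have h1 : dist (α + ContinuousMap.const K (z - α s)) α < δ := by
      rw [dist_eq_norm, add_sub_cancel_left]
      refine lt_of_le_of_lt ((ContinuousMap.norm_le _ (norm_nonneg (z - α s))).2 fun _ => le_rfl) ?_
      rwa [← dist_eq_norm]
    have h2 := h h1
    have h3 := (ContinuousMap.dist_apply_le_dist (f := f'.comp (α + ContinuousMap.const K (z - α s)))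
      (g := f'.comp α) s).trans h2.le
    rw [dist_eq_norm] at h3
    simpa using h3
  have hβs : β s ∈ Metric.ball (α s) δ :=
    lt_of_le_of_lt (ContinuousMap.dist_apply_le_dist s) hβ
  have h4 := (convex_ball (α s) δ).norm_image_sub_le_of_norm_hasFDerivWithin_le'
    (f := f) (φ := f' (α s)) (C := c) (fun z _ => (hf z).hasFDerivWithinAt) hz
    (Metric.mem_ball_self hδ) hβs
  refine le_trans ?_ (h4.trans (mul_le_mul_of_nonneg_left ?_ hc.le))
  · simp
  · exact (β - α).norm_coe_le_norm s

/-- The derivative is the superposition operator of `f'` followed by a bounded linear map, so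
smoothness climbs by one order at a time. The spaces vary in the induction because `f'` takes values
in `F →L[ℝ] G`. -/
lemma contDiff_superposition_nat (n : ℕ) : ∀ {F G : Type} [NormedAddCommGroup F]
    [NormedSpace ℝ F] [NormedAddCommGroup G] [NormedSpace ℝ G] (f : C(F, G)),
    ContDiff ℝ n f → ContDiff ℝ n (fun β : C(K, F) => f.comp β) := by
  induction n with
  | zero =>
    intro F G _ _ _ _ f _
    exact contDiff_zero.2 (ContinuousMap.continuous_postcomp f)
  | succ n ih =>
    intro F G _ _ _ _ f hf
    have hf' : ContDiff ℝ n (fderiv ℝ f) := by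
      refine hf.fderiv_right (m := n) ?_
      norm_cast
    let f' : C(F, F →L[ℝ] G) := ⟨fderiv ℝ f, hf'.continuous⟩
    have h1 : ∀ x, HasFDerivAt f (f' x) x := fun x =>
      (hf.differentiable (by simp) x).hasFDerivAt
    have hd := hasFDerivAt_superposition (K := K) f f' h1
    have hn : ((n + 1 : ℕ) : ℕ∞ω) = (n : ℕ∞ω) + 1 := by norm_cast
    rw [hn, contDiff_succ_iff_fderiv]
    refine ⟨fun α => (hd α).differentiableAt, by simp, ?_⟩
    have : fderiv ℝ (fun β : C(K, F) => f.comp β) =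
        fun α => pointwiseApply K F G (f'.comp α) := funext fun α => (hd α).fderiv
    rw [this]
    exact (pointwiseApply K F G).contDiff.comp (ih f' hf')

/-- The superposition operator of a smooth function is smooth. -/
lemma contDiff_superposition {F G : Type} [NormedAddCommGroup F]
    [NormedSpace ℝ F] [NormedAddCommGroup G] [NormedSpace ℝ G] (f : C(F, G))
    (hf : ContDiff ℝ ∞ f) : ContDiff ℝ ∞ (fun β : C(K, F) => f.comp β) :=
  contDiff_infty.2 fun n => contDiff_superposition_nat n f (contDiff_infty.1 hf n)

end Superposition

section Volterra

abbrev UI : Type := Icc (0 : ℝ) 1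

variable {F : Type} [NormedAddCommGroup F]

lemma continuous_extend (α : C(UI, F)) :
    Continuous fun u : ℝ => α (projIcc 0 1 zero_le_one u) :=
  α.continuous.comp continuous_projIcc

variable [NormedSpace ℝ F]

/-- The integration operator `α ↦ ∫₀ˢ α`. -/
def volterra (F : Type) [NormedAddCommGroup F] [NormedSpace ℝ F] : C(UI, F) →L[ℝ] C(UI, F) :=
  LinearMap.mkContinuous
    { toFun := fun α => ⟨fun s => ∫ u in (0 : ℝ)..s, α (projIcc 0 1 zero_le_one u),
        (intervalIntegral.continuous_primitive
          (fun a b => (continuous_extend α).intervalIntegrable a b) 0).comp continuous_subtype_val⟩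
      map_add' := fun α β => by
        ext s
        exact intervalIntegral.integral_add ((continuous_extend α).intervalIntegrable _ _)
          ((continuous_extend β).intervalIntegrable _ _)
      map_smul' := fun c α => by
        ext s
        exact intervalIntegral.integral_smul c _ } 1
    (fun α => by
      rw [one_mul, ContinuousMap.norm_le _ (norm_nonneg _)]
      intro s
      have h := intervalIntegral.norm_integral_le_of_norm_le_const (a := 0) (b := (s : ℝ))
        (f := fun u => α (projIcc 0 1 zero_le_one u)) (C := ‖α‖)
        (fun u _ => α.norm_coe_le_norm _)
      refine h.trans ?_
      rw [sub_zero, abs_of_nonneg s.2.1]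
      exact mul_le_of_le_one_right (norm_nonneg _) s.2.2)

lemma volterra_apply (α : C(UI, F)) (s : UI) :
    volterra F α s = ∫ u in (0 : ℝ)..s, α (projIcc 0 1 zero_le_one u) := rfl

lemma norm_volterra_le : ‖volterra F‖ ≤ 1 :=
  LinearMap.mkContinuous_norm_le _ zero_le_one _

end Volterra

section Flow

variable {F : Type} [NormedAddCommGroup F] [NormedSpace ℝ F] [FiniteDimensional ℝ F]

open scoped NNReal

variable {f : F → F} {K L : ℝ≥0}

omit [FiniteDimensional ℝ F] in
lemma integralCurve_unique (hK : LipschitzWith K f) {γ γ' : ℝ → F} {a b t₀ : ℝ}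
    (h₀ : t₀ ∈ Ioo a b) (hγ : ∀ t ∈ Ioo a b, HasDerivAt γ (f (γ t)) t)
    (hγ' : ∀ t ∈ Ioo a b, HasDerivAt γ' (f (γ' t)) t) (h : γ t₀ = γ' t₀) :
    EqOn γ γ' (Ioo a b) :=
  ODE_solution_unique_of_mem_Ioo (v := fun _ => f) (s := fun _ => univ) (K := K)
    (fun _ _ => hK.lipschitzOnWith) h₀ (fun t ht => ⟨hγ t ht, mem_univ _⟩)
    (fun t ht => ⟨hγ' t ht, mem_univ _⟩) h

/-- A bounded Lipschitz vector field has integral curves on every bounded interval. -/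
lemma exists_integralCurve_Ioo (hK : LipschitzWith K f) (hL : ∀ x, ‖f x‖ ≤ L) (T : ℝ≥0)
    (y : F) :
    ∃ γ : ℝ → F, γ 0 = y ∧ ∀ t ∈ Ioo (-(T : ℝ)) T, HasDerivAt γ (f (γ t)) t := by
  have h0 : (0 : ℝ) ∈ Icc (-(T : ℝ)) T := by simp
  have hpl : IsPicardLindelof (fun _ => f) (⟨0, h0⟩ : Icc (-(T : ℝ)) T) y (L * T) 0 L K :=
    IsPicardLindelof.of_time_independent (fun x _ => hL x) hK.lipschitzOnWith (by simp)
  obtain ⟨γ, h1, h2⟩ := hpl.exists_eq_forall_mem_Icc_hasDerivWithinAt₀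
  exact ⟨γ, h1, fun t ht => (h2 t (Ioo_subset_Icc_self ht)).hasDerivAt (Icc_mem_nhds ht.1 ht.2)⟩

/-- A bounded Lipschitz vector field has global integral curves. -/
lemma exists_integralCurve (hK : LipschitzWith K f) (hL : ∀ x, ‖f x‖ ≤ L) (y : F) :
    ∃ γ : ℝ → F, γ 0 = y ∧ ∀ t, HasDerivAt γ (f (γ t)) t := by
  choose γ h0 hγ using fun n : ℕ => exists_integralCurve_Ioo hK hL ((n : ℝ≥0) + 1) y
  have hmono : ∀ m n : ℕ, m ≤ n → EqOn (γ m) (γ n) (Ioo (-((m : ℝ) + 1)) (m + 1)) := by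
    intro m n hmn
    have hmn' : (m : ℝ) ≤ n := by exact_mod_cast hmn
    refine integralCurve_unique hK (t₀ := 0) ⟨by linarith [m.cast_nonneg (α := ℝ)],
      by linarith [m.cast_nonneg (α := ℝ)]⟩ (fun t ht => hγ m t (by simpa using ht))
      (fun t ht => hγ n t ?_) (by rw [h0, h0])
    simp only [NNReal.coe_add, NNReal.coe_natCast, NNReal.coe_one]
    exact ⟨by linarith [ht.1], by linarith [ht.2]⟩
  -- The n-th curve lives on (-(n+1), n+1), so the index ⌈|t|⌉₊ leaves room on both sides of t; near
  -- t all the curves involved agree with the one of index ⌈|t|⌉₊ + 1.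
  refine ⟨fun t => γ ⌈|t|⌉₊ t, by simp [h0], fun t => ?_⟩
  set N := ⌈|t|⌉₊ + 1 with hN
  have ht : |t| ≤ ⌈|t|⌉₊ := Nat.le_ceil _
  have hev : (fun s => γ ⌈|s|⌉₊ s) =ᶠ[𝓝 t] γ N := by
    have hU : {s : ℝ | |s| < |t| + 1} ∈ 𝓝 t :=
      (isOpen_lt continuous_abs continuous_const).mem_nhds (by simp)
    filter_upwards [hU] with s (hs : |s| < |t| + 1)
    refine hmono _ _ ?_ ?_
    · refine Nat.ceil_le.2 ?_
      rw [hN]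
      push_cast
      linarith
    · have := Nat.le_ceil |s|
      exact abs_lt.1 (by linarith)
  have hv : γ ⌈|t|⌉₊ t = γ N t := hev.eq_of_nhds
  simp only [hv]
  refine (hγ N t ?_).congr_of_eventuallyEq hev
  have h2 : |t| < N := by rw [hN]; push_cast; linarith
  have h3 := abs_lt.1 h2
  simp only [NNReal.coe_add, NNReal.coe_natCast, NNReal.coe_one]
  exact ⟨by linarith, by linarith⟩

omit [FiniteDimensional ℝ F] in
lemma norm_volterra_apply_le (α : C(UI, F)) : ‖volterra F α‖ ≤ ‖α‖ := by
  simpa using (volterra F).le_of_opNorm_le norm_volterra_le α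

/-- The time-rescaled integral curve solves the integral equation. -/
lemma integralCurve_eq_volterra (hf : Continuous f) {γ : ℝ → F}
    (hγ : ∀ t, HasDerivAt γ (f (γ t)) t) (t : ℝ) (α : C(UI, F)) (hα : ∀ s, α s = γ (t * s)) :
    α = ContinuousMap.const UI (γ 0) + t • volterra F ((⟨f, hf⟩ : C(F, F)).comp α) := by
  have hcont : Continuous γ := continuous_iff_continuousAt.2 fun s => (hγ s).continuousAt
  ext s
  have hd : ∀ u ∈ uIcc (0 : ℝ) s, HasDerivAt (fun u => γ (t * u)) (t • f (γ (t * u))) u := by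
    intro u _
    have h2 := (hγ (t * u)).scomp u ((hasDerivAt_id u).const_mul t)
    simpa [Function.comp_def] using h2
  have hint := intervalIntegral.integral_eq_sub_of_hasDerivAt hd
    ((hf.comp (hcont.comp (continuous_const.mul continuous_id))).const_smul t
      |>.intervalIntegrable _ _)
  rw [intervalIntegral.integral_smul] at hint
  simp only [ContinuousMap.add_apply, ContinuousMap.const_apply, ContinuousMap.smul_apply,
    volterra_apply, ContinuousMap.comp_apply, ContinuousMap.coe_mk, hα]
  have : ∫ u in (0 : ℝ)..s, f (γ (t * (projIcc (0 : ℝ) 1 zero_le_one u : ℝ))) =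
      ∫ u in (0 : ℝ)..s, f (γ (t * u)) := by
    refine intervalIntegral.integral_congr fun u hu => ?_
    rw [uIcc_of_le s.2.1] at hu
    rw [projIcc_of_mem zero_le_one ⟨hu.1, hu.2.trans s.2.2⟩]
  rw [this, hint]
  simp

/-- Smooth dependence on initial conditions for short times. -/
lemma contDiffAt_flow_of_small (hf : ContDiff ℝ ∞ f) (hK : LipschitzWith K f) {φ : ℝ → F → F}
    (h0 : ∀ y, φ 0 y = y) (hφ : ∀ t y, HasDerivAt (fun s => φ s y) (f (φ t y)) t)
    (t₀ : ℝ) (y₀ : F) (ht₀ : |t₀| * K < 1) :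
    ContDiffAt ℝ ∞ (fun p : ℝ × F => φ p.1 p.2) (t₀, y₀) := by
  have : CompleteSpace F := FiniteDimensional.complete ℝ F
  have hcont : ∀ y, Continuous fun s => φ s y := fun y =>
    continuous_iff_continuousAt.2 fun s => (hφ s y).continuousAt
  let fc : C(F, F) := ⟨f, hf.continuous⟩
  let α : ℝ × F → C(UI, F) := fun p =>
    ⟨fun s => φ (p.1 * s) p.2, (hcont p.2).comp (continuous_const.mul continuous_subtype_val)⟩
  have hα : ∀ p : ℝ × F, α p = ContinuousMap.const UI p.2 + p.1 • volterra F (fc.comp (α p)) := by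
    intro p
    have := integralCurve_eq_volterra hf.continuous (fun t => hφ t p.2) p.1 (α p) (fun s => rfl)
    rwa [h0] at this
  -- The zero of `Θ` over (t, y) is the curve s ↦ φ(ts, y). Rescaling time to [0, 1] makes t a
  -- parameter, so smoothness in time and in the initial value is obtained at once.
  let Θ : (ℝ × F) × C(UI, F) → C(UI, F) := fun q =>
    q.2 - ContinuousMap.const UI q.1.2 - q.1.1 • volterra F (fc.comp q.2)
  let cst : F →L[ℝ] C(UI, F) := LinearMap.mkContinuous
    { toFun := fun y => ContinuousMap.const UI y, map_add' := fun _ _ => rfl,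
      map_smul' := fun _ _ => rfl } 1
    (fun y => by
      rw [one_mul]
      exact (ContinuousMap.norm_le _ (norm_nonneg _)).2 fun _ => le_rfl)
  have hN : ContDiff ℝ ∞ fun β : C(UI, F) => fc.comp β := contDiff_superposition fc hf
  have hΘ : ContDiff ℝ ∞ Θ := by
    refine (contDiff_snd.sub ?_).sub ?_
    · exact cst.contDiff.comp (contDiff_snd.comp contDiff_fst)
    · exact (contDiff_fst.comp contDiff_fst).smul
        ((volterra F).contDiff.comp (hN.comp contDiff_snd))
  have hΘ0 : ∀ p, Θ (p, α p) = 0 := by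
    intro p
    simp only [Θ]
    rw [sub_sub, sub_eq_zero]
    exact hα p
  let u : (ℝ × F) × C(UI, F) := ((t₀, y₀), α (t₀, y₀))
  let f' : C(F, F →L[ℝ] F) := ⟨fderiv ℝ f, hf.continuous_fderiv (by simp)⟩
  have hf' : ∀ x, HasFDerivAt fc (f' x) x := fun x => (hf.differentiable (by simp) x).hasFDerivAt
  let A : C(UI, F) →L[ℝ] C(UI, F) :=
    t₀ • (volterra F).comp (pointwiseApply UI F F (f'.comp u.2))
  -- The smallness of the time makes the partial derivative `1 - A` invertible by a Neumann series.
  have hA : ‖A‖ < 1 := by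
    refine lt_of_le_of_lt (ContinuousLinearMap.opNorm_le_bound _ (by positivity) fun β => ?_) ht₀
    have h1 : ‖pointwiseApply UI F F (f'.comp u.2) β‖ ≤ K * ‖β‖ := by
      rw [ContinuousMap.norm_le _ (by positivity)]
      intro s
      refine (ContinuousLinearMap.le_opNorm _ _).trans
        (mul_le_mul ?_ (β.norm_coe_le_norm s) (norm_nonneg _) K.2)
      exact norm_fderiv_le_of_lipschitz ℝ hK
    calc ‖A β‖ = |t₀| * ‖volterra F (pointwiseApply UI F F (f'.comp u.2) β)‖ := by
          simp [A, norm_smul]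
      _ ≤ |t₀| * (K * ‖β‖) := by
          gcongr
          exact (norm_volterra_apply_le _).trans h1
      _ = |t₀| * K * ‖β‖ := by ring
  have hpart : fderiv ℝ Θ u ∘L .inr ℝ (ℝ × F) C(UI, F) = 1 - A := by
    have h1 : HasFDerivAt (fun β => Θ (u.1, β)) (fderiv ℝ Θ u ∘L .inr ℝ (ℝ × F) C(UI, F)) u.2 :=
      ((hΘ.differentiable (by simp) u).hasFDerivAt).comp u.2 (hasFDerivAt_prodMk_right u.1 u.2)
    have h2 : HasFDerivAt (fun β => Θ (u.1, β)) (1 - A) u.2 := by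
      have h3 : HasFDerivAt (fun β => t₀ • volterra F (fc.comp β)) A u.2 :=
        ((volterra F).hasFDerivAt.comp u.2
          (hasFDerivAt_superposition fc f' hf' u.2)).const_smul t₀
      exact ((hasFDerivAt_id u.2).sub_const (ContinuousMap.const UI y₀)).sub h3
    exact h1.unique h2
  have hinv : (fderiv ℝ Θ u ∘L .inr ℝ (ℝ × F) C(UI, F)).IsInvertible := by
    rw [hpart]
    exact ⟨ContinuousLinearEquiv.ofUnit (Units.oneSub A hA), by ext; rfl⟩
  have hΘu : ContDiffAt ℝ ∞ Θ u := hΘ.contDiffAt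
  have hψ := hΘu.contDiffAt_implicitFunction (by simp) hinv
  have hψ0 := hΘu.eventually_apply_implicitFunction (by simp) hinv
  set ψ := hΘu.implicitFunction (by simp) hinv
  have hev : (fun p : ℝ × F => φ p.1 p.2) =ᶠ[𝓝 (t₀, y₀)] fun p => ψ p ⟨1, by simp⟩ := by
    have hU : {p : ℝ × F | |p.1| * K < 1} ∈ 𝓝 (t₀, y₀) :=
      (isOpen_lt ((continuous_abs.comp continuous_fst).mul continuous_const)
        continuous_const).mem_nhds ht₀
    filter_upwards [hψ0, hU] with p hp (hpK : |p.1| * K < 1)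
    have hp' : Θ (p, ψ p) = 0 := hp.trans (hΘ0 _)
    have hp2 : ψ p = ContinuousMap.const UI p.2 + p.1 • volterra F (fc.comp (ψ p)) := by
      simp only [Θ] at hp'
      rwa [sub_sub, sub_eq_zero] at hp'
    -- The same contraction estimate identifies the implicit function with the flow: two zeros of
    -- `Θ` over one `p` coincide.
    have hle : ‖α p - ψ p‖ ≤ |p.1| * K * ‖α p - ψ p‖ := by
      have h1 : α p - ψ p = p.1 • volterra F (fc.comp (α p) - fc.comp (ψ p)) := by
        conv_lhs => rw [hα p, hp2]
        rw [map_sub, smul_sub]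
        abel
      conv_lhs => rw [h1]
      rw [norm_smul, Real.norm_eq_abs, mul_assoc]
      gcongr
      refine (norm_volterra_apply_le _).trans ((ContinuousMap.norm_le _ (by positivity)).2 ?_)
      intro s
      refine (hK.norm_sub_le _ _).trans ?_
      gcongr
      exact (α p - ψ p).norm_coe_le_norm s
    have hz : α p = ψ p := by
      by_contra hne
      have : 0 < ‖α p - ψ p‖ := norm_pos_iff.2 (sub_ne_zero.2 hne)
      nlinarith
    rw [← hz]
    simp [α]
  refine ContDiffAt.congr_of_eventuallyEq ?_ hev
  exact (ContinuousMap.evalCLM ℝ (⟨1, by simp⟩ : UI)).contDiff.contDiffAt.comp (t₀, y₀) hψ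

/-- A bounded, smooth, globally Lipschitz vector field has a smooth global flow. -/
theorem exists_flow (hf : ContDiff ℝ ∞ f) (hK : LipschitzWith K f) (hL : ∀ x, ‖f x‖ ≤ L) :
    ∃ φ : ℝ → F → F, (∀ y, φ 0 y = y) ∧ (∀ t y, HasDerivAt (fun s => φ s y) (f (φ t y)) t) ∧
      (∀ s t y, φ (s + t) y = φ s (φ t y)) ∧ ContDiff ℝ ∞ (fun p : ℝ × F => φ p.1 p.2) := by
  have : CompleteSpace F := FiniteDimensional.complete ℝ F
  choose γ h0 hγ using exists_integralCurve (F := F) hK hL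
  let φ : ℝ → F → F := fun t y => γ y t
  have hadd : ∀ s t y, φ (s + t) y = φ s (φ t y) := by
    intro s t y
    refine integralCurve_unique hK (t₀ := 0) (a := -(|s| + 1)) (b := |s| + 1)
      (γ := fun s => φ (s + t) y) (γ' := fun s => φ s (φ t y)) ⟨?_, ?_⟩ (fun r _ => ?_)
      (fun r _ => hγ _ r) ?_ ⟨?_, ?_⟩
    · linarith [abs_nonneg s]
    · linarith [abs_nonneg s]
    · exact (hγ y (r + t)).comp_add_const r t
    · simp [φ, h0]
    · linarith [neg_abs_le s]
    · linarith [le_abs_self s]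
  have hsmall : ∀ (t : ℝ) (y : F), |t| * K < 1 → ContDiffAt ℝ ∞ (fun p : ℝ × F => φ p.1 p.2) (t, y) :=
    fun t y ht => contDiffAt_flow_of_small hf hK h0 (fun t y => hγ y t) t y ht
  have hslice : ∀ t : ℝ, |t| * K < 1 → ContDiff ℝ ∞ (φ t) := fun t ht =>
    contDiff_iff_contDiffAt.2 fun y =>
      (hsmall t y ht).comp y (contDiffAt_const.prodMk contDiffAt_id)
  -- Long times are reached by composing short ones.
  have hiter : ∀ (n : ℕ) (t : ℝ), |t| * K < 1 → ContDiff ℝ ∞ (φ (n * t)) := by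
    intro n t ht
    induction n with
    | zero =>
      have : φ ((0 : ℕ) * t) = id := funext fun y => by simp [φ, h0]
      rw [this]
      exact contDiff_id
    | succ n ih =>
      have : φ ((n + 1 : ℕ) * t) = φ t ∘ φ (n * t) := funext fun y => by
        rw [Function.comp_apply, ← hadd]
        congr 1
        push_cast
        ring
      rw [this]
      exact (hslice t ht).comp ih
  have hall : ∀ t : ℝ, ContDiff ℝ ∞ (φ t) := by
    intro t
    obtain ⟨n, hn⟩ := exists_nat_gt (|t| * K)
    have hn0 : (0 : ℝ) < n := lt_of_le_of_lt (by positivity) hn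
    have h := hiter n (t / n) (by
      rw [abs_div, abs_of_pos hn0, div_mul_eq_mul_div, div_lt_one hn0]
      exact hn)
    rwa [mul_div_cancel₀ _ hn0.ne'] at h
  refine ⟨φ, h0, fun t y => hγ y t, hadd, contDiff_iff_contDiffAt.2 fun p => ?_⟩
  -- By the group law, joint smoothness at time `p.1` reduces to joint smoothness at time 0.
  have heq : (fun q : ℝ × F => φ q.1 q.2) =
      (fun q : ℝ × F => φ q.1 q.2) ∘ fun q : ℝ × F => (q.1 - p.1, φ p.1 q.2) := by
    funext q
    simp only [Function.comp_apply]
    rw [← hadd]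
    congr 1
    ring
  rw [heq]
  refine ContDiffAt.comp p ?_ ((contDiffAt_fst.sub contDiffAt_const).prodMk
    ((hall p.1).contDiffAt.comp p contDiffAt_snd))
  exact hsmall _ _ (by simp)

end Flow
end SmoothFlow
end

/-! ### The projective plane and the Fubini–Study form in homogeneous coordinates. -/

noncomputable section

open Filter

namespace QuinticSmoothing

/-- Homogeneous coordinates. -/
abbrev V3 : Type := Fin 3 → ℂ

/-! ### The projection from `ℂ³` -/

/-- The projection `ℂ³ ∖ {0} → CP²`, with a junk value at `0`. -/
def toCP (z : V3) : CP2 :=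
  open Classical in
  if h : z ≠ 0 then Projectivization.mk ℂ z h
  else Projectivization.mk ℂ (fun _ => 1) (fun h => one_ne_zero (congrFun h 0))

lemma toCP_of_ne {z : V3} (h : z ≠ 0) : toCP z = Projectivization.mk ℂ z h := dif_pos h

lemma toCP_rep (p : CP2) : toCP p.rep = p := by
  rw [toCP_of_ne p.rep_nonzero, p.mk_rep]

lemma toCP_eq_iff {z w : V3} (hz : z ≠ 0) (hw : w ≠ 0) :
    toCP z = toCP w ↔ ∃ a : ℂ, a ≠ 0 ∧ w = a • z := by
  rw [toCP_of_ne hz, toCP_of_ne hw, eq_comm, Projectivization.mk_eq_mk_iff']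
  constructor
  · rintro ⟨a, ha⟩
    refine ⟨a, ?_, ha.symm⟩
    rintro rfl
    exact hw (by rw [← ha, zero_smul])
  · rintro ⟨a, _, rfl⟩
    exact ⟨a, rfl⟩

lemma toCP_smul {a : ℂ} (ha : a ≠ 0) {z : V3} (hz : z ≠ 0) : toCP (a • z) = toCP z :=
  ((toCP_eq_iff hz (smul_ne_zero ha hz)).2 ⟨a, ha, rfl⟩).symm

lemma exists_rep_toCP {z : V3} (hz : z ≠ 0) : ∃ a : ℂ, a ≠ 0 ∧ (toCP z).rep = a • z :=
  (toCP_eq_iff hz (toCP z).rep_nonzero).1 (toCP_rep _).symm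

lemma rep_toCP_ne_zero_iff {z : V3} (hz : z ≠ 0) (k : Fin 3) : (toCP z).rep k ≠ 0 ↔ z k ≠ 0 := by
  rw [toCP_of_ne hz]
  exact rep_mk_ne_zero_iff z hz k

/-- The affine coordinates of a vector of homogeneous coordinates. -/
def affOf (k : Fin 3) (z : V3) : Fin 2 → ℂ := fun j => z (k.succAbove j) / z k

lemma affCoord_toCP (k : Fin 3) {z : V3} (hz : z ≠ 0) : affCoord k (toCP z) = affOf k z := by
  rw [toCP_of_ne hz]
  exact affCoord_mk k z hz

/-- The homogeneous coordinates with `1` in position `k`. -/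
def affLift (k : Fin 3) (x : Fin 2 → ℂ) : V3 := k.insertNth (1 : ℂ) x

lemma affLift_ne_zero (k : Fin 3) (x : Fin 2 → ℂ) : affLift k x ≠ 0 := insertNth_one_ne_zero k x

@[simp] lemma affLift_same (k : Fin 3) (x : Fin 2 → ℂ) : affLift k x k = 1 := by simp [affLift]

@[simp] lemma affLift_succAbove (k : Fin 3) (x : Fin 2 → ℂ) (j : Fin 2) :
    affLift k x (k.succAbove j) = x j := by simp [affLift]

lemma smul_affLift_affOf {k : Fin 3} {z : V3} (hz : z k ≠ 0) :
    z k • affLift k (affOf k z) = z := by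
  funext i
  rcases Fin.eq_self_or_eq_succAbove k i with rfl | ⟨j, rfl⟩
  · simp
  · simp [affOf]
    field_simp

lemma affOf_smul (k : Fin 3) {a : ℂ} (ha : a ≠ 0) (z : V3) : affOf k (a • z) = affOf k z := by
  funext j
  simp only [affOf, Pi.smul_apply, smul_eq_mul]
  rw [mul_div_mul_left _ _ ha]

lemma contDiff_affLift (k : Fin 3) : ContDiff ℝ ∞ (affLift k) := by
  refine contDiff_pi.2 fun i => ?_
  rcases Fin.eq_self_or_eq_succAbove k i with rfl | ⟨j, rfl⟩
  · simpa using contDiff_const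
  · simpa using contDiff_apply ℝ ℂ j

lemma contDiffAt_affOf {k : Fin 3} {z : V3} (hz : z k ≠ 0) : ContDiffAt ℝ ∞ (affOf k) z := by
  refine contDiffAt_pi.2 fun j => ?_
  simp only [affOf, div_eq_mul_inv]
  exact (contDiff_apply ℝ ℂ (k.succAbove j)).contDiffAt.mul
    ((contDiff_apply ℝ ℂ k).contDiffAt.inv hz)

lemma continuousAt_toCP {z : V3} (hz : z ≠ 0) : ContinuousAt toCP z := by
  have h : ContinuousOn toCP {z : V3 | z ≠ 0} := by
    rw [continuousOn_iff_continuous_domRestrict]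
    have : ({z : V3 | z ≠ 0}.domRestrict toCP) = proj := funext fun v => toCP_of_ne v.2
    rw [this]
    exact isQuotientMap_proj.continuous
  exact h.continuousAt (isOpen_ne.mem_nhds hz)

lemma isOpen_iff_toCP {U : Set CP2} : IsOpen U ↔ IsOpen {z : V3 | z ≠ 0 ∧ toCP z ∈ U} := by
  have h0 : IsOpen {z : V3 | z ≠ 0} := isOpen_ne
  rw [← isQuotientMap_proj.isOpen_preimage, h0.isOpenEmbedding_subtypeVal.isOpen_iff_image_isOpen]
  have : Subtype.val '' (proj ⁻¹' U) = {z : V3 | z ≠ 0 ∧ toCP z ∈ U} := by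
    ext z
    constructor
    · rintro ⟨v, hv, rfl⟩
      exact ⟨v.2, by rwa [toCP_of_ne v.2]⟩
    · rintro ⟨h, hz⟩
      exact ⟨⟨z, h⟩, by rwa [toCP_of_ne h] at hz, rfl⟩
  rw [← this]
  rfl

lemma toCP_affLift_affCoord {k : Fin 3} {p : CP2} (hp : p.rep k ≠ 0) :
    toCP (affLift k (affCoord k p)) = p := by
  have h := affCoord_toCP k p.rep_nonzero
  rw [toCP_rep] at h
  conv_rhs => rw [← toCP_rep p, ← smul_affLift_affOf hp]
  rw [h, toCP_smul hp (affLift_ne_zero _ _)]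

lemma affChart_mem_maximalAtlas (k : Fin 3) :
    affChart k ∈ IsManifold.maximalAtlas I4 ∞ CP2 :=
  IsManifold.subset_maximalAtlas (mem_range_self k)

lemma contMDiffAt_affCoord {k : Fin 3} {p : CP2} (hp : p.rep k ≠ 0) :
    ContMDiffAt I4 I4 ∞ (affCoord k) p :=
  contMDiffAt_of_mem_maximalAtlas (affChart_mem_maximalAtlas k) hp

/-- Local smooth sections of the projection. -/
lemma exists_section {z : V3} (hz : z ≠ 0) :
    ∃ σ : CP2 → V3, ContMDiffAt I4 𝓘(ℝ, V3) ∞ σ (toCP z) ∧ σ (toCP z) = z ∧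
      ∀ᶠ p in 𝓝 (toCP z), σ p ≠ 0 ∧ toCP (σ p) = p := by
  obtain ⟨k, hk⟩ := Function.ne_iff.1 hz
  have hk : z k ≠ 0 := hk
  refine ⟨fun p => z k • affLift k (affCoord k p), ?_, ?_, ?_⟩
  · have h1 : ContMDiff I4 𝓘(ℝ, V3) ∞ fun x : Fin 2 → ℂ => z k • affLift k x :=
      ((contDiff_affLift k).const_smul (z k)).contMDiff
    exact h1.contMDiffAt.comp (toCP z) (contMDiffAt_affCoord ((rep_toCP_ne_zero_iff hz k).2 hk))
  · beta_reduce
    rw [affCoord_toCP k hz, smul_affLift_affOf hk]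
  · filter_upwards [(isOpen_source k).mem_nhds
      ((rep_toCP_ne_zero_iff hz k).2 hk : (toCP z).rep k ≠ 0)] with p hp
    exact ⟨smul_ne_zero hk (affLift_ne_zero _ _), by
      rw [toCP_smul hk (affLift_ne_zero _ _), toCP_affLift_affCoord hp]⟩

lemma contMDiffAt_toCP {z : V3} (hz : z ≠ 0) : ContMDiffAt 𝓘(ℝ, V3) I4 ∞ toCP z := by
  obtain ⟨k, hk⟩ := Function.ne_iff.1 hz
  have hk : z k ≠ 0 := hk
  refine (contMDiffAt_iff_of_mem_maximalAtlas (e := .refl V3) (e' := affChart k) ?_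
    (affChart_mem_maximalAtlas k) (mem_univ _) ((rep_toCP_ne_zero_iff hz k).2 hk)).2
    ⟨continuousAt_toCP hz, ?_⟩
  · exact IsManifold.subset_maximalAtlas (by simp)
  · refine ((contDiffAt_affOf hk).contDiffWithinAt).congr_of_eventuallyEq ?_ ?_
    · simp only [mfld_simps]
      filter_upwards [mem_nhdsWithin_of_mem_nhds (isOpen_ne.mem_nhds hz)] with w hw
      exact affCoord_toCP k hw
    · exact affCoord_toCP k hz

section Maps

variable {E : Type*} [NormedAddCommGroup E] [NormedSpace ℝ E] {H : Type*} [TopologicalSpace H]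
  {I : ModelWithCorners ℝ E H} {M : Type*} [TopologicalSpace M] [ChartedSpace H M]

/-- Local sections reduce smoothness on the projective plane to smoothness on ℂ³ ∖ {0}. -/
lemma contMDiffAt_of_toCP {f : CP2 → M} {z : V3} (hz : z ≠ 0)
    (hf : ContMDiffAt 𝓘(ℝ, V3) I ∞ (f ∘ toCP) z) : ContMDiffAt I4 I ∞ f (toCP z) := by
  obtain ⟨σ, h1, h2, h3⟩ := exists_section hz
  have h4 : ContMDiffAt I4 I ∞ ((f ∘ toCP) ∘ σ) (toCP z) := by
    refine ContMDiffAt.comp _ ?_ h1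
    rwa [h2]
  exact h4.congr_of_eventuallyEq (h3.mono fun p hp => by simp [hp.2])

lemma contMDiffAt_of_toCP_prod {f : ℝ × CP2 → M} {t : ℝ} {z : V3} (hz : z ≠ 0)
    (hf : ContMDiffAt 𝓘(ℝ, ℝ × V3) I ∞ (fun q : ℝ × V3 => f (q.1, toCP q.2)) (t, z)) :
    ContMDiffAt (𝓘(ℝ, ℝ).prod I4) I ∞ f (t, toCP z) := by
  obtain ⟨σ, h1, h2, h3⟩ := exists_section hz
  have h5 : ContMDiffAt (𝓘(ℝ, ℝ).prod I4) 𝓘(ℝ, ℝ × V3) ∞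
      (fun q : ℝ × CP2 => (q.1, σ q.2)) (t, toCP z) :=
    ContMDiffAt.prodMk_space contMDiffAt_fst (ContMDiffAt.comp (t, toCP z) h1 contMDiffAt_snd)
  have h4 : ContMDiffAt (𝓘(ℝ, ℝ).prod I4) I ∞
      ((fun q : ℝ × V3 => f (q.1, toCP q.2)) ∘ fun q : ℝ × CP2 => (q.1, σ q.2)) (t, toCP z) := by
    refine ContMDiffAt.comp _ ?_ h5
    simpa only [h2] using hf
  refine h4.congr_of_eventuallyEq ?_
  have h6 : Tendsto (Prod.snd : ℝ × CP2 → CP2) (𝓝 (t, toCP z)) (𝓝 (toCP z)) :=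
    continuous_snd.continuousAt
  exact (h6.eventually h3).mono fun p hp => by simp [hp.2]

end Maps

/-! ### Topology of `CP²` -/

/-- The squared Hermitian norm. -/
def hsq (z : V3) : ℝ := ‖z 0‖ ^ 2 + ‖z 1‖ ^ 2 + ‖z 2‖ ^ 2

lemma hsq_pos {z : V3} (hz : z ≠ 0) : 0 < hsq z := by
  obtain ⟨k, hk⟩ := Function.ne_iff.1 hz
  have hk : 0 < ‖z k‖ := norm_pos_iff.2 hk
  unfold hsq
  fin_cases k <;> simp at hk <;> positivity

lemma hsq_smul (a : ℂ) (z : V3) : hsq (a • z) = ‖a‖ ^ 2 * hsq z := by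
  simp [hsq, mul_pow]
  ring

lemma contDiff_hsq : ContDiff ℝ ∞ hsq := by
  have h : ∀ i : Fin 3, ContDiff ℝ ∞ fun z : V3 => ‖z i‖ ^ 2 := fun i =>
    (contDiff_apply ℝ ℂ i).norm_sq ℝ
  exact ((h 0).add (h 1)).add (h 2)

/-- The orthogonal projection matrix onto a line. -/
def projMatrix (z : V3) (i j : Fin 3) : ℂ := z i * conj (z j) / hsq z

lemma projMatrix_smul {a : ℂ} (ha : a ≠ 0) (z : V3) : projMatrix (a • z) = projMatrix z := by
  have h2 : ((‖a‖ ^ 2 : ℝ) : ℂ) ≠ 0 := by exact_mod_cast (pow_pos (norm_pos_iff.2 ha) 2).ne'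
  have h3 : a * conj a = ((‖a‖ ^ 2 : ℝ) : ℂ) := by
    rw [Complex.mul_conj, Complex.normSq_eq_norm_sq]
  funext i j
  simp only [projMatrix, hsq_smul, Pi.smul_apply, smul_eq_mul, map_mul]
  rw [show a * z i * (conj a * conj (z j)) = (a * conj a) * (z i * conj (z j)) by ring, h3,
    Complex.ofReal_mul, mul_div_mul_left _ _ h2]

lemma continuous_projMatrix : Continuous fun p : CP2 => projMatrix p.rep := by
  refine isQuotientMap_proj.continuous_iff.2 ?_
  have h : (fun p : CP2 => projMatrix p.rep) ∘ proj =
      fun v : {v : V3 // v ≠ 0} => projMatrix v.1 := by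
    funext v
    obtain ⟨a, ha, h⟩ := exists_rep_toCP v.2
    rw [Function.comp_apply, proj, ← toCP_of_ne v.2, h, projMatrix_smul ha]
  rw [h]
  refine continuous_pi fun i => continuous_pi fun j => ?_
  have hc : ∀ i, Continuous fun v : {v : V3 // v ≠ 0} => v.1 i := fun i =>
    (continuous_apply i).comp continuous_subtype_val
  refine ((hc i).mul (Complex.continuous_conj.comp (hc j))).div
    (Complex.continuous_ofReal.comp (contDiff_hsq.continuous.comp continuous_subtype_val)) ?_
  intro v
  exact_mod_cast (hsq_pos v.2).ne'

/-- A line is spanned by any nonzero column of its orthogonal projection. The resulting injection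
into matrices makes the projective plane Hausdorff. -/
lemma projMatrix_injective : Function.Injective fun p : CP2 => projMatrix p.rep := by
  intro p q h
  obtain ⟨j, hj⟩ := Function.ne_iff.1 p.rep_nonzero
  have hj : p.rep j ≠ 0 := hj
  have hp : ((hsq p.rep : ℝ) : ℂ) ≠ 0 := by exact_mod_cast (hsq_pos p.rep_nonzero).ne'
  have hq : ((hsq q.rep : ℝ) : ℂ) ≠ 0 := by exact_mod_cast (hsq_pos q.rep_nonzero).ne'
  have hj' : conj (p.rep j) ≠ 0 := (map_ne_zero _).2 hj
  set c := conj (q.rep j) * hsq p.rep / (conj (p.rep j) * hsq q.rep) with hc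
  have key : p.rep = c • q.rep := by
    funext i
    have h1 : projMatrix p.rep i j = projMatrix q.rep i j := congrFun (congrFun h i) j
    simp only [projMatrix] at h1
    rw [div_eq_div_iff hp hq] at h1
    simp only [Pi.smul_apply, smul_eq_mul, hc]
    field_simp
    linear_combination h1
  have hc0 : c ≠ 0 := by
    intro h0
    rw [h0, zero_smul] at key
    exact p.rep_nonzero key
  rw [← toCP_rep p, ← toCP_rep q, key, toCP_smul hc0 q.rep_nonzero]

instance : T2Space CP2 := T2Space.of_injective_continuous projMatrix_injective continuous_projMatrix

instance : CompactSpace CP2 := by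
  refine ⟨?_⟩
  have h : toCP '' Metric.sphere (0 : V3) 1 = univ := by
    refine eq_univ_of_forall fun p => ?_
    have hp : ‖p.rep‖ ≠ 0 := norm_ne_zero_iff.2 p.rep_nonzero
    have hp' : ((‖p.rep‖⁻¹ : ℝ) : ℂ) ≠ 0 := by exact_mod_cast inv_ne_zero hp
    refine ⟨((‖p.rep‖⁻¹ : ℝ) : ℂ) • p.rep, ?_, ?_⟩
    · rw [mem_sphere_zero_iff_norm, norm_smul, Complex.norm_real, norm_inv, norm_norm,
        inv_mul_cancel₀ hp]
    · rw [toCP_smul hp' p.rep_nonzero, toCP_rep]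
  rw [← h]
  refine (isCompact_sphere _ _).image_of_continuousOn fun z hz => ?_
  refine (continuousAt_toCP ?_).continuousWithinAt
  rintro rfl
  simp at hz

/-! ### The Fubini–Study form in homogeneous coordinates -/

/-- The standard Hermitian product, conjugate linear in the first argument. -/
def herm (u v : V3) : ℂ := conj (u 0) * v 0 + conj (u 1) * v 1 + conj (u 2) * v 2

/-- The pullback of the Fubini–Study form to `ℂ³ ∖ {0}`. -/
def fsHom (z u v : V3) : ℝ := (herm u v * hsq z - herm u z * herm z v).im / hsq z ^ 2

/-- The derivative of the affine coordinates. -/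
def dAffOf (k : Fin 3) (z : V3) : V3 →L[ℝ] (Fin 2 → ℂ) := fderiv ℝ (affOf k) z

lemma dAffOf_apply {k : Fin 3} {z : V3} (hz : z k ≠ 0) (u : V3) (j : Fin 2) :
    dAffOf k z u j = (u (k.succAbove j) * z k - z (k.succAbove j) * u k) / z k ^ 2 := by
  have h1 : ∀ i : Fin 3, HasDerivAt (fun s : ℝ => z i + s * u i) (u i) 0 := fun i => by
    simpa using ((Complex.ofRealCLM.hasDerivAt (x := 0)).mul_const (u i)).const_add (z i)
  have h2 : HasDerivAt (fun s : ℝ => affOf k (z + s • u) j)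
      ((u (k.succAbove j) * z k - z (k.succAbove j) * u k) / z k ^ 2) 0 := by
    have h := (h1 (k.succAbove j)).fun_div (h1 k) (by simpa using hz)
    simpa [affOf] using h
  have h3 : HasDerivAt (fun s : ℝ => z + s • u) u 0 := by
    simpa using ((hasDerivAt_id (0 : ℝ)).smul_const u).const_add z
  have h4 : HasFDerivAt (affOf k) (dAffOf k z) (z + (0 : ℝ) • u) := by
    rw [zero_smul, add_zero]
    exact ((contDiffAt_affOf hz).differentiableAt (by simp)).hasFDerivAt
  have h5 := (hasDerivAt_pi.1 (h4.comp_hasDerivAt 0 h3)) j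
  exact h5.unique h2

/-- The right side does not depend on `k`: the chart formulas for the form are compatible, and later
computations can be made in ℂ³. -/
lemma fsCoord_affOf {k : Fin 3} {z : V3} (hz : z k ≠ 0) (u v : V3) :
    fsCoord (affOf k z) (dAffOf k z u) (dAffOf k z v) = fsHom z u v := by
  have hz0 : z ≠ 0 := fun h => hz (by simp [h])
  have hs : ((hsq z : ℝ) : ℂ) ≠ 0 := by exact_mod_cast (hsq_pos hz0).ne'
  have hq : ((hsq z : ℝ) : ℂ) = z 0 * conj (z 0) + z 1 * conj (z 1) + z 2 * conj (z 2) := by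
    simp [hsq, Complex.mul_conj, Complex.normSq_eq_norm_sq]
  have hn : ∀ w : ℂ, ((‖w‖ ^ 2 : ℝ) : ℂ) = w * conj w := fun w => by
    rw [Complex.mul_conj, Complex.normSq_eq_norm_sq]
  have hc : conj (z k) ≠ 0 := (map_ne_zero _).2 hz
  have him : ∀ w : ℂ, ((w.im : ℝ) : ℂ) = -(Complex.I / 2) * (w - conj w) := fun w => by
    rw [Complex.sub_conj]
    push_cast
    linear_combination (w.im : ℂ) * Complex.I_sq
  have hsum : ∀ f : Fin 3 → ℂ, f 0 + f 1 + f 2 =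
      f k + f (k.succAbove 0) + f (k.succAbove 1) := fun f => by
    have h := Fin.sum_univ_succAbove f k
    rw [Fin.sum_univ_three, Fin.sum_univ_two] at h
    rw [h]
    ring
  have hherm : ∀ a b : V3, herm a b = conj (a k) * b k +
      conj (a (k.succAbove 0)) * b (k.succAbove 0) +
      conj (a (k.succAbove 1)) * b (k.succAbove 1) := fun a b => hsum fun i => conj (a i) * b i
  rw [hsum fun i => z i * conj (z i)] at hq
  have key : (Complex.I / 2) *
    (((1 + ‖affOf k z 1‖ ^ 2 : ℝ) * dWedge 0 0 (dAffOf k z u) (dAffOf k z v)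
      + (1 + ‖affOf k z 0‖ ^ 2 : ℝ) * dWedge 1 1 (dAffOf k z u) (dAffOf k z v)
      - conj (affOf k z 0) * affOf k z 1 * dWedge 0 1 (dAffOf k z u) (dAffOf k z v)
      - conj (affOf k z 1) * affOf k z 0 * dWedge 1 0 (dAffOf k z u) (dAffOf k z v)) /
      ((1 + ‖affOf k z 0‖ ^ 2 + ‖affOf k z 1‖ ^ 2 : ℝ) : ℂ) ^ 2) = ((fsHom z u v : ℝ) : ℂ) := by
    have hD : ((1 + ‖affOf k z 0‖ ^ 2 + ‖affOf k z 1‖ ^ 2 : ℝ) : ℂ) =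
        hsq z / (z k * conj (z k)) := by
      rw [Complex.ofReal_add, Complex.ofReal_add, hn, hn, hq]
      simp only [affOf, map_div₀]
      generalize conj (z k) = c0 at *
      field_simp
      push_cast
      ring
    have hR : ((fsHom z u v : ℝ) : ℂ) = -(Complex.I / 2) *
        ((herm u v * hsq z - herm u z * herm z v) -
          conj (herm u v * hsq z - herm u z * herm z v)) / (hsq z : ℂ) ^ 2 := by
      rw [fsHom, Complex.ofReal_div, him, Complex.ofReal_pow]
    rw [hD, hR, Complex.ofReal_add, Complex.ofReal_add, hn, hn, div_pow, div_div_eq_mul_div,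
      mul_div_assoc']
    congr 1
    simp only [dWedge, hherm, affOf, dAffOf_apply hz, map_sub, map_mul, map_div₀, map_pow, map_add,
      Complex.conj_conj, hq]
    -- With the conjugates as independent variables the claim is an identity of rational functions.
    clear hR hD hherm hsum him hn hs hz0 hq
    generalize conj (z k) = c0 at *
    generalize conj (z (k.succAbove 0)) = c1 at *
    generalize conj (z (k.succAbove 1)) = c2 at *
    generalize z k = z0 at *
    field_simp
    push_cast
    ring
  rw [fsCoord, key, Complex.ofReal_re]

end QuinticSmoothing
end

/-! ### The differential of the projection and the kernel of the pulled-back form. -/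

noncomputable section

open Filter

namespace QuinticSmoothing

lemma hasMFDerivAt_toCP {z : V3} (hz : z ≠ 0) :
    HasMFDerivAt 𝓘(ℝ, V3) I4 toCP z (dAffOf (chartIndex (toCP z)) z) := by
  have hk : z (chartIndex (toCP z)) ≠ 0 :=
    (rep_toCP_ne_zero_iff hz _).1 (rep_chartIndex_ne_zero _)
  refine ⟨continuousAt_toCP hz, ?_⟩
  have h : HasFDerivAt (affOf (chartIndex (toCP z))) (dAffOf (chartIndex (toCP z)) z) z :=
    ((contDiffAt_affOf hk).differentiableAt (by simp)).hasFDerivAt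
  have he : writtenInExtChartAt 𝓘(ℝ, V3) I4 z toCP =ᶠ[𝓝 z] affOf (chartIndex (toCP z)) := by
    filter_upwards [isOpen_ne.mem_nhds hz] with w hw
    exact affCoord_toCP _ hw
  exact (h.congr_of_eventuallyEq he).hasFDerivWithinAt

lemma mfderiv_toCP {z : V3} (hz : z ≠ 0) :
    mfderiv 𝓘(ℝ, V3) I4 toCP z = dAffOf (chartIndex (toCP z)) z :=
  (hasMFDerivAt_toCP hz).mfderiv

lemma fsForm_mfderiv_toCP {z : V3} (hz : z ≠ 0) (u v : V3) :
    fsForm (toCP z) (mfderiv 𝓘(ℝ, V3) I4 toCP z u) (mfderiv 𝓘(ℝ, V3) I4 toCP z v) =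
      fsHom z u v := by
  rw [mfderiv_toCP hz]
  have hk : z (chartIndex (toCP z)) ≠ 0 :=
    (rep_toCP_ne_zero_iff hz _).1 (rep_chartIndex_ne_zero _)
  have h : (chartAt (Fin 2 → ℂ) (toCP z)) (toCP z) = affOf (chartIndex (toCP z)) z :=
    affCoord_toCP _ hz
  exact (congrArg (fun x => fsCoord x (dAffOf (chartIndex (toCP z)) z u)
    (dAffOf (chartIndex (toCP z)) z v)) h).trans (fsCoord_affOf hk u v)

lemma mfderiv_toCP_surjective {z : V3} (hz : z ≠ 0) :
    Function.Surjective (mfderiv 𝓘(ℝ, V3) I4 toCP z) := by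
  obtain ⟨σ, h1, h2, h3⟩ := exists_section hz
  intro w
  have hσ : MDifferentiableAt I4 𝓘(ℝ, V3) σ (toCP z) := h1.mdifferentiableAt (by simp)
  have hd : MDifferentiableAt 𝓘(ℝ, V3) I4 toCP (σ (toCP z)) := by
    rw [h2]
    exact (contMDiffAt_toCP hz).mdifferentiableAt (by simp)
  have hc := mfderiv_comp (toCP z) hd hσ
  have he : toCP ∘ σ =ᶠ[𝓝 (toCP z)] id := h3.mono fun p hp => hp.2
  rw [he.mfderiv_eq, mfderiv_id] at hc
  have hw := congrArg (fun A => A w) hc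
  refine ⟨mfderiv I4 𝓘(ℝ, V3) σ (toCP z) w, ?_⟩
  have h4 : ∀ y, y = z → ∀ v : V3, (mfderiv 𝓘(ℝ, V3) I4 toCP y v : Fin 2 → ℂ) =
      mfderiv 𝓘(ℝ, V3) I4 toCP z v := by
    rintro y rfl v
    rfl
  exact (h4 _ h2 _).symm.trans hw.symm

/-! ### Algebra of the Fubini–Study form -/

lemma herm_add_left (u u' v : V3) : herm (u + u') v = herm u v + herm u' v := by
  simp [herm]; ring

lemma herm_add_right (u v v' : V3) : herm u (v + v') = herm u v + herm u v' := by
  simp [herm]; ring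

lemma herm_smul_left (a : ℂ) (u v : V3) : herm (a • u) v = conj a * herm u v := by
  simp [herm]; ring

lemma herm_smul_right (a : ℂ) (u v : V3) : herm u (a • v) = a * herm u v := by
  simp [herm]; ring

lemma conj_herm (u v : V3) : conj (herm u v) = herm v u := by
  simp [herm]; ring

lemma herm_self (z : V3) : herm z z = hsq z := by
  have h : ∀ w : ℂ, conj w * w = ((‖w‖ ^ 2 : ℝ) : ℂ) := fun w => by
    rw [mul_comm, Complex.mul_conj, Complex.normSq_eq_norm_sq]
  simp only [herm, h, hsq]
  push_cast
  ring

lemma fsHom_add_left (z u u' v : V3) : fsHom z (u + u') v = fsHom z u v + fsHom z u' v := by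
  rw [fsHom, fsHom, fsHom, ← add_div, ← Complex.add_im, herm_add_left, herm_add_left]
  congr 2
  ring

lemma fsHom_add_right (z u v v' : V3) : fsHom z u (v + v') = fsHom z u v + fsHom z u v' := by
  rw [fsHom, fsHom, fsHom, ← add_div, ← Complex.add_im, herm_add_right, herm_add_right]
  congr 2
  ring

lemma fsHom_smul_left (z : V3) (a : ℝ) (u v : V3) : fsHom z (a • u) v = a * fsHom z u v := by
  have h : a • u = (a : ℂ) • u := by ext; simp
  rw [fsHom, fsHom, h, herm_smul_left, herm_smul_left, Complex.conj_ofReal, mul_div_assoc',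
    ← Complex.im_ofReal_mul]
  congr 2
  ring

lemma fsHom_swap (z u v : V3) : fsHom z v u = -fsHom z u v := by
  rw [fsHom, fsHom, ← neg_div, ← Complex.conj_im]
  congr 2
  simp [conj_herm]
  ring

lemma fsHom_smul_right (z : V3) (a : ℝ) (u v : V3) : fsHom z u (a • v) = a * fsHom z u v := by
  rw [fsHom_swap, fsHom_smul_left, fsHom_swap z u v]
  ring

lemma fsHom_radial_left (z : V3) (c : ℂ) (v : V3) : fsHom z (c • z) v = 0 := by
  rw [fsHom, herm_smul_left, herm_smul_left, herm_self]
  have : conj c * herm z v * (hsq z : ℂ) - conj c * (hsq z : ℂ) * herm z v = 0 := by ring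
  rw [this]
  simp

lemma fsHom_radial_right (z : V3) (c : ℂ) (v : V3) : fsHom z v (c • z) = 0 := by
  rw [fsHom_swap, fsHom_radial_left, neg_zero]

lemma fsHom_smul {a : ℂ} (ha : a ≠ 0) (z u v : V3) :
    fsHom (a • z) (a • u) (a • v) = fsHom z u v := by
  have h2 : (‖a‖ ^ 2 : ℝ) ≠ 0 := (pow_pos (norm_pos_iff.2 ha) 2).ne'
  have h3 : conj a * a = ((‖a‖ ^ 2 : ℝ) : ℂ) := by
    rw [mul_comm, Complex.mul_conj, Complex.normSq_eq_norm_sq]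
  simp only [fsHom, herm_smul_left, herm_smul_right, hsq_smul]
  have : a * (conj a * herm u v) * ((‖a‖ ^ 2 * hsq z : ℝ) : ℂ) -
      a * (conj a * herm u z) * (a * (conj a * herm z v)) =
      ((‖a‖ ^ 2 * ‖a‖ ^ 2 : ℝ) : ℂ) * (herm u v * hsq z - herm u z * herm z v) := by
    push_cast at h3 ⊢
    rw [← h3]
    ring
  rw [this, Complex.im_ofReal_mul]
  rw [mul_pow]
  rw [show (‖a‖ ^ 2) ^ 2 = ‖a‖ ^ 2 * ‖a‖ ^ 2 by ring]
  exact mul_div_mul_left _ _ (mul_ne_zero h2 h2)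

lemma fsHom_self (z v : V3) : fsHom z v v = 0 := by
  have := fsHom_swap z v v
  linarith

/-- On the complement of the radial direction the form is given by the Hermitian product. -/
lemma fsHom_of_herm_eq_zero {z u : V3} (hu : herm u z = 0) (v : V3) (hz : z ≠ 0) :
    fsHom z u v = (herm u v).im / hsq z := by
  have h := (hsq_pos hz).ne'
  rw [fsHom, hu, zero_mul, sub_zero, mul_comm, Complex.im_ofReal_mul]
  field_simp

/-- After the radial component is removed, the pairing of the rest `u'` with `I • u'` is `hsq u' /
hsq z`. -/
lemma eq_smul_of_fsHom_eq_zero {z u : V3} (hz : z ≠ 0) (h : ∀ w, fsHom z u w = 0) :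
    ∃ c : ℂ, u = c • z := by
  have hs : ((hsq z : ℝ) : ℂ) ≠ 0 := by exact_mod_cast (hsq_pos hz).ne'
  set c := herm z u / hsq z with hc
  set u' := u + (-c) • z with hu'
  have h1 : herm u' z = 0 := by
    rw [hu', herm_add_left, herm_smul_left, herm_self, hc, map_neg, map_div₀, conj_herm,
      Complex.conj_ofReal]
    field_simp
    ring
  have h2 : fsHom z u' (Complex.I • u') = 0 := by
    rw [hu', fsHom_add_left, h, fsHom_radial_left, add_zero]
  rw [fsHom_of_herm_eq_zero h1 _ hz, herm_smul_right, herm_self] at h2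
  have h3 : hsq u' = 0 := by
    have := (div_eq_zero_iff.1 h2).resolve_right (hsq_pos hz).ne'
    simpa using this
  have h4 : u' = 0 := by
    by_contra hne
    exact (hsq_pos hne).ne' h3
  refine ⟨c, ?_⟩
  rw [hu', neg_smul, ← sub_eq_add_neg, sub_eq_zero] at h4
  exact h4

section Smooth

variable {E : Type*} [NormedAddCommGroup E] [NormedSpace ℝ E] {n : ℕ∞ω}

lemma ContDiffAt.herm {f g : E → V3} {x : E} (hf : ContDiffAt ℝ n f x) (hg : ContDiffAt ℝ n g x) :
    ContDiffAt ℝ n (fun x => herm (f x) (g x)) x := by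
  have hf' := contDiffAt_pi.1 hf
  have hg' := contDiffAt_pi.1 hg
  have hc : ∀ i, ContDiffAt ℝ n (fun x => conj (f x i)) x := fun i =>
    Complex.conjCLE.contDiff.contDiffAt.comp x (hf' i)
  exact (((hc 0).mul (hg' 0)).add ((hc 1).mul (hg' 1))).add ((hc 2).mul (hg' 2))

lemma ContDiffAt.hsq {f : E → V3} {x : E} (hf : ContDiffAt ℝ ∞ f x) :
    ContDiffAt ℝ ∞ (fun x => hsq (f x)) x := contDiff_hsq.contDiffAt.comp x hf

lemma ContDiffAt.fsHom {f g k : E → V3} {x : E} (hf : ContDiffAt ℝ ∞ f x)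
    (hg : ContDiffAt ℝ ∞ g x) (hk : ContDiffAt ℝ ∞ k x) (h0 : f x ≠ 0) :
    ContDiffAt ℝ ∞ (fun x => fsHom (f x) (g x) (k x)) x := by
  have h1 := ContDiffAt.hsq hf
  have h2 : ContDiffAt ℝ ∞ (fun x => ((QuinticSmoothing.hsq (f x) : ℝ) : ℂ)) x :=
    Complex.ofRealCLM.contDiff.contDiffAt.comp x h1
  refine ContDiffAt.div ?_ (h1.pow 2) (pow_pos (hsq_pos h0) 2).ne'
  exact Complex.imCLM.contDiff.contDiffAt.comp x
    (((ContDiffAt.herm hg hk).mul h2).sub ((ContDiffAt.herm hg hf).mul (ContDiffAt.herm hf hk)))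

end Smooth

end QuinticSmoothing
end

/-! ### The smoothed maximum and its symmetries. -/

noncomputable section

open Filter

namespace QuinticSmoothing

variable {b : ℝ → ℝ} {ε : ℝ}

lemma IsTransition.le_one (hb : IsTransition b ε) (a : ℝ) : b a ≤ 1 := by
  have h1 := hb.add_neg a
  have h2 := hb.nonneg (-a)
  linarith

/-- The logarithm of `softMax` in logarithmic coordinates. -/
def logSoftMax (b : ℝ → ℝ) (x y : ℝ) : ℝ := x + (y - x) * b (y - x)

lemma softMax_eq_exp (b : ℝ → ℝ) {u v : ℝ} (hu : 0 < u) (hv : 0 < v) :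
    softMax b u v = Real.exp (logSoftMax b (Real.log u) (Real.log v)) := by
  rw [softMax, if_neg hu.ne', if_neg hv.ne', Real.rpow_def_of_pos (div_pos hv hu),
    Real.log_div hv.ne' hu.ne', logSoftMax, Real.exp_add, Real.exp_log hu]

lemma logSoftMax_comm (hb : IsTransition b ε) (x y : ℝ) :
    logSoftMax b x y = logSoftMax b y x := by
  have h := hb.add_neg (y - x)
  rw [neg_sub] at h
  rw [logSoftMax, logSoftMax]
  linear_combination (y - x) * h

lemma softMax_comm (hb : IsTransition b ε) {u v : ℝ} (hu : 0 ≤ u) (hv : 0 ≤ v) :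
    softMax b u v = softMax b v u := by
  rcases hu.eq_or_lt with rfl | hu
  · by_cases h : v = 0 <;> simp [softMax, h]
  rcases hv.eq_or_lt with rfl | hv
  · simp [softMax, hu.ne']
  rw [softMax_eq_exp b hu hv, softMax_eq_exp b hv hu, logSoftMax_comm hb]

lemma softMax_of_small_right (hb : IsTransition b ε) {u v : ℝ} (hu : 0 < u) (hv : 0 ≤ v)
    (h : v ≤ u * Real.exp (-ε)) : softMax b u v = u := by
  rcases hv.eq_or_lt with rfl | hv
  · simp [softMax, hu.ne']
  rw [softMax, if_neg hu.ne', if_neg hv.ne', hb.vanish, Real.rpow_zero, mul_one]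
  rw [← Real.log_exp (-ε)]
  exact Real.log_le_log (div_pos hv hu) ((div_le_iff₀' hu).2 h)

lemma softMax_of_small_left (hb : IsTransition b ε) {u v : ℝ} (hu : 0 ≤ u) (hv : 0 < v)
    (h : u ≤ v * Real.exp (-ε)) : softMax b u v = v := by
  rw [softMax_comm hb hu hv.le, softMax_of_small_right hb hv hu h]

/-- The norm is not smooth at 0. But where one modulus is less than e^(-ε) times the other, the
function equals the larger one, whose argument is nonzero. -/
lemma contDiffAt_softMax_norm (hb : IsTransition b ε) {z w : ℂ} (h : z ≠ 0 ∨ w ≠ 0) :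
    ContDiffAt ℝ ∞ (fun q : ℂ × ℂ => softMax b ‖q.1‖ ‖q.2‖) (z, w) := by
  have hnorm : ∀ {u : ℂ}, u ≠ 0 → ContDiffAt ℝ ∞ (fun u : ℂ => ‖u‖) u := fun hu =>
    contDiffAt_norm ℝ hu
  have hopen : IsOpen {q : ℂ × ℂ | ‖q.2‖ < ‖q.1‖ * Real.exp (-ε)} :=
    isOpen_lt (by fun_prop) (by fun_prop)
  have hopen' : IsOpen {q : ℂ × ℂ | ‖q.1‖ < ‖q.2‖ * Real.exp (-ε)} :=
    isOpen_lt (by fun_prop) (by fun_prop)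
  by_cases hz : z = 0
  · have hw : w ≠ 0 := h.resolve_left (not_not.2 hz)
    refine ((hnorm hw).comp (z, w) contDiffAt_snd).congr_of_eventuallyEq ?_
    have : (z, w) ∈ {q : ℂ × ℂ | ‖q.1‖ < ‖q.2‖ * Real.exp (-ε)} := by
      simp only [mem_ofPred_eq, hz, norm_zero]
      positivity
    filter_upwards [hopen'.mem_nhds this] with q (hq : ‖q.1‖ < ‖q.2‖ * Real.exp (-ε))
    refine softMax_of_small_left hb (norm_nonneg _) ?_ hq.le
    exact pos_of_mul_pos_left ((norm_nonneg _).trans_lt hq) (Real.exp_pos _).le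
  by_cases hw : w = 0
  · refine ((hnorm hz).comp (z, w) contDiffAt_fst).congr_of_eventuallyEq ?_
    have : (z, w) ∈ {q : ℂ × ℂ | ‖q.2‖ < ‖q.1‖ * Real.exp (-ε)} := by
      simp only [mem_ofPred_eq, hw, norm_zero]
      positivity
    filter_upwards [hopen.mem_nhds this] with q (hq : ‖q.2‖ < ‖q.1‖ * Real.exp (-ε))
    refine softMax_of_small_right hb ?_ (norm_nonneg _) hq.le
    exact pos_of_mul_pos_left ((norm_nonneg _).trans_lt hq) (Real.exp_pos _).le
  have h1 : ContDiffAt ℝ ∞ (fun q : ℂ × ℂ => Real.log ‖q.1‖) (z, w) :=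
    ((hnorm hz).comp (z, w) contDiffAt_fst).log (norm_ne_zero_iff.2 hz)
  have h2 : ContDiffAt ℝ ∞ (fun q : ℂ × ℂ => Real.log ‖q.2‖) (z, w) :=
    ((hnorm hw).comp (z, w) contDiffAt_snd).log (norm_ne_zero_iff.2 hw)
  have h3 : ContDiffAt ℝ ∞ (fun q : ℂ × ℂ =>
      Real.exp (logSoftMax b (Real.log ‖q.1‖) (Real.log ‖q.2‖))) (z, w) :=
    (h1.add ((h2.sub h1).mul (hb.smooth.contDiffAt.comp (z, w) (h2.sub h1)))).exp
  refine h3.congr_of_eventuallyEq ?_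
  have e1 : ∀ᶠ q : ℂ × ℂ in 𝓝 (z, w), q.1 ≠ 0 := continuousAt_fst.eventually_ne hz
  have e2 : ∀ᶠ q : ℂ × ℂ in 𝓝 (z, w), q.2 ≠ 0 := continuousAt_snd.eventually_ne hw
  filter_upwards [e1, e2] with q hq1 hq2
  exact softMax_eq_exp b (norm_pos_iff.2 hq1) (norm_pos_iff.2 hq2)

/-! ### The deformation in homogeneous coordinates -/

/-- At most one homogeneous coordinate vanishes. -/
def NonVertex (z : V3) : Prop := ∀ i : Fin 3, z (i + 1) ≠ 0 ∨ z (i + 2) ≠ 0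

lemma NonVertex.ne_zero {z : V3} (hz : NonVertex z) : z ≠ 0 := by
  rintro rfl
  simpa using hz 0

lemma NonVertex.smul {z : V3} (hz : NonVertex z) {a : ℂ} (ha : a ≠ 0) : NonVertex (a • z) := by
  intro i
  simpa [ha] using hz i

/-- The factor of the deformation at the coordinate `i`. -/
def deformFactor (b : ℝ → ℝ) (z : V3) (i : Fin 3) : ℝ := softMax b ‖z (i + 1)‖ ‖z (i + 2)‖

/-- The cyclic labelling (i + 1, i + 2) reverses the arguments at the middle index, hence the appeal
to symmetry. -/
lemma deformVec_apply (hb : IsTransition b ε) (t : ℝ) (z : V3) (i : Fin 3) :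
    deformVec b t z i = z i * ((deformFactor b z i ^ t : ℝ) : ℂ) := by
  fin_cases i
  · rfl
  · change z 1 * ((softMax b ‖z 0‖ ‖z 2‖ ^ t : ℝ) : ℂ) = z 1 * ((softMax b ‖z 2‖ ‖z 0‖ ^ t : ℝ) : ℂ)
    rw [softMax_comm hb (norm_nonneg (z 0)) (norm_nonneg (z 2))]
  · rfl

lemma deformFactor_pos {z : V3} (hz : NonVertex z) (i : Fin 3) : 0 < deformFactor b z i :=
  softMax_pos b (norm_nonneg _) (norm_nonneg _) (by simpa using hz i)

lemma deformVec_eq_zero_iff (hb : IsTransition b ε) {t : ℝ} {z : V3} (hz : NonVertex z)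
    (i : Fin 3) : deformVec b t z i = 0 ↔ z i = 0 := by
  have h : ((deformFactor b z i ^ t : ℝ) : ℂ) ≠ 0 := by
    exact_mod_cast (Real.rpow_pos_of_pos (deformFactor_pos hz i) t).ne'
  rw [deformVec_apply hb, mul_eq_zero, or_iff_left h]

lemma deformVec_nonVertex (hb : IsTransition b ε) (t : ℝ) {z : V3} (hz : NonVertex z) :
    NonVertex (deformVec b t z) := fun i => by
  simpa [deformVec_eq_zero_iff hb hz] using hz i

lemma contDiffAt_deformFactor (hb : IsTransition b ε) {z : V3} (hz : NonVertex z) (i : Fin 3) :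
    ContDiffAt ℝ ∞ (fun z => deformFactor b z i) z := by
  have h : ContDiffAt ℝ ∞ (fun z : V3 => (z (i + 1), z (i + 2))) z :=
    (contDiff_apply ℝ ℂ (i + 1)).contDiffAt.prodMk (contDiff_apply ℝ ℂ (i + 2)).contDiffAt
  exact (contDiffAt_softMax_norm hb (hz i)).comp z h

lemma contDiffAt_deformVec (hb : IsTransition b ε) (t : ℝ) {z : V3} (hz : NonVertex z) :
    ContDiffAt ℝ ∞ (fun q : ℝ × V3 => deformVec b q.1 q.2) (t, z) := by
  refine contDiffAt_pi.2 fun i => ?_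
  simp only [deformVec_apply hb]
  have h1 : ContDiffAt ℝ ∞ (fun q : ℝ × V3 => deformFactor b q.2 i) (t, z) :=
    (contDiffAt_deformFactor hb hz i).comp (t, z) contDiffAt_snd
  have h2 : ContDiffAt ℝ ∞ (fun q : ℝ × V3 => deformFactor b q.2 i ^ q.1) (t, z) :=
    h1.rpow contDiffAt_fst (deformFactor_pos hz i).ne'
  exact ((contDiff_apply ℝ ℂ i).contDiffAt.comp (t, z) contDiffAt_snd).mul
    (Complex.ofRealCLM.contDiff.contDiffAt.comp (t, z) h2)

lemma contDiffAt_deformVec_right (hb : IsTransition b ε) (t : ℝ) {z : V3} (hz : NonVertex z) :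
    ContDiffAt ℝ ∞ (deformVec b t) z :=
  (contDiffAt_deformVec hb t hz).comp z (contDiffAt_const.prodMk contDiffAt_id)

lemma deformVec_smul' (t : ℝ) {a : ℂ} (ha : a ≠ 0) (z : V3) :
    deformVec b t (a • z) = (a * ((‖a‖ ^ t : ℝ) : ℂ)) • deformVec b t z :=
  deformVec_smul b t ha z

lemma deform_toCP (hb : IsTransition b ε) (t : ℝ) {z : V3} (hz : NonVertex z) :
    deform b t (toCP z) = toCP (deformVec b t z) := by
  have h := (deformVec_nonVertex hb t hz).ne_zero
  rw [toCP_of_ne hz.ne_zero, toCP_of_ne h, deform_mk b t z _ h]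

/-- The derivative of the deformation in the space variable. -/
def dDeform (b : ℝ → ℝ) (t : ℝ) (z : V3) : V3 →L[ℝ] V3 := fderiv ℝ (deformVec b t) z

/-- The time derivative of the deformation. -/
def deformVel (b : ℝ → ℝ) (t : ℝ) (z : V3) : V3 := deriv (fun s => deformVec b s z) t

lemma hasFDerivAt_deformVec (hb : IsTransition b ε) (t : ℝ) {z : V3} (hz : NonVertex z) :
    HasFDerivAt (deformVec b t) (dDeform b t z) z :=
  ((contDiffAt_deformVec_right hb t hz).differentiableAt (by simp)).hasFDerivAt

lemma hasDerivAt_deformVec_time (hb : IsTransition b ε) (t : ℝ) {z : V3} (hz : NonVertex z) :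
    HasDerivAt (fun s => deformVec b s z) (deformVel b t z) t := by
  have h : ContDiffAt ℝ ∞ (fun s => deformVec b s z) t :=
    (contDiffAt_deformVec hb t hz).comp t (contDiffAt_id.prodMk contDiffAt_const)
  exact (h.differentiableAt (by simp)).hasDerivAt

lemma hasFDerivAt_deformVec_total (hb : IsTransition b ε) (t : ℝ) {z : V3} (hz : NonVertex z) :
    HasFDerivAt (fun q : ℝ × V3 => deformVec b q.1 q.2)
      ((ContinuousLinearMap.toSpanSingleton ℝ (deformVel b t z)).comp (.fst ℝ ℝ V3) +
        (dDeform b t z).comp (.snd ℝ ℝ V3)) (t, z) := by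
  have h := ((contDiffAt_deformVec hb t hz).differentiableAt (by simp)).hasFDerivAt
  set A := fderiv ℝ (fun q : ℝ × V3 => deformVec b q.1 q.2) (t, z)
  have h1 : A.comp (.inr ℝ ℝ V3) = dDeform b t z :=
    (h.comp z (hasFDerivAt_prodMk_right t z)).unique (hasFDerivAt_deformVec hb t hz)
  have h2 : A (1, 0) = deformVel b t z := by
    have h3 : HasDerivAt (fun s : ℝ => (s, z)) ((1 : ℝ), (0 : V3)) t :=
      (hasDerivAt_id t).prodMk (hasDerivAt_const t z)
    have h4 : HasDerivAt (fun s => deformVec b s z) (A (1, 0)) t :=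
      HasFDerivAt.comp_hasDerivAt (l := fun q : ℝ × V3 => deformVec b q.1 q.2) t h h3
    exact h4.unique (hasDerivAt_deformVec_time hb t hz)
  have h5 : (ContinuousLinearMap.toSpanSingleton ℝ (deformVel b t z)).comp (.fst ℝ ℝ V3) +
      (dDeform b t z).comp (.snd ℝ ℝ V3) = A := by
    refine ContinuousLinearMap.ext fun ⟨r, v⟩ => ?_
    have e : ((r, v) : ℝ × V3) = r • ((1 : ℝ), (0 : V3)) + (0, v) := by simp
    have h6 : A (0, v) = dDeform b t z v := congrArg (fun B => B v) h1
    rw [e, map_add A, map_smul A, h2, h6]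
    simp
  rw [h5]
  exact h

/-- Differentiate F_t(e^(sc) z) = e^(s((1+t) Re c + i Im c)) F_t(z) at s = 0: moduli scale with
degree 1 + t, phases with degree 1. In particular radial vectors go to radial vectors. -/
lemma dDeform_radial (hb : IsTransition b ε) (t : ℝ) {z : V3} (hz : NonVertex z) (c : ℂ) :
    dDeform b t z (c • z) = (((1 + t) * c.re : ℝ) + Complex.I * c.im : ℂ) • deformVec b t z := by
  have h1 : HasDerivAt (fun s : ℝ => Complex.exp (s * c) • z) (c • z) 0 := by
    have h : HasDerivAt (fun s : ℝ => Complex.exp (s * c)) c 0 := by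
      have := ((Complex.ofRealCLM.hasDerivAt (x := 0)).mul_const c).cexp
      simpa using this
    exact h.smul_const z
  have h2 : HasFDerivAt (deformVec b t) (dDeform b t z) (Complex.exp ((0 : ℝ) * c) • z) := by
    simpa using hasFDerivAt_deformVec hb t hz
  have h3 := h2.comp_hasDerivAt 0 h1
  have h4 : (deformVec b t ∘ fun s : ℝ => Complex.exp (s * c) • z) =
      fun s : ℝ => Complex.exp (s * (((1 + t) * c.re : ℝ) + Complex.I * c.im : ℂ)) •
        deformVec b t z := by
    funext s
    rw [Function.comp_apply, deformVec_smul' t (Complex.exp_ne_zero _), Complex.norm_exp,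
      ← Real.exp_mul]
    congr 1
    rw [Complex.ofReal_exp, ← Complex.exp_add]
    congr 1
    have hre : (↑s * c : ℂ).re = s * c.re := by simp
    rw [hre]
    have hc : (s : ℂ) * c = s * (c.re + c.im * Complex.I) := by rw [Complex.re_add_im c]
    rw [hc]
    push_cast
    ring
  rw [h4] at h3
  have h5 : HasDerivAt (fun s : ℝ => Complex.exp (s * (((1 + t) * c.re : ℝ) +
      Complex.I * c.im : ℂ)) • deformVec b t z)
      ((((1 + t) * c.re : ℝ) + Complex.I * c.im : ℂ) • deformVec b t z) 0 := by
    have h : HasDerivAt (fun s : ℝ => Complex.exp (s * (((1 + t) * c.re : ℝ) +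
        Complex.I * c.im : ℂ))) (((1 + t) * c.re : ℝ) + Complex.I * c.im : ℂ) 0 := by
      have := ((Complex.ofRealCLM.hasDerivAt (x := 0)).mul_const
        (((1 + t) * c.re : ℝ) + Complex.I * c.im : ℂ)).cexp
      simpa using this
    exact h.smul_const _
  exact h3.unique h5

/-! ### Permutations of the coordinates -/

/-- A permutation of three indices keeps or reverses their cyclic order, and a reversal only swaps
the two arguments of `softMax`. This symmetry lets later estimates assume that the moduli are
sorted. -/
lemma deformFactor_comp_perm (hb : IsTransition b ε) (σ : Equiv.Perm (Fin 3)) (z : V3)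
    (i : Fin 3) : deformFactor b (z ∘ σ) i = deformFactor b z (σ i) := by
  have h : ∀ (σ : Equiv.Perm (Fin 3)) (i : Fin 3),
      (σ (i + 1) = σ i + 1 ∧ σ (i + 2) = σ i + 2) ∨
        (σ (i + 1) = σ i + 2 ∧ σ (i + 2) = σ i + 1) := by decide
  rcases h σ i with ⟨h1, h2⟩ | ⟨h1, h2⟩
  · simp [deformFactor, h1, h2]
  · simp only [deformFactor, Function.comp_apply, h1, h2]
    exact softMax_comm hb (norm_nonneg _) (norm_nonneg _)

lemma deformVec_comp_perm (hb : IsTransition b ε) (t : ℝ) (σ : Equiv.Perm (Fin 3)) (z : V3) :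
    deformVec b t (z ∘ σ) = deformVec b t z ∘ σ := by
  funext i
  rw [Function.comp_apply, deformVec_apply hb, deformVec_apply hb, deformFactor_comp_perm hb]
  rfl

lemma sum_comp_perm {R : Type*} [AddCommMonoid R] (σ : Equiv.Perm (Fin 3)) (f : Fin 3 → R) :
    f (σ 0) + f (σ 1) + f (σ 2) = f 0 + f 1 + f 2 := by
  rw [← Fin.sum_univ_three, ← Fin.sum_univ_three fun i => f (σ i)]
  exact Equiv.sum_comp σ f

lemma hsq_comp_perm (σ : Equiv.Perm (Fin 3)) (z : V3) : hsq (z ∘ σ) = hsq z :=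
  sum_comp_perm σ fun i => ‖z i‖ ^ 2

lemma herm_comp_perm (σ : Equiv.Perm (Fin 3)) (u v : V3) : herm (u ∘ σ) (v ∘ σ) = herm u v :=
  sum_comp_perm σ fun i => conj (u i) * v i

lemma fsHom_comp_perm (σ : Equiv.Perm (Fin 3)) (z u v : V3) :
    fsHom (z ∘ σ) (u ∘ σ) (v ∘ σ) = fsHom z u v := by
  simp only [fsHom, herm_comp_perm, hsq_comp_perm]

lemma NonVertex.comp_perm {z : V3} (hz : NonVertex z) (σ : Equiv.Perm (Fin 3)) :
    NonVertex (z ∘ σ) := by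
  have h : ∀ (σ : Equiv.Perm (Fin 3)) (i : Fin 3),
      (σ (i + 1) = σ i + 1 ∧ σ (i + 2) = σ i + 2) ∨
        (σ (i + 1) = σ i + 2 ∧ σ (i + 2) = σ i + 1) := by decide
  intro i
  rcases h σ i with ⟨h1, h2⟩ | ⟨h1, h2⟩
  · simpa [h1, h2] using hz (σ i)
  · simpa [h1, h2] using (hz (σ i)).symm

/-- Reindexing of the coordinates as a linear map. -/
def permCLM (σ : Equiv.Perm (Fin 3)) : V3 →L[ℝ] V3 :=
  ContinuousLinearMap.pi fun i => ContinuousLinearMap.proj (σ i)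

lemma dDeform_comp_perm (hb : IsTransition b ε) (t : ℝ) (σ : Equiv.Perm (Fin 3)) {z : V3}
    (hz : NonVertex z) (w : V3) : dDeform b t (z ∘ σ) (w ∘ σ) = dDeform b t z w ∘ σ := by
  have h1 := (hasFDerivAt_deformVec hb t (hz.comp_perm σ)).comp z (permCLM σ).hasFDerivAt
  have h2 := (permCLM σ).hasFDerivAt.comp z (hasFDerivAt_deformVec hb t hz)
  have h3 : deformVec b t ∘ permCLM σ = permCLM σ ∘ deformVec b t :=
    funext fun z => deformVec_comp_perm hb t σ z
  rw [h3] at h1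
  exact congrArg (fun A => A w) (h1.unique h2)

/-- The cone over the Fermat quintic. -/
def quinticPoly (z : V3) : ℂ := z 0 ^ 5 + z 1 ^ 5 + z 2 ^ 5

lemma nonVertex_of_quintic {z : V3} (hz : z ≠ 0) (h : quinticPoly z = 0) : NonVertex z := by
  intro i
  by_contra hi
  push Not at hi
  apply hz
  funext j
  unfold quinticPoly at h
  fin_cases i <;> fin_cases j <;> simp_all

lemma mem_fermatQuintic {z : V3} (hz : z ≠ 0) : toCP z ∈ fermatQuintic ↔ quinticPoly z = 0 := by
  obtain ⟨a, ha, h⟩ := exists_rep_toCP hz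
  have : quinticPoly (a • z) = a ^ 5 * quinticPoly z := by
    simp [quinticPoly, mul_pow]
    ring
  change quinticPoly (toCP z).rep = 0 ↔ _
  rw [h, this, mul_eq_zero, or_iff_right (pow_ne_zero 5 ha)]

end QuinticSmoothing
end

/-! ### Logarithmic derivatives of the deformation. -/

noncomputable section

open Filter

namespace QuinticSmoothing

variable {b : ℝ → ℝ} {ε : ℝ}

lemma logSoftMax_le (hb : IsTransition b ε) (x y : ℝ) : logSoftMax b x y ≤ max x y := by
  have h0 := hb.nonneg (y - x)
  have h1 := hb.le_one (y - x)
  unfold logSoftMax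
  rcases le_total x y with h | h
  · rw [max_eq_right h]; nlinarith
  · rw [max_eq_left h]; nlinarith

lemma le_logSoftMax (hb : IsTransition b ε) (x y : ℝ) :
    max x y - ε ≤ logSoftMax b x y := by
  wlog h : y ≤ x generalizing x y
  · rw [max_comm, logSoftMax_comm hb]
    exact this y x (le_of_not_ge h)
  rw [max_eq_left h]
  unfold logSoftMax
  have h0 := hb.nonneg (y - x)
  have h1 := hb.le_one (y - x)
  rcases le_total (y - x) (-ε) with h2 | h2
  · rw [hb.vanish _ h2]
    have := hb.add_neg 0
    have : 0 < ε := by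
      by_contra hε
      have := hb.vanish 0 (by linarith)
      simp_all
    linarith
  · nlinarith

/-- The maximum is 1-Lipschitz in one argument and `logSoftMax` lies below it by at most ε; no
derivative of `b` is involved. -/
lemma logSoftMax_sub_le (hb : IsTransition b ε) (x x' y : ℝ) :
    |logSoftMax b x y - logSoftMax b x' y| ≤ |x - x'| + ε := by
  have h1 := logSoftMax_le hb x y
  have h2 := logSoftMax_le hb x' y
  have h3 := le_logSoftMax hb x y
  have h4 := le_logSoftMax hb x' y
  have h5 := abs_max_sub_max_le_abs x x' y
  rw [abs_le] at h5 ⊢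
  constructor <;> linarith

/-- The derivative of `a ↦ a b(a)`. -/
def slope (b : ℝ → ℝ) (a : ℝ) : ℝ := b a + deriv b a * a

lemma slope_of_lt (hb : IsTransition b ε) {a : ℝ} (ha : a < -ε) : slope b a = 0 := by
  have h : deriv b a = 0 := by
    have : b =ᶠ[𝓝 a] fun _ => 0 := by
      filter_upwards [Iio_mem_nhds ha] with x hx using hb.vanish x (le_of_lt hx)
    rw [this.deriv_eq, deriv_const]
  rw [slope, hb.vanish a ha.le, h]
  simp

lemma hasDerivAt_log_norm {z : ℝ → ℂ} {w : ℂ} {s : ℝ} (hz : HasDerivAt z w s) (h0 : z s ≠ 0) :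
    HasDerivAt (fun s => Real.log ‖z s‖) ((w / z s).re) s := by
  have h1 : HasDerivAt (fun s => ‖z s‖ ^ 2) (2 * inner ℝ (z s) w) s := hz.norm_sq
  have h2 := h1.log (by positivity)
  have h3 : (fun s => Real.log ‖z s‖) = fun s => Real.log (‖z s‖ ^ 2) / 2 := by
    funext s
    rw [Real.log_pow]
    push_cast
    ring
  rw [h3]
  refine (h2.div_const 2).congr_deriv ?_
  rw [Complex.div_re, Complex.inner, ← Complex.normSq_eq_norm_sq]
  simp
  ring

lemma hasDerivAt_logSoftMax (hb : IsTransition b ε) {x y : ℝ → ℝ} {x' y' s : ℝ}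
    (hx : HasDerivAt x x' s) (hy : HasDerivAt y y' s) :
    HasDerivAt (fun s => logSoftMax b (x s) (y s))
      ((1 - slope b (y s - x s)) * x' + slope b (y s - x s) * y') s := by
  have h1 := hy.sub hx
  have h2 : HasDerivAt b (deriv b (y s - x s)) (y s - x s) :=
    (hb.smooth.differentiable (by simp)).differentiableAt.hasDerivAt
  have h3 := hx.add (h1.mul (h2.comp s h1))
  refine h3.congr_deriv ?_
  simp only [slope, Pi.sub_apply, Function.comp_apply]
  ring

/-- The logarithmic derivative of `softMax` is a combination of those of the two moduli with weights
`1 - slope` and `slope`. The weights need not lie in [0, 1]; this is why a bound on `slope` enters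
the estimates. -/
lemma hasDerivAt_mul_softMax (hb : IsTransition b ε) (t : ℝ) {x y z : ℝ → ℂ} {x' y' z' : ℂ} {s : ℝ}
    (hx : HasDerivAt x x' s) (hy : HasDerivAt y y' s) (hz : HasDerivAt z z' s)
    (hx0 : x s ≠ 0) (hy0 : y s ≠ 0) (hz0 : z s ≠ 0) :
    HasDerivAt (fun s => x s * ((softMax b ‖y s‖ ‖z s‖ ^ t : ℝ) : ℂ))
      (x s * ((softMax b ‖y s‖ ‖z s‖ ^ t : ℝ) : ℂ) * (x' / x s +
        (t * ((1 - slope b (Real.log ‖z s‖ - Real.log ‖y s‖)) * (y' / y s).re +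
          slope b (Real.log ‖z s‖ - Real.log ‖y s‖) * (z' / z s).re) : ℝ))) s := by
  have h1 := ((hasDerivAt_logSoftMax hb (hasDerivAt_log_norm hy hy0)
    (hasDerivAt_log_norm hz hz0)).mul_const t).exp.ofReal_comp
  have h2 := hx.mul h1
  have e : ∀ᶠ s in 𝓝 s, softMax b ‖y s‖ ‖z s‖ ^ t =
      Real.exp (logSoftMax b (Real.log ‖y s‖) (Real.log ‖z s‖) * t) := by
    filter_upwards [hy.continuousAt.eventually_ne hy0, hz.continuousAt.eventually_ne hz0] with r h h'
    rw [softMax_eq_exp b (norm_pos_iff.2 h) (norm_pos_iff.2 h'), Real.exp_mul]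
  have h3 : (fun s => x s * ((softMax b ‖y s‖ ‖z s‖ ^ t : ℝ) : ℂ)) =ᶠ[𝓝 s]
      (x * fun s => ((Real.exp (logSoftMax b (Real.log ‖y s‖) (Real.log ‖z s‖) * t) : ℝ) : ℂ)) := by
    filter_upwards [e] with r hr
    rw [hr, Pi.mul_apply]
  refine (h2.congr_of_eventuallyEq h3).congr_deriv ?_
  rw [e.self_of_nhds]
  push_cast
  field_simp

/-- The logarithmic derivative of the deformation at a point with nonzero coordinates. -/
lemma dDeform_apply (hb : IsTransition b ε) (t : ℝ) {z : V3} (hz : ∀ i, z i ≠ 0) (w : V3) :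
    dDeform b t z w = ![
      deformVec b t z 0 * (w 0 / z 0 +
        (t * ((1 - slope b (Real.log ‖z 2‖ - Real.log ‖z 1‖)) * (w 1 / z 1).re +
          slope b (Real.log ‖z 2‖ - Real.log ‖z 1‖) * (w 2 / z 2).re) : ℝ)),
      deformVec b t z 1 * (w 1 / z 1 +
        (t * ((1 - slope b (Real.log ‖z 2‖ - Real.log ‖z 0‖)) * (w 0 / z 0).re +
          slope b (Real.log ‖z 2‖ - Real.log ‖z 0‖) * (w 2 / z 2).re) : ℝ)),
      deformVec b t z 2 * (w 2 / z 2 +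
        (t * ((1 - slope b (Real.log ‖z 1‖ - Real.log ‖z 0‖)) * (w 0 / z 0).re +
          slope b (Real.log ‖z 1‖ - Real.log ‖z 0‖) * (w 1 / z 1).re) : ℝ))] := by
  have hnv : NonVertex z := fun i => Or.inl (hz _)
  have hc : ∀ i, HasDerivAt (fun s : ℝ => z i + s * w i) (w i) 0 := fun i => by
    have := ((Complex.ofRealCLM.hasDerivAt (x := 0)).mul_const (w i)).const_add (z i)
    simpa using this
  have hline : HasDerivAt (fun s : ℝ => fun i => z i + s * w i) w 0 :=
    hasDerivAt_pi.2 hc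
  have h1 : HasFDerivAt (deformVec b t) (dDeform b t z) (fun i => z i + (0 : ℝ) * w i) := by
    simpa using hasFDerivAt_deformVec hb t hnv
  have h2 := hasDerivAt_pi.1 (h1.comp_hasDerivAt 0 hline)
  have h3 := fun i j k => hasDerivAt_mul_softMax hb t (hc i) (hc j) (hc k)
    (by simpa using hz i) (by simpa using hz j) (by simpa using hz k)
  funext i
  fin_cases i
  · refine ((h2 0).unique (h3 0 1 2)).trans ?_
    simp [deformVec]
  · refine ((h2 1).unique (h3 1 0 2)).trans ?_
    simp [deformVec]
  · refine ((h2 2).unique (h3 2 0 1)).trans ?_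
    simp [deformVec]

/-! ### The positivity estimate -/

/-- The bilinear form of the symplectic area of a tangent plane of the deformed curve. -/
lemma area_form_pos {C κ t m0 m1 m2 a0 a1 a2 c12 c02 c01 : ℝ} (hC : 1 ≤ C) (hκ : 0 < κ)
    (hCκ : C * κ ≤ 1 / 50) (ht0 : 0 ≤ t) (ht1 : t ≤ 1) (hm0 : 0 < m0) (hm1 : 0 < m1) (hm2 : 0 < m2)
    (ha2 : 0 < a2) (ha21 : a2 ≤ a1) (ha10 : a1 ≤ a0) (ha : a0 ≤ 4 * a1)
    (hc12 : |c12| ≤ C) (hc02 : |c02| ≤ C) (hc01 : |c01| ≤ C)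
    (h12 : c12 = 0 ∨ (a1 - a2 ≤ κ * a1 ∧ |m1 - m2| ≤ κ * m2))
    (h02 : c02 = 0 ∨ (a0 - a2 ≤ κ * a0 ∧ |m0 - m2| ≤ κ * m2))
    (h01 : c01 = 0 ∨ (a0 - a1 ≤ κ * a0 ∧ |m0 - m1| ≤ κ * m1)) :
    0 < m0 * m1 * (1 - t) * a2 + m0 * m2 * ((1 - t) * a1 + t * (a0 + a1 - a2) / 2) + m1 * m2 * a0 +
      t * (c12 * (m0 * (((m1 - m2) * a0 - (m1 + m2) * (a1 - a2)) / 2))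
        - c02 * (m1 * (((m0 + m2) * (a0 - a2) - (m0 - m2) * a1) / 2))
        + c01 * (m2 * (((m0 - m1) * a2 - (m0 + m1) * (a0 - a1)) / 2))) := by
  have hκ1 : κ ≤ 1 / 50 := by nlinarith
  -- A slope can be as large as C, but it is nonzero only for two nearly equal coordinates, where
  -- its cofactor is O(κ); then C κ ≤ 1/50 gives 1/25.
  have err : ∀ {c M P D E : ℝ}, |c| ≤ C → 0 < M → 0 < P →
      (c = 0 ∨ |E| ≤ 2 * κ * P) → |c * (M * E)| ≤ (1 / 25) * (M * P) := by
    intro c M P D E hc hM hP h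
    rcases h with rfl | h
    · rw [zero_mul, abs_zero]; positivity
    · rw [abs_mul, abs_mul, abs_of_pos hM]
      calc |c| * (M * |E|) ≤ C * (M * (2 * κ * P)) := by gcongr
        _ = (C * κ) * (2 * (M * P)) := by ring
        _ ≤ (1 / 50) * (2 * (M * P)) := by gcongr
        _ = _ := by ring
  have main : ∀ {x y d r s : ℝ}, 0 < y → 0 < s → |x - y| ≤ κ * y → 0 ≤ d → d ≤ κ * s → 0 ≤ r →
      r ≤ s → |((x - y) * r - (x + y) * d) / 2| ≤ 2 * κ * (y * s) := by
    intro x y d r s hy hs hxy hd0 hd hr0 hr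
    have h1 : |(x - y) * r| ≤ κ * y * s := by
      rw [abs_mul, abs_of_nonneg hr0]; gcongr
    have h2 : |x + y| ≤ 3 * y := by
      rw [abs_le] at hxy ⊢
      constructor <;> nlinarith
    have h3 : |(x + y) * d| ≤ 3 * y * (κ * s) := by
      rw [abs_mul, abs_of_nonneg hd0]; gcongr
    have h4 := abs_sub ((x - y) * r) ((x + y) * d)
    rw [abs_div, abs_of_pos (by norm_num : (0 : ℝ) < 2)]
    linarith
  have e12 := err (D := 0) (E := ((m1 - m2) * a0 - (m1 + m2) * (a1 - a2)) / 2) hc12 hm0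
    (P := m2 * a0) (by nlinarith) (h12.imp_right fun h =>
      main hm2 (by linarith) h.2 (by linarith) (h.1.trans (by nlinarith)) (by linarith) le_rfl)
  have e02 := err (D := 0) (E := ((m0 + m2) * (a0 - a2) - (m0 - m2) * a1) / 2) hc02 hm1
    (P := m2 * a0) (by nlinarith) (h02.imp_right fun h => by
      have := main (r := a1) hm2 (s := a0) (by linarith) h.2 (d := a0 - a2) (by linarith) h.1
        (by linarith) ha10
      rw [abs_div] at this ⊢
      rwa [abs_sub_comm])
  have e01 := err (D := 0) (E := ((m0 - m1) * a2 - (m0 + m1) * (a0 - a1)) / 2) hc01 hm2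
    (P := m1 * a0) (by nlinarith) (h01.imp_right fun h =>
      main hm1 (by linarith) h.2 (by linarith) h.1 (by linarith) (by linarith))
  rw [abs_le] at e12 e02 e01
  have hA : 0 ≤ m0 * m1 * (1 - t) * a2 := by
    have : 0 ≤ 1 - t := by linarith
    positivity
  -- The part with 1 - t uses a0 ≤ 4 a1, the part with t uses a2 ≤ a1; the bound survives up to t =
  -- 1.
  have hB : a0 / 4 ≤ (1 - t) * a1 + t * (a0 + a1 - a2) / 2 := by nlinarith
  have hB' : m0 * m2 * (a0 / 4) ≤ m0 * m2 * ((1 - t) * a1 + t * (a0 + a1 - a2) / 2) := by gcongr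
  have p1 : 0 < m0 * m2 * a0 := by have : 0 < a0 := by linarith
                                   positivity
  have p2 : 0 < m1 * m2 * a0 := by have : 0 < a0 := by linarith
                                   positivity
  set T := c12 * (m0 * (((m1 - m2) * a0 - (m1 + m2) * (a1 - a2)) / 2))
        - c02 * (m1 * (((m0 + m2) * (a0 - a2) - (m0 - m2) * a1) / 2))
        + c01 * (m2 * (((m0 - m1) * a2 - (m0 + m1) * (a0 - a1)) / 2)) with hT
  -- The errors consume 1/25 of m0 m2 a0 and 2/25 of m1 m2 a0, of which 1/4 and 1 are available.
  have hTl : -(1 / 25 * (m0 * m2 * a0) + 2 / 25 * (m1 * m2 * a0)) ≤ T := by linarith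
  have htT : -(1 / 25 * (m0 * m2 * a0) + 2 / 25 * (m1 * m2 * a0)) ≤ t * T := by nlinarith
  linarith

lemma abs_exp_sub_exp_le {x y δ : ℝ} (h : |x - y| ≤ δ) (hδ : δ ≤ 1) :
    |Real.exp x - Real.exp y| ≤ 2 * δ * Real.exp y := by
  have h1 : Real.exp x - Real.exp y = (Real.exp (x - y) - 1) * Real.exp y := by
    rw [sub_mul, ← Real.exp_add]; simp
  rw [h1, abs_mul, abs_of_pos (Real.exp_pos y)]
  gcongr
  exact (Real.abs_exp_sub_one_le (h.trans hδ)).trans (by linarith)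

/-- Lagrange's identity in logarithmic coordinates. Only differences of the entries of `η` enter,
because a constant `η` is radial. -/
lemma fsHom_mul (F η η' : V3) :
    fsHom F (F * η) (F * η') =
      (‖F 0‖ ^ 2 * ‖F 1‖ ^ 2 * (conj (η 1 - η 0) * (η' 1 - η' 0)).im +
        ‖F 0‖ ^ 2 * ‖F 2‖ ^ 2 * (conj (η 2 - η 0) * (η' 2 - η' 0)).im +
        ‖F 1‖ ^ 2 * ‖F 2‖ ^ 2 * (conj (η 2 - η 1) * (η' 2 - η' 1)).im) / hsq F ^ 2 := by
  have hm : ∀ i, conj (F i) * F i = ((‖F i‖ ^ 2 : ℝ) : ℂ) := fun i => by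
    rw [Complex.conj_mul']; push_cast; rfl
  have h : herm (F * η) (F * η') * hsq F - herm (F * η) F * herm F (F * η') =
      ((‖F 0‖ ^ 2 * ‖F 1‖ ^ 2 : ℝ) : ℂ) * (conj (η 1 - η 0) * (η' 1 - η' 0)) +
        ((‖F 0‖ ^ 2 * ‖F 2‖ ^ 2 : ℝ) : ℂ) * (conj (η 2 - η 0) * (η' 2 - η' 0)) +
        ((‖F 1‖ ^ 2 * ‖F 2‖ ^ 2 : ℝ) : ℂ) * (conj (η 2 - η 1) * (η' 2 - η' 1)) := by
    have e1 : herm (F * η) (F * η') = ((‖F 0‖ ^ 2 : ℝ) : ℂ) * (conj (η 0) * η' 0) +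
        ((‖F 1‖ ^ 2 : ℝ) : ℂ) * (conj (η 1) * η' 1) +
        ((‖F 2‖ ^ 2 : ℝ) : ℂ) * (conj (η 2) * η' 2) := by
      simp only [herm, ← hm, Pi.mul_apply, map_mul]; ring
    have e2 : herm (F * η) F = ((‖F 0‖ ^ 2 : ℝ) : ℂ) * conj (η 0) +
        ((‖F 1‖ ^ 2 : ℝ) : ℂ) * conj (η 1) + ((‖F 2‖ ^ 2 : ℝ) : ℂ) * conj (η 2) := by
      simp only [herm, ← hm, Pi.mul_apply, map_mul]; ring
    have e3 : herm F (F * η') = ((‖F 0‖ ^ 2 : ℝ) : ℂ) * η' 0 +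
        ((‖F 1‖ ^ 2 : ℝ) : ℂ) * η' 1 + ((‖F 2‖ ^ 2 : ℝ) : ℂ) * η' 2 := by
      simp only [herm, ← hm, Pi.mul_apply]; ring
    rw [e1, e2, e3, hsq]
    simp only [map_sub]
    push_cast
    ring
  rw [fsHom, h]
  simp only [Complex.add_im, Complex.im_ofReal_mul]

/-- Positivity at a point with nonzero coordinates of decreasing size. -/
lemma fsHom_dDeform_pos_of_sorted {C t : ℝ} (hb : IsTransition b ε) (hC : 1 ≤ C) (hε : 0 < ε)
    (hεC : 1000 * C * ε ≤ 1) (hbC : ∀ a, |slope b a| ≤ C) (ht0 : 0 ≤ t) (ht1 : t ≤ 1) {z w : V3}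
    (hz : ∀ i, z i ≠ 0) (hP : quinticPoly z = 0)
    (hw : z 0 ^ 4 * w 0 + z 1 ^ 4 * w 1 + z 2 ^ 4 * w 2 = 0) (hwz : ∀ c : ℂ, w ≠ c • z)
    (h10 : ‖z 1‖ ≤ ‖z 0‖) (h21 : ‖z 2‖ ≤ ‖z 1‖) :
    0 < fsHom (deformVec b t z) (dDeform b t z w) (dDeform b t z (Complex.I • w)) := by
  have hε1 : ε ≤ 1 / 1000 := by nlinarith
  have hpos : ∀ i, 0 < ‖z i‖ := fun i => norm_pos_iff.2 (hz i)
  have hnv : NonVertex z := fun i => Or.inl (hz _)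
  set F := deformVec b t z with hF
  have hF0 : ∀ i, F i ≠ 0 := fun i => (deformVec_eq_zero_iff hb hnv i).not.2 (hz i)
  set u : Fin 3 → ℝ := fun i => Real.log ‖z i‖ with hu
  set c12 := slope b (u 2 - u 1) with hc12
  set c02 := slope b (u 2 - u 0) with hc02
  set c01 := slope b (u 1 - u 0) with hc01
  set η : V3 := fun i => w i / z i with hη
  -- the slope of `η`
  set s : ℂ := (η 1 - η 0) / z 2 ^ 5 with hs
  have hp2 : z 2 ^ 5 ≠ 0 := pow_ne_zero _ (hz 2)
  have hwη : ∀ i, w i = z i * η i := fun i => by simp only [hη]; field_simp [hz i]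
  have hP' : z 0 ^ 5 + z 1 ^ 5 + z 2 ^ 5 = 0 := hP
  have hsum : z 0 ^ 5 * η 0 + z 1 ^ 5 * η 1 + z 2 ^ 5 * η 2 = 0 := by
    rw [hwη 0, hwη 1, hwη 2] at hw
    linear_combination hw
  -- The relations Σ z_i⁵ = 0 and Σ z_i⁵ η_i = 0 determine `η`, up to a constant, by the single
  -- number `s`: each side of the triangle of the η_i is ±s times the fifth power at the opposite
  -- index.
  have hs1 : η 1 - η 0 = s * z 2 ^ 5 := (div_mul_cancel₀ _ hp2).symm
  have hs2 : η 2 - η 0 = -(s * z 1 ^ 5) := by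
    refine mul_left_cancel₀ hp2 ?_
    linear_combination hsum - η 0 * hP' - z 1 ^ 5 * hs1
  have hs3 : η 2 - η 1 = s * z 0 ^ 5 := by
    linear_combination hs2 - hs1 - s * hP'
  have hs0 : s ≠ 0 := by
    intro h0
    rw [h0, zero_mul] at hs1
    rw [h0, zero_mul, neg_zero] at hs2
    refine hwz (η 0) (funext fun i => ?_)
    rw [hwη i, Pi.smul_apply, smul_eq_mul, mul_comm]
    congr 1
    fin_cases i
    · rfl
    · exact sub_eq_zero.1 hs1
    · exact sub_eq_zero.1 hs2
  set S := ‖s‖ ^ 2 with hS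
  have hSpos : 0 < S := by positivity
  set a : Fin 3 → ℝ := fun i => ‖z i ^ 5‖ ^ 2 with ha
  have hn1 : ((η 1).re - (η 0).re) ^ 2 + ((η 1).im - (η 0).im) ^ 2 = S * a 2 := by
    rw [hS, ha, ← mul_pow, ← norm_mul, ← hs1, ← Complex.normSq_eq_norm_sq, Complex.normSq_apply]
    simp only [Complex.sub_re, Complex.sub_im]; ring
  have hn2 : ((η 2).re - (η 0).re) ^ 2 + ((η 2).im - (η 0).im) ^ 2 = S * a 1 := by
    rw [hS, ha, ← mul_pow, ← norm_mul, ← norm_neg, ← hs2, ← Complex.normSq_eq_norm_sq,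
      Complex.normSq_apply]
    simp only [Complex.sub_re, Complex.sub_im]; ring
  have hn3 : ((η 2).re - (η 1).re) ^ 2 + ((η 2).im - (η 1).im) ^ 2 = S * a 0 := by
    rw [hS, ha, ← mul_pow, ← norm_mul, ← hs3, ← Complex.normSq_eq_norm_sq, Complex.normSq_apply]
    simp only [Complex.sub_re, Complex.sub_im]; ring
  -- the derivative
  let L : ℝ → ℝ → ℝ → V3 := fun x0 x1 x2 => ![((t * ((1 - c12) * x1 + c12 * x2) : ℝ) : ℂ),
    ((t * ((1 - c02) * x0 + c02 * x2) : ℝ) : ℂ), ((t * ((1 - c01) * x0 + c01 * x1) : ℝ) : ℂ)]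
  have hD : ∀ w' : V3, dDeform b t z w' = F * ((fun i => w' i / z i) +
      L (w' 0 / z 0).re (w' 1 / z 1).re (w' 2 / z 2).re) := fun w' => by
    rw [dDeform_apply hb t hz]
    funext i
    fin_cases i <;> rfl
  have hI : ∀ i, (Complex.I • w) i / z i = Complex.I * η i := fun i => by
    rw [Pi.smul_apply, smul_eq_mul, mul_div_assoc]
  set m : Fin 3 → ℝ := fun i => ‖F i‖ ^ 2 with hm
  -- `hn1`, `hn2`, `hn3` are the three squared side lengths of that triangle, so polarization
  -- eliminates the mixed products. The terms without slopes are the area for a true maximum.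
  have key : fsHom F (dDeform b t z w) (dDeform b t z (Complex.I • w)) = S * (
      m 0 * m 1 * (1 - t) * a 2 + m 0 * m 2 * ((1 - t) * a 1 + t * (a 0 + a 1 - a 2) / 2)
        + m 1 * m 2 * a 0 +
      t * (c12 * (m 0 * (((m 1 - m 2) * a 0 - (m 1 + m 2) * (a 1 - a 2)) / 2))
        - c02 * (m 1 * (((m 0 + m 2) * (a 0 - a 2) - (m 0 - m 2) * a 1) / 2))
        + c01 * (m 2 * (((m 0 - m 1) * a 2 - (m 0 + m 1) * (a 0 - a 1)) / 2)))) / hsq F ^ 2 := by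
    rw [hD, hD, fsHom_mul]
    congr 1
    simp only [hI]
    change m 0 * m 1 * (conj ((η 1 + _) - (η 0 + _)) *
        ((Complex.I * η 1 + _) - (Complex.I * η 0 + _))).im +
      m 0 * m 2 * (conj ((η 2 + _) - (η 0 + _)) *
        ((Complex.I * η 2 + _) - (Complex.I * η 0 + _))).im +
      m 1 * m 2 * (conj ((η 2 + _) - (η 1 + _)) *
        ((Complex.I * η 2 + _) - (Complex.I * η 1 + _))).im = _
    simp only [L, Matrix.cons_val, map_sub, map_add, Complex.conj_ofReal, Complex.mul_im,
      Complex.sub_im, Complex.add_im, Complex.sub_re, Complex.add_re, Complex.conj_re,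
      Complex.conj_im, Complex.ofReal_re, Complex.ofReal_im, Complex.mul_re, Complex.I_re,
      Complex.I_im]
    clear_value m a S c12 c02 c01
    change _ * _ * (((η 1).re + t * ((1 - c02) * (η 0).re + c02 * (η 2).re) - _) * _ + _) +
      _ + _ = _
    linear_combination
      (m 0 * m 1 * (1 - t) + m 1 * m 2 + t * (c12 * m 0 * m 1 - c01 * m 1 * m 2) +
        (-t * m 0 * m 2 - 2 * m 1 * m 2 + t * (c12 * (m 0 * m 2 - m 0 * m 1) +
          c02 * (m 0 * m 1 + m 1 * m 2) + c01 * (m 0 * m 2 + m 1 * m 2))) / 2) * hn1 +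
      (m 0 * m 2 + m 1 * m 2 + t * (-c12 * m 0 * m 2 - c02 * m 1 * m 2) +
        (-t * m 0 * m 2 - 2 * m 1 * m 2 + t * (c12 * (m 0 * m 2 - m 0 * m 1) +
          c02 * (m 0 * m 1 + m 1 * m 2) + c01 * (m 0 * m 2 + m 1 * m 2))) / 2) * hn2 -
      ((-t * m 0 * m 2 - 2 * m 1 * m 2 + t * (c12 * (m 0 * m 2 - m 0 * m 1) +
          c02 * (m 0 * m 1 + m 1 * m 2) + c01 * (m 0 * m 2 + m 1 * m 2))) / 2) * hn3
  rw [key]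
  have hFne : F ≠ 0 := (deformVec_nonVertex hb t hnv).ne_zero
  refine div_pos (mul_pos hSpos ?_) (pow_pos (hsq_pos hFne) 2)
  -- the estimates
  have hexp : ∀ i, ‖z i‖ = Real.exp (u i) := fun i => (Real.exp_log (hpos i)).symm
  have ha_exp : ∀ i, a i = Real.exp (10 * u i) := fun i => by
    simp only [ha]
    rw [norm_pow, hexp, ← pow_mul, ← Real.exp_nat_mul]
    norm_num
  have hm_exp : ∀ i j k, F i = z i * ((softMax b ‖z j‖ ‖z k‖ ^ t : ℝ) : ℂ) →
      m i = Real.exp (2 * (u i + logSoftMax b (u j) (u k) * t)) := fun i j k h => by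
    have h0 : 0 ≤ softMax b ‖z j‖ ‖z k‖ ^ t := by
      have := softMax_nonneg b (norm_nonneg (z j)) (norm_nonneg (z k))
      positivity
    simp only [hm]
    rw [h, norm_mul, Complex.norm_real, Real.norm_of_nonneg h0,
      softMax_eq_exp b (hpos j) (hpos k), ← Real.exp_mul, hexp, ← Real.exp_add, ← Real.exp_nat_mul]
    rw [Nat.cast_ofNat]
  have hm0 := hm_exp 0 1 2 rfl
  have hm1 := hm_exp 1 0 2 rfl
  have hm2 := hm_exp 2 0 1 rfl
  -- The exponents differ by at most 2(ε + 2ε) = 6ε, so the exponentials differ by a relative error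
  -- of at most 12ε. The constant 20 is dictated by the factor 10 in the exponent of `a`.
  have hmd : ∀ {x y l l' : ℝ}, |x - y| ≤ ε → |l - l'| ≤ |x - y| + ε →
      |Real.exp (2 * (x + l * t)) - Real.exp (2 * (y + l' * t))| ≤
        20 * ε * Real.exp (2 * (y + l' * t)) := by
    intro x y l l' h1 h2
    have h3 : |2 * (x + l * t) - 2 * (y + l' * t)| ≤ 6 * ε := by
      have e : 2 * (x + l * t) - 2 * (y + l' * t) = 2 * (x - y) + 2 * ((l - l') * t) := by ring
      have h5 : |(l - l') * t| ≤ 2 * ε * 1 := by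
        rw [abs_mul, abs_of_nonneg ht0]; gcongr; linarith
      rw [e]
      rw [abs_le] at *
      constructor <;> linarith
    refine (abs_exp_sub_exp_le h3 (by linarith)).trans ?_
    nlinarith [mul_pos hε (Real.exp_pos (2 * (y + l' * t)))]
  have had : ∀ {i j}, |u i - u j| ≤ ε → a i - a j ≤ 20 * ε * a i := fun {i j} h => by
    rw [ha_exp, ha_exp]
    have h3 : |10 * u j - 10 * u i| ≤ 10 * ε := by
      rw [← mul_sub, abs_mul, abs_sub_comm]; norm_num; exact h
    have := abs_exp_sub_exp_le h3 (by linarith)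
    rw [abs_le] at this
    linarith [this.1]
  have hule : ∀ {i j}, ‖z j‖ ≤ ‖z i‖ → u j ≤ u i := fun h => Real.log_le_log (hpos _) h
  have hclose : ∀ {i j}, ‖z j‖ ≤ ‖z i‖ → slope b (u j - u i) = 0 ∨ |u i - u j| ≤ ε := by
    intro i j h
    rcases lt_or_ge (u j - u i) (-ε) with h1 | h1
    · exact Or.inl (slope_of_lt hb h1)
    · right
      rw [abs_of_nonneg (by linarith [hule h])]
      linarith
  have hale : ∀ {i j}, ‖z j‖ ≤ ‖z i‖ → a j ≤ a i := fun h => by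
    rw [ha_exp, ha_exp]
    exact Real.exp_le_exp.2 (by linarith [hule h])
  -- On the quintic |z_0⁵| ≤ |z_1⁵| + |z_2⁵| ≤ 2 |z_1⁵|, and `a` is the square.
  have ha04 : a 0 ≤ 4 * a 1 := by
    have h1 : ‖z 0 ^ 5‖ ≤ ‖z 1 ^ 5‖ + ‖z 2 ^ 5‖ := by
      have : z 0 ^ 5 = -(z 1 ^ 5 + z 2 ^ 5) := by linear_combination hP'
      rw [this, norm_neg]
      exact norm_add_le _ _
    have h2 : ‖z 2 ^ 5‖ ≤ ‖z 1 ^ 5‖ := by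
      rw [norm_pow, norm_pow]; gcongr
    simp only [ha]
    nlinarith [norm_nonneg (z 0 ^ 5), norm_nonneg (z 1 ^ 5)]
  refine area_form_pos (κ := 20 * ε) hC (by linarith) (by linarith) ht0 ht1
    (by rw [hm0]; positivity) (by rw [hm1]; positivity) (by rw [hm2]; positivity)
    (by rw [ha_exp]; positivity) (hale h21) (hale h10) ha04 (hbC _) (hbC _) (hbC _)
    ((hclose h21).imp_right fun h => ⟨had h, ?_⟩)
    ((hclose (h21.trans h10)).imp_right fun h => ⟨had h, ?_⟩)
    ((hclose h10).imp_right fun h => ⟨had h, ?_⟩)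
  · rw [hm1, hm2]
    refine hmd h ?_
    rw [logSoftMax_comm hb (u 0) (u 2), logSoftMax_comm hb (u 0) (u 1), abs_sub_comm (u 1)]
    exact logSoftMax_sub_le hb _ _ _
  · rw [hm0, hm2]
    refine hmd h ?_
    rw [logSoftMax_comm hb (u 1) (u 2), abs_sub_comm (u 0)]
    exact logSoftMax_sub_le hb _ _ _
  · rw [hm0, hm1]
    refine hmd h ?_
    rw [abs_sub_comm (u 0)]
    exact logSoftMax_sub_le hb _ _ _

/-- The derivative of the deformation in the direction normal to a coordinate line. -/
lemma dDeform_normal (hb : IsTransition b ε) (t : ℝ) {z : V3} (h0 : z 0 ≠ 0) (h1 : z 1 ≠ 0)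
    (h2 : z 2 = 0) (d : ℂ) : dDeform b t z ![0, 0, d] =
      ![0, 0, d * ((softMax b ‖z 0‖ ‖z 1‖ ^ t : ℝ) : ℂ)] := by
  have hnv : NonVertex z := fun i => by fin_cases i <;> simp [h0, h1]
  have hline : HasDerivAt (fun s : ℝ => z + s • ![0, 0, d]) (![0, 0, d] : V3) 0 := by
    simpa using ((hasDerivAt_id (0 : ℝ)).smul_const (![0, 0, d] : V3)).const_add z
  have h3 : HasFDerivAt (deformVec b t) (dDeform b t z) (z + (0 : ℝ) • ![0, 0, d]) := by
    simpa using hasFDerivAt_deformVec hb t hnv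
  have h4 := h3.comp_hasDerivAt 0 hline
  have h5 : HasDerivAt (fun s : ℝ => (![z 0 * ((‖z 1‖ ^ t : ℝ) : ℂ), z 1 * ((‖z 0‖ ^ t : ℝ) : ℂ), 0] : V3)
      + s • ![0, 0, d * ((softMax b ‖z 0‖ ‖z 1‖ ^ t : ℝ) : ℂ)])
      ![0, 0, d * ((softMax b ‖z 0‖ ‖z 1‖ ^ t : ℝ) : ℂ)] 0 := by
    simpa using ((hasDerivAt_id (0 : ℝ)).smul_const
      (![0, 0, d * ((softMax b ‖z 0‖ ‖z 1‖ ^ t : ℝ) : ℂ)] : V3)).const_add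
      (![z 0 * ((‖z 1‖ ^ t : ℝ) : ℂ), z 1 * ((‖z 0‖ ^ t : ℝ) : ℂ), 0] : V3)
  have hlim : Tendsto (fun s : ℝ => ‖s * d‖) (𝓝 0) (𝓝 0) := by
    have : Continuous fun s : ℝ => ‖s * d‖ := by fun_prop
    simpa using this.tendsto 0
  have p0 : 0 < ‖z 0‖ * Real.exp (-ε) := mul_pos (norm_pos_iff.2 h0) (Real.exp_pos _)
  have p1 : 0 < ‖z 1‖ * Real.exp (-ε) := mul_pos (norm_pos_iff.2 h1) (Real.exp_pos _)
  refine h4.unique (h5.congr_of_eventuallyEq ?_)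
  -- As long as the third coordinate is small, the two factors that contain it are constant.
  filter_upwards [hlim.eventually (gt_mem_nhds p0), hlim.eventually (gt_mem_nhds p1)] with s e0 e1
  have q0 := softMax_of_small_right hb (norm_pos_iff.2 h0) (norm_nonneg _) e0.le
  have q1 := softMax_of_small_right hb (norm_pos_iff.2 h1) (norm_nonneg _) e1.le
  have ez : z + s • ![0, 0, d] = ![z 0, z 1, s * d] := by
    funext i
    fin_cases i <;> simp [h2]
  rw [Function.comp_apply, ez]
  simp only [deformVec, Matrix.cons_val]
  rw [q0, q1]
  simp [mul_assoc]

/-- Logarithmic coordinates fail on a coordinate line. But modulo the radial direction the tangent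
line of the cone is the normal direction of that line, on which the derivative is multiplication by
a positive number; hence positivity, without any smallness of ε. -/
lemma fsHom_dDeform_pos_of_zero {t : ℝ} (hb : IsTransition b ε) {z w : V3}
    (h0 : z 0 ≠ 0) (h1 : z 1 ≠ 0) (h2 : z 2 = 0) (hP : quinticPoly z = 0)
    (hw : z 0 ^ 4 * w 0 + z 1 ^ 4 * w 1 + z 2 ^ 4 * w 2 = 0) (hwz : ∀ c : ℂ, w ≠ c • z) :
    0 < fsHom (deformVec b t z) (dDeform b t z w) (dDeform b t z (Complex.I • w)) := by
  have hnv : NonVertex z := fun i => by fin_cases i <;> simp [h0, h1]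
  have hw' : w = (w 0 / z 0) • z + ![0, 0, w 2] := by
    funext i
    fin_cases i
    · simp [h0]
    · have hP' : z 0 ^ 5 + z 1 ^ 5 = 0 := by simpa [quinticPoly, h2] using hP
      have hw' : z 0 ^ 4 * w 0 + z 1 ^ 4 * w 1 = 0 := by simpa [h2] using hw
      simp
      field_simp
      refine mul_left_cancel₀ (pow_ne_zero 4 h1) ?_
      linear_combination z 0 * hw' - w 0 * hP'
    · simp [h2]
  have hd : w 2 ≠ 0 := by
    intro h
    refine hwz (w 0 / z 0) ?_
    conv_lhs => rw [hw', h]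
    funext i
    fin_cases i <;> simp
  have hIw : Complex.I • w = (Complex.I * (w 0 / z 0)) • z + ![0, 0, Complex.I * w 2] := by
    conv_lhs => rw [hw', smul_add, smul_smul]
    simp
  have hM : 0 < softMax b ‖z 0‖ ‖z 1‖ ^ t :=
    Real.rpow_pos_of_pos (softMax_pos b (norm_nonneg _) (norm_nonneg _) (by simp [h0])) t
  rw [hIw]
  conv => enter [2, 2]; rw [hw']
  rw [map_add, map_add, dDeform_radial hb t hnv, dDeform_radial hb t hnv,
    dDeform_normal hb t h0 h1 h2, dDeform_normal hb t h0 h1 h2, fsHom_add_left,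
    fsHom_radial_left, fsHom_add_right, fsHom_radial_right, zero_add, zero_add,
    fsHom_of_herm_eq_zero _ _ (deformVec_nonVertex hb t hnv).ne_zero]
  · refine div_pos ?_ (hsq_pos (deformVec_nonVertex hb t hnv).ne_zero)
    set M := softMax b ‖z 0‖ ‖z 1‖ ^ t
    have : herm ![0, 0, w 2 * (M : ℂ)] ![0, 0, Complex.I * w 2 * (M : ℂ)] =
        Complex.I * ((‖w 2‖ ^ 2 * M ^ 2 : ℝ) : ℂ) := by
      have h := Complex.conj_mul' (w 2)
      simp [herm]
      linear_combination Complex.I * M ^ 2 * h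
    rw [this, Complex.I_mul_im, Complex.ofReal_re]
    have := norm_pos_iff.2 hd
    positivity
  · simp [herm, deformVec, h2]

lemma exists_perm_antitone (z : V3) : ∃ σ : Equiv.Perm (Fin 3),
    ‖(z ∘ σ) 1‖ ≤ ‖(z ∘ σ) 0‖ ∧ ‖(z ∘ σ) 2‖ ≤ ‖(z ∘ σ) 1‖ := by
  have hσ := Tuple.monotone_sort fun i => -‖z i‖
  exact ⟨_, neg_le_neg_iff.1 (hσ (by decide : (0 : Fin 3) ≤ 1)),
    neg_le_neg_iff.1 (hσ (by decide : (1 : Fin 3) ≤ 2))⟩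

/-- The deformed quintic is symplectic: the Fubini–Study form is positive on the image of
every complex tangent line of the quintic. -/
theorem fsHom_dDeform_pos {C t : ℝ} (hb : IsTransition b ε) (hC : 1 ≤ C) (hε : 0 < ε)
    (hεC : 1000 * C * ε ≤ 1) (hbC : ∀ a, |slope b a| ≤ C) (ht0 : 0 ≤ t) (ht1 : t ≤ 1) {z w : V3}
    (hz : z ≠ 0) (hP : quinticPoly z = 0)
    (hw : z 0 ^ 4 * w 0 + z 1 ^ 4 * w 1 + z 2 ^ 4 * w 2 = 0) (hwz : ∀ c : ℂ, w ≠ c • z) :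
    0 < fsHom (deformVec b t z) (dDeform b t z w) (dDeform b t z (Complex.I • w)) := by
  have hnv := nonVertex_of_quintic hz hP
  obtain ⟨σ, h10, h21⟩ := exists_perm_antitone z
  have hP' : quinticPoly (z ∘ σ) = 0 := (sum_comp_perm σ fun i => z i ^ 5).trans hP
  have hw' : (z ∘ σ) 0 ^ 4 * (w ∘ σ) 0 + (z ∘ σ) 1 ^ 4 * (w ∘ σ) 1 +
      (z ∘ σ) 2 ^ 4 * (w ∘ σ) 2 = 0 := (sum_comp_perm σ fun i => z i ^ 4 * w i).trans hw
  have hwz' : ∀ c : ℂ, w ∘ σ ≠ c • (z ∘ σ) := fun c h => hwz c (by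
    funext i
    simpa using congrFun h (σ.symm i))
  have key : 0 < fsHom (deformVec b t (z ∘ σ)) (dDeform b t (z ∘ σ) (w ∘ σ))
      (dDeform b t (z ∘ σ) (Complex.I • (w ∘ σ))) := by
    by_cases h2 : (z ∘ σ) 2 = 0
    · have hnv' := hnv.comp_perm σ
      have h0 : (z ∘ σ) 0 ≠ 0 := (hnv' 1).resolve_left (not_not.2 h2)
      have h1 : (z ∘ σ) 1 ≠ 0 := (hnv' 0).resolve_right (not_not.2 h2)
      exact fsHom_dDeform_pos_of_zero hb h0 h1 h2 hP' hw' hwz'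
    · have p2 := norm_pos_iff.2 h2
      have h1 : (z ∘ σ) 1 ≠ 0 := norm_pos_iff.1 (p2.trans_le h21)
      have h0 : (z ∘ σ) 0 ≠ 0 := norm_pos_iff.1 ((p2.trans_le h21).trans_le h10)
      refine fsHom_dDeform_pos_of_sorted hb hC hε hεC hbC ht0 ht1 (fun i => ?_) hP' hw' hwz' h10 h21
      fin_cases i <;> assumption
  have e : Complex.I • (w ∘ σ) = (Complex.I • w) ∘ σ := rfl
  rwa [e, dDeform_comp_perm hb t σ hnv, dDeform_comp_perm hb t σ hnv, deformVec_comp_perm hb,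
    fsHom_comp_perm] at key

end QuinticSmoothing
end

/-! ### Injectivity of the deformation on the quintic. -/

noncomputable section

open Filter

namespace QuinticSmoothing

variable {b : ℝ → ℝ} {ε : ℝ}

lemma hasDerivAt_sub_mul (hb : IsTransition b ε) (t u : ℝ) :
    HasDerivAt (fun u => u - t * (u * b u)) (1 - t * slope b u) u := by
  have h : HasDerivAt b (deriv b u) u :=
    (hb.smooth.differentiable (by simp)).differentiableAt.hasDerivAt
  refine ((hasDerivAt_id u).sub (((hasDerivAt_id u).mul h).const_mul t)).congr_deriv ?_
  simp only [slope, id]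
  ring

/-- The logarithm of the ratio of two coordinates of the deformation, along the real segment of
the quintic, is increasing. -/
lemma strictMonoOn_segment {C t : ℝ} (hb : IsTransition b ε) (hC : 1 ≤ C) (hε : 0 < ε)
    (hεC : 1000 * C * ε ≤ 1) (hbC : ∀ a, |slope b a| ≤ C) (ht0 : 0 ≤ t) (ht1 : t ≤ 1) :
    StrictMonoOn (fun ρ => (Real.log ρ / 5 - t * (Real.log ρ / 5 * b (Real.log ρ / 5))) -
      (Real.log (1 - ρ) / 5 - t * (Real.log (1 - ρ) / 5 * b (Real.log (1 - ρ) / 5))))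
      (Ioo 0 1) := by
  have hd : ∀ ρ ∈ Ioo (0 : ℝ) 1, HasDerivAt
      (fun ρ => (Real.log ρ / 5 - t * (Real.log ρ / 5 * b (Real.log ρ / 5))) -
      (Real.log (1 - ρ) / 5 - t * (Real.log (1 - ρ) / 5 * b (Real.log (1 - ρ) / 5))))
      ((1 - t * slope b (Real.log ρ / 5)) * (ρ⁻¹ / 5) -
        (1 - t * slope b (Real.log (1 - ρ) / 5)) * ((-1) / (1 - ρ) / 5)) ρ := by
    intro ρ hρ
    have h1 := (Real.hasDerivAt_log hρ.1.ne').div_const 5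
    have h2 := (((hasDerivAt_id ρ).const_sub 1).log
      (by simpa using (sub_pos.2 hρ.2).ne')).div_const 5
    exact ((hasDerivAt_sub_mul hb t _).comp ρ h1).sub ((hasDerivAt_sub_mul hb t _).comp ρ h2)
  -- one of the two summands of the derivative dominates
  have key : ∀ x y : ℝ, 0 < x → 0 < y → x + y = 1 → x ≤ y →
      0 < (1 - t * slope b (Real.log x / 5)) / x + (1 - t * slope b (Real.log y / 5)) / y := by
    intro x y hx hy hxy hle
    have hx2 : x ≤ 1 / 2 := by linarith
    have hlx : slope b (Real.log x / 5) = 0 := by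
      -- For x ≤ 1/2 one has log x / 5 ≤ -1/10 < -ε, so only the larger variable can have a nonzero
      -- slope.
      refine slope_of_lt hb ?_
      have h1 : Real.log x ≤ x - 1 := Real.log_le_sub_one_of_pos hx
      nlinarith
    rw [hlx, mul_zero, sub_zero]
    have hy2 : 1 / 2 ≤ y := by linarith
    have hs := abs_le.1 (hbC (Real.log y / 5))
    by_cases hy0 : slope b (Real.log y / 5) = 0
    · rw [hy0, mul_zero, sub_zero]
      positivity
    have hly : -ε ≤ Real.log y / 5 := by
      by_contra h
      exact hy0 (slope_of_lt hb (lt_of_not_ge h))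
    -- A nonzero slope at y puts y within 5ε of 1. Then x ≤ 5ε, and 1/x ≥ 200 C outweighs the other
    -- summand, which is at least -2C.
    have hyε : 1 - 5 * ε ≤ y := by
      rw [← Real.exp_log hy]
      linarith [Real.add_one_le_exp (Real.log y)]
    have hxε : x ≤ 5 * ε := by linarith
    have h1 : 200 * C ≤ 1 / x := by
      rw [le_div_iff₀ hx]
      nlinarith
    have h2 : -(2 * C) ≤ (1 - t * slope b (Real.log y / 5)) / y := by
      rw [le_div_iff₀ hy]
      nlinarith
    linarith
  refine strictMonoOn_of_deriv_pos (convex_Ioo 0 1)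
    (fun ρ hρ => (hd ρ hρ).continuousAt.continuousWithinAt) fun ρ hρ => ?_
  rw [interior_Ioo] at hρ
  rw [(hd ρ hρ).deriv]
  have h1 : 0 < 1 - ρ := sub_pos.2 hρ.2
  have e : (1 - t * slope b (Real.log ρ / 5)) * (ρ⁻¹ / 5) -
        (1 - t * slope b (Real.log (1 - ρ) / 5)) * ((-1) / (1 - ρ) / 5) =
      ((1 - t * slope b (Real.log ρ / 5)) / ρ +
        (1 - t * slope b (Real.log (1 - ρ) / 5)) / (1 - ρ)) / 5 := by
    have := hρ.1.ne'
    field_simp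
    ring
  rw [e]
  refine div_pos ?_ (by norm_num)
  rcases le_total ρ (1 - ρ) with h | h
  · exact key ρ (1 - ρ) hρ.1 h1 (by ring) h
  · rw [add_comm]
    exact key (1 - ρ) ρ h1 hρ.1 (by ring) h

lemma log_norm_deformVec (b : ℝ → ℝ) (t : ℝ) {x y z : ℂ} (hx : x ≠ 0) (hy : y ≠ 0) (hz : z ≠ 0) :
    Real.log ‖x * ((softMax b ‖y‖ ‖z‖ ^ t : ℝ) : ℂ)‖ =
      Real.log ‖x‖ + t * logSoftMax b (Real.log ‖y‖) (Real.log ‖z‖) := by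
  rw [softMax_eq_exp b (norm_pos_iff.2 hy) (norm_pos_iff.2 hz), ← Real.exp_mul, norm_mul,
    Complex.norm_real, Real.norm_of_nonneg (Real.exp_pos _).le, Real.log_mul (norm_ne_zero_iff.2 hx)
    (Real.exp_pos _).ne', Real.log_exp, mul_comm]

/-- On the real segment of the quintic, the deformation determines the point. -/
lemma log_ratio_segment {t ρ : ℝ} {z : V3} (hz : ∀ i, z i ≠ 0) (hρ0 : 0 < ρ) (hρ1 : ρ < 1)
    (h1 : z 1 ^ 5 = -(ρ * z 0 ^ 5)) (h2 : z 2 ^ 5 = -((1 - ρ : ℝ) * z 0 ^ 5)) :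
    (Real.log ρ / 5 - t * (Real.log ρ / 5 * b (Real.log ρ / 5))) -
      (Real.log (1 - ρ) / 5 - t * (Real.log (1 - ρ) / 5 * b (Real.log (1 - ρ) / 5))) =
    Real.log ‖deformVec b t z 1‖ - Real.log ‖deformVec b t z 2‖ := by
  have key : ∀ (i : Fin 3) (r : ℝ), 0 < r → z i ^ 5 = -(r * z 0 ^ 5) →
      Real.log ‖z i‖ - Real.log ‖z 0‖ = Real.log r / 5 := by
    intro i r hr h
    have h' := congrArg (fun x => Real.log ‖x‖) h
    simp only [norm_neg, norm_mul, norm_pow, Complex.norm_real, Real.norm_of_nonneg hr.le] at h'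
    rw [Real.log_mul hr.ne' (pow_ne_zero 5 (norm_ne_zero_iff.2 (hz 0))), Real.log_pow,
      Real.log_pow] at h'
    push_cast at h'
    linarith
  have e1 := key 1 ρ hρ0 h1
  have e2 := key 2 (1 - ρ) (sub_pos.2 hρ1) h2
  change _ = Real.log ‖z 1 * ((softMax b ‖z 0‖ ‖z 2‖ ^ t : ℝ) : ℂ)‖ -
    Real.log ‖z 2 * ((softMax b ‖z 0‖ ‖z 1‖ ^ t : ℝ) : ℂ)‖
  rw [log_norm_deformVec b t (hz 1) (hz 0) (hz 2), log_norm_deformVec b t (hz 2) (hz 0) (hz 1),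
    logSoftMax, logSoftMax, e1, e2, ← e1, ← e2]
  ring

lemma im_conj_mul_eq {p q : ℂ} (hp : p ≠ 0) (h : (conj p * q).im = 0) : ∃ x : ℝ, q = x * p := by
  have h1 : conj p ≠ 0 := (map_ne_zero _).2 hp
  refine ⟨(conj p * q).re / ‖p‖ ^ 2, ?_⟩
  have h2 : conj p * q = ((conj p * q).re : ℂ) := Complex.ext (by simp) (by simpa using h)
  refine mul_left_cancel₀ h1 ?_
  have h3 := Complex.conj_mul' p
  have h4 : (‖p‖ : ℂ) ≠ 0 := by exact_mod_cast norm_ne_zero_iff.2 hp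
  push_cast
  rw [mul_left_comm, h3, ← h2]
  field_simp

/-- The numbers z_i⁵ satisfy two real relations, with coefficients 1 and l_i⁵. If they span ℂ over
ℝ, such a relation is unique up to a factor and `l` is constant. Otherwise they lie on a real line,
and the ratio of two coordinates of the common image decides by monotonicity. -/
lemma eq_smul_of_deformVec_eq_of_sorted {C t : ℝ} (hb : IsTransition b ε) (hC : 1 ≤ C) (hε : 0 < ε)
    (hεC : 1000 * C * ε ≤ 1) (hbC : ∀ a, |slope b a| ≤ C) (ht0 : 0 ≤ t) (ht1 : t ≤ 1) {z z' : V3}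
    (hz : z ≠ 0) (hP : quinticPoly z = 0) (hP' : quinticPoly z' = 0) {l : Fin 3 → ℝ}
    (hl : ∀ i, 0 < l i) (hz' : ∀ i, z' i = l i * z i) (hF : deformVec b t z = deformVec b t z')
    (h10 : ‖z 1‖ ≤ ‖z 0‖) (h21 : ‖z 2‖ ≤ ‖z 1‖) : ∃ r : ℝ, 0 < r ∧ z' = (r : ℂ) • z := by
  have hnv := nonVertex_of_quintic hz hP
  have hP1 : z 0 ^ 5 + z 1 ^ 5 + z 2 ^ 5 = 0 := hP
  have hP2 : (l 0 : ℂ) ^ 5 * z 0 ^ 5 + l 1 ^ 5 * z 1 ^ 5 + l 2 ^ 5 * z 2 ^ 5 = 0 := by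
    have : z' 0 ^ 5 + z' 1 ^ 5 + z' 2 ^ 5 = 0 := hP'
    simpa only [hz', mul_pow] using this
  have inj : ∀ {i j}, l i ^ 5 = l j ^ 5 → l i = l j := fun {i j} h =>
    (pow_left_inj₀ (hl i).le (hl j).le (by norm_num)).1 h
  -- When the third coordinate vanishes, `l 2` carries no information.
  have fin : l 0 = l 1 → (l 1 = l 2 ∨ z 2 = 0) → ∃ r : ℝ, 0 < r ∧ z' = (r : ℂ) • z := by
    intro h01 h12
    refine ⟨l 0, hl 0, funext fun i => ?_⟩
    rw [hz', Pi.smul_apply, smul_eq_mul]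
    fin_cases i
    · rfl
    · simp [h01]
    · rcases h12 with h12 | h12 <;> simp [h01, h12]
  have h1 : z 1 ≠ 0 := by
    intro h
    have h' : z 2 = 0 := by simpa [h] using h21
    simpa [h, h'] using hnv 0
  have h0 : z 0 ≠ 0 := fun h => h1 (by simpa [h] using h10)
  by_cases h2 : z 2 = 0
  · refine fin (inj ?_) (Or.inr h2)
    have : ((l 0 : ℂ) ^ 5 - l 1 ^ 5) * z 0 ^ 5 = 0 := by
      rw [h2] at hP1 hP2
      linear_combination hP2 - l 1 ^ 5 * hP1
    have := sub_eq_zero.1 ((mul_eq_zero.1 this).resolve_right (pow_ne_zero 5 h0))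
    exact_mod_cast this
  have hz0 : ∀ i, z i ≠ 0 := fun i => by fin_cases i <;> assumption
  have him : ∀ i, (conj (z i ^ 5) * z 0 ^ 5).im + (conj (z i ^ 5) * z 1 ^ 5).im +
      (conj (z i ^ 5) * z 2 ^ 5).im = 0 := fun i => by
    rw [← Complex.add_im, ← Complex.add_im, ← mul_add, ← mul_add, hP1, mul_zero, Complex.zero_im]
  have himl : ∀ i, l 0 ^ 5 * (conj (z i ^ 5) * z 0 ^ 5).im + l 1 ^ 5 * (conj (z i ^ 5) * z 1 ^ 5).im
      + l 2 ^ 5 * (conj (z i ^ 5) * z 2 ^ 5).im = 0 := fun i => by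
    rw [← Complex.im_ofReal_mul, ← Complex.im_ofReal_mul, ← Complex.im_ofReal_mul,
      ← Complex.add_im, ← Complex.add_im]
    push_cast
    rw [show (l 0 : ℂ) ^ 5 * (conj (z i ^ 5) * z 0 ^ 5) + l 1 ^ 5 * (conj (z i ^ 5) * z 1 ^ 5) +
      l 2 ^ 5 * (conj (z i ^ 5) * z 2 ^ 5) = conj (z i ^ 5) * (l 0 ^ 5 * z 0 ^ 5 +
        l 1 ^ 5 * z 1 ^ 5 + l 2 ^ 5 * z 2 ^ 5) by ring, hP2, mul_zero, Complex.zero_im]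
  have hself : ∀ i, (conj (z i ^ 5) * z i ^ 5).im = 0 := fun i => by
    rw [Complex.conj_mul', ← Complex.ofReal_pow, Complex.ofReal_im]
  by_cases hD : (conj (z 0 ^ 5) * z 1 ^ 5).im = 0
  swap
  · have hswap : (conj (z 1 ^ 5) * z 0 ^ 5).im = -(conj (z 0 ^ 5) * z 1 ^ 5).im := by
      rw [← Complex.conj_im, map_mul, Complex.conj_conj, mul_comm]
    have a1 := him 0
    have a2 := himl 0
    have a3 := him 1
    have a4 := himl 1
    rw [hself, zero_add] at a1
    rw [hself, mul_zero, zero_add] at a2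
    rw [hself, add_zero] at a3
    rw [hself, mul_zero, add_zero] at a4
    rw [hswap] at a3 a4
    have h12 : l 1 = l 2 := inj (mul_right_cancel₀ hD (by linear_combination a2 - l 2 ^ 5 * a1))
    have h02 : l 0 = l 2 := inj (mul_right_cancel₀ hD (by linear_combination l 2 ^ 5 * a3 - a4))
    exact fin (h02.trans h12.symm) (Or.inl h12)
  -- the three fifth powers lie on a real line
  have hp0 : z 0 ^ 5 ≠ 0 := pow_ne_zero 5 h0
  obtain ⟨x, hx⟩ := im_conj_mul_eq hp0 hD
  have hx2 : z 2 ^ 5 = -((1 + x : ℝ) * z 0 ^ 5) := by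
    push_cast
    linear_combination hP1 - hx
  have hn0 : 0 < ‖z 0 ^ 5‖ := norm_pos_iff.2 hp0
  have hx0 : x ≠ 0 := by
    rintro rfl
    exact pow_ne_zero 5 h1 (by simpa using hx)
  have hx1 : 1 + x ≠ 0 := by
    intro h
    rw [h] at hx2
    exact pow_ne_zero 5 h2 (by simpa using hx2)
  have hn1 : |x| ≤ 1 := by
    have h : ‖z 1 ^ 5‖ ≤ 1 * ‖z 0 ^ 5‖ := by rw [norm_pow, norm_pow, one_mul]; gcongr
    rw [hx, norm_mul, Complex.norm_real] at h
    exact le_of_mul_le_mul_right h hn0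
  have hn2 : |1 + x| ≤ 1 := by
    have h : ‖z 2 ^ 5‖ ≤ 1 * ‖z 0 ^ 5‖ := by
      rw [norm_pow, norm_pow, one_mul]; gcongr; exact h21.trans h10
    rw [hx2, norm_neg, norm_mul, Complex.norm_real] at h
    exact le_of_mul_le_mul_right h hn0
  -- The ordering of the moduli confines x to (-1, 0), so `-x` is an admissible parameter of the
  -- segment. For `x'` the signs follow from positivity of `l`, although the coordinates of `z'`
  -- need not be sorted.
  have hxneg : x < 0 := lt_of_le_of_ne (by linarith [(abs_le.1 hn2).2]) hx0
  have hx1pos : 0 < 1 + x := lt_of_le_of_ne (by linarith [(abs_le.1 hn1).1]) hx1.symm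
  -- the same for `z'`
  have hzl : ∀ i, z' i ^ 5 = (l i ^ 5 : ℝ) * z i ^ 5 := fun i => by
    rw [hz', mul_pow]; push_cast; ring
  set x' : ℝ := l 1 ^ 5 * x / l 0 ^ 5 with hx'
  have hl0 : l 0 ^ 5 ≠ 0 := pow_ne_zero 5 (hl 0).ne'
  have hl0c : (l 0 : ℂ) ≠ 0 := by exact_mod_cast (hl 0).ne'
  have hrel : l 0 ^ 5 + l 1 ^ 5 * x = l 2 ^ 5 * (1 + x) := by
    have h : ((l 0 : ℂ) ^ 5 + l 1 ^ 5 * x - l 2 ^ 5 * (1 + x)) * z 0 ^ 5 = 0 := by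
      rw [hx, hx2] at hP2
      push_cast at hP2
      linear_combination hP2
    have := sub_eq_zero.1 ((mul_eq_zero.1 h).resolve_right hp0)
    exact_mod_cast this
  have hx1' : 1 + x' = l 2 ^ 5 * (1 + x) / l 0 ^ 5 := by
    rw [← hrel, hx', add_div, div_self hl0]
  have hz1' : z' 1 ^ 5 = -((-x' : ℝ) * z' 0 ^ 5) := by
    rw [hzl, hzl, hx, hx']
    push_cast
    field_simp
    try ring
  have hz2' : z' 2 ^ 5 = -((1 - -x' : ℝ) * z' 0 ^ 5) := by
    rw [hzl, hzl, hx2, sub_neg_eq_add, hx1']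
    push_cast
    field_simp
    try ring
  have hxneg' : x' < 0 := div_neg_of_neg_of_pos
    (mul_neg_of_pos_of_neg (pow_pos (hl 1) 5) hxneg) (pow_pos (hl 0) 5)
  have hx1pos' : 0 < 1 + x' := by
    rw [hx1']
    exact div_pos (mul_pos (pow_pos (hl 2) 5) hx1pos) (pow_pos (hl 0) 5)
  have hz0' : ∀ i, z' i ≠ 0 := fun i => by
    rw [hz']
    exact mul_ne_zero (by exact_mod_cast (hl i).ne') (hz0 i)
  have e1 := log_ratio_segment (b := b) (t := t) hz0 (ρ := -x) (by linarith) (by linarith)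
    (by rw [hx]; push_cast; ring) (by rw [hx2, sub_neg_eq_add])
  have e2 := log_ratio_segment (b := b) (t := t) hz0' (ρ := -x') (by linarith) (by linarith) hz1' hz2'
  rw [← hF] at e2
  -- Both parameters yield the same logarithmic ratio, because the image is the same.
  have hxx : -x = -x' := (strictMonoOn_segment hb hC hε hεC hbC ht0 ht1).injOn
    ⟨by linarith, by linarith⟩ ⟨by linarith, by linarith⟩ (e1.trans e2.symm)
  have hxx' : x = x' := neg_injective hxx
  have h01 : l 0 ^ 5 = l 1 ^ 5 := by
    rw [hx', eq_div_iff hl0] at hxx'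
    exact mul_left_cancel₀ hx0 (by linear_combination hxx')
  have h02 : l 0 ^ 5 = l 2 ^ 5 :=
    mul_right_cancel₀ hx1 (by linear_combination hrel + x * h01)
  exact fin (inj h01) (Or.inl (inj (h01.symm.trans h02)))

lemma eq_smul_of_deformVec_eq {C t : ℝ} (hb : IsTransition b ε) (hC : 1 ≤ C) (hε : 0 < ε)
    (hεC : 1000 * C * ε ≤ 1) (hbC : ∀ a, |slope b a| ≤ C) (ht0 : 0 ≤ t) (ht1 : t ≤ 1) {z z' : V3}
    (hz : z ≠ 0) (hz' : z' ≠ 0) (hP : quinticPoly z = 0) (hP' : quinticPoly z' = 0)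
    (hF : deformVec b t z = deformVec b t z') : ∃ r : ℝ, 0 < r ∧ z' = (r : ℂ) • z := by
  have hnv := nonVertex_of_quintic hz hP
  have hnv' := nonVertex_of_quintic hz' hP'
  -- The deformation changes no phase, so equal images force the coordinates to differ by positive
  -- factors.
  obtain ⟨l, hl⟩ : ∃ l : Fin 3 → ℝ, ∀ i, l i = deformFactor b z i ^ t / deformFactor b z' i ^ t :=
    ⟨_, fun _ => rfl⟩
  have hpos : ∀ {z : V3}, NonVertex z → ∀ i, 0 < deformFactor b z i ^ t := fun h i =>
    Real.rpow_pos_of_pos (deformFactor_pos h i) t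
  have hlpos : ∀ i, 0 < l i := fun i => by
    rw [hl]; exact div_pos (hpos hnv i) (hpos hnv' i)
  have hzl : ∀ i, z' i = l i * z i := fun i => by
    have h := congrFun hF i
    rw [deformVec_apply hb, deformVec_apply hb] at h
    have h1 : ((deformFactor b z' i ^ t : ℝ) : ℂ) ≠ 0 := by exact_mod_cast (hpos hnv' i).ne'
    rw [hl, Complex.ofReal_div, div_mul_eq_mul_div, eq_div_iff h1, ← h, mul_comm]
  obtain ⟨σ, h10, h21⟩ := exists_perm_antitone z
  have hPσ : quinticPoly (z ∘ σ) = 0 := (sum_comp_perm σ fun i => z i ^ 5).trans hP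
  have hPσ' : quinticPoly (z' ∘ σ) = 0 := (sum_comp_perm σ fun i => z' i ^ 5).trans hP'
  have hFσ : deformVec b t (z ∘ σ) = deformVec b t (z' ∘ σ) := by
    rw [deformVec_comp_perm hb, deformVec_comp_perm hb, hF]
  have hlσ : ∀ i, 0 < (l ∘ σ) i := fun i => hlpos (σ i)
  have hzσ : ∀ i, (z' ∘ σ) i = ((l ∘ σ) i : ℝ) * (z ∘ σ) i := fun i => hzl (σ i)
  obtain ⟨r, hr, h⟩ := eq_smul_of_deformVec_eq_of_sorted hb hC hε hεC hbC ht0 ht1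
    (hnv.comp_perm σ).ne_zero hPσ hPσ' hlσ hzσ hFσ h10 h21
  exact ⟨r, hr, funext fun i => by simpa using congrFun h (σ.symm i)⟩

/-- The deformation is injective on the quintic. -/
theorem deform_injOn {C t : ℝ} (hb : IsTransition b ε) (hC : 1 ≤ C) (hε : 0 < ε)
    (hεC : 1000 * C * ε ≤ 1) (hbC : ∀ a, |slope b a| ≤ C) (ht0 : 0 ≤ t) (ht1 : t ≤ 1) :
    InjOn (deform b t) fermatQuintic := by
  intro p hp q hq h
  rw [← toCP_rep p] at hp h ⊢
  rw [← toCP_rep q] at hq h ⊢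
  have hz := p.rep_nonzero
  have hw := q.rep_nonzero
  set z := p.rep
  set w := q.rep
  have hPz := (mem_fermatQuintic hz).1 hp
  have hPw := (mem_fermatQuintic hw).1 hq
  have hnz := nonVertex_of_quintic hz hPz
  have hnw := nonVertex_of_quintic hw hPw
  rw [deform_toCP hb t hnz, deform_toCP hb t hnw, toCP_eq_iff
    (deformVec_nonVertex hb t hnz).ne_zero (deformVec_nonVertex hb t hnw).ne_zero] at h
  obtain ⟨a, ha, h⟩ := h
  -- rescale `z` so that the values agree
  set c : ℝ := ‖a‖ ^ (1 / (1 + t)) with hc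
  have hna : 0 < ‖a‖ := norm_pos_iff.2 ha
  have hcpos : 0 < c := Real.rpow_pos_of_pos hna _
  have hcc : c * c ^ t = ‖a‖ := by
    have h1 : (1 : ℝ) + t ≠ 0 := by linarith
    have : c * c ^ t = c ^ (1 + t) := by rw [Real.rpow_add hcpos, Real.rpow_one]
    rw [this, hc, ← Real.rpow_mul hna.le, one_div, inv_mul_cancel₀ h1, Real.rpow_one]
  -- `d` has the phase of `a` and modulus `c`, where c^(1+t) = |a|; hence d |d|^t = a, the factor by
  -- which scaling by `d` multiplies the image.
  set d : ℂ := (c / ‖a‖ : ℝ) * a with hd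
  have hd0 : d ≠ 0 := mul_ne_zero (by exact_mod_cast (div_pos hcpos hna).ne') ha
  have hdn : ‖d‖ = c := by
    rw [hd, norm_mul, Complex.norm_real, Real.norm_of_nonneg (div_pos hcpos hna).le,
      div_mul_cancel₀ _ hna.ne']
  have hd' : d * ((‖d‖ ^ t : ℝ) : ℂ) = a := by
    rw [hdn, hd, mul_right_comm, ← Complex.ofReal_mul, div_mul_eq_mul_div, hcc, div_self hna.ne',
      Complex.ofReal_one, one_mul]
  have hF : deformVec b t (d • z) = deformVec b t w := by
    rw [deformVec_smul' t hd0, hd', h]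
  have hPd : quinticPoly (d • z) = 0 := by
    have : quinticPoly (d • z) = d ^ 5 * quinticPoly z := by
      simp [quinticPoly, mul_pow]
      ring
    rw [this, hPz, mul_zero]
  obtain ⟨r, hr, e⟩ := eq_smul_of_deformVec_eq hb hC hε hεC hbC ht0 ht1 (smul_ne_zero hd0 hz) hw
    hPd hPw hF
  rw [toCP_eq_iff hz hw]
  exact ⟨r * d, mul_ne_zero (by exact_mod_cast hr.ne') hd0, by rw [e, smul_smul]⟩

end QuinticSmoothing
end

/-! ### Local inverses and the smooth structure of the quintic. -/

noncomputable section

open Filter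

namespace QuinticSmoothing

variable {b : ℝ → ℝ} {ε : ℝ}

/-- The inverse function theorem, with smoothness on open sets. -/
lemma exists_localDiffeo {E G : Type*} [NormedAddCommGroup E] [NormedSpace ℝ E] [CompleteSpace E]
    [NormedAddCommGroup G] [NormedSpace ℝ G] {f : E → G} {O : Set E} (hO : IsOpen O)
    (hf : ∀ x ∈ O, ContDiffAt ℝ ∞ f x) {a : E} (ha : a ∈ O) {f' : E ≃L[ℝ] G}
    (hf' : HasFDerivAt f (f' : E →L[ℝ] G) a) :
    ∃ θ : OpenPartialHomeomorph E G, a ∈ θ.source ∧ θ.source ⊆ O ∧ ⇑θ = f ∧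
      (∀ x ∈ θ.source, ContDiffAt ℝ ∞ f x) ∧ ∀ y ∈ θ.target, ContDiffAt ℝ ∞ θ.symm y := by
  have h1 : (1 : WithTop ℕ∞) ≤ ∞ := by exact_mod_cast le_top
  set θ₀ := (hf a ha).toOpenPartialHomeomorph f hf' (by simp)
  have hc : ContinuousOn (fderiv ℝ f) O := fun x hx =>
    (((hf x hx).fderiv_right (m := 0) (by simp)).continuousAt).continuousWithinAt
  set R : Set (E →L[ℝ] G) := range ((↑) : (E ≃L[ℝ] G) → E →L[ℝ] G)
  -- Invertibility of the derivative is an open condition; restricting to it makes the inverse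
  -- smooth on the whole target, not just at the image of `a`.
  have hO' : IsOpen (O ∩ fderiv ℝ f ⁻¹' R) := hc.isOpen_inter_preimage hO ContinuousLinearEquiv.isOpen
  have ha0 : a ∈ θ₀.source := (hf a ha).mem_toOpenPartialHomeomorph_source hf' (by simp)
  refine ⟨θ₀.restrOpen _ hO', ⟨ha0, ha, f', hf'.fderiv.symm⟩, fun x hx => hx.2.1, rfl,
    fun x hx => hf x hx.2.1, fun y hy => ?_⟩
  have hx := (θ₀.restrOpen _ hO').map_target hy
  obtain ⟨g, hg⟩ := hx.2.2
  have hfx := hf _ hx.2.1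
  refine OpenPartialHomeomorph.contDiffAt_symm (f₀' := g) _ hy ?_ hfx
  rw [hg]
  exact (hfx.differentiableAt (by simp)).hasFDerivAt

/-! ### Parametrizations of the quintic -/

/-- The domain on which the principal fifth root of `1 + x⁵` is used. -/
def rootDomain : Set ℂ := {x | 0 < (1 + x ^ 5).re}

lemma isOpen_rootDomain : IsOpen rootDomain :=
  isOpen_lt continuous_const (by fun_prop)

/-- The principal fifth root of `1 + x⁵`. -/
def root5 (x : ℂ) : ℂ := (1 + x ^ 5) ^ (((5 : ℕ) : ℂ)⁻¹)

lemma root5_pow (x : ℂ) : root5 x ^ 5 = 1 + x ^ 5 := Complex.cpow_nat_inv_pow _ (by norm_num)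

lemma root5_ne_zero {x : ℂ} (hx : x ∈ rootDomain) : root5 x ≠ 0 := by
  intro h
  have h1 := root5_pow x
  rw [h] at h1
  have h2 : 0 < (1 + x ^ 5).re := hx
  rw [← h1] at h2
  simp at h2

lemma contDiffAt_root5 {x : ℂ} (hx : x ∈ rootDomain) : ContDiffAt ℝ ∞ root5 x := by
  have h : AnalyticAt ℂ root5 x := by
    refine AnalyticAt.cpow (by fun_prop) analyticAt_const ?_
    exact Or.inl hx
  exact h.contDiffAt.restrict_scalars ℝ

/-- The root 1 is isolated: with u = 1 + v the other factor of u⁵ - 1 is 5 + 10v + 10v² + 5v³ + v⁴,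
and for |v| < 1/5 the terms after 5 sum to less than 5 in modulus. The radius 1/5 in `region` comes
from here. -/
lemma eq_one_of_pow_five {u : ℂ} (h : u ^ 5 = 1) (hu : ‖u - 1‖ < 1 / 5) : u = 1 := by
  set v := u - 1 with hv
  have h1 : v * (5 + v * (10 + v * (10 + v * (5 + v)))) = 0 := by
    rw [hv]
    linear_combination h
  rcases mul_eq_zero.1 h1 with h2 | h2
  · exact sub_eq_zero.1 h2
  exfalso
  have h3 : (5 : ℂ) = -(v * (10 + v * (10 + v * (5 + v)))) := by linear_combination h2
  have h4 : ‖v * (10 + v * (10 + v * (5 + v)))‖ ≤ 1 / 5 * (10 + 1 / 5 * (10 + 1 / 5 * (5 + 1 / 5))) := by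
    have e1 : ‖5 + v‖ ≤ 5 + 1 / 5 := (norm_add_le _ _).trans (by simpa using hu.le)
    have e2 : ‖10 + v * (5 + v)‖ ≤ 10 + 1 / 5 * (5 + 1 / 5) := by
      refine (norm_add_le _ _).trans ?_
      rw [norm_mul]
      gcongr
      simp
    have e3 : ‖10 + v * (10 + v * (5 + v))‖ ≤ 10 + 1 / 5 * (10 + 1 / 5 * (5 + 1 / 5)) := by
      refine (norm_add_le _ _).trans ?_
      rw [norm_mul]
      gcongr
      simp
    rw [norm_mul]
    gcongr
  have h5 := congrArg norm h3
  rw [norm_neg, Complex.norm_ofNat] at h5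
  rw [← h5] at h4
  norm_num at h4

/-- The indices of the standard parametrizations: an order of the coordinates and a fifth root
of `-1`. -/
abbrev ParamIndex : Type := Equiv.Perm (Fin 3) × {ζ : ℂ // ζ ^ 5 = -1}

namespace ParamIndex

variable (i : ParamIndex)

lemma root_ne_zero : (i.2 : ℂ) ≠ 0 := by
  intro h
  have := i.2.2
  rw [h] at this
  norm_num at this

/-- The coordinate normalized to `1`. -/
def unitCoord : Fin 3 := i.1.symm 0

/-- The coordinate which is a fifth root. -/
def rootCoord : Fin 3 := i.1.symm 1

/-- The coordinate which is the parameter. -/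
def freeCoord : Fin 3 := i.1.symm 2

/-- The parametrization `x ↦ (1, ζ (1 + x⁵)^{1/5}, x)`, with the coordinates permuted. -/
def param (x : ℂ) : V3 := ![1, i.2 * root5 x, x] ∘ i.1

lemma param_unit (x : ℂ) : i.param x i.unitCoord = 1 := by simp [param, unitCoord]

lemma param_root (x : ℂ) : i.param x i.rootCoord = i.2 * root5 x := by simp [param, rootCoord]

lemma param_free (x : ℂ) : i.param x i.freeCoord = x := by simp [param, freeCoord]

lemma param_ne_zero (x : ℂ) : i.param x ≠ 0 := fun h => by
  simpa [param_unit] using congrFun h i.unitCoord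

lemma ext_coords {z w : V3} (h0 : z i.unitCoord = w i.unitCoord)
    (h1 : z i.rootCoord = w i.rootCoord) (h2 : z i.freeCoord = w i.freeCoord) : z = w := by
  funext j
  obtain ⟨k, rfl⟩ := i.1.symm.surjective j
  fin_cases k <;> assumption

lemma quinticPoly_param (x : ℂ) : quinticPoly (i.param x) = 0 := by
  refine (sum_comp_perm i.1 fun j => (![1, i.2 * root5 x, x] : V3) j ^ 5).trans ?_
  simp [mul_pow, root5_pow, i.2.2]

lemma contDiffAt_param {x : ℂ} (hx : x ∈ rootDomain) : ContDiffAt ℝ ∞ i.param x := by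
  refine contDiffAt_pi.2 fun j => ?_
  have h : ∀ k, ContDiffAt ℝ ∞ (fun x => (![1, i.2 * root5 x, x] : V3) k) x := fun k => by
    fin_cases k
    · exact contDiffAt_const
    · exact contDiffAt_const.mul (contDiffAt_root5 hx)
    · exact contDiffAt_id
  exact h (i.1 j)

/-- The quotient of the root coordinate by the chosen branch is a fifth root of unity closer to 1
than 1/5, hence equal to 1. -/
lemma eq_smul_param {z : V3} (hP : quinticPoly z = 0) {x : ℂ} (hx : x ∈ rootDomain)
    (h0 : z i.unitCoord ≠ 0) (h2 : z i.freeCoord / z i.unitCoord = x)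
    (h1 : ‖z i.rootCoord / z i.unitCoord - i.2 * root5 x‖ < 1 / 5 * ‖root5 x‖) :
    z = z i.unitCoord • i.param x := by
  have hr := root5_ne_zero hx
  have hζ := i.root_ne_zero
  have hζn : ‖(i.2 : ℂ)‖ = 1 := by
    have := congrArg norm i.2.2
    rw [norm_pow, norm_neg, norm_one] at this
    exact (pow_eq_one_iff_of_nonneg (norm_nonneg _) (by norm_num)).1 this
  set y := z i.rootCoord / z i.unitCoord with hy
  have hsum : z i.unitCoord ^ 5 + z i.rootCoord ^ 5 + z i.freeCoord ^ 5 = 0 :=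
    (sum_comp_perm i.1.symm fun j => z j ^ 5).trans hP
  have hy5 : y ^ 5 = -(1 + x ^ 5) := by
    rw [hy, ← h2]
    field_simp
    linear_combination hsum
  have hu : y / (i.2 * root5 x) = 1 := by
    refine eq_one_of_pow_five ?_ ?_
    · rw [div_pow, mul_pow, i.2.2, root5_pow, hy5, neg_one_mul, div_self]
      rw [neg_ne_zero, ← root5_pow]
      exact pow_ne_zero 5 hr
    · rw [div_sub_one (mul_ne_zero hζ hr), norm_div, norm_mul, hζn, one_mul,
        div_lt_iff₀ (norm_pos_iff.2 hr)]
      exact h1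
  have hy' : y = i.2 * root5 x := by
    rwa [div_eq_one_iff_eq (mul_ne_zero hζ hr)] at hu
  refine i.ext_coords ?_ ?_ ?_
  · rw [Pi.smul_apply, param_unit, smul_eq_mul, mul_one]
  · rw [Pi.smul_apply, param_root, smul_eq_mul, ← hy', hy, mul_div_cancel₀ _ h0]
  · rw [Pi.smul_apply, param_free, smul_eq_mul, ← h2, mul_div_cancel₀ _ h0]

/-- The affine coordinates used by the chart. -/
def ratios (p : CP2) : ℂ × ℂ :=
  (p.rep i.freeCoord / p.rep i.unitCoord, p.rep i.rootCoord / p.rep i.unitCoord)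

lemma ratios_toCP {z : V3} (hz : z ≠ 0) : i.ratios (toCP z) =
    (z i.freeCoord / z i.unitCoord, z i.rootCoord / z i.unitCoord) := by
  obtain ⟨a, ha, h⟩ := exists_rep_toCP hz
  simp only [ratios, h, Pi.smul_apply, smul_eq_mul]
  rw [mul_div_mul_left _ _ ha, mul_div_mul_left _ _ ha]

lemma contMDiffAt_ratios {p : CP2} (hp : p.rep i.unitCoord ≠ 0) :
    ContMDiffAt I4 𝓘(ℝ, ℂ × ℂ) ∞ i.ratios p := by
  rw [← toCP_rep p]
  refine contMDiffAt_of_toCP p.rep_nonzero ?_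
  have h : ∀ j, ContDiffAt ℝ ∞ (fun z : V3 => z j / z i.unitCoord) p.rep := fun j => by
    simp only [div_eq_mul_inv]
    exact (contDiff_apply ℝ ℂ j).contDiffAt.mul ((contDiff_apply ℝ ℂ _).contDiffAt.inv hp)
  refine (((h i.freeCoord).prodMk (h i.rootCoord)).congr_of_eventuallyEq ?_).contMDiffAt
  filter_upwards [isOpen_ne.mem_nhds p.rep_nonzero] with z hz using i.ratios_toCP hz

/-- The region of the affine coordinates in which the chosen fifth root is used. -/
def region : Set (ℂ × ℂ) :=
  {q | q.1 ∈ rootDomain ∧ ‖q.2 - i.2 * root5 q.1‖ < 1 / 5 * ‖root5 q.1‖}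

lemma isOpen_region : IsOpen i.region := by
  have hO : IsOpen {q : ℂ × ℂ | q.1 ∈ rootDomain} := isOpen_rootDomain.preimage continuous_fst
  have hr : ContinuousOn (fun q : ℂ × ℂ => root5 q.1) {q : ℂ × ℂ | q.1 ∈ rootDomain} := fun q hq =>
    (ContinuousAt.comp (f := Prod.fst) (x := q) (contDiffAt_root5 hq).continuousAt
      continuousAt_fst).continuousWithinAt
  have h : ContinuousOn (fun q : ℂ × ℂ => 1 / 5 * ‖root5 q.1‖ - ‖q.2 - i.2 * root5 q.1‖)
      {q : ℂ × ℂ | q.1 ∈ rootDomain} :=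
    (continuousOn_const.mul hr.norm).sub (continuousOn_snd.sub (continuousOn_const.mul hr)).norm
  have := h.isOpen_inter_preimage hO isOpen_Ioi (t := Ioi 0)
  convert this using 1
  ext q
  simp [region]

/-- The domain of the chart in the projective plane. -/
def domain : Set CP2 := {p | p.rep i.unitCoord ≠ 0} ∩ i.ratios ⁻¹' i.region

lemma isOpen_domain : IsOpen i.domain :=
  ContinuousOn.isOpen_inter_preimage (fun _ hp =>
    (i.contMDiffAt_ratios hp).continuousAt.continuousWithinAt) (isOpen_source _) i.isOpen_region

lemma toCP_param_mem (x : ℂ) : toCP (i.param x) ∈ fermatQuintic :=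
  (mem_fermatQuintic (i.param_ne_zero x)).2 (i.quinticPoly_param x)

lemma ratios_param (x : ℂ) : i.ratios (toCP (i.param x)) = (x, i.2 * root5 x) := by
  rw [ratios_toCP _ (i.param_ne_zero x), param_unit, param_root, param_free, div_one, div_one]

lemma toCP_param_mem_domain {x : ℂ} (hx : x ∈ rootDomain) : toCP (i.param x) ∈ i.domain := by
  refine ⟨?_, ?_⟩
  · exact (rep_toCP_ne_zero_iff (i.param_ne_zero x) _).2 (by rw [param_unit]; exact one_ne_zero)
  · rw [mem_preimage, ratios_param]
    exact ⟨hx, by simpa using root5_ne_zero hx⟩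

lemma toCP_param_ratios {p : CP2} (hp : p ∈ fermatQuintic) (hd : p ∈ i.domain) :
    toCP (i.param (i.ratios p).1) = p := by
  have h := i.eq_smul_param (z := p.rep) hp hd.2.1 hd.1 rfl hd.2.2
  conv_rhs => rw [← toCP_rep p, h]
  rw [toCP_smul hd.1 (i.param_ne_zero _)]

/-- The chart of the quintic inverse to the parametrization. -/
def chart : OpenPartialHomeomorph fermatQuintic ℂ where
  toFun p := (i.ratios p.1).1
  invFun x := ⟨toCP (i.param x), i.toCP_param_mem x⟩
  source := {p | p.1 ∈ i.domain}
  target := rootDomain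
  map_source' _ hp := hp.2.1
  map_target' _ hx := i.toCP_param_mem_domain hx
  left_inv' p hp := Subtype.ext (i.toCP_param_ratios p.2 hp)
  right_inv' x _ := by rw [ratios_param]
  open_source := i.isOpen_domain.preimage continuous_subtype_val
  open_target := isOpen_rootDomain
  continuousOn_toFun p hp := (ContinuousAt.comp (f := Subtype.val) (x := p) (g := fun p => (i.ratios p).1)
    (continuousAt_fst.comp (i.contMDiffAt_ratios hp.1).continuousAt)
    continuousAt_subtype_val).continuousWithinAt
  continuousOn_invFun := by
    refine Topology.IsInducing.subtypeVal.continuousOn_iff.2 fun x hx => ?_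
    exact (ContinuousAt.comp (g := toCP) (continuousAt_toCP (i.param_ne_zero x))
      (i.contDiffAt_param hx).continuousAt).continuousWithinAt

end ParamIndex

lemma exists_root_neg {x y : ℂ} (h : y ^ 5 = -(1 + x ^ 5)) (hx : x ∈ rootDomain) :
    ∃ ζ : {ζ : ℂ // ζ ^ 5 = -1}, y = ζ * root5 x := by
  have hr := root5_ne_zero hx
  refine ⟨⟨y / root5 x, ?_⟩, (div_mul_cancel₀ y hr).symm⟩
  rw [div_pow, h, root5_pow, neg_div, div_self]
  rw [← root5_pow]
  exact pow_ne_zero 5 hr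

/-- The parametrizations cover the quintic. -/
lemma exists_param {z : V3} (hz : z ≠ 0) (hP : quinticPoly z = 0) :
    ∃ (i : ParamIndex) (x : ℂ) (a : ℂ), x ∈ rootDomain ∧ a ≠ 0 ∧ z = a • i.param x := by
  obtain ⟨σ, h10, h21⟩ := exists_perm_antitone z
  have hnv := (nonVertex_of_quintic hz hP).comp_perm σ
  have hsum : (z ∘ σ) 0 ^ 5 + (z ∘ σ) 1 ^ 5 + (z ∘ σ) 2 ^ 5 = 0 :=
    (sum_comp_perm σ fun j => z j ^ 5).trans hP
  have h1 : (z ∘ σ) 1 ≠ 0 := by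
    intro h
    have h' : (z ∘ σ) 2 = 0 := by
      rw [h, norm_zero] at h21
      exact norm_le_zero_iff.1 h21
    exact (hnv 0).elim (fun h0 => h0 h) (fun h0 => h0 h')
  have h0 : (z ∘ σ) 0 ≠ 0 := norm_pos_iff.1 ((norm_pos_iff.2 h1).trans_le h10)
  set x := (z ∘ σ) 2 / (z ∘ σ) 0 with hx
  set y := (z ∘ σ) 1 / (z ∘ σ) 0 with hy
  have hy5 : y ^ 5 = -(1 + x ^ 5) := by
    rw [hx, hy]
    field_simp
    linear_combination hsum
  have hy0 : y ≠ 0 := div_ne_zero h1 h0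
  have hxn : ‖x ^ 5‖ ≤ 1 := by
    rw [norm_pow]
    refine pow_le_one₀ (norm_nonneg _) ?_
    rw [hx, norm_div]
    exact div_le_one_of_le₀ (h21.trans h10) (norm_nonneg _)
  -- Since |x⁵| ≤ 1, only x⁵ = -1 could violate the condition, and then y = 0, whereas the two
  -- largest coordinates are nonzero.
  have hxD : x ∈ rootDomain := by
    change 0 < (1 + x ^ 5).re
    rw [Complex.add_re, Complex.one_re]
    have h2 := (abs_le.1 ((Complex.abs_re_le_norm (x ^ 5)).trans hxn)).1
    refine lt_of_le_of_ne (by linarith) fun h3 => ?_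
    have hre : (x ^ 5).re = -1 := by linarith
    have him : (x ^ 5).im = 0 := by
      have h4 := Complex.sq_norm (x ^ 5)
      rw [Complex.normSq_apply, hre] at h4
      nlinarith [norm_nonneg (x ^ 5)]
    have : x ^ 5 = -1 := Complex.ext (by simpa using hre) (by simpa using him)
    rw [this, add_neg_cancel, neg_zero] at hy5
    exact hy0 (pow_eq_zero_iff (by norm_num) |>.1 hy5)
  obtain ⟨ζ, hζ⟩ := exists_root_neg hy5 hxD
  refine ⟨(σ.symm, ζ), x, (z ∘ σ) 0, hxD, h0, ?_⟩
  refine ParamIndex.ext_coords (σ.symm, ζ) ?_ ?_ ?_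
  · rw [Pi.smul_apply, ParamIndex.param_unit, smul_eq_mul, mul_one]; rfl
  · rw [Pi.smul_apply, ParamIndex.param_root, smul_eq_mul, ← hζ, hy, mul_div_cancel₀ _ h0]; rfl
  · rw [Pi.smul_apply, ParamIndex.param_free, smul_eq_mul, hx, mul_div_cancel₀ _ h0]; rfl

lemma exists_mem_chart_source (p : fermatQuintic) : ∃ i : ParamIndex, p ∈ i.chart.source := by
  obtain ⟨i, x, a, hx, ha, h⟩ := exists_param p.1.rep_nonzero p.2
  refine ⟨i, ?_⟩
  change p.1 ∈ i.domain
  rw [← toCP_rep p.1, h, toCP_smul ha (i.param_ne_zero x)]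
  exact i.toCP_param_mem_domain hx

/-- The smooth structure of the quintic. -/
instance : ChartedSpace ℂ fermatQuintic where
  atlas := range ParamIndex.chart
  chartAt p := (exists_mem_chart_source p).choose.chart
  mem_chart_source p := (exists_mem_chart_source p).choose_spec
  chart_mem_atlas _ := mem_range_self _

instance : IsManifold 𝓘(ℝ, ℂ) ∞ fermatQuintic := by
  refine isManifold_of_contDiffOn _ _ _ ?_
  rintro _ _ ⟨i, rfl⟩ ⟨j, rfl⟩
  intro x hx
  simp only [mfld_simps] at hx
  have h1 : x ∈ rootDomain := hx.1
  have h2 : toCP (i.param x) ∈ j.domain := hx.2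
  have h3 : ContMDiffAt 𝓘(ℝ, ℂ) 𝓘(ℝ, ℂ × ℂ) ∞ (fun x => j.ratios (toCP (i.param x))) x :=
    (j.contMDiffAt_ratios h2.1).comp x
      ((contMDiffAt_toCP (i.param_ne_zero x)).comp x (i.contDiffAt_param h1).contMDiffAt)
  exact (contDiffAt_fst.comp x h3.contDiffAt).contDiffWithinAt

lemma chart_mem_maximalAtlas (i : ParamIndex) :
    i.chart ∈ IsManifold.maximalAtlas 𝓘(ℝ, ℂ) ∞ fermatQuintic :=
  IsManifold.subset_maximalAtlas (mem_range_self i)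

end QuinticSmoothing
end

/-! ### The deformation along the parametrizations, and linear complements. -/

noncomputable section

open Filter

namespace QuinticSmoothing

variable {b : ℝ → ℝ} {ε : ℝ}

/-- The derivative of the quintic polynomial, up to the factor `5`. -/
def dQuintic (z w : V3) : ℂ := z 0 ^ 4 * w 0 + z 1 ^ 4 * w 1 + z 2 ^ 4 * w 2

lemma hasDerivAt_quinticPoly {𝕜 : Type*} [NontriviallyNormedField 𝕜] [NormedAlgebra 𝕜 ℂ]
    {f : 𝕜 → V3} {f' : V3} {s : 𝕜} (h : HasDerivAt f f' s) :
    HasDerivAt (fun s => quinticPoly (f s)) (5 * dQuintic (f s) f') s := by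
  have h1 := fun j => (hasDerivAt_pi.1 h j).pow 5
  refine (((h1 0).add (h1 1)).add (h1 2)).congr_deriv ?_
  simp [dQuintic]
  ring

namespace ParamIndex

variable (i : ParamIndex)

/-- The complex derivative of the parametrization. -/
def vel (x : ℂ) : V3 := deriv i.param x

lemma hasDerivAt_param {x : ℂ} (hx : x ∈ rootDomain) : HasDerivAt i.param (i.vel x) x := by
  have h : AnalyticAt ℂ root5 x := by
    refine AnalyticAt.cpow (by fun_prop) analyticAt_const ?_
    exact Or.inl hx
  have h2 : DifferentiableAt ℂ i.param x := by
    refine differentiableAt_pi.2 fun j => ?_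
    have h : ∀ k, DifferentiableAt ℂ (fun x => (![1, i.2 * root5 x, x] : V3) k) x := fun k => by
      fin_cases k
      · exact differentiableAt_const _
      · exact (differentiableAt_const _).mul h.differentiableAt
      · exact differentiableAt_id
    exact h (i.1 j)
  exact h2.hasDerivAt

lemma hasFDerivAt_param {x : ℂ} (hx : x ∈ rootDomain) :
    HasFDerivAt i.param ((ContinuousLinearMap.id ℝ ℂ).smulRight (i.vel x)) x :=
  (i.hasDerivAt_param hx).hasFDerivAt.restrictScalars ℝ

lemma vel_unit {x : ℂ} (hx : x ∈ rootDomain) : i.vel x i.unitCoord = 0 := by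
  have h := hasDerivAt_pi.1 (i.hasDerivAt_param hx) i.unitCoord
  simp only [param_unit] at h
  exact h.unique (hasDerivAt_const x 1)

lemma vel_free {x : ℂ} (hx : x ∈ rootDomain) : i.vel x i.freeCoord = 1 := by
  have h := hasDerivAt_pi.1 (i.hasDerivAt_param hx) i.freeCoord
  simp only [param_free] at h
  exact h.unique (hasDerivAt_id x)

lemma dQuintic_vel {x : ℂ} (hx : x ∈ rootDomain) : dQuintic (i.param x) (i.vel x) = 0 := by
  have h := hasDerivAt_quinticPoly (i.hasDerivAt_param hx)
  simp only [quinticPoly_param] at h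
  exact (mul_eq_zero.1 (h.unique (hasDerivAt_const x 0))).resolve_left (by norm_num)

lemma dQuintic_smul_vel {x : ℂ} (hx : x ∈ rootDomain) (v : ℂ) :
    dQuintic (i.param x) (v • i.vel x) = 0 := by
  have h : dQuintic (i.param x) (v • i.vel x) = v * dQuintic (i.param x) (i.vel x) := by
    simp [dQuintic]; ring
  rw [h, dQuintic_vel i hx, mul_zero]

lemma smul_vel_ne {x : ℂ} (hx : x ∈ rootDomain) {v : ℂ} (hv : v ≠ 0) (c : ℂ) :
    v • i.vel x ≠ c • i.param x := by
  intro h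
  have h0 := congrFun h i.unitCoord
  have h2 := congrFun h i.freeCoord
  simp only [Pi.smul_apply, vel_unit i hx, param_unit, vel_free i hx, smul_eq_mul, mul_zero,
    mul_one] at h0 h2
  rw [← h0, zero_mul] at h2
  exact hv h2

lemma nonVertex_param (x : ℂ) : NonVertex (i.param x) :=
  nonVertex_of_quintic (i.param_ne_zero x) (i.quinticPoly_param x)

/-- The affine coordinates of the deformed parametrization. -/
def affDeform (b : ℝ → ℝ) (k : Fin 3) (t : ℝ) (x : ℂ) : Fin 2 → ℂ :=
  affOf k (deformVec b t (i.param x))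

lemma contDiffAt_deformVec_param (hb : IsTransition b ε) (t : ℝ) {x : ℂ} (hx : x ∈ rootDomain) :
    ContDiffAt ℝ ∞ (fun q : ℝ × ℂ => deformVec b q.1 (i.param q.2)) (t, x) :=
  ContDiffAt.comp (g := fun q : ℝ × V3 => deformVec b q.1 q.2) (t, x)
    (contDiffAt_deformVec hb t (i.nonVertex_param x))
    (contDiffAt_fst.prodMk ((i.contDiffAt_param hx).comp (t, x) contDiffAt_snd))

lemma contDiffAt_affDeform (hb : IsTransition b ε) {k : Fin 3} (t : ℝ) {x : ℂ} (hx : x ∈ rootDomain)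
    (hk : deformVec b t (i.param x) k ≠ 0) :
    ContDiffAt ℝ ∞ (fun q : ℝ × ℂ => i.affDeform b k q.1 q.2) (t, x) :=
  ContDiffAt.comp (g := affOf k) (t, x) (contDiffAt_affOf hk) (i.contDiffAt_deformVec_param hb t hx)

/-- The space derivative of `affDeform`. -/
def dAffDeform (b : ℝ → ℝ) (k : Fin 3) (t : ℝ) (x : ℂ) : ℂ →L[ℝ] (Fin 2 → ℂ) :=
  (dAffOf k (deformVec b t (i.param x))).comp ((dDeform b t (i.param x)).comp
    ((ContinuousLinearMap.id ℝ ℂ).smulRight (i.vel x)))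

lemma dAffDeform_apply (b : ℝ → ℝ) (k : Fin 3) (t : ℝ) (x v : ℂ) : i.dAffDeform b k t x v =
    dAffOf k (deformVec b t (i.param x)) (dDeform b t (i.param x) (v • i.vel x)) := rfl

lemma hasFDerivAt_affDeform (hb : IsTransition b ε) {k : Fin 3} (t : ℝ) {x : ℂ}
    (hx : x ∈ rootDomain) (hk : deformVec b t (i.param x) k ≠ 0) :
    HasFDerivAt (i.affDeform b k t) (i.dAffDeform b k t x) x := by
  have h : HasFDerivAt (affOf k) (dAffOf k (deformVec b t (i.param x)))
      (deformVec b t (i.param x)) :=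
    ((contDiffAt_affOf hk).differentiableAt (by simp)).hasFDerivAt
  exact h.comp x ((hasFDerivAt_deformVec hb t (i.nonVertex_param x)).comp x (i.hasFDerivAt_param hx))

lemma deform_symm_chart (hb : IsTransition b ε) (t : ℝ) {p : fermatQuintic}
    (hp : p ∈ i.chart.source) :
    deform b t p = toCP (deformVec b t (i.param (i.chart p))) := by
  rw [← deform_toCP hb t (i.nonVertex_param _)]
  exact congrArg (deform b t) (i.toCP_param_ratios p.2 hp).symm

end ParamIndex

lemma contMDiffAt_deform (hb : IsTransition b ε) (t : ℝ) (p : fermatQuintic) :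
    ContMDiffAt (𝓘(ℝ, ℝ).prod 𝓘(ℝ, ℂ)) I4 ∞
      (fun q : ℝ × fermatQuintic => deform b q.1 q.2) (t, p) := by
  obtain ⟨i, hi⟩ := exists_mem_chart_source p
  have h1 : ContMDiffAt (𝓘(ℝ, ℝ).prod 𝓘(ℝ, ℂ)) 𝓘(ℝ, ℂ) ∞
      (fun q : ℝ × fermatQuintic => i.chart q.2) (t, p) :=
    ContMDiffAt.comp (t, p) (contMDiffAt_of_mem_maximalAtlas (chart_mem_maximalAtlas i) hi)
      contMDiffAt_snd
  have hx : i.chart p ∈ rootDomain := i.chart.map_source hi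
  have h2 : ContDiffAt ℝ ∞ (fun q : ℝ × ℂ => deformVec b q.1 (i.param q.2)) (t, i.chart p) :=
    i.contDiffAt_deformVec_param hb t hx
  have h3 : ContMDiffAt 𝓘(ℝ, ℝ × ℂ) I4 ∞ (fun q : ℝ × ℂ => toCP (deformVec b q.1 (i.param q.2)))
      (t, i.chart p) :=
    ContMDiffAt.comp (t, i.chart p)
      (contMDiffAt_toCP (deformVec_nonVertex hb t (i.nonVertex_param _)).ne_zero) h2.contMDiffAt
  have h4 : ContMDiffAt (𝓘(ℝ, ℝ).prod 𝓘(ℝ, ℂ)) 𝓘(ℝ, ℝ × ℂ) ∞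
      (fun q : ℝ × fermatQuintic => (q.1, i.chart q.2)) (t, p) :=
    ContMDiffAt.prodMk_space contMDiffAt_fst h1
  have h5 := ContMDiffAt.comp (t, p) h3 h4
  refine h5.congr_of_eventuallyEq ?_
  have h6 : Tendsto (Prod.snd : ℝ × fermatQuintic → fermatQuintic) (𝓝 (t, p)) (𝓝 p) :=
    continuous_snd.continuousAt
  filter_upwards [h6.eventually (i.chart.open_source.mem_nhds hi)] with q hq
  exact i.deform_symm_chart hb q.1 hq

lemma isClosed_fermatQuintic : IsClosed fermatQuintic := by
  rw [← isOpen_compl_iff, isOpen_iff_toCP]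
  have : {z : V3 | z ≠ 0 ∧ toCP z ∈ fermatQuinticᶜ} = {z | z ≠ 0} ∩ {z | quinticPoly z ≠ 0} := by
    ext z
    refine and_congr_right fun hz => ?_
    rw [mem_compl_iff, mem_fermatQuintic hz]
    rfl
  rw [this]
  refine isOpen_ne.inter (isOpen_ne_fun ?_ continuous_const)
  unfold quinticPoly
  fun_prop

instance : CompactSpace fermatQuintic := isCompact_iff_compactSpace.1 isClosed_fermatQuintic.isCompact

/-- An injective real-linear map `ℂ → ℂ²` has a linear complement. -/
lemma exists_complement {A : ℂ →L[ℝ] (Fin 2 → ℂ)} (hA : Function.Injective A) :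
    ∃ N : ℂ →L[ℝ] (Fin 2 → ℂ), Function.Bijective fun q : ℂ × ℂ => A q.1 + N q.2 := by
  obtain ⟨q, hq⟩ := Submodule.exists_isCompl (LinearMap.range (A : ℂ →ₗ[ℝ] (Fin 2 → ℂ)))
  have h1 : Module.finrank ℝ (LinearMap.range (A : ℂ →ₗ[ℝ] (Fin 2 → ℂ))) = 2 := by
    rw [LinearMap.finrank_range_of_inj hA, Complex.finrank_real_complex]
  have h2 : Module.finrank ℝ (Fin 2 → ℂ) = 4 := by
    rw [Module.finrank_pi_fintype]
    simp [Complex.finrank_real_complex]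
  have h3 : Module.finrank ℝ q = Module.finrank ℝ ℂ := by
    have := Submodule.finrank_add_eq_of_isCompl hq
    rw [Complex.finrank_real_complex]
    omega
  let e : ℂ ≃ₗ[ℝ] q := (LinearEquiv.ofFinrankEq q ℂ h3).symm
  let N : ℂ →ₗ[ℝ] (Fin 2 → ℂ) := q.subtype ∘ₗ e.toLinearMap
  refine ⟨LinearMap.toContinuousLinearMap N, ?_, ?_⟩
  · rintro ⟨x, n⟩ ⟨x', n'⟩ h
    have h' : A (x - x') = N (n' - n) := by
      rw [map_sub, map_sub, sub_eq_sub_iff_add_eq_add]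
      exact h.trans (add_comm _ _)
    have h4 : A (x - x') ∈ LinearMap.range (A : ℂ →ₗ[ℝ] (Fin 2 → ℂ)) ⊓ q :=
      ⟨⟨_, rfl⟩, by rw [h']; exact (e (n' - n)).2⟩
    rw [hq.inf_eq_bot, Submodule.mem_bot] at h4
    have h5 : x - x' = 0 := hA (h4.trans (map_zero A).symm)
    have h6 : e (n' - n) = 0 := Subtype.ext (by rw [h4] at h'; exact h'.symm)
    rw [LinearEquiv.map_eq_zero_iff] at h6
    rw [sub_eq_zero.1 h5, sub_eq_zero.1 h6]
  · intro y
    have h4 : y ∈ LinearMap.range (A : ℂ →ₗ[ℝ] (Fin 2 → ℂ)) ⊔ q := by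
      rw [hq.sup_eq_top]; trivial
    obtain ⟨_, ⟨x, rfl⟩, w, hw, rfl⟩ := Submodule.mem_sup.1 h4
    refine ⟨(x, e.symm ⟨w, hw⟩), ?_⟩
    change A x + (e (e.symm ⟨w, hw⟩) : Fin 2 → ℂ) = _
    rw [LinearEquiv.apply_symm_apply]
    rfl

section Positive

variable {C t : ℝ}

/-- The standing smallness assumptions. -/
structure IsGood (b : ℝ → ℝ) (ε C : ℝ) : Prop where
  tr : IsTransition b ε
  one_le : 1 ≤ C
  pos : 0 < ε
  small : 1000 * C * ε ≤ 1
  bound : ∀ a, |slope b a| ≤ C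

lemma IsGood.fsHom_pos (hb : IsGood b ε C) (ht : t ∈ Icc (0 : ℝ) 1) {z w : V3} (hz : z ≠ 0)
    (hP : quinticPoly z = 0) (hw : dQuintic z w = 0) (hwz : ∀ c : ℂ, w ≠ c • z) :
    0 < fsHom (deformVec b t z) (dDeform b t z w) (dDeform b t z (Complex.I • w)) :=
  fsHom_dDeform_pos hb.tr hb.one_le hb.pos hb.small hb.bound ht.1 ht.2 hz hP hw hwz

lemma IsGood.injOn (hb : IsGood b ε C) (ht : t ∈ Icc (0 : ℝ) 1) : InjOn (deform b t) fermatQuintic :=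
  deform_injOn hb.tr hb.one_le hb.pos hb.small hb.bound ht.1 ht.2

lemma IsGood.fsHom_param_pos (hb : IsGood b ε C) (ht : t ∈ Icc (0 : ℝ) 1) (i : ParamIndex) {x : ℂ}
    (hx : x ∈ rootDomain) {v : ℂ} (hv : v ≠ 0) :
    0 < fsHom (deformVec b t (i.param x)) (dDeform b t (i.param x) (v • i.vel x))
      (dDeform b t (i.param x) ((Complex.I * v) • i.vel x)) := by
  rw [mul_smul]
  exact hb.fsHom_pos ht (i.param_ne_zero x) (i.quinticPoly_param x) (i.dQuintic_smul_vel hx v)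
    (i.smul_vel_ne hx hv)

/-- A vector in the kernel would pair to zero with everything, against positivity: a symplectic
image plane is never degenerate. -/
lemma IsGood.dAffDeform_injective (hb : IsGood b ε C) (ht : t ∈ Icc (0 : ℝ) 1) (i : ParamIndex)
    {x : ℂ} (hx : x ∈ rootDomain) {k : Fin 3} (hk : deformVec b t (i.param x) k ≠ 0) :
    Function.Injective (i.dAffDeform b k t x) := by
  refine (injective_iff_map_eq_zero _).2 fun v hv => ?_
  by_contra hv0
  have h := hb.fsHom_param_pos ht i hx hv0
  rw [← fsCoord_affOf hk, ← i.dAffDeform_apply, hv] at h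
  simp [fsCoord, dWedge] at h

end Positive

end QuinticSmoothing
end

/-! ### The deformation as a symplectic isotopy of embeddings. -/

noncomputable section

open Filter

namespace QuinticSmoothing

variable {b : ℝ → ℝ} {ε C t : ℝ}

lemma rep_ne_zero_iff_of_eq_toCP {p : CP2} {z : V3} (hz : z ≠ 0) (h : p = toCP z) (k : Fin 3) :
    p.rep k ≠ 0 ↔ z k ≠ 0 := by
  rw [h, rep_toCP_ne_zero_iff hz]

lemma affCoord_of_eq_toCP {p : CP2} {z : V3} (hz : z ≠ 0) (h : p = toCP z) (k : Fin 3) :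
    affCoord k p = affOf k z := by
  rw [h, affCoord_toCP k hz]

/-- The differential of the deformation on the quintic. -/
lemma hasMFDerivAt_deform (hb : IsTransition b ε) (t : ℝ) (p : fermatQuintic) {i : ParamIndex}
    (hi : chartAt ℂ p = i.chart) :
    HasMFDerivAt 𝓘(ℝ, ℂ) I4 (fun p : fermatQuintic => deform b t p) p
      (i.dAffDeform b (chartIndex (deform b t p)) t (i.chart p)) := by
  have hp : p ∈ i.chart.source := hi ▸ mem_chart_source ℂ p
  have hx : i.chart p ∈ rootDomain := i.chart.map_source hp
  have hF := (deformVec_nonVertex hb t (i.nonVertex_param (i.chart p))).ne_zero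
  set k := chartIndex (deform b t p) with hk
  have hFk : deformVec b t (i.param (i.chart p)) k ≠ 0 :=
    (rep_ne_zero_iff_of_eq_toCP hF (i.deform_symm_chart hb t hp) k).1 (rep_chartIndex_ne_zero _)
  have hcont : ContinuousAt (fun p : fermatQuintic => deform b t p) p :=
    ContinuousAt.comp (g := fun q : ℝ × fermatQuintic => deform b q.1 q.2) (f := fun p => (t, p))
      (contMDiffAt_deform hb t p).continuousAt (by fun_prop)
  refine ⟨hcont, ?_⟩
  have h := i.hasFDerivAt_affDeform hb t hx hFk
  have he : writtenInExtChartAt 𝓘(ℝ, ℂ) I4 p (fun p : fermatQuintic => deform b t p)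
      =ᶠ[𝓝 (i.chart p)] i.affDeform b k t := by
    filter_upwards [isOpen_rootDomain.mem_nhds hx] with x hx
    change affCoord k (deform b t ((chartAt ℂ p).symm x)) = _
    rw [hi]
    change affCoord k (deform b t (toCP (i.param x))) = _
    rw [deform_toCP hb t (i.nonVertex_param x),
      affCoord_toCP k (deformVec_nonVertex hb t (i.nonVertex_param x)).ne_zero]
    rfl
  have he2 : extChartAt 𝓘(ℝ, ℂ) p p = i.chart p := by
    change (chartAt ℂ p) p = _
    rw [hi]
  rw [he2]
  exact (h.congr_of_eventuallyEq he).hasFDerivWithinAt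

lemma fsForm_deform (hb : IsTransition b ε) (t : ℝ) (p : fermatQuintic) {i : ParamIndex}
    (hi : chartAt ℂ p = i.chart) (v w : ℂ) :
    fsForm (deform b t p)
      (mfderiv 𝓘(ℝ, ℂ) I4 (fun p : fermatQuintic => deform b t p) p v)
      (mfderiv 𝓘(ℝ, ℂ) I4 (fun p : fermatQuintic => deform b t p) p w) =
    fsHom (deformVec b t (i.param (i.chart p)))
      (dDeform b t (i.param (i.chart p)) (v • i.vel (i.chart p)))
      (dDeform b t (i.param (i.chart p)) (w • i.vel (i.chart p))) := by
  have hp : p ∈ i.chart.source := hi ▸ mem_chart_source ℂ p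
  have hF := (deformVec_nonVertex hb t (i.nonVertex_param (i.chart p))).ne_zero
  have hFk : deformVec b t (i.param (i.chart p)) (chartIndex (deform b t p)) ≠ 0 :=
    (rep_ne_zero_iff_of_eq_toCP hF (i.deform_symm_chart hb t hp) _).1 (rep_chartIndex_ne_zero _)
  rw [(hasMFDerivAt_deform hb t p hi).mfderiv, ← fsCoord_affOf hFk]
  have h : affCoord (chartIndex (deform b t p)) (deform b t p) =
      affOf (chartIndex (deform b t p)) (deformVec b t (i.param (i.chart p))) :=
    affCoord_of_eq_toCP hF (i.deform_symm_chart hb t hp) _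
  exact congrArg (fun x => fsCoord x
    (i.dAffDeform b (chartIndex (deform b t p)) t (i.chart p) v)
    (i.dAffDeform b (chartIndex (deform b t p)) t (i.chart p) w)) h

lemma exists_chartAt_eq (p : fermatQuintic) : ∃ i : ParamIndex, chartAt ℂ p = i.chart := by
  obtain ⟨i, hi⟩ := chart_mem_atlas ℂ p
  exact ⟨i, hi.symm⟩

lemma bijective_clm_equiv {E G : Type*} [NormedAddCommGroup E] [NormedSpace ℝ E]
    [FiniteDimensional ℝ E] [NormedAddCommGroup G] [NormedSpace ℝ G] {A : E →L[ℝ] G}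
    (hA : Function.Bijective A) : ∃ e : E ≃L[ℝ] G, (e : E →L[ℝ] G) = A :=
  ⟨(LinearEquiv.ofBijective (A : E →ₗ[ℝ] G) hA).toContinuousLinearEquiv,
    ContinuousLinearMap.ext fun _ => rfl⟩

/-- An immersed disc in `ℂ²` is straightened by a local diffeomorphism. -/
lemma exists_straightening {g : ℂ → Fin 2 → ℂ} {D : Set ℂ} (hD : IsOpen D)
    (hg : ∀ x ∈ D, ContDiffAt ℝ ∞ g x) {x₀ : ℂ} (hx₀ : x₀ ∈ D) {A : ℂ →L[ℝ] (Fin 2 → ℂ)}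
    (hA : HasFDerivAt g A x₀) (hinj : Function.Injective A) :
    ∃ θ : OpenPartialHomeomorph (Fin 2 → ℂ) (Fin 2 → ℂ), ![x₀, 0] ∈ θ.source ∧
      (∀ x, θ ![x, 0] = g x) ∧ (∀ y ∈ θ.source, ContDiffAt ℝ ∞ θ y) ∧
      ∀ y ∈ θ.target, ContDiffAt ℝ ∞ θ.symm y := by
  obtain ⟨N, hN⟩ := exists_complement hinj
  have hcoord : ∀ (j : Fin 2) (y : Fin 2 → ℂ), ContDiffAt ℝ ∞ (fun y : Fin 2 → ℂ => y j) y :=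
    fun j y => (contDiff_apply ℝ ℂ j).contDiffAt
  have hO : IsOpen {y : Fin 2 → ℂ | y 0 ∈ D} := hD.preimage (continuous_apply 0)
  have hf : ∀ y ∈ {y : Fin 2 → ℂ | y 0 ∈ D},
      ContDiffAt ℝ ∞ (fun y : Fin 2 → ℂ => g (y 0) + N (y 1)) y := fun y hy =>
    (ContDiffAt.comp (g := g) (f := fun y : Fin 2 → ℂ => y 0) y (hg _ hy) (hcoord 0 y)).add
      (ContDiffAt.comp (g := N) (f := fun y : Fin 2 → ℂ => y 1) y
        N.contDiff.contDiffAt (hcoord 1 y))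
  have hfA : HasFDerivAt (fun y : Fin 2 → ℂ => g (y 0) + N (y 1))
      (A.comp (ContinuousLinearMap.proj 0) + N.comp (ContinuousLinearMap.proj 1)) ![x₀, 0] := by
    refine HasFDerivAt.add ?_ ?_
    · exact HasFDerivAt.comp (g := g) (f := fun y : Fin 2 → ℂ => y 0) ![x₀, 0] hA
        (ContinuousLinearMap.proj (R := ℝ) (φ := fun _ : Fin 2 => ℂ) 0).hasFDerivAt
    · exact HasFDerivAt.comp (g := N) (f := fun y : Fin 2 → ℂ => y 1) ![x₀, 0] N.hasFDerivAt
        (ContinuousLinearMap.proj (R := ℝ) (φ := fun _ : Fin 2 => ℂ) 1).hasFDerivAt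
  have hbij : Function.Bijective (A.comp (ContinuousLinearMap.proj (R := ℝ) (φ := fun _ : Fin 2 => ℂ) 0)
      + N.comp (ContinuousLinearMap.proj (R := ℝ) (φ := fun _ : Fin 2 => ℂ) 1)) :=
    hN.comp (finTwoArrowEquiv ℂ).bijective
  obtain ⟨e, he⟩ := bijective_clm_equiv hbij
  obtain ⟨θ, h1, -, h2, h3, h4⟩ := exists_localDiffeo hO hf (a := ![x₀, 0]) hx₀ (f' := e)
    (by rw [he]; exact hfA)
  refine ⟨θ, h1, fun x => ?_, by rwa [h2], h4⟩
  rw [h2]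
  simp

lemma isImmersionAt_deform (hb : IsGood b ε C) (ht : t ∈ Icc (0 : ℝ) 1) (p : fermatQuintic) :
    Manifold.IsImmersionAtOfComplement ℂ 𝓘(ℝ, ℂ) I4 ∞
      (fun p : fermatQuintic => deform b t p) p := by
  obtain ⟨i, hp⟩ := exists_mem_chart_source p
  have hx : i.chart p ∈ rootDomain := i.chart.map_source hp
  have hF := fun x => (deformVec_nonVertex hb.tr t (i.nonVertex_param x)).ne_zero
  obtain ⟨k, hk⟩ : ∃ k, chartIndex (deform b t p) = k := ⟨_, rfl⟩
  have hpk : (deform b t p).rep k ≠ 0 := hk ▸ rep_chartIndex_ne_zero _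
  have hFk : deformVec b t (i.param (i.chart p)) k ≠ 0 :=
    (rep_ne_zero_iff_of_eq_toCP (hF _) (i.deform_symm_chart hb.tr t hp) _).1 hpk
  have hco : ∀ x ∈ rootDomain, ContDiffAt ℝ ∞ (fun x => deformVec b t (i.param x)) x := fun x hx =>
    ContDiffAt.comp (g := deformVec b t) (f := i.param) x
      (contDiffAt_deformVec_right hb.tr t (i.nonVertex_param x)) (i.contDiffAt_param hx)
  have hD : IsOpen (rootDomain ∩ (fun x => deformVec b t (i.param x) k) ⁻¹' {0}ᶜ) :=
    ContinuousOn.isOpen_inter_preimage (fun x hx =>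
      (contDiffAt_pi.1 (hco x hx) k).continuousAt.continuousWithinAt) isOpen_rootDomain
      isOpen_compl_singleton
  obtain ⟨θ, haθ, hθf, hθ1, hθ2⟩ := exists_straightening hD (g := i.affDeform b k t)
    (fun x hx => ContDiffAt.comp (g := affOf k) (f := fun x => deformVec b t (i.param x)) x
      (contDiffAt_affOf hx.2) (hco x hx.1)) ⟨hx, hFk⟩
    (i.hasFDerivAt_affDeform hb.tr t hx hFk) (hb.dAffDeform_injective ht i hx hFk)
  -- the adapted charts
  have hU : IsOpen ((fun x => (![x, 0] : Fin 2 → ℂ)) ⁻¹' θ.source) :=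
    θ.open_source.preimage (by fun_prop)
  have hcont : ContinuousAt (fun p : fermatQuintic => deform b t p) p :=
    ContinuousAt.comp (g := fun q : ℝ × fermatQuintic => deform b q.1 q.2) (f := fun p => (t, p))
      (contMDiffAt_deform hb.tr t p).continuousAt (by fun_prop)
  have haff : ∀ x, affCoord k (toCP (deformVec b t (i.param x))) = θ ![x, 0] := fun x => by
    rw [affCoord_toCP k (hF x), hθf]
    rfl
  have hdef : ∀ x, deform b t (toCP (i.param x)) = toCP (deformVec b t (i.param x)) := fun x =>
    deform_toCP hb.tr t (i.nonVertex_param x)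
  have hpx : deform b t p = toCP (deformVec b t (i.param (i.chart p))) :=
    i.deform_symm_chart hb.tr t hp
  have hs : IsOpen (i.chart.source ∩ i.chart ⁻¹' ((fun x => (![x, 0] : Fin 2 → ℂ)) ⁻¹' θ.source)) :=
    i.chart.isOpen_inter_preimage hU
  -- In the affine chart followed by the inverse of the straightening map, the deformation reads x ↦
  -- (x, 0).
  refine Manifold.IsImmersionAtOfComplement.mk_of_continuousAt hcont
    (ContinuousLinearEquiv.finTwoArrow ℝ ℂ).symm
    (i.chart.restr (i.chart.source ∩ i.chart ⁻¹' ((fun x => (![x, 0] : Fin 2 → ℂ)) ⁻¹' θ.source)))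
    (affChart k ≫ₕ θ.symm) ?_ ?_ ?_ ?_ ?_
  · rw [OpenPartialHomeomorph.restr_source, hs.interior_eq]
    exact ⟨hp, hp, haθ⟩
  · rw [OpenPartialHomeomorph.trans_source]
    refine ⟨hpk, ?_⟩
    change affCoord k (deform b t p) ∈ θ.target
    rw [hpx, haff]
    exact θ.map_source haθ
  · exact restr_mem_maximalAtlas _ (chart_mem_maximalAtlas i) hs
  · refine OpenPartialHomeomorph.mem_maximalAtlas_of_contMDiffOn _ ?_ ?_
    · intro q hq
      rw [OpenPartialHomeomorph.trans_source] at hq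
      exact (ContMDiffAt.comp q (hθ2 _ hq.2).contMDiffAt
        (contMDiffAt_affCoord hq.1)).contMDiffWithinAt
    · intro y hy
      rw [OpenPartialHomeomorph.trans_target] at hy
      have h1 : ContMDiffAt I4 I4 ∞ (affChart k).symm (θ y) :=
        contMDiffAt_symm_of_mem_maximalAtlas (affChart_mem_maximalAtlas k) (mem_univ _)
      exact (ContMDiffAt.comp y h1 (hθ1 y hy.1).contMDiffAt).contMDiffWithinAt
  · intro x hx
    simp only [mfld_simps] at hx
    have hxD : x ∈ rootDomain := hx.1
    have hxU : ![x, 0] ∈ θ.source := by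
      have h := hx.2
      rw [hs.interior_eq] at h
      have h2 := i.chart.right_inv hxD
      have h3 : ![i.chart (i.chart.symm x), 0] ∈ θ.source := h.2
      rwa [h2] at h3
    change θ.symm (affCoord k (deform b t (toCP (i.param x)))) = ![x, 0]
    rw [hdef, haff, θ.left_inv hxU]

theorem isSymplecticIsotopy_deform (hb : IsGood b ε C) :
    IsSymplecticIsotopy (fun (t : ℝ) (p : fermatQuintic) => deform b t p) where
  smooth q _ := (contMDiffAt_deform hb.tr q.1 q.2).contMDiffWithinAt
  embedding t ht := by
    refine ⟨Manifold.IsImmersionOfComplement.isImmersion (F := ℂ)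
      fun p => isImmersionAt_deform hb ht p, ?_⟩
    have hcont : Continuous (fun p : fermatQuintic => deform b t p) :=
      continuous_iff_continuousAt.2 fun p =>
        ContinuousAt.comp (g := fun q : ℝ × fermatQuintic => deform b q.1 q.2)
          (f := fun p => (t, p)) (contMDiffAt_deform hb.tr t p).continuousAt (by fun_prop)
    exact (hcont.isClosedEmbedding fun p q h =>
      Subtype.ext (hb.injOn ht p.2 q.2 h)).isEmbedding
  symplectic t ht p v hv := by
    obtain ⟨i, hi⟩ := exists_chartAt_eq p
    have hp : p ∈ i.chart.source := hi ▸ mem_chart_source ℂ p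
    let u : ℂ := v
    refine ⟨Complex.I * u, ?_⟩
    refine ne_of_eq_of_ne (fsForm_deform hb.tr t p hi u (Complex.I * u)) ?_
    exact (hb.fsHom_param_pos ht i (i.chart.map_source hp) hv).ne'

end QuinticSmoothing
end

noncomputable section

open Filter

namespace QuinticSmoothing

variable {b : ℝ → ℝ} {ε C t : ℝ}

/-! ### The normal velocity of the deformed curve -/

lemma fsHom_neg_left (z u v : V3) : fsHom z (-u) v = -fsHom z u v := by
  have := fsHom_smul_left z (-1) u v
  simpa using this

lemma fsHom_sub_left (z u u' v : V3) : fsHom z (u - u') v = fsHom z u v - fsHom z u' v := by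
  rw [sub_eq_add_neg, fsHom_add_left, fsHom_neg_left, ← sub_eq_add_neg]

/-- The symplectic projection of `v` along the plane spanned by `a₁, a₂` to its symplectic
complement. -/
def symNormal (z a₁ a₂ v : V3) : V3 :=
  v - (fsHom z v a₂ / fsHom z a₁ a₂) • a₁ + (fsHom z v a₁ / fsHom z a₁ a₂) • a₂

lemma fsHom_symNormal_left {z a₁ a₂ : V3} (h : fsHom z a₁ a₂ ≠ 0) (v : V3) :
    fsHom z (symNormal z a₁ a₂ v) a₁ = 0 := by
  rw [symNormal, fsHom_add_left, fsHom_sub_left, fsHom_smul_left, fsHom_smul_left, fsHom_self,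
    fsHom_swap z a₁ a₂]
  field_simp
  ring

lemma fsHom_symNormal_right {z a₁ a₂ : V3} (h : fsHom z a₁ a₂ ≠ 0) (v : V3) :
    fsHom z (symNormal z a₁ a₂ v) a₂ = 0 := by
  rw [symNormal, fsHom_add_left, fsHom_sub_left, fsHom_smul_left, fsHom_smul_left, fsHom_self]
  field_simp
  ring

lemma symNormal_smul (z a₁ a₂ v : V3) (r : ℝ) :
    symNormal z a₁ a₂ (r • v) = r • symNormal z a₁ a₂ v := by
  simp only [symNormal, fsHom_smul_left, smul_add, smul_sub, smul_smul, mul_div_assoc]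

lemma ContDiffAt.symNormal {E : Type*} [NormedAddCommGroup E] [NormedSpace ℝ E]
    {f g₁ g₂ k : E → V3} {x : E} (hf : ContDiffAt ℝ ∞ f x) (hg₁ : ContDiffAt ℝ ∞ g₁ x)
    (hg₂ : ContDiffAt ℝ ∞ g₂ x) (hk : ContDiffAt ℝ ∞ k x) (hfx : f x ≠ 0)
    (h : QuinticSmoothing.fsHom (f x) (g₁ x) (g₂ x) ≠ 0) :
    ContDiffAt ℝ ∞ (fun x => QuinticSmoothing.symNormal (f x) (g₁ x) (g₂ x) (k x)) x := by
  have h12 := ContDiffAt.fsHom hf hg₁ hg₂ hfx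
  have hk1 := ContDiffAt.fsHom hf hk hg₁ hfx
  have hk2 := ContDiffAt.fsHom hf hk hg₂ hfx
  exact (hk.sub ((hk2.div h12 h).smul hg₁)).add ((hk1.div h12 h).smul hg₂)

/-- `V` is a velocity of the deformed cone at the point over `z`, symplectically orthogonal to
the cone. -/
def IsNormalVel (b : ℝ → ℝ) (t : ℝ) (z V : V3) : Prop :=
  (∃ θ, dQuintic z θ = 0 ∧ V = deformVel b t z + dDeform b t z θ) ∧
    ∀ κ, dQuintic z κ = 0 → fsHom (deformVec b t z) V (dDeform b t z κ) = 0

lemma dQuintic_sub (z u v : V3) : dQuintic z (u - v) = dQuintic z u - dQuintic z v := by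
  simp [dQuintic]; ring

lemma dQuintic_add (z u v : V3) : dQuintic z (u + v) = dQuintic z u + dQuintic z v := by
  simp [dQuintic]; ring

lemma dQuintic_smul (a : ℂ) (z u : V3) : dQuintic (a • z) (a • u) = a ^ 5 * dQuintic z u := by
  simp [dQuintic]; ring

lemma dQuintic_smul_right (a : ℂ) (z u : V3) : dQuintic z (a • u) = a * dQuintic z u := by
  simp [dQuintic]; ring

lemma quinticPoly_smul (a : ℂ) (z : V3) : quinticPoly (a • z) = a ^ 5 * quinticPoly z := by
  simp [quinticPoly]; ring

/-- The difference of two normal velocities is the image of a tangent vector that is orthogonal to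
all tangent images. Testing it against its own multiple by `I`, positivity makes it radial, hence
invisible to the form. So the differential prescribed on the curve is independent of the
parametrization, and local solutions can be averaged. -/
lemma IsNormalVel.fsHom_eq (hb : IsGood b ε C) (ht : t ∈ Icc (0 : ℝ) 1) {z V V' : V3}
    (hz : z ≠ 0) (hP : quinticPoly z = 0) (h : IsNormalVel b t z V) (h' : IsNormalVel b t z V')
    (w : V3) : fsHom (deformVec b t z) V w = fsHom (deformVec b t z) V' w := by
  obtain ⟨⟨θ, hθ, rfl⟩, h⟩ := h
  obtain ⟨⟨θ', hθ', rfl⟩, h'⟩ := h'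
  have hd : dQuintic z (θ - θ') = 0 := by rw [dQuintic_sub, hθ, hθ', sub_zero]
  have hnv := nonVertex_of_quintic hz hP
  have hrad : ∃ c : ℂ, θ - θ' = c • z := by
    by_contra hc
    push Not at hc
    have hpos := hb.fsHom_pos ht hz hP hd hc
    have hI : dQuintic z (Complex.I • (θ - θ')) = 0 := by rw [dQuintic_smul_right, hd, mul_zero]
    have h1 := h _ hI
    have h2 := h' _ hI
    rw [fsHom_add_left] at h1 h2
    rw [map_sub, fsHom_sub_left] at hpos
    linarith
  obtain ⟨c, hc⟩ := hrad
  have e : θ = θ' + c • z := by rw [← hc]; abel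
  rw [e, map_add, dDeform_radial hb.tr t hnv, ← add_assoc, fsHom_add_left _ (_ + _),
    fsHom_radial_left, add_zero]

lemma dDeform_smul_smul (hb : IsTransition b ε) (t : ℝ) {z : V3} (hz : NonVertex z) {a : ℂ}
    (ha : a ≠ 0) (w : V3) :
    dDeform b t (a • z) (a • w) = (a * ((‖a‖ ^ t : ℝ) : ℂ)) • dDeform b t z w := by
  have h1 : HasDerivAt (fun s : ℝ => z + s • w) w 0 := by
    simpa using ((hasDerivAt_id (0 : ℝ)).smul_const w).const_add z
  have h2 : HasFDerivAt (deformVec b t) (dDeform b t z) (z + (0 : ℝ) • w) := by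
    simpa using hasFDerivAt_deformVec hb t hz
  have h3 : HasFDerivAt (deformVec b t) (dDeform b t (a • z)) (a • (z + (0 : ℝ) • w)) := by
    simpa using hasFDerivAt_deformVec hb t (hz.smul ha)
  have h4 := h3.comp_hasDerivAt 0 (h1.const_smul a)
  have h5 := (h2.comp_hasDerivAt 0 h1).const_smul (a * ((‖a‖ ^ t : ℝ) : ℂ))
  refine h4.unique (h5.congr_of_eventuallyEq (Eventually.of_forall fun s => ?_))
  exact deformVec_smul' t ha _

/-- The scaling factor a|a|^s itself depends on the time s, which produces the radial term with
log|a|. -/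
lemma deformVel_smul (hb : IsTransition b ε) (t : ℝ) {z : V3} (hz : NonVertex z) {a : ℂ}
    (ha : a ≠ 0) : deformVel b t (a • z) = (a * ((‖a‖ ^ t : ℝ) : ℂ)) • deformVel b t z +
      (a * ((‖a‖ ^ t : ℝ) : ℂ) * Real.log ‖a‖) • deformVec b t z := by
  have h1 := hasDerivAt_deformVec_time hb t (hz.smul ha)
  have h2 := hasDerivAt_deformVec_time hb t hz
  have h3 : HasDerivAt (fun s : ℝ => a * ((‖a‖ ^ s : ℝ) : ℂ))
      (a * ((‖a‖ ^ t : ℝ) : ℂ) * Real.log ‖a‖) t := by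
    have h := (((hasDerivAt_id t).const_rpow (norm_pos_iff.2 ha)).ofReal_comp).const_mul a
    refine h.congr_deriv ?_
    simp
    ring
  have h4 : HasDerivAt (fun s => deformVec b s (a • z)) _ t :=
    (h3.smul h2).congr_of_eventuallyEq (Eventually.of_forall fun s => deformVec_smul' s ha z)
  exact h1.unique h4

lemma IsNormalVel.smul (hb : IsTransition b ε) {z V : V3} (hz : NonVertex z) {a : ℂ} (ha : a ≠ 0)
    (h : IsNormalVel b t z V) : IsNormalVel b t (a • z) ((a * ((‖a‖ ^ t : ℝ) : ℂ)) • V +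
      (a * ((‖a‖ ^ t : ℝ) : ℂ) * Real.log ‖a‖) • deformVec b t z) := by
  obtain ⟨⟨θ, hθ, rfl⟩, h⟩ := h
  have hc : a * ((‖a‖ ^ t : ℝ) : ℂ) ≠ 0 := by
    have : (0 : ℝ) < ‖a‖ ^ t := Real.rpow_pos_of_pos (norm_pos_iff.2 ha) t
    exact mul_ne_zero ha (by exact_mod_cast this.ne')
  refine ⟨⟨a • θ, by rw [dQuintic_smul, hθ, mul_zero], ?_⟩, fun κ hκ => ?_⟩
  · rw [deformVel_smul hb t hz ha, dDeform_smul_smul hb t hz ha, smul_add]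
    abel
  · have e : κ = a • (a⁻¹ • κ) := by rw [smul_smul, mul_inv_cancel₀ ha, one_smul]
    have hκ' : dQuintic z (a⁻¹ • κ) = 0 := by
      rw [e, dQuintic_smul] at hκ
      exact (mul_eq_zero.1 hκ).resolve_left (pow_ne_zero 5 ha)
    rw [e, dDeform_smul_smul hb t hz ha, deformVec_smul' t ha]
    generalize a * ((‖a‖ ^ t : ℝ) : ℂ) = c at hc ⊢
    have e2 : (c * Real.log ‖a‖) • deformVec b t z = (Real.log ‖a‖ : ℂ) • (c • deformVec b t z) := by
      rw [smul_smul, mul_comm]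
    rw [e2, fsHom_add_left, fsHom_smul hc, h _ hκ', fsHom_radial_left, zero_add]

namespace ParamIndex

variable (i : ParamIndex)

/-- The deformation on a parametrization, as a function of time and parameter. -/
def lift (b : ℝ → ℝ) (q : ℝ × ℂ) : V3 := deformVec b q.1 (i.param q.2)

lemma lift_ne_zero (hb : IsTransition b ε) (q : ℝ × ℂ) : i.lift b q ≠ 0 :=
  (deformVec_nonVertex hb q.1 (i.nonVertex_param q.2)).ne_zero

lemma contDiffAt_lift (hb : IsTransition b ε) {q : ℝ × ℂ} (hq : q.2 ∈ rootDomain) :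
    ContDiffAt ℝ ∞ (i.lift b) q := i.contDiffAt_deformVec_param hb q.1 hq

/-- The derivative of the deformation on a parametrization. -/
def dLift (b : ℝ → ℝ) (q : ℝ × ℂ) : ℝ × ℂ →L[ℝ] V3 := fderiv ℝ (i.lift b) q

lemma hasFDerivAt_lift (hb : IsTransition b ε) {q : ℝ × ℂ} (hq : q.2 ∈ rootDomain) :
    HasFDerivAt (i.lift b) (i.dLift b q) q :=
  ((i.contDiffAt_lift hb hq).differentiableAt (by simp)).hasFDerivAt

lemma contDiffAt_dLift (hb : IsTransition b ε) {q : ℝ × ℂ} (hq : q.2 ∈ rootDomain) (v : ℝ × ℂ) :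
    ContDiffAt ℝ ∞ (fun q => i.dLift b q v) q :=
  ((i.contDiffAt_lift hb hq).fderiv_right (m := ∞) (by simp)).clm_apply contDiffAt_const

lemma dLift_apply (hb : IsTransition b ε) {q : ℝ × ℂ} (hq : q.2 ∈ rootDomain) (v : ℝ × ℂ) :
    i.dLift b q v = v.1 • deformVel b q.1 (i.param q.2) +
      dDeform b q.1 (i.param q.2) (v.2 • i.vel q.2) := by
  have h1 := hasFDerivAt_deformVec_total hb q.1 (i.nonVertex_param q.2)
  have h2 : HasFDerivAt (fun q : ℝ × ℂ => (q.1, i.param q.2)) ((ContinuousLinearMap.fst ℝ ℝ ℂ).prod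
      (((ContinuousLinearMap.id ℝ ℂ).smulRight (i.vel q.2)).comp (.snd ℝ ℝ ℂ))) q :=
    hasFDerivAt_fst.prodMk ((i.hasFDerivAt_param hq).comp q hasFDerivAt_snd)
  have h3 := HasFDerivAt.comp (g := fun q : ℝ × V3 => deformVec b q.1 q.2) q h1 h2
  have h4 := congrArg (fun A => A v) ((i.hasFDerivAt_lift hb hq).unique h3)
  exact h4.trans (by simp)

/-- The part of the domain of a parametrization where the deformed curve is symplectic. -/
def regular (b : ℝ → ℝ) : Set (ℝ × ℂ) :=
  {q | q.2 ∈ rootDomain ∧ fsHom (i.lift b q) (i.dLift b q (0, 1)) (i.dLift b q (0, Complex.I)) ≠ 0}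

lemma contDiffAt_fsHom_dLift (hb : IsTransition b ε) {q : ℝ × ℂ} (hq : q.2 ∈ rootDomain)
    (u v : ℝ × ℂ) :
    ContDiffAt ℝ ∞ (fun q => fsHom (i.lift b q) (i.dLift b q u) (i.dLift b q v)) q :=
  ContDiffAt.fsHom (i.contDiffAt_lift hb hq) (i.contDiffAt_dLift hb hq u)
    (i.contDiffAt_dLift hb hq v) (i.lift_ne_zero hb q)

lemma eventually_mem_regular (hb : IsTransition b ε) {q : ℝ × ℂ} (h1 : q.2 ∈ rootDomain)
    (h2 : fsHom (i.lift b q) (i.dLift b q (0, 1)) (i.dLift b q (0, Complex.I)) ≠ 0) :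
    ∀ᶠ q in 𝓝 q, q ∈ i.regular b := by
  have h3 : ∀ᶠ q : ℝ × ℂ in 𝓝 q, q.2 ∈ rootDomain :=
    continuous_snd.continuousAt.eventually (isOpen_rootDomain.mem_nhds h1)
  have h4 := (i.contDiffAt_fsHom_dLift hb h1 (0, 1) (0, Complex.I)).continuousAt
  have h5 := h4.eventually_ne h2
  filter_upwards [h3, h5] with q ha hb
  exact And.intro ha hb

lemma isOpen_regular (hb : IsTransition b ε) : IsOpen (i.regular b) :=
  isOpen_iff_mem_nhds.2 fun _ hq => i.eventually_mem_regular hb hq.1 hq.2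

lemma dLift_zero_left (hb : IsTransition b ε) (t : ℝ) {x : ℂ} (hx : x ∈ rootDomain) (v : ℂ) :
    i.dLift b (t, x) (0, v) = dDeform b t (i.param x) (v • i.vel x) := by
  rw [i.dLift_apply hb (q := (t, x)) hx, zero_smul, zero_add]

lemma mem_regular (hb : IsGood b ε C) (ht : t ∈ Icc (0 : ℝ) 1) {x : ℂ} (hx : x ∈ rootDomain) :
    (t, x) ∈ i.regular b := by
  have h := hb.fsHom_param_pos ht i hx one_ne_zero
  rw [mul_one, ← i.dLift_zero_left hb.tr, ← i.dLift_zero_left hb.tr] at h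
  · exact And.intro hx h.ne'
  all_goals exact hx

/-- The velocity of the deformed curve, normalized to be symplectically orthogonal to it. -/
def normalVel (b : ℝ → ℝ) (q : ℝ × ℂ) : V3 :=
  symNormal (i.lift b q) (i.dLift b q (0, 1)) (i.dLift b q (0, Complex.I)) (i.dLift b q (1, 0))

/-- The velocity of the parameter for which the deformed curve moves with `normalVel`. -/
def paramVel (b : ℝ → ℝ) (q : ℝ × ℂ) : ℂ :=
  -((fsHom (i.lift b q) (i.dLift b q (1, 0)) (i.dLift b q (0, Complex.I)) /
    fsHom (i.lift b q) (i.dLift b q (0, 1)) (i.dLift b q (0, Complex.I)) : ℝ) : ℂ) +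
  ((fsHom (i.lift b q) (i.dLift b q (1, 0)) (i.dLift b q (0, 1)) /
    fsHom (i.lift b q) (i.dLift b q (0, 1)) (i.dLift b q (0, Complex.I)) : ℝ) : ℂ) * Complex.I

lemma contDiffAt_normalVel (hb : IsTransition b ε) {q : ℝ × ℂ} (hq : q ∈ i.regular b) :
    ContDiffAt ℝ ∞ (i.normalVel b) q :=
  ContDiffAt.symNormal (i.contDiffAt_lift hb hq.1) (i.contDiffAt_dLift hb hq.1 _)
    (i.contDiffAt_dLift hb hq.1 _) (i.contDiffAt_dLift hb hq.1 _) (i.lift_ne_zero hb q) hq.2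

lemma contDiffAt_paramVel (hb : IsTransition b ε) {q : ℝ × ℂ} (hq : q ∈ i.regular b) :
    ContDiffAt ℝ ∞ (i.paramVel b) q := by
  have h := i.contDiffAt_fsHom_dLift hb hq.1
  have h1 := (h (1, 0) (0, Complex.I)).div (h (0, 1) (0, Complex.I)) hq.2
  have h2 := (h (1, 0) (0, 1)).div (h (0, 1) (0, Complex.I)) hq.2
  exact (ContDiffAt.comp (g := fun r : ℝ => (r : ℂ)) q Complex.ofRealCLM.contDiff.contDiffAt h1).neg.add
    ((ContDiffAt.comp (g := fun r : ℝ => (r : ℂ)) q Complex.ofRealCLM.contDiff.contDiffAt h2).mul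
      contDiffAt_const)

lemma dLift_zero_eq (b : ℝ → ℝ) (q : ℝ × ℂ) (v : ℂ) : i.dLift b q (0, v) =
    v.re • i.dLift b q (0, 1) + v.im • i.dLift b q (0, Complex.I) := by
  rw [← map_smul, ← map_smul, ← map_add]
  congr 1
  ext
  · simp
  · simp [Complex.re_add_im, Complex.real_smul]

/-- Symplectic projection only adds a tangential vector, so the curve moves with the normal velocity
once its parameter moves with `paramVel`. -/
lemma normalVel_eq (b : ℝ → ℝ) (q : ℝ × ℂ) :
    i.normalVel b q = i.dLift b q (1, i.paramVel b q) := by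
  have e : ((1 : ℝ), i.paramVel b q) = (1, 0) + (0, i.paramVel b q) := by simp
  rw [e, map_add, dLift_zero_eq, normalVel, symNormal]
  have hre : (i.paramVel b q).re = -(fsHom (i.lift b q) (i.dLift b q (1, 0))
      (i.dLift b q (0, Complex.I)) / fsHom (i.lift b q) (i.dLift b q (0, 1))
      (i.dLift b q (0, Complex.I))) := by simp [paramVel]
  have him : (i.paramVel b q).im = fsHom (i.lift b q) (i.dLift b q (1, 0))
      (i.dLift b q (0, 1)) / fsHom (i.lift b q) (i.dLift b q (0, 1))
      (i.dLift b q (0, Complex.I)) := by simp [paramVel]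
  rw [hre, him, neg_smul]
  abel

lemma fsHom_normalVel {q : ℝ × ℂ} (hq : q ∈ i.regular b) (v : ℂ) :
    fsHom (i.lift b q) (i.normalVel b q) (i.dLift b q (0, v)) = 0 := by
  rw [dLift_zero_eq, fsHom_add_right, fsHom_smul_right, fsHom_smul_right, normalVel,
    fsHom_symNormal_left hq.2, fsHom_symNormal_right hq.2, mul_zero, mul_zero, add_zero]

/-- Subtracting multiples of the point and of the velocity clears the unit and free coordinates; the
tangency equation then clears the root coordinate, whose coefficient does not vanish. -/
lemma exists_of_dQuintic {x : ℂ} (hx : x ∈ rootDomain) {κ : V3} (hκ : dQuintic (i.param x) κ = 0) :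
    ∃ c v : ℂ, κ = c • i.param x + v • i.vel x := by
  refine ⟨κ i.unitCoord, κ i.freeCoord - κ i.unitCoord * x, ?_⟩
  set κ' := κ - (κ i.unitCoord • i.param x + (κ i.freeCoord - κ i.unitCoord * x) • i.vel x)
    with hκ'
  have hP : dQuintic (i.param x) (i.param x) = 0 := by
    have : dQuintic (i.param x) (i.param x) = quinticPoly (i.param x) := by
      simp only [dQuintic, quinticPoly]; ring
    rw [this, quinticPoly_param]
  have h0 : dQuintic (i.param x) κ' = 0 := by
    rw [hκ', dQuintic_sub, dQuintic_add, dQuintic_smul_right, dQuintic_smul_right, hκ, hP,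
      dQuintic_vel i hx]
    ring
  have hu : κ' i.unitCoord = 0 := by simp [hκ', param_unit, vel_unit i hx]
  have hf : κ' i.freeCoord = 0 := by simp [hκ', param_free, vel_free i hx]
  have hr : κ' i.rootCoord = 0 := by
    have h : i.param x i.unitCoord ^ 4 * κ' i.unitCoord + i.param x i.rootCoord ^ 4 *
        κ' i.rootCoord + i.param x i.freeCoord ^ 4 * κ' i.freeCoord = 0 :=
      (sum_comp_perm i.1.symm fun j => i.param x j ^ 4 * κ' j).trans h0
    rw [hu, hf, mul_zero, mul_zero, zero_add, add_zero, param_root] at h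
    exact (mul_eq_zero.1 h).resolve_left
      (pow_ne_zero 4 (mul_ne_zero i.root_ne_zero (root5_ne_zero hx)))
  have : κ' = 0 := i.ext_coords (z := κ') (w := 0) hu hr hf
  exact sub_eq_zero.1 this

lemma isNormalVel (hb : IsTransition b ε) {t : ℝ} {x : ℂ} (hq : (t, x) ∈ i.regular b) :
    IsNormalVel b t (i.param x) (i.normalVel b (t, x)) := by
  refine ⟨⟨i.paramVel b (t, x) • i.vel x, i.dQuintic_smul_vel hq.1 _, ?_⟩, fun κ hκ => ?_⟩
  · rw [normalVel_eq, i.dLift_apply hb hq.1, one_smul]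
  · obtain ⟨c, v, rfl⟩ := i.exists_of_dQuintic hq.1 hκ
    have h := i.fsHom_normalVel hq v
    rw [i.dLift_apply hb hq.1, zero_smul, zero_add] at h
    rw [map_add, dDeform_radial hb t (i.nonVertex_param x), fsHom_add_right, fsHom_radial_right,
      zero_add]
    exact h

end ParamIndex

end QuinticSmoothing
end

noncomputable section

open Filter

namespace QuinticSmoothing

variable {b : ℝ → ℝ} {ε C t : ℝ}

/-! ### Tubular coordinates around the deformed curve -/

lemma fderiv_eq_of_line {E F : Type*} [NormedAddCommGroup E] [NormedSpace ℝ E]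
    [NormedAddCommGroup F] [NormedSpace ℝ F] {f : E → F} {a v : E} {f' : F}
    (hf : DifferentiableAt ℝ f a) (h : HasDerivAt (fun s : ℝ => f (a + s • v)) f' 0) :
    fderiv ℝ f a v = f' :=
  (hf.hasFDerivAt.hasLineDerivAt v).unique h

/-- The inclusion of `ℂ²` as the vectors with vanishing `k`-th coordinate. -/
def affIncl (k : Fin 3) (v : Fin 2 → ℂ) : V3 := k.insertNth (0 : ℂ) v

@[simp] lemma affIncl_same (k : Fin 3) (v : Fin 2 → ℂ) : affIncl k v k = 0 := by simp [affIncl]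

@[simp] lemma affIncl_succAbove (k : Fin 3) (v : Fin 2 → ℂ) (j : Fin 2) :
    affIncl k v (k.succAbove j) = v j := by simp [affIncl]

lemma affIncl_smul (k : Fin 3) (r : ℝ) (v : Fin 2 → ℂ) : affIncl k (r • v) = r • affIncl k v := by
  funext i
  rcases Fin.eq_self_or_eq_succAbove k i with rfl | ⟨j, rfl⟩ <;> simp

lemma contDiff_affIncl (k : Fin 3) : ContDiff ℝ ∞ (affIncl k) := by
  refine contDiff_pi.2 fun i => ?_
  rcases Fin.eq_self_or_eq_succAbove k i with rfl | ⟨j, rfl⟩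
  · simpa using contDiff_const
  · simpa using contDiff_apply ℝ ℂ j

lemma dAffOf_affIncl {k : Fin 3} {z : V3} (hz : z k ≠ 0) (v : Fin 2 → ℂ) :
    dAffOf k z (z k • affIncl k v) = v := by
  funext j
  rw [dAffOf_apply hz]
  simp only [Pi.smul_apply, affIncl_same, affIncl_succAbove, smul_eq_mul, mul_zero, sub_zero]
  field_simp

lemma fsHom_congr_dAffOf {k : Fin 3} {z : V3} (hz : z k ≠ 0) (u : V3) {v v' : V3}
    (h : dAffOf k z v = dAffOf k z v') : fsHom z u v = fsHom z u v' := by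
  rw [← fsCoord_affOf hz, h, fsCoord_affOf hz]

lemma dAffOf_smul {k : Fin 3} {z : V3} (hz : z k ≠ 0) {c : ℂ} (hc : c ≠ 0) (w : V3) :
    dAffOf k (c • z) w = dAffOf k z (c⁻¹ • w) := by
  funext j
  rw [dAffOf_apply hz, dAffOf_apply (by simpa using ⟨hc, hz⟩)]
  simp only [Pi.smul_apply, smul_eq_mul]
  field_simp

namespace ParamIndex

variable (i : ParamIndex)

lemma lift_unit_ne_zero (hb : IsTransition b ε) (q : ℝ × ℂ) : i.lift b q i.unitCoord ≠ 0 := by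
  intro h
  have := (deformVec_eq_zero_iff hb (i.nonVertex_param q.2) _).1 h
  rw [param_unit] at this
  exact one_ne_zero this

/-- The symplectic pairing of the normal velocity of the curve with the vectors of a linear
complement. -/
def pairing (b : ℝ → ℝ) (N : ℂ →L[ℝ] (Fin 2 → ℂ)) (q : ℝ × ℂ × ℂ) : ℝ :=
  fsHom (i.lift b (q.1, q.2.1)) (i.normalVel b (q.1, q.2.1))
    (i.lift b (q.1, q.2.1) i.unitCoord • affIncl i.unitCoord (N q.2.2))

variable {i} {N : ℂ →L[ℝ] (Fin 2 → ℂ)}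

lemma contDiffAt_comp_base {G : Type*} [NormedAddCommGroup G] [NormedSpace ℝ G] {f : ℝ × ℂ → G}
    {q : ℝ × ℂ × ℂ} (hf : ContDiffAt ℝ ∞ f (q.1, q.2.1)) :
    ContDiffAt ℝ ∞ (fun q : ℝ × ℂ × ℂ => f (q.1, q.2.1)) q :=
  ContDiffAt.comp (g := f) (f := fun q : ℝ × ℂ × ℂ => (q.1, q.2.1)) q hf
    (contDiff_fst.prodMk contDiff_snd.fst).contDiffAt

lemma contDiffAt_pairing (hb : IsTransition b ε) {q : ℝ × ℂ × ℂ} (hq : (q.1, q.2.1) ∈ i.regular b) :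
    ContDiffAt ℝ ∞ (i.pairing b N) q := by
  have h1 : ContDiffAt ℝ ∞ (fun q : ℝ × ℂ × ℂ => i.lift b (q.1, q.2.1)) q :=
    contDiffAt_comp_base (i.contDiffAt_lift hb hq.1)
  have h2 : ContDiffAt ℝ ∞ (fun q : ℝ × ℂ × ℂ => i.normalVel b (q.1, q.2.1)) q :=
    contDiffAt_comp_base (i.contDiffAt_normalVel hb hq)
  have h3 : ContDiffAt ℝ ∞ (fun q : ℝ × ℂ × ℂ => affIncl i.unitCoord (N q.2.2)) q :=
    ((contDiff_affIncl _).comp (N.contDiff.comp contDiff_snd.snd)).contDiffAt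
  have h4 : ContDiffAt ℝ ∞ (fun q : ℝ × ℂ × ℂ => i.lift b (q.1, q.2.1) i.unitCoord) q :=
    contDiffAt_pi.1 h1 _
  exact ContDiffAt.fsHom h1 h2 (h4.smul h3) (i.lift_ne_zero hb _)

lemma pairing_smul (t : ℝ) (x n : ℂ) (r : ℝ) :
    i.pairing b N (t, x, r • n) = r * i.pairing b N (t, x, n) := by
  simp only [pairing]
  rw [map_smul, affIncl_smul, smul_comm, fsHom_smul_right]

lemma pairing_zero (t : ℝ) (x : ℂ) : i.pairing b N (t, x, 0) = 0 := by
  simpa using pairing_smul (i := i) (b := b) (N := N) t x 0 0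

/-- The pairing vanishes for n = 0 and is linear in n, so on the curve its spatial derivative
ignores `v` and reproduces the pairing in `n`. -/
lemma fderiv_pairing (hb : IsTransition b ε) {x : ℂ} (hq : (t, x) ∈ i.regular b) (v n : ℂ) :
    fderiv ℝ (i.pairing b N) (t, x, 0) (0, v, n) = i.pairing b N (t, x, n) := by
  have hd : DifferentiableAt ℝ (i.pairing b N) (t, x, 0) :=
    (contDiffAt_pairing (q := (t, x, 0)) hb hq).differentiableAt (by simp)
  have e : ((0 : ℝ), v, n) = (0, v, 0) + (0, 0, n) := by simp
  have h1 : fderiv ℝ (i.pairing b N) (t, x, 0) (0, v, 0) = 0 := by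
    refine fderiv_eq_of_line hd ?_
    have : (fun s : ℝ => i.pairing b N ((t, x, (0 : ℂ)) + s • ((0 : ℝ), v, (0 : ℂ)))) = fun _ => 0 := by
      funext s
      have e : (t, x, (0 : ℂ)) + s • ((0 : ℝ), v, (0 : ℂ)) = (t, x + s • v, 0) := by simp
      rw [e, pairing_zero]
    rw [this]
    exact hasDerivAt_const _ _
  have h2 : fderiv ℝ (i.pairing b N) (t, x, 0) (0, 0, n) = i.pairing b N (t, x, n) := by
    refine fderiv_eq_of_line hd ?_
    have : (fun s : ℝ => i.pairing b N ((t, x, (0 : ℂ)) + s • ((0 : ℝ), (0 : ℂ), n))) =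
        fun s => s * i.pairing b N (t, x, n) := by
      funext s
      have e : (t, x, (0 : ℂ)) + s • ((0 : ℝ), (0 : ℂ), n) = (t, x, s • n) := by simp
      rw [e, pairing_smul]
    rw [this]
    simpa using (hasDerivAt_id (0 : ℝ)).mul_const (i.pairing b N (t, x, n))
  rw [e, map_add, h1, h2, zero_add]

/-- The affine coordinates of a neighborhood of the deformed curve. -/
def tubeMap (i : ParamIndex) (b : ℝ → ℝ) (N : ℂ →L[ℝ] (Fin 2 → ℂ)) (q : ℝ × ℂ × ℂ) :
    ℝ × (Fin 2 → ℂ) := (q.1, i.affDeform b i.unitCoord q.1 q.2.1 + N q.2.2)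

lemma contDiffAt_tubeMap (hb : IsTransition b ε) {q : ℝ × ℂ × ℂ} (hq : q.2.1 ∈ rootDomain) :
    ContDiffAt ℝ ∞ (i.tubeMap b N) q := by
  have h1 := i.contDiffAt_affDeform hb q.1 hq (i.lift_unit_ne_zero hb (q.1, q.2.1))
  have h2 : ContDiffAt ℝ ∞ (fun q : ℝ × ℂ × ℂ => i.affDeform b i.unitCoord q.1 q.2.1) q :=
    contDiffAt_comp_base (f := fun q : ℝ × ℂ => i.affDeform b i.unitCoord q.1 q.2) h1
  exact contDiffAt_fst.prodMk (h2.add (N.contDiff.comp contDiff_snd.snd).contDiffAt)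

lemma hasFDerivAt_tubeMap (hb : IsTransition b ε) {q : ℝ × ℂ × ℂ} (hq : q.2.1 ∈ rootDomain) :
    ∃ D : ℝ × ℂ × ℂ →L[ℝ] ℝ × (Fin 2 → ℂ), HasFDerivAt (i.tubeMap b N) D q ∧
      (∀ u, (D u).1 = u.1) ∧
      ∀ v n : ℂ, D (0, v, n) = (0, i.dAffDeform b i.unitCoord q.1 q.2.1 v + N n) := by
  have hk := i.lift_unit_ne_zero hb (q.1, q.2.1)
  have h1 : HasFDerivAt (fun q : ℝ × ℂ => i.affDeform b i.unitCoord q.1 q.2)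
      (fderiv ℝ (fun q : ℝ × ℂ => i.affDeform b i.unitCoord q.1 q.2) (q.1, q.2.1)) (q.1, q.2.1) :=
    ((i.contDiffAt_affDeform hb q.1 hq hk).differentiableAt (by simp)).hasFDerivAt
  obtain ⟨D₂, hD₂⟩ : ∃ D₂, D₂ =
    fderiv ℝ (fun q : ℝ × ℂ => i.affDeform b i.unitCoord q.1 q.2) (q.1, q.2.1) := ⟨_, rfl⟩
  rw [← hD₂] at h1
  have h2 : ∀ v, D₂ (0, v) = i.dAffDeform b i.unitCoord q.1 q.2.1 v := fun v => by
    have h3 : HasFDerivAt (fun x : ℂ => (q.1, x)) ((0 : ℂ →L[ℝ] ℝ).prod (.id ℝ ℂ)) q.2.1 :=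
      (hasFDerivAt_const q.1 q.2.1).prodMk (hasFDerivAt_id q.2.1)
    have h4 := HasFDerivAt.comp (g := fun q : ℝ × ℂ => i.affDeform b i.unitCoord q.1 q.2)
      (f := fun x : ℂ => (q.1, x)) q.2.1 h1 h3
    exact congrArg (fun A => A v) (h4.unique (i.hasFDerivAt_affDeform hb q.1 hq hk))
  obtain ⟨π, hπ⟩ : ∃ π : ℝ × ℂ × ℂ →L[ℝ] ℝ × ℂ, ∀ u, π u = (u.1, u.2.1) :=
    ⟨(ContinuousLinearMap.fst ℝ ℝ (ℂ × ℂ)).prod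
      ((ContinuousLinearMap.fst ℝ ℂ ℂ).comp (.snd ℝ ℝ (ℂ × ℂ))), fun _ => rfl⟩
  obtain ⟨κ, hκ⟩ : ∃ κ : ℝ × ℂ × ℂ →L[ℝ] ℂ, ∀ u, κ u = u.2.2 :=
    ⟨(ContinuousLinearMap.snd ℝ ℂ ℂ).comp (.snd ℝ ℝ (ℂ × ℂ)), fun _ => rfl⟩
  have h5 : HasFDerivAt (fun q : ℝ × ℂ × ℂ => i.affDeform b i.unitCoord (π q).1 (π q).2)
      (D₂.comp π) q :=
    HasFDerivAt.comp (g := fun q : ℝ × ℂ => i.affDeform b i.unitCoord q.1 q.2) (f := π) q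
      (by rw [hπ]; exact h1) π.hasFDerivAt
  have h6 : HasFDerivAt (fun q => N (κ q)) (N.comp κ) q := (N.comp κ).hasFDerivAt
  refine ⟨(ContinuousLinearMap.fst ℝ ℝ (ℂ × ℂ)).prod (D₂.comp π + N.comp κ), ?_, fun _ => rfl,
    fun v n => ?_⟩
  · refine (hasFDerivAt_fst.prodMk (h5.add h6)).congr_of_eventuallyEq (Eventually.of_forall ?_)
    intro q
    simp only [tubeMap, hπ, hκ]
    rfl
  · refine Prod.ext rfl ?_
    change D₂ (π (0, v, n)) + N (κ (0, v, n)) = _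
    rw [hπ, hκ, h2]

/-- The derivative of the tubular map preserves the time component and is bijective on each time
slice, so the inverse function theorem applies. -/
lemma exists_tube (hb : IsGood b ε C) (ht : t ∈ Icc (0 : ℝ) 1) {x : ℂ} (hx : x ∈ rootDomain)
    (hN : Function.Bijective fun q : ℂ × ℂ => i.dAffDeform b i.unitCoord t x q.1 + N q.2) :
    ∃ θ : OpenPartialHomeomorph (ℝ × ℂ × ℂ) (ℝ × (Fin 2 → ℂ)), (t, x, 0) ∈ θ.source ∧
      (∀ t x n, (t, x, n) ∈ θ.source → (t, x) ∈ i.regular b) ∧ ⇑θ = i.tubeMap b N ∧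
      ∀ y ∈ θ.target, ContDiffAt ℝ ∞ θ.symm y := by
  have hO : IsOpen {q : ℝ × ℂ × ℂ | (q.1, q.2.1) ∈ i.regular b} :=
    (i.isOpen_regular hb.tr).preimage (continuous_fst.prodMk continuous_snd.fst)
  obtain ⟨D, hD, h1, h2⟩ := hasFDerivAt_tubeMap (N := N) hb.tr (q := (t, x, 0)) hx
  have hbij : Function.Bijective D := by
    constructor
    · refine (injective_iff_map_eq_zero D).2 fun u hu => ?_
      obtain ⟨s, v, n⟩ := u
      have hs : s = 0 := (h1 (s, v, n)).symm.trans (by rw [hu]; rfl)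
      subst hs
      have h3 : i.dAffDeform b i.unitCoord t x v + N n = 0 :=
        congrArg Prod.snd ((h2 v n).symm.trans hu)
      have h4 : ((v, n) : ℂ × ℂ) = (0, 0) := hN.1 (by simpa using h3)
      rw [Prod.mk.injEq] at h4
      rw [h4.1, h4.2]
      rfl
    · rintro ⟨s, y⟩
      obtain ⟨⟨v, n⟩, h3⟩ := hN.2 (y - (D (s, 0, 0)).2)
      refine ⟨(s, 0, 0) + (0, v, n), ?_⟩
      rw [map_add, h2]
      refine Prod.ext ?_ ?_
      · simpa using h1 (s, 0, 0)
      · change (D (s, 0, 0)).2 + (i.dAffDeform b i.unitCoord t x v + N n) = y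
        rw [show i.dAffDeform b i.unitCoord t x v + N n = _ from h3]
        abel
  obtain ⟨e, he⟩ := bijective_clm_equiv hbij
  obtain ⟨θ, h3, h4, h5, -, h6⟩ := exists_localDiffeo hO (f := i.tubeMap b N)
    (fun q hq => contDiffAt_tubeMap hb.tr hq.1) (a := (t, x, 0)) (i.mem_regular hb ht hx) (f' := e)
    (by rw [he]; exact hD)
  exact ⟨θ, h3, fun t x n h => @h4 (t, x, n) h, h5, h6⟩

end ParamIndex

end QuinticSmoothing
end

noncomputable section

open Filter

namespace QuinticSmoothing

variable {b : ℝ → ℝ} {ε C t : ℝ}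

/-! ### Local Hamiltonian functions -/

/-- On `W`, the function `H` vanishes on the deformed curves and the coordinate lines, and there its
Hamiltonian vector field is the normal velocity of the curve and zero, respectively. -/
structure IsLocalHam (b : ℝ → ℝ) (W : Set (ℝ × CP2)) (H : ℝ × CP2 → ℝ) : Prop where
  smooth : ∀ q ∈ W, ContMDiffAt (𝓘(ℝ, ℝ).prod I4) 𝓘(ℝ, ℝ) ∞ H q
  zero_curve : ∀ t ∈ Icc (0 : ℝ) 1, ∀ z, z ≠ 0 → quinticPoly z = 0 →
    (t, toCP (deformVec b t z)) ∈ W → H (t, toCP (deformVec b t z)) = 0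
  deriv_curve : ∀ t ∈ Icc (0 : ℝ) 1, ∀ z V, z ≠ 0 → quinticPoly z = 0 → IsNormalVel b t z V →
    (t, toCP (deformVec b t z)) ∈ W → ∀ w,
      fderiv ℝ (fun y => H (t, toCP y)) (deformVec b t z) w = fsHom (deformVec b t z) V w
  zero_line : ∀ k t y, y ≠ 0 → y k = 0 → (t, toCP y) ∈ W → H (t, toCP y) = 0
  deriv_line : ∀ k t y, y ≠ 0 → y k = 0 → (t, toCP y) ∈ W → fderiv ℝ (fun y => H (t, toCP y)) y = 0

lemma apply_fderiv_symm {E G : Type*} [NormedAddCommGroup E] [NormedSpace ℝ E]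
    [NormedAddCommGroup G] [NormedSpace ℝ G] (θ : OpenPartialHomeomorph E G) {y : G}
    (hy : y ∈ θ.target) {D : E →L[ℝ] G} (hD : HasFDerivAt θ D (θ.symm y))
    (h : DifferentiableAt ℝ θ.symm y) (w : G) : D (fderiv ℝ θ.symm y w) = w := by
  have h1 : HasFDerivAt (θ ∘ θ.symm) (D.comp (fderiv ℝ θ.symm y)) y := hD.comp y h.hasFDerivAt
  have h2 : HasFDerivAt (θ ∘ θ.symm) (ContinuousLinearMap.id ℝ G) y := by
    refine (hasFDerivAt_id y).congr_of_eventuallyEq ?_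
    filter_upwards [θ.open_target.mem_nhds hy] with y hy using θ.right_inv hy
  exact congrArg (fun A => A w) (h1.unique h2)

namespace ParamIndex

variable {i : ParamIndex} {N : ℂ →L[ℝ] (Fin 2 → ℂ)}
  {θ : OpenPartialHomeomorph (ℝ × ℂ × ℂ) (ℝ × (Fin 2 → ℂ))}

/-- The local Hamiltonian function around the deformed curve. -/
def tubeHam (i : ParamIndex) (b : ℝ → ℝ) (N : ℂ →L[ℝ] (Fin 2 → ℂ))
    (θ : OpenPartialHomeomorph (ℝ × ℂ × ℂ) (ℝ × (Fin 2 → ℂ))) (q : ℝ × CP2) : ℝ :=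
  i.pairing b N (θ.symm (q.1, affCoord i.unitCoord q.2))

lemma contDiffAt_pairing_symm (hb : IsTransition b ε)
    (hθ : ∀ t x n, (t, x, n) ∈ θ.source → (t, x) ∈ i.regular b)
    (hθs : ∀ y ∈ θ.target, ContDiffAt ℝ ∞ θ.symm y) {y : ℝ × (Fin 2 → ℂ)} (hy : y ∈ θ.target) :
    ContDiffAt ℝ ∞ (fun y => i.pairing b N (θ.symm y)) y :=
  ContDiffAt.comp (g := i.pairing b N) (f := θ.symm) y
    (contDiffAt_pairing hb (hθ _ _ _ (θ.map_target hy))) (hθs y hy)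

lemma contMDiffAt_tubeHam (hb : IsTransition b ε)
    (hθ : ∀ t x n, (t, x, n) ∈ θ.source → (t, x) ∈ i.regular b)
    (hθs : ∀ y ∈ θ.target, ContDiffAt ℝ ∞ θ.symm y) {q : ℝ × CP2} (hq : q.2.rep i.unitCoord ≠ 0)
    (hy : (q.1, affCoord i.unitCoord q.2) ∈ θ.target) :
    ContMDiffAt (𝓘(ℝ, ℝ).prod I4) 𝓘(ℝ, ℝ) ∞ (i.tubeHam b N θ) q := by
  have h1 : ContMDiffAt (𝓘(ℝ, ℝ).prod I4) 𝓘(ℝ, ℝ × (Fin 2 → ℂ)) ∞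
      (fun q : ℝ × CP2 => (q.1, affCoord i.unitCoord q.2)) q :=
    ContMDiffAt.prodMk_space contMDiffAt_fst
      (ContMDiffAt.comp q (contMDiffAt_affCoord hq) contMDiffAt_snd)
  exact ContMDiffAt.comp (g := fun y => i.pairing b N (θ.symm y)) q
    (contDiffAt_pairing_symm hb hθ hθs hy).contMDiffAt h1

/-- The inverse of the tubular map splits a spatial vector into a part `v` along the parameter and a
part `m` along the complement, with no time component. -/
lemma fderiv_tubeHam (hb : IsTransition b ε) (hθm : ⇑θ = i.tubeMap b N)
    (hθ : ∀ t x n, (t, x, n) ∈ θ.source → (t, x) ∈ i.regular b)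
    (hθs : ∀ y ∈ θ.target, ContDiffAt ℝ ∞ θ.symm y) {t : ℝ} {y : V3} (hy : y i.unitCoord ≠ 0)
    {x n : ℂ} (hx : (t, x, n) ∈ θ.source) (hxy : i.tubeMap b N (t, x, n) = (t, affOf i.unitCoord y))
    (w : V3) : ∃ v m : ℂ, fderiv ℝ (fun y => i.tubeHam b N θ (t, toCP y)) y w =
        fderiv ℝ (i.pairing b N) (t, x, n) (0, v, m) ∧
      i.dAffDeform b i.unitCoord t x v + N m = dAffOf i.unitCoord y w := by
  have hxy' : θ (t, x, n) = (t, affOf i.unitCoord y) := by rw [hθm, hxy]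
  have hyt : (t, affOf i.unitCoord y) ∈ θ.target := hxy' ▸ θ.map_source hx
  have hsymm : θ.symm (t, affOf i.unitCoord y) = (t, x, n) := by rw [← hxy', θ.left_inv hx]
  have hds := (hθs _ hyt).differentiableAt (by simp)
  have hdp : DifferentiableAt ℝ (i.pairing b N) (θ.symm (t, affOf i.unitCoord y)) :=
    (contDiffAt_pairing hb (hθ _ _ _ (θ.map_target hyt))).differentiableAt (by simp)
  have ha : HasFDerivAt (fun y => (t, affOf i.unitCoord y))
      ((0 : V3 →L[ℝ] ℝ).prod (dAffOf i.unitCoord y)) y :=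
    (hasFDerivAt_const t y).prodMk
      (((contDiffAt_affOf hy).differentiableAt (by simp)).hasFDerivAt)
  have h1 : HasFDerivAt (fun y => i.pairing b N (θ.symm (t, affOf i.unitCoord y)))
      ((fderiv ℝ (i.pairing b N) (θ.symm (t, affOf i.unitCoord y))).comp
        ((fderiv ℝ θ.symm (t, affOf i.unitCoord y)).comp
          ((0 : V3 →L[ℝ] ℝ).prod (dAffOf i.unitCoord y)))) y :=
    HasFDerivAt.comp (g := i.pairing b N) (f := fun y => θ.symm (t, affOf i.unitCoord y)) y
      hdp.hasFDerivAt (HasFDerivAt.comp (g := θ.symm) (f := fun y => (t, affOf i.unitCoord y)) y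
        hds.hasFDerivAt ha)
  have hy0 : y ≠ 0 := fun h => hy (by rw [h]; rfl)
  have h2 : (fun y => i.tubeHam b N θ (t, toCP y)) =ᶠ[𝓝 y]
      fun y => i.pairing b N (θ.symm (t, affOf i.unitCoord y)) := by
    filter_upwards [isOpen_ne.mem_nhds hy0] with y hy
    rw [tubeHam, affCoord_toCP _ hy]
  obtain ⟨D, hD, hD1, hD2⟩ := hasFDerivAt_tubeMap (i := i) (N := N) hb (q := (t, x, n)) (hθ t x n hx).1
  obtain ⟨u, hu⟩ : ∃ u, u = fderiv ℝ θ.symm (t, affOf i.unitCoord y) (0, dAffOf i.unitCoord y w) :=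
    ⟨_, rfl⟩
  have h3 : D u = (0, dAffOf i.unitCoord y w) := by
    rw [hu]
    exact apply_fderiv_symm θ hyt (by rw [hsymm, hθm]; exact hD) hds _
  have h4 : u.1 = 0 := by rw [← hD1, h3]
  obtain ⟨s, v, m⟩ := u
  obtain rfl : s = 0 := h4
  refine ⟨v, m, ?_, ?_⟩
  · rw [(h1.congr_of_eventuallyEq h2).fderiv]
    change fderiv ℝ (i.pairing b N) (θ.symm (t, affOf i.unitCoord y))
      (fderiv ℝ θ.symm (t, affOf i.unitCoord y) (0, dAffOf i.unitCoord y w)) = _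
    rw [← hu, hsymm]
  · exact congrArg Prod.snd ((hD2 v m).symm.trans h3)

lemma deformVec_smul_param (b : ℝ → ℝ) (t : ℝ) {c : ℂ} (hc : c ≠ 0) (x : ℂ) :
    deformVec b t (c • i.param x) = (c * ((‖c‖ ^ t : ℝ) : ℂ)) • i.lift b (t, x) :=
  deformVec_smul' t hc _

lemma factor_ne_zero (t : ℝ) {c : ℂ} (hc : c ≠ 0) : c * ((‖c‖ ^ t : ℝ) : ℂ) ≠ 0 := by
  have : (0 : ℝ) < ‖c‖ ^ t := Real.rpow_pos_of_pos (norm_pos_iff.2 hc) t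
  exact mul_ne_zero hc (by exact_mod_cast this.ne')

lemma tubeMap_zero (t : ℝ) {c : ℂ} (hc : c ≠ 0) (x : ℂ) : i.tubeMap b N (t, x, 0) =
    (t, affOf i.unitCoord (deformVec b t (c • i.param x))) := by
  rw [deformVec_smul_param b t hc, affOf_smul _ (factor_ne_zero t hc), tubeMap, map_zero, add_zero]
  rfl

lemma tubeHam_curve (hb : IsTransition b ε) (hθm : ⇑θ = i.tubeMap b N) {t : ℝ} {c : ℂ} (hc : c ≠ 0)
    {x : ℂ} (hx : (t, x, 0) ∈ θ.source) :
    i.tubeHam b N θ (t, toCP (deformVec b t (c • i.param x))) = 0 := by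
  have h0 := (deformVec_nonVertex hb t ((i.nonVertex_param x).smul hc)).ne_zero
  rw [tubeHam, affCoord_toCP _ h0]
  change i.pairing b N (θ.symm (t, _)) = 0
  rw [← tubeMap_zero (N := N) t hc x, ← hθm, θ.left_inv hx, pairing_zero]

/-- The normal velocity is orthogonal to the curve, so its pairing with `w` sees only the
complementary part `N m`, and this is the derivative of `pairing`. The scale `c` of the homogeneous
coordinates drops out by invariance of the form. -/
lemma fderiv_tubeHam_curve (hb : IsGood b ε C) (hθm : ⇑θ = i.tubeMap b N)
    (hθ : ∀ t x n, (t, x, n) ∈ θ.source → (t, x) ∈ i.regular b)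
    (hθs : ∀ y ∈ θ.target, ContDiffAt ℝ ∞ θ.symm y) (ht : t ∈ Icc (0 : ℝ) 1) {c : ℂ} (hc : c ≠ 0)
    {x : ℂ} (hx : (t, x, 0) ∈ θ.source) {V : V3} (hV : IsNormalVel b t (c • i.param x) V) (w : V3) :
    fderiv ℝ (fun y => i.tubeHam b N θ (t, toCP y)) (deformVec b t (c • i.param x)) w =
      fsHom (deformVec b t (c • i.param x)) V w := by
  obtain ⟨c', hc'⟩ : ∃ c', c' = c * ((‖c‖ ^ t : ℝ) : ℂ) := ⟨_, rfl⟩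
  have hc0 : c' ≠ 0 := by rw [hc']; exact factor_ne_zero t hc
  have hF : deformVec b t (c • i.param x) = c' • i.lift b (t, x) := by
    rw [hc', deformVec_smul_param b t hc]
  have hk := i.lift_unit_ne_zero hb.tr (t, x)
  have hr := hθ t x 0 hx
  have hkF : deformVec b t (c • i.param x) i.unitCoord ≠ 0 := by
    rw [hF, Pi.smul_apply, smul_eq_mul]
    exact mul_ne_zero hc0 hk
  obtain ⟨v, m, h1, h2⟩ := fderiv_tubeHam hb.tr hθm hθ hθs hkF hx (tubeMap_zero t hc x) w
  have hP : quinticPoly (c • i.param x) = 0 := by rw [quinticPoly_smul, quinticPoly_param, mul_zero]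
  have hV' := (i.isNormalVel hb.tr hr).smul hb.tr (i.nonVertex_param x) hc
  rw [h1, fderiv_pairing hb.tr hr, hV.fsHom_eq hb ht (smul_ne_zero hc (i.param_ne_zero x)) hP hV' w,
    ← hc', hF]
  have h3 : (c' * Real.log ‖c‖) • deformVec b t (i.param x) =
    (Real.log ‖c‖ : ℂ) • (c' • i.lift b (t, x)) := by rw [smul_smul, mul_comm, lift]
  have h4 : w = c' • (c'⁻¹ • w) := by rw [smul_smul, mul_inv_cancel₀ hc0, one_smul]
  rw [h3, fsHom_add_left, fsHom_radial_left, add_zero, h4, fsHom_smul hc0]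
  have h5 : dAffOf i.unitCoord (i.lift b (t, x)) (c'⁻¹ • w) =
      dAffOf i.unitCoord (i.lift b (t, x)) (i.dLift b (t, x) (0, v) +
        i.lift b (t, x) i.unitCoord • affIncl i.unitCoord (N m)) := by
    rw [map_add, dAffOf_affIncl hk, i.dLift_zero_left hb.tr t hr.1, ← dAffOf_smul hk hc0, ← hF, ← h2,
      dAffDeform_apply, lift]
  rw [fsHom_congr_dAffOf hk _ h5, fsHom_add_right, i.fsHom_normalVel hr, zero_add, pairing]

end ParamIndex

end QuinticSmoothing
end

/-! ### Isolating one patch of the deformed family in space-time. -/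

noncomputable section

open Filter

namespace QuinticSmoothing

variable {b : ℝ → ℝ} {ε C t : ℝ}

lemma continuous_deform (hb : IsTransition b ε) :
    Continuous fun q : ℝ × fermatQuintic => deform b q.1 q.2 :=
  continuous_iff_continuousAt.2 fun q => (contMDiffAt_deform hb q.1 q.2).continuousAt

namespace ParamIndex

variable {i : ParamIndex} {N : ℂ →L[ℝ] (Fin 2 → ℂ)}

lemma deform_toCP_param (hb : IsTransition b ε) (t : ℝ) (x : ℂ) :
    deform b t (toCP (i.param x)) = toCP (i.lift b (t, x)) := deform_toCP hb t (i.nonVertex_param x)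

/-- Around a point of the deformed family there is a neighborhood meeting the family only in a
given patch of the parametrization. -/
lemma exists_isOpen_patch (hb : IsGood b ε C) (ht : t ∈ Icc (0 : ℝ) 1) {x : ℂ} (hx : x ∈ rootDomain)
    {O : Set (ℝ × ℂ)} (hO : IsOpen O) (hxO : (t, x) ∈ O) :
    ∃ W : Set (ℝ × CP2), IsOpen W ∧ (t, toCP (i.lift b (t, x))) ∈ W ∧
      ∀ t ∈ Icc (0 : ℝ) 1, ∀ z, z ≠ 0 → quinticPoly z = 0 → (t, toCP (deformVec b t z)) ∈ W →
        ∃ x c : ℂ, c ≠ 0 ∧ (t, x) ∈ O ∧ z = c • i.param x := by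
  obtain ⟨T, B, hT, hB, htT, hxB, hTB⟩ := isOpen_prod_iff.1 hO t x hxO
  obtain ⟨B', hB'⟩ : ∃ B' : Set fermatQuintic, B' = i.chart.source ∩ i.chart ⁻¹' B := ⟨_, rfl⟩
  have hB'o : IsOpen B' := hB' ▸ i.chart.isOpen_inter_preimage hB
  -- `K` is the trace of the family outside the patch. It is compact, and by injectivity it misses
  -- the given point, so its complement keeps other sheets of the curve away.
  obtain ⟨K, hK⟩ : ∃ K : Set (ℝ × CP2), K =
    (fun q : ℝ × fermatQuintic => (q.1, deform b q.1 q.2)) '' (Icc (0 : ℝ) 1 ×ˢ B'ᶜ) := ⟨_, rfl⟩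
  have hKc : IsClosed K := by
    rw [hK]
    exact ((isCompact_Icc.prod hB'o.isClosed_compl.isCompact).image
      (continuous_fst.prodMk (continuous_deform hb.tr))).isClosed
  refine ⟨Prod.fst ⁻¹' T ∩ Kᶜ, (hT.preimage continuous_fst).inter hKc.isOpen_compl, ⟨htT, ?_⟩, ?_⟩
  · rw [hK]
    rintro ⟨⟨s, p⟩, ⟨hs, hp⟩, h⟩
    rw [Prod.mk.injEq] at h
    obtain ⟨rfl, h⟩ := h
    rw [← deform_toCP_param hb.tr] at h
    have hpx : p.1 = toCP (i.param x) := hb.injOn ht p.2 (i.toCP_param_mem x) h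
    refine hp ?_
    rw [hB']
    refine ⟨?_, ?_⟩
    · change p.1 ∈ i.domain
      rw [hpx]
      exact i.toCP_param_mem_domain hx
    · change (i.ratios p.1).1 ∈ B
      rw [hpx, ratios_param]
      exact hxB
  · rintro s hs z hz hP ⟨hsT, hsK⟩
    have hzq := (mem_fermatQuintic hz).2 hP
    have h1 : (⟨toCP z, hzq⟩ : fermatQuintic) ∈ B' := by
      by_contra h
      refine hsK ?_
      rw [hK]
      refine ⟨(s, ⟨toCP z, hzq⟩), ⟨hs, h⟩, ?_⟩
      exact Prod.ext rfl (deform_toCP hb.tr s (nonVertex_of_quintic hz hP))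
    rw [hB'] at h1
    have h2 : toCP (i.param (i.ratios (toCP z)).1) = toCP z := i.toCP_param_ratios hzq h1.1
    obtain ⟨c, hc, h3⟩ := (toCP_eq_iff (i.param_ne_zero _) hz).1 h2
    exact ⟨(i.ratios (toCP z)).1, c, hc, hTB ⟨hsT, h1.2⟩, h3⟩

/-- The conditions on the coordinate lines are reduced to a hypothesis on `pairing`: it is vacuous
off the lines, and on a line it depends on a suitable choice of `N`. -/
lemma exists_tubeHam (hb : IsGood b ε C) (ht : t ∈ Icc (0 : ℝ) 1) {x : ℂ} (hx : x ∈ rootDomain)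
    (hN : Function.Bijective fun q : ℂ × ℂ => i.dAffDeform b i.unitCoord t x q.1 + N q.2)
    {U : Set CP2} (hU : IsOpen U) (hp : toCP (i.lift b (t, x)) ∈ U) :
    ∃ (W : Set (ℝ × CP2)) (H : ℝ × CP2 → ℝ), IsOpen W ∧ (t, toCP (i.lift b (t, x))) ∈ W ∧
      (∀ q ∈ W, q.2 ∈ U) ∧
      ((∀ k t y, y ≠ 0 → y k = 0 → (t, toCP y) ∈ W →
        (∀ x n, (t, x) ∈ i.regular b → affOf i.unitCoord y = i.affDeform b i.unitCoord t x + N n →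
          i.pairing b N (t, x, n) = 0 ∧
            ∀ v m, fderiv ℝ (i.pairing b N) (t, x, n) (0, v, m) = 0)) → IsLocalHam b W H) := by
  obtain ⟨θ, hxθ, hθ, hθm, hθs⟩ := exists_tube hb ht hx hN
  have hO : IsOpen {q : ℝ × ℂ | (q.1, q.2, (0 : ℂ)) ∈ θ.source} :=
    θ.open_source.preimage (continuous_fst.prodMk (continuous_snd.prodMk continuous_const))
  obtain ⟨W, hW, hxW, hcurve⟩ := exists_isOpen_patch (i := i) hb ht hx hO hxθ
  obtain ⟨W', hW'⟩ : ∃ W' : Set (ℝ × CP2), W' = {q | q.2.rep i.unitCoord ≠ 0 ∧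
    (q.1, affCoord i.unitCoord q.2) ∈ θ.target} := ⟨_, rfl⟩
  have hW'o : IsOpen W' := by
    rw [hW', isOpen_iff_mem_nhds]
    rintro q ⟨hq1, hq2⟩
    have h1 : ∀ᶠ q : ℝ × CP2 in 𝓝 q, q.2.rep i.unitCoord ≠ 0 :=
      continuous_snd.continuousAt.eventually ((isOpen_source _).mem_nhds hq1)
    have h2 : ContinuousAt (fun q : ℝ × CP2 => (q.1, affCoord i.unitCoord q.2)) q :=
      continuousAt_fst.prodMk (ContinuousAt.comp (f := Prod.snd) (g := affCoord i.unitCoord)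
        (contMDiffAt_affCoord hq1).continuousAt continuousAt_snd)
    filter_upwards [h1, h2.eventually (θ.open_target.mem_nhds hq2)] with q ha hb using ⟨ha, hb⟩
  have h0 : i.lift b (t, x) ≠ 0 := i.lift_ne_zero hb.tr _
  refine ⟨W ∩ W' ∩ Prod.snd ⁻¹' U, i.tubeHam b N θ,
    (hW.inter hW'o).inter (hU.preimage continuous_snd), ⟨⟨hxW, ?_⟩, hp⟩, fun q hq => hq.2, ?_⟩
  · rw [hW']
    refine ⟨(rep_toCP_ne_zero_iff h0 _).2 (i.lift_unit_ne_zero hb.tr _), ?_⟩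
    have h := θ.map_source hxθ
    rw [hθm, tubeMap_zero t one_ne_zero x, one_smul] at h
    rwa [affCoord_toCP _ h0]
  · intro hline
    have hmem : ∀ q ∈ W', q.2.rep i.unitCoord ≠ 0 ∧
        (q.1, affCoord i.unitCoord q.2) ∈ θ.target := fun q hq => by rwa [hW'] at hq
    have key : ∀ t y, y ≠ 0 → (t, toCP y) ∈ W' → ∃ x n, (t, x, n) ∈ θ.source ∧
        i.tubeMap b N (t, x, n) = (t, affOf i.unitCoord y) ∧ y i.unitCoord ≠ 0 ∧
        i.tubeHam b N θ (t, toCP y) = i.pairing b N (t, x, n) := by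
      intro t y hy hq
      obtain ⟨h1, h2⟩ := hmem _ hq
      have hyk := (rep_toCP_ne_zero_iff hy _).1 h1
      obtain ⟨⟨s, x, n⟩, hs⟩ : ∃ u, u = θ.symm (t, affCoord i.unitCoord (toCP y)) := ⟨_, rfl⟩
      have h3 : (s, x, n) ∈ θ.source := hs ▸ θ.map_target h2
      have h4 : i.tubeMap b N (s, x, n) = (t, affCoord i.unitCoord (toCP y)) := by
        rw [← hθm, hs]
        exact θ.right_inv h2
      have h5 : s = t := congrArg Prod.fst h4
      subst h5
      refine ⟨x, n, h3, ?_, hyk, ?_⟩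
      · rw [h4, affCoord_toCP _ hy]
      · rw [tubeHam, ← hs]
    constructor
    · rintro q ⟨⟨-, hq⟩, -⟩
      obtain ⟨h1, h2⟩ := hmem q hq
      exact contMDiffAt_tubeHam (i := i) (N := N) (θ := θ) (q := q) hb.tr hθ hθs h1 h2
    · rintro t ht z hz hP ⟨⟨hq, -⟩, -⟩
      obtain ⟨x, c, hc, hx, rfl⟩ := hcurve t ht z hz hP hq
      exact tubeHam_curve hb.tr hθm hc hx
    · rintro t ht z V hz hP hV ⟨⟨hq, -⟩, -⟩
      obtain ⟨x, c, hc, hx, rfl⟩ := hcurve t ht z hz hP hq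
      exact fderiv_tubeHam_curve hb hθm hθ hθs ht hc hx hV
    · rintro k t y hy hyk hq
      obtain ⟨x, n, h1, h2, -, h3⟩ := key t y hy hq.1.2
      rw [h3]
      exact (hline k t y hy hyk hq x n (hθ _ _ _ h1) (congrArg Prod.snd h2).symm).1
    · rintro k t y hy hyk hq
      obtain ⟨x, n, h1, h2, hyu, h3⟩ := key t y hy hq.1.2
      ext w
      obtain ⟨v, m, h4, -⟩ := fderiv_tubeHam hb.tr hθm hθ hθs hyu h1 h2 w
      rw [h4, (hline k t y hy hyk hq x n (hθ _ _ _ h1) (congrArg Prod.snd h2).symm).2]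
      rfl

end ParamIndex

end QuinticSmoothing
end

noncomputable section

open Filter

namespace QuinticSmoothing

variable {b : ℝ → ℝ} {ε C t : ℝ}

/-! ### The deformed curve near the coordinate lines -/

lemma zero_mem_rootDomain : (0 : ℂ) ∈ rootDomain := by simp [rootDomain]

lemma root5_zero : root5 0 = 1 := by simp [root5]

/-- The logarithm of `|1 + x⁵|^{1/5}`. -/
def logRoot (x : ℂ) : ℝ := Real.log ‖root5 x‖

lemma logRoot_zero : logRoot 0 = 0 := by simp [logRoot, root5_zero]

lemma logRoot_eq (x : ℂ) : logRoot x = Real.log ‖1 + x ^ 5‖ / 5 := by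
  rw [logRoot, ← root5_pow, norm_pow, Real.log_pow]
  push_cast
  ring

lemma contDiffAt_logRoot {x : ℂ} (hx : x ∈ rootDomain) : ContDiffAt ℝ ∞ logRoot x := by
  have h := (contDiffAt_root5 hx).norm ℝ (root5_ne_zero hx)
  exact h.log (norm_ne_zero_iff.2 (root5_ne_zero hx))

/-- The function is log|1 + x⁵| / 5, of order x⁵; only its vanishing to first order is needed. -/
lemma hasDerivAt_logRoot (v : ℂ) : HasDerivAt (fun s : ℝ => logRoot (s • v)) 0 0 := by
  have h1 : HasDerivAt (fun s : ℝ => s • v) v 0 := by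
    simpa using (hasDerivAt_id (0 : ℝ)).smul_const v
  have h2 : HasDerivAt (fun s : ℝ => 1 + (s • v) ^ 5) 0 0 := by
    simpa using (h1.fun_pow 5).const_add 1
  have h3 := (hasDerivAt_log_norm h2 (by simp)).div_const 5
  simp only [logRoot_eq]
  simpa using h3

lemma deformVel_apply (hb : IsTransition b ε) (t : ℝ) {z : V3} (hz : NonVertex z) (j : Fin 3) :
    deformVel b t z j = (Real.log (deformFactor b z j) : ℂ) * deformVec b t z j := by
  have h1 := hasDerivAt_pi.1 (hasDerivAt_deformVec_time hb t hz) j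
  have h2 := (Real.hasStrictDerivAt_const_rpow (deformFactor_pos (b := b) hz j) t).hasDerivAt
  have h3 := h2.ofReal_comp.const_mul (z j)
  have h4 : (fun s => deformVec b s z j) = fun s => z j * ((deformFactor b z j ^ s : ℝ) : ℂ) :=
    funext fun s => deformVec_apply hb s z j
  rw [h4] at h1
  refine (h1.unique h3).trans ?_
  rw [deformVec_apply hb]
  push_cast
  ring

namespace ParamIndex

variable (i : ParamIndex)

lemma norm_root : ‖(i.2 : ℂ)‖ = 1 := by
  have h : ‖(i.2 : ℂ)‖ ^ 5 = 1 := by rw [← norm_pow, i.2.2, norm_neg, norm_one]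
  exact (pow_eq_one_iff_of_nonneg (norm_nonneg _) (by norm_num)).1 h

/-- Near the coordinate line the velocity of the deformation is `logRoot x` times this vector. -/
def scaledVel (b : ℝ → ℝ) (q : ℝ × ℂ) : V3 :=
  fun j => (((![1, 0, b (logRoot q.2)] : Fin 3 → ℝ) (i.1 j) : ℝ) : ℂ) * i.lift b q j

variable {i}

lemma contDiffAt_scaledVel (hb : IsTransition b ε) {q : ℝ × ℂ} (hq : q.2 ∈ rootDomain) :
    ContDiffAt ℝ ∞ (i.scaledVel b) q := by
  refine contDiffAt_pi.2 fun j => ?_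
  have h1 : ContDiffAt ℝ ∞ (fun q : ℝ × ℂ => b (logRoot q.2)) q :=
    ContDiffAt.comp (g := b) (f := fun q : ℝ × ℂ => logRoot q.2) q hb.smooth.contDiffAt
      (ContDiffAt.comp (g := logRoot) (f := fun q : ℝ × ℂ => q.2) q (contDiffAt_logRoot hq)
        contDiffAt_snd)
  have h2 : ContDiffAt ℝ ∞ (fun q : ℝ × ℂ =>
      ((![1, 0, b (logRoot q.2)] : Fin 3 → ℝ) (i.1 j) : ℝ)) q := by
    generalize i.1 j = m
    fin_cases m
    · exact contDiffAt_const
    · exact contDiffAt_const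
    · exact h1
  have h3 : ContDiffAt ℝ ∞ (fun q : ℝ × ℂ =>
      ((((![1, 0, b (logRoot q.2)] : Fin 3 → ℝ) (i.1 j) : ℝ)) : ℂ)) q :=
    ContDiffAt.comp (g := fun r : ℝ => (r : ℂ)) q Complex.ofRealCLM.contDiff.contDiffAt h2
  exact h3.mul (contDiffAt_pi.1 (i.contDiffAt_lift hb hq) j)

/-- For small x the free coordinate loses against the other two, so the three factors are |root5 x|,
1, and the smoothed maximum of 1 and |root5 x|. Their logarithms are all multiples of `logRoot x`.
-/
lemma log_deformFactor_param (hb : IsTransition b ε) {x : ℂ} (hx : x ∈ rootDomain)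
    (h1 : ‖x‖ ≤ ‖root5 x‖ * Real.exp (-ε)) (h2 : ‖x‖ ≤ Real.exp (-ε)) (j : Fin 3) :
    Real.log (deformFactor b (i.param x) j) =
      logRoot x * (![1, 0, b (logRoot x)] : Fin 3 → ℝ) (i.1 j) := by
  have hr : 0 < ‖root5 x‖ := norm_pos_iff.2 (root5_ne_zero hx)
  have hn : ‖(i.2 : ℂ) * root5 x‖ = ‖root5 x‖ := by rw [norm_mul, norm_root, one_mul]
  rw [param, deformFactor_comp_perm hb]
  generalize i.1 j = m
  fin_cases m
  · change Real.log (softMax b ‖(i.2 : ℂ) * root5 x‖ ‖x‖) = logRoot x * 1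
    rw [hn, softMax_of_small_right hb hr (norm_nonneg _) h1, mul_one, logRoot]
  · change Real.log (softMax b ‖x‖ ‖(1 : ℂ)‖) = logRoot x * 0
    rw [norm_one, softMax_of_small_left hb (norm_nonneg _) one_pos (by rwa [one_mul]), Real.log_one,
      mul_zero]
  · change Real.log (softMax b ‖(1 : ℂ)‖ ‖(i.2 : ℂ) * root5 x‖) = logRoot x * b (logRoot x)
    rw [hn, norm_one, softMax_eq_exp b one_pos hr, Real.log_exp, logSoftMax, Real.log_one, zero_add,
      sub_zero, logRoot]

lemma eventually_dLift_eq (hb : IsTransition b ε) :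
    ∀ᶠ x in 𝓝 (0 : ℂ), ∀ t, i.dLift b (t, x) (1, 0) = logRoot x • i.scaledVel b (t, x) := by
  have hc : ContinuousAt (fun x => ‖root5 x‖ * Real.exp (-ε)) 0 :=
    (contDiffAt_root5 zero_mem_rootDomain).continuousAt.norm.mul continuousAt_const
  have h1 : ∀ᶠ x in 𝓝 (0 : ℂ), ‖x‖ < ‖root5 x‖ * Real.exp (-ε) :=
    continuous_norm.continuousAt.eventually_lt hc (by simp [root5_zero, Real.exp_pos])
  have h2 : ∀ᶠ x in 𝓝 (0 : ℂ), ‖x‖ < Real.exp (-ε) :=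
    continuous_norm.continuousAt.eventually_lt continuousAt_const (by simp [Real.exp_pos])
  filter_upwards [h1, h2, isOpen_rootDomain.mem_nhds zero_mem_rootDomain] with x h1 h2 hx t
  rw [i.dLift_apply hb (q := (t, x)) hx, zero_smul, map_zero, add_zero, one_smul]
  funext j
  rw [deformVel_apply hb t (i.nonVertex_param x), log_deformFactor_param hb hx h1.le h2.le,
    Pi.smul_apply, scaledVel, lift, Complex.real_smul]
  push_cast
  ring

variable {N : ℂ →L[ℝ] (Fin 2 → ℂ)}

/-- The function `pairing` divided by `logRoot`. -/
def scaledPairing (i : ParamIndex) (b : ℝ → ℝ) (N : ℂ →L[ℝ] (Fin 2 → ℂ)) (q : ℝ × ℂ × ℂ) : ℝ :=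
  fsHom (i.lift b (q.1, q.2.1)) (symNormal (i.lift b (q.1, q.2.1)) (i.dLift b (q.1, q.2.1) (0, 1))
    (i.dLift b (q.1, q.2.1) (0, Complex.I)) (i.scaledVel b (q.1, q.2.1)))
    (i.lift b (q.1, q.2.1) i.unitCoord • affIncl i.unitCoord (N q.2.2))

lemma contDiffAt_symNormal_scaledVel (hb : IsTransition b ε) {q : ℝ × ℂ} (hq : q ∈ i.regular b) :
    ContDiffAt ℝ ∞ (fun q => symNormal (i.lift b q) (i.dLift b q (0, 1))
      (i.dLift b q (0, Complex.I)) (i.scaledVel b q)) q :=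
  ContDiffAt.symNormal (i.contDiffAt_lift hb hq.1) (i.contDiffAt_dLift hb hq.1 _)
    (i.contDiffAt_dLift hb hq.1 _) (contDiffAt_scaledVel hb hq.1) (i.lift_ne_zero hb q) hq.2

lemma contDiffAt_scaledPairing (hb : IsTransition b ε) {q : ℝ × ℂ × ℂ}
    (hq : (q.1, q.2.1) ∈ i.regular b) : ContDiffAt ℝ ∞ (i.scaledPairing b N) q := by
  have h1 : ContDiffAt ℝ ∞ (fun q : ℝ × ℂ × ℂ => i.lift b (q.1, q.2.1)) q :=
    contDiffAt_comp_base (i.contDiffAt_lift hb hq.1)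
  have h2 := contDiffAt_comp_base (contDiffAt_symNormal_scaledVel hb hq)
  have h3 : ContDiffAt ℝ ∞ (fun q : ℝ × ℂ × ℂ => affIncl i.unitCoord (N q.2.2)) q :=
    ((contDiff_affIncl _).comp (N.contDiff.comp contDiff_snd.snd)).contDiffAt
  have h4 : ContDiffAt ℝ ∞ (fun q : ℝ × ℂ × ℂ => i.lift b (q.1, q.2.1) i.unitCoord) q :=
    contDiffAt_pi.1 h1 _
  exact ContDiffAt.fsHom h1 h2 (h4.smul h3) (i.lift_ne_zero hb _)

lemma eventually_pairing_eq (hb : IsTransition b ε) : ∀ᶠ x in 𝓝 (0 : ℂ), ∀ t n,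
    i.pairing b N (t, x, n) = logRoot x * i.scaledPairing b N (t, x, n) := by
  filter_upwards [eventually_dLift_eq (i := i) hb] with x hx t n
  rw [pairing, normalVel, hx, symNormal_smul, fsHom_smul_left, scaledPairing]

lemma pairing_axis (hb : IsTransition b ε) (t : ℝ) (n : ℂ) : i.pairing b N (t, 0, n) = 0 := by
  rw [(eventually_pairing_eq hb).self_of_nhds, logRoot_zero, zero_mul]

/-- Near x = 0 the pairing is `logRoot` times a smooth function, and `logRoot` vanishes at 0
together with its derivative. This is what makes the flow fix the coordinate line pointwise. -/
lemma fderiv_pairing_axis (hb : IsTransition b ε) (ht : (t, 0) ∈ i.regular b) (n v m : ℂ) :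
    fderiv ℝ (i.pairing b N) (t, 0, n) (0, v, m) = 0 := by
  refine fderiv_eq_of_line ((contDiffAt_pairing (q := (t, 0, n)) hb ht).differentiableAt (by simp)) ?_
  have e : ∀ s : ℝ, (t, (0 : ℂ), n) + s • ((0 : ℝ), v, m) = (t, s • v, n + s • m) := fun s => by simp
  have h1 : HasDerivAt (fun s : ℝ => s • v) v 0 := by
    simpa using (hasDerivAt_id (0 : ℝ)).smul_const v
  have h0 : Tendsto (fun s : ℝ => s • v) (𝓝 0) (𝓝 0) := by simpa using h1.continuousAt.tendsto
  have h2 : ∀ᶠ s in 𝓝 (0 : ℝ), ∀ t n,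
      i.pairing b N (t, s • v, n) = logRoot (s • v) * i.scaledPairing b N (t, s • v, n) :=
    h0.eventually (eventually_pairing_eq hb)
  have h3 := ((contDiffAt_scaledPairing (N := N) (q := (t, 0, n)) hb ht).differentiableAt
    (by simp)).hasFDerivAt.hasLineDerivAt (0, v, m)
  have h4 := (hasDerivAt_logRoot v).mul h3
  rw [zero_smul ℝ v, logRoot_zero, zero_mul, zero_mul, add_zero] at h4
  refine h4.congr_of_eventuallyEq ?_
  filter_upwards [h2] with s hs
  rw [Pi.mul_apply, e, hs]

/-- The free coordinate vanishes at x = 0, so the derivative of its factor drops out of the product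
rule. -/
lemma dDeform_param_zero (hb : IsTransition b ε) (t : ℝ) (v : ℂ) :
    dDeform b t (i.param 0) (v • i.vel 0) i.freeCoord =
      v * ((deformFactor b (i.param 0) i.freeCoord ^ t : ℝ) : ℂ) := by
  have hnv := i.nonVertex_param 0
  have h1 := (hasFDerivAt_deformVec hb t hnv).hasLineDerivAt (v • i.vel 0)
  have h2 := hasDerivAt_pi.1 h1 i.freeCoord
  have h3 := ((contDiffAt_deformFactor hb hnv i.freeCoord).differentiableAt
    (by simp)).hasFDerivAt.hasLineDerivAt (v • i.vel 0)
  have hpos : 0 < deformFactor b (i.param 0 + (0 : ℝ) • v • i.vel 0) i.freeCoord := by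
    rw [zero_smul, add_zero]
    exact deformFactor_pos hnv _
  have h4 := (HasDerivAt.rpow_const (p := t) h3 (Or.inl hpos.ne')).ofReal_comp
  have h5 : HasDerivAt (fun s : ℝ => s • v) v 0 := by
    simpa using (hasDerivAt_id (0 : ℝ)).smul_const v
  have h6 := h5.mul h4
  rw [zero_smul, add_zero, zero_smul, zero_mul, add_zero] at h6
  refine h2.unique (h6.congr_of_eventuallyEq (Eventually.of_forall fun s => ?_))
  simp only [Pi.mul_apply]
  rw [deformVec_apply hb]
  simp [param_free, vel_free i zero_mem_rootDomain]

/-- The deformed curve crosses the line transversally, which leaves the direction of the line free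
to serve as the complement `N`. -/
lemma dAffDeform_axis (hb : IsTransition b ε) (t : ℝ) {j : Fin 2}
    (hj : i.unitCoord.succAbove j = i.freeCoord) : ∃ r : ℂ, r ≠ 0 ∧
      ∀ v, i.dAffDeform b i.unitCoord t 0 v j = v * r := by
  have hk : deformVec b t (i.param 0) i.unitCoord ≠ 0 := i.lift_unit_ne_zero hb (t, 0)
  have h0 : deformVec b t (i.param 0) i.freeCoord = 0 :=
    (deformVec_eq_zero_iff hb (i.nonVertex_param 0) _).2 (i.param_free 0)
  have hr : ((deformFactor b (i.param 0) i.freeCoord ^ t : ℝ) : ℂ) ≠ 0 := by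
    exact_mod_cast (Real.rpow_pos_of_pos (deformFactor_pos (i.nonVertex_param 0) _) t).ne'
  refine ⟨_, div_ne_zero hr hk, fun v => ?_⟩
  rw [dAffDeform_apply, dAffOf_apply hk, hj, h0, dDeform_param_zero hb]
  field_simp
  ring

end ParamIndex

end QuinticSmoothing
end

/-! ### Existence of local Hamiltonian functions. -/

noncomputable section

open Filter

namespace QuinticSmoothing

variable {b : ℝ → ℝ} {ε C t : ℝ}

namespace ParamIndex

variable {i : ParamIndex}

lemma rootCoord_ne_unitCoord : i.rootCoord ≠ i.unitCoord := by simp [rootCoord, unitCoord]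

lemma freeCoord_ne_unitCoord : i.freeCoord ≠ i.unitCoord := by simp [freeCoord, unitCoord]

lemma freeCoord_ne_rootCoord : i.freeCoord ≠ i.rootCoord := by simp [freeCoord, rootCoord]

lemma coord_cases (k : Fin 3) : k = i.unitCoord ∨ k = i.rootCoord ∨ k = i.freeCoord := by
  obtain ⟨m, rfl⟩ := i.1.symm.surjective k
  fin_cases m
  · exact Or.inl rfl
  · exact Or.inr (Or.inl rfl)
  · exact Or.inr (Or.inr rfl)

/-- Local Hamiltonian functions around the points of the curve on no coordinate line. -/
lemma exists_localHam_of_ne_zero (hb : IsGood b ε C) (ht : t ∈ Icc (0 : ℝ) 1) {x : ℂ}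
    (hx : x ∈ rootDomain) (hx0 : x ≠ 0) {U : Set CP2} (hU : IsOpen U)
    (hp : toCP (i.lift b (t, x)) ∈ U) :
    ∃ (W : Set (ℝ × CP2)) (H : ℝ × CP2 → ℝ), IsOpen W ∧ (t, toCP (i.lift b (t, x))) ∈ W ∧
      (∀ q ∈ W, q.2 ∈ U) ∧ IsLocalHam b W H := by
  obtain ⟨N, hN⟩ := exists_complement (hb.dAffDeform_injective ht i hx
    (i.lift_unit_ne_zero hb.tr (t, x)))
  have h0 := i.lift_ne_zero hb.tr (t, x)
  have hne : ∀ k, (toCP (i.lift b (t, x))).rep k ≠ 0 := fun k => by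
    rw [rep_toCP_ne_zero_iff h0, lift, Ne, deformVec_eq_zero_iff hb.tr (i.nonVertex_param x)]
    rcases i.coord_cases k with rfl | rfl | rfl
    · rw [param_unit]
      exact one_ne_zero
    · rw [param_root]
      exact mul_ne_zero i.root_ne_zero (root5_ne_zero hx)
    · rwa [param_free]
  -- Away from the three lines the conditions on them are vacuous, and any complement will do.
  have hO : IsOpen (⋂ k : Fin 3, {p : CP2 | p.rep k ≠ 0}) :=
    isOpen_iInter_of_finite fun k => isOpen_source k
  obtain ⟨W, H, hW, hm, hWU, hH⟩ := exists_tubeHam hb ht hx hN (hU.inter hO)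
    ⟨hp, mem_iInter.2 hne⟩
  refine ⟨W, H, hW, hm, fun q hq => (hWU q hq).1, hH fun k s y hy hyk hq => ?_⟩
  exact absurd hyk ((rep_toCP_ne_zero_iff hy k).1 (mem_iInter.1 (hWU _ hq).2 k))

lemma affDeform_free_eq_zero (hb : IsTransition b ε) {x : ℂ} {j : Fin 2}
    (hj : i.unitCoord.succAbove j = i.freeCoord) (h : i.affDeform b i.unitCoord t x j = 0) :
    x = 0 := by
  rw [affDeform, affOf, div_eq_zero_iff, hj,
    deformVec_eq_zero_iff hb (i.nonVertex_param x), param_free] at h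
  exact h.resolve_right (i.lift_unit_ne_zero hb (t, x))

/-- Local Hamiltonian functions around the points of the curve on a coordinate line. -/
lemma exists_localHam_of_eq_zero (hb : IsGood b ε C) (ht : t ∈ Icc (0 : ℝ) 1) {U : Set CP2}
    (hU : IsOpen U) (hp : toCP (i.lift b (t, 0)) ∈ U) :
    ∃ (W : Set (ℝ × CP2)) (H : ℝ × CP2 → ℝ), IsOpen W ∧ (t, toCP (i.lift b (t, 0))) ∈ W ∧
      (∀ q ∈ W, q.2 ∈ U) ∧ IsLocalHam b W H := by
  obtain ⟨j₀, hj₀⟩ := Fin.exists_succAbove_eq (freeCoord_ne_unitCoord (i := i))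
  obtain ⟨j₁, hj₁⟩ := Fin.exists_succAbove_eq (rootCoord_ne_unitCoord (i := i))
  have hj : j₀ ≠ j₁ := by
    rintro rfl
    exact freeCoord_ne_rootCoord (hj₀.symm.trans hj₁)
  have hcases : ∀ j : Fin 2, j = j₀ ∨ j = j₁ := by omega
  -- `N` points along the coordinate line, so that in tubular coordinates the line is exactly {x =
  -- 0}.
  obtain ⟨N, hN₀, hN₁⟩ : ∃ N : ℂ →L[ℝ] (Fin 2 → ℂ), (∀ n, N n j₀ = 0) ∧ ∀ n, N n j₁ = n :=
    ⟨ContinuousLinearMap.single ℝ (fun _ : Fin 2 => ℂ) j₁, fun n => by simp [hj], fun n => by simp⟩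
  obtain ⟨r, hr, hA⟩ := dAffDeform_axis (i := i) hb.tr t hj₀
  have hN : Function.Bijective fun q : ℂ × ℂ => i.dAffDeform b i.unitCoord t 0 q.1 + N q.2 := by
    constructor
    · rintro ⟨v, n⟩ ⟨v', n'⟩ h
      have h0 := congrFun h j₀
      have h1 := congrFun h j₁
      simp only [Pi.add_apply, hN₀, hN₁, hA, add_zero] at h0 h1
      obtain rfl := mul_right_cancel₀ hr h0
      rw [add_left_cancel h1]
    · intro y
      refine ⟨(y j₀ / r, y j₁ - i.dAffDeform b i.unitCoord t 0 (y j₀ / r) j₁), ?_⟩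
      funext j
      rcases hcases j with rfl | rfl
      · simp only [Pi.add_apply, hN₀, hA, add_zero]
        exact div_mul_cancel₀ _ hr
      · simp only [Pi.add_apply, hN₁]
        ring
  have h0 := i.lift_ne_zero hb.tr (t, 0)
  have hne : (toCP (i.lift b (t, 0))).rep i.unitCoord ≠ 0 ∧
      (toCP (i.lift b (t, 0))).rep i.rootCoord ≠ 0 := by
    rw [rep_toCP_ne_zero_iff h0, rep_toCP_ne_zero_iff h0]
    refine ⟨i.lift_unit_ne_zero hb.tr _, ?_⟩
    rw [lift, Ne, deformVec_eq_zero_iff hb.tr (i.nonVertex_param 0), param_root]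
    exact mul_ne_zero i.root_ne_zero (root5_ne_zero zero_mem_rootDomain)
  obtain ⟨W, H, hW, hm, hWU, hH⟩ := exists_tubeHam hb ht zero_mem_rootDomain hN
    (hU.inter ((isOpen_source i.unitCoord).inter (isOpen_source i.rootCoord))) ⟨hp, hne⟩
  refine ⟨W, H, hW, hm, fun q hq => (hWU q hq).1, hH fun k s y hy hyk hq x n hx hxy => ?_⟩
  have h1 := (rep_toCP_ne_zero_iff hy _).1 (hWU _ hq).2.1
  have h2 := (rep_toCP_ne_zero_iff hy _).1 (hWU _ hq).2.2
  have hk : k = i.freeCoord := by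
    rcases i.coord_cases k with rfl | rfl | rfl
    · exact absurd hyk h1
    · exact absurd hyk h2
    · rfl
  subst hk
  have hx0 : x = 0 := by
    have h3 := congrFun hxy j₀
    rw [Pi.add_apply, hN₀, add_zero, affOf, hj₀, hyk, zero_div] at h3
    exact affDeform_free_eq_zero hb.tr hj₀ h3.symm
  subst hx0
  exact ⟨pairing_axis hb.tr s n, fderiv_pairing_axis hb.tr hx n⟩

end ParamIndex

lemma isLocalHam_zero {W : Set (ℝ × CP2)}
    (hW : ∀ t ∈ Icc (0 : ℝ) 1, ∀ z, z ≠ 0 → quinticPoly z = 0 →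
      (t, toCP (deformVec b t z)) ∉ W) : IsLocalHam b W 0 where
  smooth _ _ := contMDiffAt_const
  zero_curve _ _ _ _ _ _ := rfl
  deriv_curve t ht z _ hz hP _ h := absurd h (hW t ht z hz hP)
  zero_line _ _ _ _ _ _ := rfl
  deriv_line _ _ y _ _ _ := (hasFDerivAt_const (0 : ℝ) y).fderiv

/-- Every point of `[0, 1] × CP²` has a neighborhood with a local Hamiltonian function. -/
lemma exists_localHam (hb : IsGood b ε C) {U : Set CP2} (hU : IsOpen U)
    (hSU : ∀ t ∈ Icc (0 : ℝ) 1, smoothedFamily b t ⊆ U) (ht : t ∈ Icc (0 : ℝ) 1) (p : CP2) :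
    ∃ (W : Set (ℝ × CP2)) (H : ℝ × CP2 → ℝ), IsOpen W ∧ (t, p) ∈ W ∧ IsLocalHam b W H ∧
      ((∀ q ∈ W, q.2 ∈ U) ∨ H = 0) := by
  by_cases hp : p ∈ smoothedFamily b t
  · obtain ⟨p', hp', rfl⟩ := hp
    obtain ⟨i, x, a, hx, ha, hz⟩ := exists_param p'.rep_nonzero hp'
    have h1 : p' = toCP (i.param x) := by
      rw [← toCP_rep p', hz, toCP_smul ha (i.param_ne_zero x)]
    rw [h1, ParamIndex.deform_toCP_param hb.tr]
    have hpU : toCP (i.lift b (t, x)) ∈ U := by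
      rw [← ParamIndex.deform_toCP_param hb.tr, ← h1]
      exact hSU t ht ⟨p', hp', rfl⟩
    by_cases hx0 : x = 0
    · subst hx0
      obtain ⟨W, H, h2, h3, h4, h5⟩ := ParamIndex.exists_localHam_of_eq_zero hb ht hU hpU
      exact ⟨W, H, h2, h3, h5, Or.inl h4⟩
    · obtain ⟨W, H, h2, h3, h4, h5⟩ := ParamIndex.exists_localHam_of_ne_zero hb ht hx hx0 hU hpU
      exact ⟨W, H, h2, h3, h5, Or.inl h4⟩
  · obtain ⟨K, hK⟩ : ∃ K : Set (ℝ × CP2), K =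
      (fun q : ℝ × fermatQuintic => (q.1, deform b q.1 q.2)) '' (Icc (0 : ℝ) 1 ×ˢ univ) := ⟨_, rfl⟩
    have hKc : IsClosed K := by
      rw [hK]
      exact ((isCompact_Icc.prod isCompact_univ).image
        (continuous_fst.prodMk (continuous_deform hb.tr))).isClosed
    refine ⟨Kᶜ, 0, hKc.isOpen_compl, ?_, isLocalHam_zero fun s hs z hz hP h => h ?_, Or.inr rfl⟩
    · rw [hK]
      rintro ⟨⟨s, p'⟩, -, h⟩
      rw [Prod.mk.injEq] at h
      obtain ⟨rfl, rfl⟩ := h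
      exact hp ⟨p', p'.2, rfl⟩
    · rw [hK]
      exact ⟨(s, ⟨toCP z, (mem_fermatQuintic hz).2 hP⟩), ⟨hs, mem_univ _⟩,
        Prod.ext rfl (deform_toCP hb.tr s (nonVertex_of_quintic hz hP))⟩

end QuinticSmoothing
end

noncomputable section

open Filter

namespace QuinticSmoothing

variable {b : ℝ → ℝ} {ε C t : ℝ}

/-! ### The global Hamiltonian function -/

lemma ContMDiffAt.contDiffAt_toCP {f : ℝ × CP2 → ℝ} {y : V3} (hy : y ≠ 0)
    (hf : ContMDiffAt (𝓘(ℝ, ℝ).prod I4) 𝓘(ℝ, ℝ) ∞ f (t, toCP y)) :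
    ContDiffAt ℝ ∞ (fun y => f (t, toCP y)) y := by
  have h1 : ContMDiffAt 𝓘(ℝ, V3) (𝓘(ℝ, ℝ).prod I4) ∞ (fun y => (t, toCP y)) y :=
    ContMDiffAt.prodMk contMDiffAt_const (contMDiffAt_toCP hy)
  exact contMDiffAt_iff_contDiffAt.1 (ContMDiffAt.comp (g := f) (f := fun y => (t, toCP y)) y hf h1)

lemma ContMDiffAt.contDiffAt_prod_toCP {f : ℝ × CP2 → ℝ} {y : V3} (hy : y ≠ 0)
    (hf : ContMDiffAt (𝓘(ℝ, ℝ).prod I4) 𝓘(ℝ, ℝ) ∞ f (t, toCP y)) :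
    ContDiffAt ℝ ∞ (fun q : ℝ × V3 => f (q.1, toCP q.2)) (t, y) := by
  have h1 : ContMDiffAt 𝓘(ℝ, ℝ × V3) (𝓘(ℝ, ℝ).prod I4) ∞
      (fun q : ℝ × V3 => (q.1, toCP q.2)) (t, y) :=
    ContMDiffAt.prodMk contDiffAt_fst.contMDiffAt
      (ContMDiffAt.comp (g := toCP) (f := fun q : ℝ × V3 => q.2) (t, y) (contMDiffAt_toCP hy)
        contDiffAt_snd.contMDiffAt)
  exact contMDiffAt_iff_contDiffAt.1
    (ContMDiffAt.comp (g := f) (f := fun q : ℝ × V3 => (q.1, toCP q.2)) (t, y) hf h1)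

section Cutoff

variable {W : Set (ℝ × CP2)} {H : ℝ × CP2 → ℝ} {f : C^∞⟮𝓘(ℝ, ℝ).prod I4, ℝ × CP2; ℝ⟯}

lemma eventually_cutoff_eq_zero (H : ℝ × CP2 → ℝ) {q : ℝ × CP2} (hq : q ∉ tsupport f) :
    ∀ᶠ q in 𝓝 q, f q * H q = 0 := by
  filter_upwards [(isClosed_tsupport f).isOpen_compl.mem_nhds hq] with q hq
  rw [image_eq_zero_of_notMem_tsupport hq, zero_mul]

lemma fderiv_cutoff_eq_zero (H : ℝ × CP2 → ℝ) {y : V3} (hy : y ≠ 0)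
    (hq : (t, toCP y) ∉ tsupport f) :
    fderiv ℝ (fun y => f (t, toCP y) * H (t, toCP y)) y = 0 := by
  have h1 : ContinuousAt (fun y => (t, toCP y)) y := continuousAt_const.prodMk (continuousAt_toCP hy)
  have h2 : (fun y => f (t, toCP y) * H (t, toCP y)) =ᶠ[𝓝 y] fun _ => 0 :=
    h1.eventually (eventually_cutoff_eq_zero H hq)
  rw [h2.fderiv_eq]
  exact (hasFDerivAt_const (0 : ℝ) y).fderiv

lemma IsLocalHam.contMDiff_cutoff (hH : IsLocalHam b W H) (hf : tsupport f ⊆ W) :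
    ContMDiff (𝓘(ℝ, ℝ).prod I4) 𝓘(ℝ, ℝ) ∞ (fun q => f q * H q) := by
  intro q
  by_cases hq : q ∈ tsupport f
  · exact (f.contMDiff q).mul (hH.smooth q (hf hq))
  · exact contMDiffAt_const.congr_of_eventuallyEq (eventually_cutoff_eq_zero H hq)

/-- In the product rule the derivative of the cutoff is multiplied by the value of `H`, which is
zero. This is why the local functions have to vanish on the curve and on the lines. -/
lemma IsLocalHam.fderiv_cutoff (hH : IsLocalHam b W H) {y : V3} (hy : y ≠ 0)
    (hq : (t, toCP y) ∈ W) (h0 : H (t, toCP y) = 0) :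
    fderiv ℝ (fun y => f (t, toCP y) * H (t, toCP y)) y =
      f (t, toCP y) • fderiv ℝ (fun y => H (t, toCP y)) y := by
  have h1 := (ContMDiffAt.contDiffAt_toCP hy (f.contMDiff (t, toCP y))).differentiableAt
    (by simp : (∞ : WithTop ℕ∞) ≠ 0)
  have h2 := (ContMDiffAt.contDiffAt_toCP hy (hH.smooth _ hq)).differentiableAt
    (by simp : (∞ : WithTop ℕ∞) ≠ 0)
  have h3 := (h1.hasFDerivAt.mul h2.hasFDerivAt).fderiv
  rw [h0, zero_smul, add_zero] at h3
  exact h3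

lemma IsLocalHam.fderiv_cutoff_curve (hH : IsLocalHam b W H) (hf : tsupport f ⊆ W)
    (hb : IsTransition b ε) (ht : t ∈ Icc (0 : ℝ) 1) {z V : V3} (hz : z ≠ 0) (hP : quinticPoly z = 0)
    (hV : IsNormalVel b t z V) (w : V3) :
    fderiv ℝ (fun y => f (t, toCP y) * H (t, toCP y)) (deformVec b t z) w =
      f (t, toCP (deformVec b t z)) * fsHom (deformVec b t z) V w := by
  have h0 := (deformVec_nonVertex hb t (nonVertex_of_quintic hz hP)).ne_zero
  by_cases hq : (t, toCP (deformVec b t z)) ∈ tsupport f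
  · rw [hH.fderiv_cutoff h0 (hf hq) (hH.zero_curve t ht z hz hP (hf hq)),
      ← hH.deriv_curve t ht z V hz hP hV (hf hq) w]
    rfl
  · rw [fderiv_cutoff_eq_zero H h0 hq, image_eq_zero_of_notMem_tsupport hq, zero_mul]
    rfl

lemma IsLocalHam.fderiv_cutoff_line (hH : IsLocalHam b W H) (hf : tsupport f ⊆ W) {k : Fin 3}
    {y : V3} (hy : y ≠ 0) (hk : y k = 0) :
    fderiv ℝ (fun y => f (t, toCP y) * H (t, toCP y)) y = 0 := by
  by_cases hq : (t, toCP y) ∈ tsupport f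
  · rw [hH.fderiv_cutoff hy (hf hq) (hH.zero_line k t y hy hk (hf hq)),
      hH.deriv_line k t y hy hk (hf hq), smul_zero]
  · exact fderiv_cutoff_eq_zero H hy hq

end Cutoff

/-- A Hamiltonian function whose flow moves the deformed curve, preserves the coordinate lines and
is supported in `U`. -/
structure IsDeformHam (b : ℝ → ℝ) (U : Set CP2) (H : ℝ → CP2 → ℝ) : Prop where
  smooth : ContMDiff (𝓘(ℝ, ℝ).prod I4) 𝓘(ℝ, ℝ) ∞ (fun q : ℝ × CP2 => H q.1 q.2)
  support : ∀ t, 3 ≤ |t| → ∀ p, H t p = 0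
  deriv_curve : ∀ t ∈ Icc (0 : ℝ) 1, ∀ z V, z ≠ 0 → quinticPoly z = 0 → IsNormalVel b t z V →
    ∀ w, fderiv ℝ (fun y => H t (toCP y)) (deformVec b t z) w = fsHom (deformVec b t z) V w
  deriv_line : ∀ k t y, y ≠ 0 → y k = 0 → fderiv ℝ (fun y => H t (toCP y)) y = 0
  deriv_compl : ∀ t y, y ≠ 0 → toCP y ∉ U → fderiv ℝ (fun y => H t (toCP y)) y = 0

/-- A partition of unity over [0, 1] × CP² averages the local functions. On the curve they all have
the same differential, which the average inherits; on the lines it stays zero. -/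
theorem exists_isDeformHam (hb : IsGood b ε C) {U : Set CP2} (hU : IsOpen U)
    (hSU : ∀ t ∈ Icc (0 : ℝ) 1, smoothedFamily b t ⊆ U) : ∃ H, IsDeformHam b U H := by
  have hex : ∀ q : Icc (0 : ℝ) 1 × CP2, ∃ (W : Set (ℝ × CP2)) (H : ℝ × CP2 → ℝ), IsOpen W ∧
      ((q.1 : ℝ), q.2) ∈ W ∧ IsLocalHam b W H ∧ ((∀ q ∈ W, q.2 ∈ U) ∨ H = 0) :=
    fun q => exists_localHam hb hU hSU q.1.2 q.2
  choose W H hW hqW hH hWU using hex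
  obtain ⟨K, hK⟩ : ∃ K : Set (ℝ × CP2), K = Icc (0 : ℝ) 1 ×ˢ univ := ⟨_, rfl⟩
  have hKc : IsCompact K := hK ▸ isCompact_Icc.prod isCompact_univ
  obtain ⟨s, hs⟩ := hKc.elim_finite_subcover W hW fun q hq => by
    rw [hK] at hq
    exact mem_iUnion.2 ⟨(⟨q.1, hq.1⟩, q.2), hqW (⟨q.1, hq.1⟩, q.2)⟩
  obtain ⟨f, hf⟩ := SmoothPartitionOfUnity.exists_isSubordinate (𝓘(ℝ, ℝ).prod I4) hKc.isClosed
    (fun i : s => W i) (fun i => hW i)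
    (hs.trans (iUnion₂_subset fun i hi => subset_iUnion (fun i : s => W i) ⟨i, hi⟩))
  -- The cutoff in time is 1 on [0, 1], where the curve has to be followed, and bounds the support
  -- in time for the integration of the field.
  let χ : ContDiffBump (0 : ℝ) := ⟨2, 3, by norm_num, by norm_num⟩
  have hχ1 : ∀ t ∈ Icc (0 : ℝ) 1, χ t = 1 := fun t ht => by
    refine χ.one_of_mem_closedBall ?_
    rw [Metric.mem_closedBall, Real.dist_eq, sub_zero, abs_of_nonneg ht.1]
    exact ht.2.trans (by norm_num)
  have hχ0 : ∀ t, 3 ≤ |t| → χ t = 0 := fun t ht => by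
    refine χ.zero_of_le_dist ?_
    rwa [Real.dist_eq, sub_zero]
  have hχs : ContMDiff (𝓘(ℝ, ℝ).prod I4) 𝓘(ℝ, ℝ) ∞ (fun q : ℝ × CP2 => χ q.1) :=
    ContMDiff.comp (g := χ) (f := fun q : ℝ × CP2 => q.1) (χ.contDiff (n := ⊤)).contMDiff
      contMDiff_fst
  have hd : ∀ t, ∀ y : V3, y ≠ 0 → fderiv ℝ (fun y => χ t * ∑ i : s, f i (t, toCP y) *
      H i (t, toCP y)) y = χ t • ∑ i : s, fderiv ℝ (fun y => f i (t, toCP y) * H i (t, toCP y)) y := by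
    intro t y hy
    have h1 : ∀ i : s, DifferentiableAt ℝ (fun y => f i (t, toCP y) * H i (t, toCP y)) y := fun i =>
      (ContMDiffAt.contDiffAt_toCP hy ((hH i).contMDiff_cutoff (hf i) (t, toCP y))).differentiableAt
        (by simp)
    have h2 := HasFDerivAt.fun_sum (u := Finset.univ) fun i _ => (h1 i).hasFDerivAt
    exact (h2.const_mul (χ t)).fderiv
  refine ⟨fun t p => χ t * ∑ i : s, f i (t, p) * H i (t, p), ?_, ?_, ?_, ?_, ?_⟩
  · exact hχs.mul (contMDiff_finsetSum fun i _ => (hH i).contMDiff_cutoff (hf i))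
  · intro t ht p
    rw [hχ0 t ht, zero_mul]
  · intro t ht z V hz hP hV w
    have h0 := (deformVec_nonVertex hb.tr t (nonVertex_of_quintic hz hP)).ne_zero
    have hsum : ∑ i : s, f i (t, toCP (deformVec b t z)) = 1 := by
      rw [← finsum_eq_sum_of_fintype]
      exact f.sum_eq_one (hK ▸ ⟨ht, mem_univ _⟩)
    rw [hd t _ h0, hχ1 t ht, one_smul, sum_apply,
      Finset.sum_congr rfl fun (i : s) _ => (hH i).fderiv_cutoff_curve (hf i) hb.tr ht hz hP hV w,
      ← Finset.sum_mul, hsum, one_mul]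
  · intro k t y hy hk
    rw [hd t y hy, Finset.sum_eq_zero fun (i : s) _ => (hH i).fderiv_cutoff_line (hf i) hy hk, smul_zero]
  · intro t y hy hyU
    rw [hd t y hy, Finset.sum_eq_zero fun i _ => ?_, smul_zero]
    rcases hWU i with h | h
    · exact fderiv_cutoff_eq_zero (H i) hy fun hq => hyU (h _ (hf i hq))
    · simp only [h, Pi.zero_apply, mul_zero]
      exact (hasFDerivAt_const (0 : ℝ) y).fderiv

end QuinticSmoothing
end

noncomputable section

open Filter

/-! ### Flows of time-dependent vector fields -/

namespace SmoothFlow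

variable {F : Type} [NormedAddCommGroup F] [NormedSpace ℝ F] [FiniteDimensional ℝ F]

/-- A compactly supported smooth time-dependent vector field has a smooth evolution family. -/
theorem exists_evolution {X : ℝ × F → F} (hX : ContDiff ℝ ∞ X) (hc : HasCompactSupport X) :
    ∃ Φ : ℝ → ℝ → F → F, (∀ s y, Φ s s y = y) ∧
      (∀ s t y, HasDerivAt (fun t => Φ s t y) (X (t, Φ s t y)) t) ∧
      (∀ s t u y, Φ t u (Φ s t y) = Φ s u y) ∧
      ContDiff ℝ ∞ (fun p : ℝ × ℝ × F => Φ p.1 p.2.1 p.2.2) := by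
  obtain ⟨K, hK⟩ := ContDiff.lipschitzWith_of_hasCompactSupport hc hX (by simp)
  obtain ⟨L, hL⟩ := hc.exists_bound_of_continuous hX.continuous
  -- Time becomes a coordinate of velocity 1. The autonomous field is no longer compactly supported,
  -- but it is bounded and Lipschitz.
  have hf : ContDiff ℝ ∞ (fun q : ℝ × F => ((1 : ℝ), X q)) := contDiff_const.prodMk hX
  have hfK : LipschitzWith K (fun q : ℝ × F => ((1 : ℝ), X q)) := by
    simpa using (LipschitzWith.const (1 : ℝ)).prodMk hK
  have hfL : ∀ q : ℝ × F, ‖((1 : ℝ), X q)‖ ≤ (max 1 L).toNNReal := fun q => by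
    rw [Real.coe_toNNReal _ (le_max_of_le_left zero_le_one), Prod.norm_mk, norm_one]
    exact max_le_max le_rfl (hL q)
  obtain ⟨φ, h0, hφ, hadd, hs⟩ := exists_flow (f := fun q : ℝ × F => ((1 : ℝ), X q)) hf hfK hfL
  have hfst : ∀ τ q, (φ τ q).1 = q.1 + τ := by
    intro τ q
    have h1 : ∀ τ, HasDerivAt (fun τ => (φ τ q).1 - τ) 0 τ := fun τ => by
      have h : HasDerivAt (fun τ => (φ τ q).1) 1 τ :=
        HasFDerivAt.comp_hasDerivAt (l := Prod.fst) (f := fun τ => φ τ q)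
          (l' := ContinuousLinearMap.fst ℝ ℝ F) τ hasFDerivAt_fst (hφ τ q)
      exact (h.fun_sub (hasDerivAt_id' τ)).congr_deriv (sub_self 1)
    have h2 := is_const_of_deriv_eq_zero (fun τ => (h1 τ).differentiableAt)
      (fun τ => (h1 τ).deriv) τ 0
    rw [h0] at h2
    linarith
  refine ⟨fun s t y => (φ (t - s) (s, y)).2, fun s y => ?_, fun s t y => ?_, fun s t u y => ?_, ?_⟩
  · simp only [sub_self, h0]
  · have h1 : HasDerivAt (fun t => φ (t - s) (s, y)) (1, X (φ (t - s) (s, y))) t :=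
      (hφ (t - s) (s, y)).comp_sub_const t s
    have h2 : φ (t - s) (s, y) = (t, (φ (t - s) (s, y)).2) := by
      refine Prod.ext ?_ rfl
      rw [hfst]
      ring
    have h3 := (hasFDerivAt_snd (𝕜 := ℝ) (p := φ (t - s) (s, y))).comp_hasDerivAt t h1
    rw [← h2]
    exact h3
  · have h2 : (t, (φ (t - s) (s, y)).2) = φ (t - s) (s, y) := by
      refine Prod.ext ?_ rfl
      rw [hfst]
      ring
    dsimp only
    rw [h2, ← hadd, sub_add_sub_cancel]
  · exact contDiff_snd.comp (hs.comp ((contDiff_snd.fst.sub contDiff_fst).prodMk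
      (contDiff_fst.prodMk contDiff_snd.snd)))

end SmoothFlow

namespace QuinticSmoothing

variable {b : ℝ → ℝ} {ε C t : ℝ}

/-! ### Hamiltonian vector fields in homogeneous coordinates -/

/-- The complex gradient of a real-linear function. -/
def hamGrad (L : V3 →L[ℝ] ℝ) : V3 := fun k =>
  (L (Pi.single k 1) : ℂ) + Complex.I * (L (Pi.single k Complex.I) : ℂ)

lemma re_herm_hamGrad (L : V3 →L[ℝ] ℝ) (w : V3) : (herm (hamGrad L) w).re = L w := by
  have h : w = ∑ k : Fin 3, ((w k).re • (Pi.single k (1 : ℂ) : V3) +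
      (w k).im • (Pi.single k Complex.I : V3)) := by
    funext j
    simp only [Finset.sum_apply, Pi.add_apply, Pi.smul_apply, Pi.single_apply, smul_ite, smul_zero,
      Finset.sum_add_distrib, Finset.sum_ite_eq, Finset.mem_univ, if_true, Complex.real_smul,
      mul_one, Complex.re_add_im]
  conv_rhs => rw [h]
  simp only [map_add, map_smul, Fin.sum_univ_three, herm, hamGrad, smul_eq_mul]
  simp
  ring

/-- The Hamiltonian vector, at `z`, of a function with derivative `L`. -/
def hamField (L : V3 →L[ℝ] ℝ) (z : V3) : V3 := (-Complex.I * hsq z) • hamGrad L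

lemma hamField_zero (z : V3) : hamField 0 z = 0 := by
  have : hamGrad 0 = 0 := by
    funext k
    simp [hamGrad]
  rw [hamField, this, smul_zero]

lemma herm_hamField {L : V3 →L[ℝ] ℝ} {z : V3} (hL : ∀ c : ℂ, L (c • z) = 0) :
    herm (hamField L z) z = 0 := by
  have h : herm (hamGrad L) z = 0 := by
    have h1 := re_herm_hamGrad L ((1 : ℂ) • z)
    have h2 := re_herm_hamGrad L (Complex.I • z)
    rw [hL, herm_smul_right] at h1 h2
    refine Complex.ext ?_ ?_
    · simpa using h1
    · simpa using h2
  rw [hamField, herm_smul_left, h, mul_zero]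

/-- As `L` kills the radial line, the gradient is Hermitian-orthogonal to `z`, where the form is the
imaginary part of the Hermitian product over `hsq z`. The factor -i `hsq z` turns it into the real
part. -/
lemma fsHom_hamField {L : V3 →L[ℝ] ℝ} {z : V3} (hz : z ≠ 0) (hL : ∀ c : ℂ, L (c • z) = 0) (w : V3) :
    fsHom z (hamField L z) w = L w := by
  have h := (hsq_pos hz).ne'
  rw [fsHom_of_herm_eq_zero (herm_hamField hL) w hz, hamField, herm_smul_left, ← re_herm_hamGrad L w]
  simp only [map_mul, map_neg, Complex.conj_I, Complex.conj_ofReal, neg_neg]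
  simp
  field_simp

lemma contDiff_hamGrad : ContDiff ℝ ∞ hamGrad := by
  refine contDiff_pi.2 fun k => ?_
  have h : ∀ v : V3, ContDiff ℝ ∞ fun L : V3 →L[ℝ] ℝ => ((L v : ℝ) : ℂ) := fun v =>
    Complex.ofRealCLM.contDiff.comp (contDiff_id.clm_apply contDiff_const)
  exact (h _).add (contDiff_const.mul (h _))

lemma herm_eq_zero_of_fsHom {z u u' : V3} (hz : z ≠ 0) (hu : herm u z = 0) (hu' : herm u' z = 0)
    (h : ∀ w, fsHom z u w = fsHom z u' w) : u = u' := by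
  obtain ⟨c, hc⟩ := eq_smul_of_fsHom_eq_zero (u := u - u') hz fun w => by
    rw [fsHom_sub_left, h, sub_self]
  have h1 : herm (u - u') z = 0 := by
    rw [sub_eq_add_neg, herm_add_left, hu, ← neg_one_smul ℂ u', herm_smul_left, hu', mul_zero,
      add_zero]
  rw [hc, herm_smul_left, herm_self] at h1
  have h2 : ((hsq z : ℝ) : ℂ) ≠ 0 := by exact_mod_cast (hsq_pos hz).ne'
  have h3 : c = 0 := by simpa [h2] using h1
  rw [h3, zero_smul] at hc
  exact sub_eq_zero.1 hc

/-- The derivative of a function of `CP²` in homogeneous coordinates. -/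
def homDeriv (H : ℝ → CP2 → ℝ) (q : ℝ × V3) : V3 →L[ℝ] ℝ := fderiv ℝ (fun y => H q.1 (toCP y)) q.2

/-- A smooth time-dependent function. -/
abbrev SmoothHam (H : ℝ → CP2 → ℝ) : Prop :=
  ContMDiff (𝓘(ℝ, ℝ).prod I4) 𝓘(ℝ, ℝ) ∞ (fun q : ℝ × CP2 => H q.1 q.2)

variable {H : ℝ → CP2 → ℝ}

lemma hasFDerivAt_homDeriv (hH : SmoothHam H) {q : ℝ × V3} (hq : q.2 ≠ 0) :
    HasFDerivAt (fun y => H q.1 (toCP y)) (homDeriv H q) q.2 :=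
  ((ContMDiffAt.contDiffAt_toCP hq (hH (q.1, toCP q.2))).differentiableAt (by simp)).hasFDerivAt

lemma contDiffAt_homDeriv (hH : SmoothHam H) {q : ℝ × V3} (hq : q.2 ≠ 0) : ContDiffAt ℝ ∞ (homDeriv H) q := by
  have h1 : ContDiffAt ℝ ∞ (fun q : ℝ × V3 => H q.1 (toCP q.2)) (q.1, q.2) :=
    ContMDiffAt.contDiffAt_prod_toCP hq (hH (q.1, toCP q.2))
  have h2 : ContDiffAt ℝ ∞ (Function.uncurry fun (q : ℝ × V3) (y : V3) => H q.1 (toCP y)) (q, q.2) :=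
    ContDiffAt.comp (g := fun q : ℝ × V3 => H q.1 (toCP q.2))
      (f := fun r : (ℝ × V3) × V3 => (r.1.1, r.2)) (q, q.2) h1
      (contDiff_fst.fst.prodMk contDiff_snd).contDiffAt
  exact ContDiffAt.fderiv h2 contDiffAt_snd (by simp)

lemma homDeriv_smul (hH : SmoothHam H) {q : ℝ × V3} (hq : q.2 ≠ 0) {a : ℂ} (ha : a ≠ 0) (w : V3) :
    homDeriv H (q.1, a • q.2) (a • w) = homDeriv H q w := by
  have h1 : HasDerivAt (fun s : ℝ => q.2 + s • w) w 0 := by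
    simpa using ((hasDerivAt_id (0 : ℝ)).smul_const w).const_add q.2
  have h2 : HasDerivAt (fun s : ℝ => H q.1 (toCP (a • q.2 + s • a • w)))
      (homDeriv H (q.1, a • q.2) (a • w)) 0 :=
    (hasFDerivAt_homDeriv hH (q := (q.1, a • q.2)) (smul_ne_zero ha hq)).hasLineDerivAt (a • w)
  have h3 : HasDerivAt (fun s : ℝ => H q.1 (toCP (q.2 + s • w))) (homDeriv H q w) 0 :=
    (hasFDerivAt_homDeriv hH hq).hasLineDerivAt w
  refine h2.unique (h3.congr_of_eventuallyEq ?_)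
  have h4 : ∀ᶠ s : ℝ in 𝓝 0, q.2 + s • w ≠ 0 :=
    h1.continuousAt.eventually_ne (by simpa using hq)
  filter_upwards [h4] with s hs
  have h5 : a • q.2 + s • a • w = a • (q.2 + s • w) := by rw [smul_add, smul_comm]
  simp only [h5]
  rw [toCP_smul ha hs]

lemma homDeriv_radial (hH : SmoothHam H) {q : ℝ × V3} (hq : q.2 ≠ 0) (c : ℂ) : homDeriv H q (c • q.2) = 0 := by
  have h1 : HasDerivAt (fun s : ℝ => 1 + (s : ℂ) * c) c 0 := by
    simpa using ((Complex.ofRealCLM.hasDerivAt (x := 0)).mul_const c).const_add 1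
  have h3 := (hasFDerivAt_homDeriv hH hq).hasLineDerivAt (c • q.2)
  refine HasDerivAt.unique h3 ((hasDerivAt_const (0 : ℝ) (H q.1 (toCP q.2))).congr_of_eventuallyEq ?_)
  have h4 : ∀ᶠ s : ℝ in 𝓝 0, 1 + (s : ℂ) * c ≠ 0 := h1.continuousAt.eventually_ne (by simp)
  filter_upwards [h4] with s hs
  have h5 : q.2 + s • c • q.2 = (1 + (s : ℂ) * c) • q.2 := by
    rw [add_smul, one_smul, mul_smul]
    rfl
  simp only [h5]
  rw [toCP_smul hs hq]

/-- The Hamiltonian vector field in homogeneous coordinates, horizontal for the Hopf fibration. -/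
def homField (H : ℝ → CP2 → ℝ) (q : ℝ × V3) : V3 := hamField (homDeriv H q) q.2

lemma contDiffAt_homField (hH : SmoothHam H) {q : ℝ × V3} (hq : q.2 ≠ 0) : ContDiffAt ℝ ∞ (homField H) q := by
  have h1 : ContDiffAt ℝ ∞ (fun q => hamGrad (homDeriv H q)) q :=
    ContDiffAt.comp (g := hamGrad) (f := homDeriv H) q contDiff_hamGrad.contDiffAt
      (contDiffAt_homDeriv hH hq)
  have h2 : ContDiff ℝ ∞ (fun q : ℝ × V3 => -Complex.I * ((hsq q.2 : ℝ) : ℂ)) :=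
    contDiff_const.mul (Complex.ofRealCLM.contDiff.comp (contDiff_hsq.comp contDiff_snd))
  exact h2.contDiffAt.smul h1

lemma herm_homField (hH : SmoothHam H) {q : ℝ × V3} (hq : q.2 ≠ 0) : herm (homField H q) q.2 = 0 :=
  herm_hamField fun c => homDeriv_radial hH hq c

lemma fsHom_homField (hH : SmoothHam H) {q : ℝ × V3} (hq : q.2 ≠ 0) (w : V3) :
    fsHom q.2 (homField H q) w = homDeriv H q w :=
  fsHom_hamField hq (fun c => homDeriv_radial hH hq c) w

/-- Both sides are horizontal and represent the same functional, so they agree. This equivariance is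
what lets the lifted flow descend. -/
lemma homField_smul (hH : SmoothHam H) {q : ℝ × V3} (hq : q.2 ≠ 0) {a : ℂ} (ha : a ≠ 0) :
    homField H (q.1, a • q.2) = a • homField H q := by
  have hq' : a • q.2 ≠ 0 := smul_ne_zero ha hq
  refine herm_eq_zero_of_fsHom hq' (herm_homField hH (q := (q.1, a • q.2)) hq') ?_ fun w => ?_
  · rw [herm_smul_left, herm_smul_right, herm_homField hH hq, mul_zero, mul_zero]
  · have hw : w = a • (a⁻¹ • w) := by rw [smul_smul, mul_inv_cancel₀ ha, one_smul]
    rw [hw, fsHom_smul ha, fsHom_homField hH hq]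
    exact (fsHom_homField hH (q := (q.1, a • q.2)) hq' _).trans (homDeriv_smul hH hq ha _)

end QuinticSmoothing
end

noncomputable section

open Filter

namespace QuinticSmoothing

variable {b : ℝ → ℝ} {ε C t : ℝ} {H : ℝ → CP2 → ℝ} {U : Set CP2}

/-! ### The flow on the unit sphere -/

lemma hasDerivAt_hsq {γ : ℝ → V3} {v : V3} (h : HasDerivAt γ v t) :
    HasDerivAt (fun t => hsq (γ t)) (2 * (herm v (γ t)).re) t := by
  have h1 := fun k => (hasDerivAt_pi.1 h k).norm_sq
  refine (((h1 0).add (h1 1)).add (h1 2)).congr_deriv ?_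
  simp only [Complex.inner, herm, Complex.add_re, Complex.mul_re, Complex.conj_re, Complex.conj_im]
  ring

lemma norm_sq_le_hsq (y : V3) : ‖y‖ ^ 2 ≤ hsq y := by
  have h : ∀ k, ‖y k‖ ^ 2 ≤ hsq y := fun k => by
    have := sq_nonneg ‖y 0‖
    have := sq_nonneg ‖y 1‖
    have := sq_nonneg ‖y 2‖
    fin_cases k <;> simp only [hsq, Fin.zero_eta, Fin.mk_one, Fin.reduceFinMk] <;> linarith
  obtain ⟨k, hk⟩ : ∃ k, ‖y k‖ = ‖y‖ := by
    obtain ⟨k, -, hk⟩ := Finset.exists_mem_eq_sup Finset.univ ⟨0, Finset.mem_univ _⟩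
      fun k : Fin 3 => ‖y k‖₊
    refine ⟨k, ?_⟩
    rw [Pi.norm_def, hk]
    rfl
  rw [← hk]
  exact h k

lemma homField_of_homDeriv {q : ℝ × V3} (h : homDeriv H q = 0) : homField H q = 0 := by
  rw [homField, h, hamField_zero]

/-- The Hamiltonian vector field cut off away from the unit sphere. -/
lemma exists_cutField (hH : IsDeformHam b U H) : ∃ X : ℝ × V3 → V3, ContDiff ℝ ∞ X ∧
    HasCompactSupport X ∧ (∀ q, hsq q.2 = 1 → X q = homField H q) ∧ (∀ q, herm (X q) q.2 = 0) ∧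
    (∀ (q : ℝ × V3) (a : ℂ), ‖a‖ = 1 → X (q.1, a • q.2) = a • X q) ∧
    ∀ q, homDeriv H q = 0 → X q = 0 := by
  -- The cutoff removes the origin and infinity. It depends on `hsq` alone, so the field stays
  -- horizontal and equivariant under phases.
  let χ : ContDiffBump (1 : ℝ) := ⟨1 / 4, 1 / 2, by norm_num, by norm_num⟩
  have hχ : ∀ u : ℝ, 1 / 2 ≤ |u - 1| → χ u = 0 := fun u hu =>
    χ.zero_of_le_dist (by rwa [Real.dist_eq])
  have hχ1 : χ 1 = 1 := χ.one_of_mem_closedBall (Metric.mem_closedBall_self (by norm_num))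
  have hz : ∀ q : ℝ × V3, q.2 = 0 → homField H q = 0 := fun q hq => by
    rw [homField, hamField, hq]
    simp [hsq]
  refine ⟨fun q => χ (hsq q.2) • homField H q, ?_, ?_, fun q hq => ?_, fun q => ?_,
    fun q a ha => ?_, fun q hq => ?_⟩
  · refine contDiff_iff_contDiffAt.2 fun q => ?_
    have h1 : ContDiff ℝ ∞ fun q : ℝ × V3 => hsq q.2 := contDiff_hsq.comp contDiff_snd
    by_cases hq : q.2 = 0
    · have h2 : ∀ᶠ q : ℝ × V3 in 𝓝 q, hsq q.2 < 1 / 2 :=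
        h1.continuous.continuousAt.eventually_lt continuousAt_const (by simp [hq, hsq])
      have h3 : (fun q : ℝ × V3 => χ (hsq q.2) • homField H q) =ᶠ[𝓝 q] fun _ => 0 := by
        filter_upwards [h2] with q hq
        rw [hχ, zero_smul]
        rw [abs_of_nonpos (by linarith)]
        linarith
      exact contDiffAt_const.congr_of_eventuallyEq h3
    · have h2 : ContDiff ℝ ∞ fun q : ℝ × V3 => χ (hsq q.2) := (χ.contDiff (n := ⊤)).comp h1
      exact h2.contDiffAt.smul (contDiffAt_homField hH.smooth hq)
  · refine HasCompactSupport.intro (K := Icc (-3) 3 ×ˢ Metric.closedBall 0 2)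
      (isCompact_Icc.prod (isCompact_closedBall _ _)) fun q hq => ?_
    by_cases h1 : 3 ≤ |q.1|
    · have h2 : homDeriv H q = 0 := by
        have : (fun y => H q.1 (toCP y)) = fun _ => 0 := funext fun y => hH.support _ h1 _
        rw [homDeriv, this]
        exact (hasFDerivAt_const (0 : ℝ) q.2).fderiv
      rw [homField_of_homDeriv h2, smul_zero]
    · have h2 : 2 < ‖q.2‖ := by
        by_contra h
        refine hq ⟨abs_le.1 (le_of_lt (not_le.1 h1)), ?_⟩
        rw [Metric.mem_closedBall, dist_zero_right]
        exact not_lt.1 h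
      have h3 := norm_sq_le_hsq q.2
      rw [hχ, zero_smul]
      rw [abs_of_nonneg (by nlinarith)]
      nlinarith
  · change χ (hsq q.2) • homField H q = _
    rw [hq, hχ1, one_smul]
  · change herm ((χ (hsq q.2) : ℝ) • homField H q) q.2 = 0
    have e : (χ (hsq q.2) : ℝ) • homField H q = ((χ (hsq q.2) : ℝ) : ℂ) • homField H q := rfl
    rw [e, herm_smul_left]
    by_cases hq : q.2 = 0
    · rw [hq]
      simp [herm]
    · rw [herm_homField hH.smooth hq, mul_zero]
  · change χ (hsq (a • q.2)) • homField H (q.1, a • q.2) = a • χ (hsq q.2) • homField H q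
    rw [hsq_smul, ha, one_pow, one_mul]
    by_cases hq : q.2 = 0
    · rw [hz q hq, hz (q.1, a • q.2) (by simp [hq])]
      simp
    · rw [homField_smul hH.smooth hq (norm_ne_zero_iff.1 (by rw [ha]; exact one_ne_zero)), smul_comm]
  · change χ (hsq q.2) • homField H q = 0
    rw [homField_of_homDeriv hq, smul_zero]

/-- An evolution family of `ℂ³` which covers the Hamiltonian flow of `H` on the unit sphere. -/
structure IsHamLift (H : ℝ → CP2 → ℝ) (Φ : ℝ → ℝ → V3 → V3) : Prop where
  self : ∀ s y, Φ s s y = y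
  comp : ∀ s t u y, Φ t u (Φ s t y) = Φ s u y
  smooth : ContDiff ℝ ∞ (fun p : ℝ × ℝ × V3 => Φ p.1 p.2.1 p.2.2)
  hsq_eq : ∀ s t y, hsq (Φ s t y) = hsq y
  smul : ∀ s t y (a : ℂ), ‖a‖ = 1 → Φ s t (a • y) = a • Φ s t y
  hasDerivAt : ∀ s t y, hsq y = 1 →
    HasDerivAt (fun t => Φ s t y) (homField H (t, Φ s t y)) t
  fixed : ∀ s t y, (∀ t, homDeriv H (t, y) = 0) → Φ s t y = y
  eqOn : ∀ s y (Z : ℝ → V3) a b t₀, t₀ ∈ Icc a b →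
    (∀ t ∈ Icc a b, HasDerivAt Z (homField H (t, Z t)) t) →
    (∀ t ∈ Icc a b, hsq (Z t) = 1) → Z t₀ = Φ s t₀ y →
    ∀ t ∈ Icc a b, Z t = Φ s t y

/-- Horizontality conserves `hsq`, so orbits on the unit sphere never feel the cutoff. Equivariance,
fixed points and the comparison with other solutions all come from uniqueness for the Lipschitz
field. -/
theorem exists_isHamLift (hH : IsDeformHam b U H) : ∃ Φ, IsHamLift H Φ := by
  obtain ⟨X, hX, hc, hX1, hXh, hXa, hX0⟩ := exists_cutField hH
  obtain ⟨Φ, h0, hd, hcomp, hs⟩ := SmoothFlow.exists_evolution hX hc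
  obtain ⟨K, hK⟩ := ContDiff.lipschitzWith_of_hasCompactSupport hc hX (by simp)
  have hKt : ∀ t, LipschitzWith K fun y => X (t, y) := fun t => by
    have h := hK.comp (LipschitzWith.prodMk_left (α := ℝ) (β := V3) t)
    rwa [mul_one] at h
  have huniq : ∀ (t₀ : ℝ) (f g : ℝ → V3), (∀ t, HasDerivAt f (X (t, f t)) t) →
      (∀ t, HasDerivAt g (X (t, g t)) t) → f t₀ = g t₀ → f = g := fun t₀ f g hf hg h =>
    ODE_solution_unique_univ (v := fun t y => X (t, y)) (s := fun _ => univ)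
      (fun t => (hKt t).lipschitzOnWith) (fun t => ⟨hf t, mem_univ _⟩)
      (fun t => ⟨hg t, mem_univ _⟩) h
  have hhsq : ∀ s t y, hsq (Φ s t y) = hsq y := by
    intro s t y
    have h1 : ∀ t, HasDerivAt (fun t => hsq (Φ s t y)) 0 t := fun t => by
      have h := hasDerivAt_hsq (hd s t y)
      rwa [hXh (t, Φ s t y), Complex.zero_re, mul_zero] at h
    have h2 := is_const_of_deriv_eq_zero (fun t => (h1 t).differentiableAt)
      (fun t => (h1 t).deriv) t s
    rwa [h0] at h2
  refine ⟨Φ, h0, hcomp, hs, hhsq, fun s t y a ha => ?_, fun s t y hy => ?_, fun s t y hy => ?_,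
    fun s y Z a b t₀ ht₀ hZ hZ1 h => ?_⟩
  · refine congrFun (huniq s (fun t => Φ s t (a • y)) (fun t => a • Φ s t y)
      (fun t => hd s t (a • y)) (fun t => ?_) ?_) t
    · rw [hXa (t, Φ s t y) a ha]
      exact (hd s t y).const_smul a
    · rw [h0, h0]
  · rw [← hX1 (t, Φ s t y) ((hhsq s t y).trans hy)]
    exact hd s t y
  · refine congrFun (huniq s (fun t => Φ s t y) (fun _ => y) (fun t => hd s t y) (fun t => ?_) ?_) t
    · rw [hX0 _ (hy t)]
      exact hasDerivAt_const t y
    · exact h0 s y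
  · have hZX : ∀ t ∈ Icc a b, HasDerivAt Z (X (t, Z t)) t := fun t ht => by
      rw [hX1 (t, Z t) (hZ1 t ht)]
      exact hZ t ht
    intro t ht
    rcases le_total t₀ t with hle | hle
    · have hsub : Icc t₀ t ⊆ Icc a b := Icc_subset_Icc ht₀.1 ht.2
      exact ODE_solution_unique_of_mem_Icc_right (v := fun t y => X (t, y)) (s := fun _ => univ)
        (f := Z) (g := fun t => Φ s t y) (a := t₀) (b := t)
        (fun t _ => (hKt t).lipschitzOnWith)
        (fun u hu => (hZX u (hsub hu)).continuousAt.continuousWithinAt)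
        (fun u hu => (hZX u (hsub (Ico_subset_Icc_self hu))).hasDerivWithinAt)
        (fun _ _ => mem_univ _) (fun u _ => (hd s u y).continuousAt.continuousWithinAt)
        (fun u _ => (hd s u y).hasDerivWithinAt) (fun _ _ => mem_univ _) h (right_mem_Icc.2 hle)
    · have hsub : Icc t t₀ ⊆ Icc a b := Icc_subset_Icc ht.1 ht₀.2
      exact ODE_solution_unique_of_mem_Icc_left (v := fun t y => X (t, y)) (s := fun _ => univ)
        (f := Z) (g := fun t => Φ s t y) (a := t) (b := t₀)
        (fun t _ => (hKt t).lipschitzOnWith)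
        (fun u hu => (hZX u (hsub hu)).continuousAt.continuousWithinAt)
        (fun u hu => (hZX u (hsub (Ioc_subset_Icc_self hu))).hasDerivWithinAt)
        (fun _ _ => mem_univ _) (fun u _ => (hd s u y).continuousAt.continuousWithinAt)
        (fun u _ => (hd s u y).hasDerivWithinAt) (fun _ _ => mem_univ _) h (left_mem_Icc.2 hle)

end QuinticSmoothing
end

noncomputable section

open Filter

namespace QuinticSmoothing

variable {b : ℝ → ℝ} {ε C t : ℝ} {H : ℝ → CP2 → ℝ} {U : Set CP2} {Φ : ℝ → ℝ → V3 → V3}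

/-! ### The Hamiltonian flow of the projective plane -/

/-- The normalization of a vector. -/
def unitRep (y : V3) : V3 := (((Real.sqrt (hsq y))⁻¹ : ℝ) : ℂ) • y

lemma ne_zero_of_hsq {y : V3} (h : hsq y = 1) : y ≠ 0 := by
  rintro rfl
  simp [hsq] at h

lemma sqrt_hsq_pos {y : V3} (hy : y ≠ 0) : 0 < Real.sqrt (hsq y) := Real.sqrt_pos.2 (hsq_pos hy)

lemma hsq_unitRep {y : V3} (hy : y ≠ 0) : hsq (unitRep y) = 1 := by
  have h := (hsq_pos hy).ne'
  rw [unitRep, hsq_smul, Complex.norm_real, Real.norm_eq_abs, sq_abs, inv_pow,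
    Real.sq_sqrt (hsq_pos hy).le, inv_mul_cancel₀ h]

lemma unitRep_of_hsq {y : V3} (h : hsq y = 1) : unitRep y = y := by
  rw [unitRep, h, Real.sqrt_one, inv_one, Complex.ofReal_one, one_smul]

lemma toCP_unitRep {y : V3} (hy : y ≠ 0) : toCP (unitRep y) = toCP y :=
  toCP_smul (by exact_mod_cast (inv_pos.2 (sqrt_hsq_pos hy)).ne') hy

lemma unitRep_smul (a : ℂ) (y : V3) : unitRep (a • y) = (a / ‖a‖) • unitRep y := by
  rw [unitRep, unitRep, hsq_smul, Real.sqrt_mul (sq_nonneg _), Real.sqrt_sq (norm_nonneg a),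
    smul_smul, smul_smul, mul_inv]
  congr 1
  push_cast
  ring

lemma contDiffAt_unitRep {y : V3} (hy : y ≠ 0) : ContDiffAt ℝ ∞ unitRep y := by
  have h1 := (contDiff_hsq.contDiffAt (x := y)).sqrt (hsq_pos hy).ne'
  have h2 := h1.inv (sqrt_hsq_pos hy).ne'
  have h3 : ContDiffAt ℝ ∞ (fun y => (((Real.sqrt (hsq y))⁻¹ : ℝ) : ℂ)) y :=
    ContDiffAt.comp (g := fun r : ℝ => (r : ℂ)) y Complex.ofRealCLM.contDiff.contDiffAt h2
  exact h3.smul contDiffAt_id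

/-- The map of the projective plane covered by `Φ s t`. -/
def hamFlow (Φ : ℝ → ℝ → V3 → V3) (s t : ℝ) (p : CP2) : CP2 := toCP (Φ s t (unitRep p.rep))

namespace IsHamLift

lemma ne_zero (hΦ : IsHamLift H Φ) (s t : ℝ) {y : V3} (hy : hsq y = 1) : Φ s t y ≠ 0 :=
  ne_zero_of_hsq ((hΦ.hsq_eq s t y).trans hy)

/-- Unit representatives of one point differ by a phase, and `Φ` commutes with phases, so the chosen
representative does not matter. -/
lemma hamFlow_toCP (hΦ : IsHamLift H Φ) (s t : ℝ) {y : V3} (hy : y ≠ 0) :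
    hamFlow Φ s t (toCP y) = toCP (Φ s t (unitRep y)) := by
  obtain ⟨a, ha, h⟩ := exists_rep_toCP hy
  have hn : ((‖a‖ : ℝ) : ℂ) ≠ 0 := by exact_mod_cast (norm_pos_iff.2 ha).ne'
  have h1 : ‖a / ‖a‖‖ = 1 := by
    rw [norm_div, Complex.norm_real, norm_norm, div_self (norm_ne_zero_iff.2 ha)]
  rw [hamFlow, h, unitRep_smul, hΦ.smul _ _ _ _ h1,
    toCP_smul (div_ne_zero ha hn) (hΦ.ne_zero s t (hsq_unitRep hy))]

lemma hamFlow_self (hΦ : IsHamLift H Φ) (s : ℝ) (p : CP2) : hamFlow Φ s s p = p := by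
  rw [hamFlow, hΦ.self, toCP_unitRep p.rep_nonzero, toCP_rep]

lemma hamFlow_comp (hΦ : IsHamLift H Φ) (s t u : ℝ) (p : CP2) :
    hamFlow Φ t u (hamFlow Φ s t p) = hamFlow Φ s u p := by
  have h1 := hsq_unitRep p.rep_nonzero
  have h2 : hamFlow Φ s t p = toCP (Φ s t (unitRep p.rep)) := rfl
  rw [h2, hΦ.hamFlow_toCP t u (hΦ.ne_zero s t h1),
    unitRep_of_hsq ((hΦ.hsq_eq s t _).trans h1), hΦ.comp]
  rfl

lemma contMDiff_hamFlow (hΦ : IsHamLift H Φ) {σ τ : ℝ → ℝ} (hσ : ContDiff ℝ ∞ σ)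
    (hτ : ContDiff ℝ ∞ τ) : ContMDiff (𝓘(ℝ, ℝ).prod I4) I4 ∞
      (fun q : ℝ × CP2 => hamFlow Φ (σ q.1) (τ q.1) q.2) := by
  rintro ⟨t, p⟩
  rw [← toCP_rep p]
  have hp := p.rep_nonzero
  refine contMDiffAt_of_toCP_prod hp ?_
  have h1 : ContDiffAt ℝ ∞ (fun q : ℝ × V3 => unitRep q.2) (t, p.rep) :=
    ContDiffAt.comp (g := unitRep) (f := fun q : ℝ × V3 => q.2) (t, p.rep) (contDiffAt_unitRep hp)
      contDiffAt_snd
  have h2 : ContDiffAt ℝ ∞ (fun q : ℝ × V3 => Φ (σ q.1) (τ q.1) (unitRep q.2)) (t, p.rep) :=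
    ContDiffAt.comp (g := fun p : ℝ × ℝ × V3 => Φ p.1 p.2.1 p.2.2)
      (f := fun q : ℝ × V3 => (σ q.1, τ q.1, unitRep q.2)) (t, p.rep) hΦ.smooth.contDiffAt
      ((hσ.comp contDiff_fst).contDiffAt.prodMk ((hτ.comp contDiff_fst).contDiffAt.prodMk h1))
  have h3 : ContMDiffAt 𝓘(ℝ, ℝ × V3) I4 ∞
      (fun q : ℝ × V3 => toCP (Φ (σ q.1) (τ q.1) (unitRep q.2))) (t, p.rep) :=
    ContMDiffAt.comp (g := toCP) (t, p.rep)
      (contMDiffAt_toCP (hΦ.ne_zero (σ t) (τ t) (hsq_unitRep hp))) h2.contMDiffAt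
  refine h3.congr_of_eventuallyEq ?_
  have h4 : ∀ᶠ q : ℝ × V3 in 𝓝 (t, p.rep), q.2 ≠ 0 :=
    continuous_snd.continuousAt.eventually_ne hp
  filter_upwards [h4] with q hq
  exact hΦ.hamFlow_toCP (σ q.1) (τ q.1) hq

lemma contMDiff_hamFlow_right (hΦ : IsHamLift H Φ) (s t : ℝ) :
    ContMDiff I4 I4 ∞ (hamFlow Φ s t) := by
  have h1 : ContMDiff I4 (𝓘(ℝ, ℝ).prod I4) ∞ (fun p : CP2 => ((0 : ℝ), p)) :=
    contMDiff_const.prodMk contMDiff_id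
  exact ContMDiff.comp (g := fun q : ℝ × CP2 => hamFlow Φ s t q.2)
    (f := fun p : CP2 => ((0 : ℝ), p))
    (hΦ.contMDiff_hamFlow (σ := fun _ => s) (τ := fun _ => t) contDiff_const contDiff_const) h1

/-- The Hamiltonian diffeomorphisms. -/
def diffeo (hΦ : IsHamLift H Φ) (t : ℝ) : CP2 ≃ₘ⟮I4, I4⟯ CP2 where
  toFun := hamFlow Φ 0 t
  invFun := hamFlow Φ t 0
  left_inv p := by rw [hΦ.hamFlow_comp, hΦ.hamFlow_self]
  right_inv p := by rw [hΦ.hamFlow_comp, hΦ.hamFlow_self]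
  contMDiff_toFun := hΦ.contMDiff_hamFlow_right 0 t
  contMDiff_invFun := hΦ.contMDiff_hamFlow_right t 0

lemma diffeo_apply (hΦ : IsHamLift H Φ) (t : ℝ) (p : CP2) : hΦ.diffeo t p = hamFlow Φ 0 t p := rfl

lemma isHamiltonianIsotopy (hΦ : IsHamLift H Φ) (hH : SmoothHam H) :
    IsHamiltonianIsotopy hΦ.diffeo where
  smooth := hΦ.contMDiff_hamFlow (σ := fun _ => 0) (τ := fun t => t) contDiff_const contDiff_id
  start p := hΦ.hamFlow_self 0 p
  flow := by
    refine ⟨H, hH, fun t p => ?_⟩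
    obtain ⟨y, hy⟩ : ∃ y, y = unitRep p.rep := ⟨_, rfl⟩
    have hy1 : hsq y = 1 := hy ▸ hsq_unitRep p.rep_nonzero
    have e : ∀ s, hΦ.diffeo s p = toCP (Φ 0 s y) := fun s => by
      rw [hy]
      rfl
    have hne := hΦ.ne_zero 0 t hy1
    have hd := (hΦ.hasDerivAt 0 t y hy1).hasFDerivAt.hasMFDerivAt
    have hm := ((contMDiffAt_toCP hne).mdifferentiableAt (by simp)).hasMFDerivAt
    have hc := hm.comp t hd
    have e2 : (fun s => hΦ.diffeo s p) = toCP ∘ fun s => Φ 0 s y := funext e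
    have hT : ∀ w, mfderiv 𝓘(ℝ, V3) 𝓘(ℝ, ℝ) (fun y => H t (toCP y)) (Φ 0 t y) w =
        mfderiv I4 𝓘(ℝ, ℝ) (H t) (toCP (Φ 0 t y)) (mfderiv 𝓘(ℝ, V3) I4 toCP (Φ 0 t y) w) := by
      intro w
      have hHt : MDifferentiableAt I4 𝓘(ℝ, ℝ) (H t) (toCP (Φ 0 t y)) := by
        have : ContMDiff I4 𝓘(ℝ, ℝ) ∞ (H t) :=
          hH.comp (contMDiff_const (c := t) |>.prodMk contMDiff_id)
        exact (this _).mdifferentiableAt (by simp)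
      have := mfderiv_comp (I := 𝓘(ℝ, V3)) (I' := I4) (I'' := 𝓘(ℝ, ℝ)) (g := H t) (f := toCP)
        (Φ 0 t y) hHt ((contMDiffAt_toCP hne).mdifferentiableAt (by simp))
      exact congrArg (fun A => A w) this
    -- The base point is generalized to `q`, so that the tangent spaces at the two expressions for
    -- it are identified by substitution.
    have key : ∀ q : CP2, q = toCP (Φ 0 t y) → ∃ V : TangentSpace I4 q,
        HasMFDerivAt 𝓘(ℝ, ℝ) I4 (fun s => hΦ.diffeo s p) t
          (ContinuousLinearMap.toSpanSingleton ℝ V) ∧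
        ∀ w : TangentSpace I4 q, fsForm q V w = mfderiv I4 𝓘(ℝ, ℝ) (H t) q w := by
      rintro _ rfl
      refine ⟨mfderiv 𝓘(ℝ, V3) I4 toCP (Φ 0 t y) (homField H (t, Φ 0 t y)), ?_, fun w => ?_⟩
      · rw [e2]
        refine hc.congr_mfderiv ?_
        have h (A : V3 →L[ℝ] (Fin 2 → ℂ)) (v : V3) : A.comp (.toSpanSingleton ℝ v) =
            .toSpanSingleton ℝ (A v) := A.comp_toSpanSingleton v
        exact h _ _
      · obtain ⟨w, rfl⟩ := mfderiv_toCP_surjective hne w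
        have h1 := fsHom_homField hH (q := (t, Φ 0 t y)) hne w
        have h2 := hT w
        rw [mfderiv_eq_fderiv] at h2
        exact (fsForm_mfderiv_toCP hne (homField H (t, Φ 0 t y)) w).trans (h1.trans h2)
    exact key _ (e t)

end IsHamLift

end QuinticSmoothing
end

noncomputable section

open Filter

namespace QuinticSmoothing

variable {b : ℝ → ℝ} {ε C t : ℝ} {H : ℝ → CP2 → ℝ} {U : Set CP2} {Φ : ℝ → ℝ → V3 → V3}

/-! ### The flow moves the deformed curve -/

namespace ParamIndex

variable (i : ParamIndex)

/-- The radial coefficient which makes the velocity of the lift horizontal. -/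
def radialCoeff (b : ℝ → ℝ) (q : ℝ × ℂ) : ℂ :=
  -(herm (i.lift b q) (i.normalVel b q) * (hsq (i.lift b q) : ℂ)⁻¹)

/-- The horizontal part of the normal velocity. -/
def horVel (b : ℝ → ℝ) (q : ℝ × ℂ) : V3 := i.normalVel b q + i.radialCoeff b q • i.lift b q

lemma contDiffAt_radialCoeff (hb : IsTransition b ε) {q : ℝ × ℂ} (hq : q ∈ i.regular b) :
    ContDiffAt ℝ ∞ (i.radialCoeff b) q := by
  have h0 := i.contDiffAt_lift hb hq.1
  have h1 := ContDiffAt.herm h0 (i.contDiffAt_normalVel hb hq)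
  have h2 : ContDiffAt ℝ ∞ (fun q => ((hsq (i.lift b q) : ℝ) : ℂ)) q :=
    Complex.ofRealCLM.contDiff.contDiffAt.comp q (ContDiffAt.hsq h0)
  have h3 : ((hsq (i.lift b q) : ℝ) : ℂ) ≠ 0 := by
    exact_mod_cast (hsq_pos (i.lift_ne_zero hb q)).ne'
  exact (h1.mul (h2.inv h3)).neg

lemma herm_horVel (hb : IsTransition b ε) (q : ℝ × ℂ) : herm (i.horVel b q) (i.lift b q) = 0 := by
  have h3 : ((hsq (i.lift b q) : ℝ) : ℂ) ≠ 0 := by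
    exact_mod_cast (hsq_pos (i.lift_ne_zero hb q)).ne'
  rw [horVel, herm_add_left, herm_smul_left, herm_self, radialCoeff, map_neg, map_mul, map_inv₀, conj_herm,
    Complex.conj_ofReal, neg_mul, inv_mul_cancel_right₀ h3, add_neg_cancel]

/-- Both fields are horizontal and represent the differential prescribed on the curve, hence
coincide. -/
lemma homField_smul_lift (hb : IsGood b ε C) (hH : IsDeformHam b U H) (ht : t ∈ Icc (0 : ℝ) 1)
    {x : ℂ} (hx : (t, x) ∈ i.regular b) {a : ℂ} (ha : a ≠ 0) :
    homField H (t, a • i.lift b (t, x)) = a • i.horVel b (t, x) := by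
  have h0 := i.lift_ne_zero hb.tr (t, x)
  have h1 : homField H (t, i.lift b (t, x)) = i.horVel b (t, x) := by
    refine herm_eq_zero_of_fsHom h0 (herm_homField hH.smooth (q := (t, i.lift b (t, x))) h0)
      (i.herm_horVel hb.tr (t, x)) fun w => ?_
    have h2 := hH.deriv_curve t ht (i.param x) _ (i.param_ne_zero x) (i.quinticPoly_param x)
      (i.isNormalVel hb.tr hx) w
    rw [horVel, fsHom_add_left, fsHom_radial_left, add_zero]
    exact (fsHom_homField hH.smooth (q := (t, i.lift b (t, x))) h0 w).trans h2
  rw [← h1]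
  exact homField_smul hH.smooth (q := (t, i.lift b (t, x))) h0 ha

/-- The system is x' = `paramVel`, a' = a · `radialCoeff`, with time as a further component of
velocity 1. The first equation produces the normal velocity, the second keeps the lift horizontal;
the solution lies on the cone over the family by construction. -/
lemma exists_horizontal_curve (hb : IsTransition b ε) {τ : ℝ} {x₀ : ℂ} (hx : (τ, x₀) ∈ i.regular b)
    (a₀ : ℂ) : ∃ δ > 0, ∃ x a : ℝ → ℂ, x τ = x₀ ∧ a τ = a₀ ∧ ∀ t ∈ Ioo (τ - δ) (τ + δ),
      (t, x t) ∈ i.regular b ∧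
      HasDerivAt (fun t => a t • i.lift b (t, x t)) (a t • i.horVel b (t, x t)) t := by
  obtain ⟨α, h0, ε, hε, hα⟩ :=
    ContDiffAt.exists_forall_mem_closedBall_exists_eq_forall_mem_Ioo_hasDerivAt₀
      (f := fun p : (ℝ × ℂ) × ℂ => (((1 : ℝ), i.paramVel b p.1), p.2 * i.radialCoeff b p.1))
      (x₀ := ((τ, x₀), a₀)) (by
        have h1 : ContDiffAt ℝ ∞ (fun p : (ℝ × ℂ) × ℂ => i.paramVel b p.1) ((τ, x₀), a₀) :=
          ContDiffAt.comp (g := i.paramVel b) (f := fun p : (ℝ × ℂ) × ℂ => p.1) ((τ, x₀), a₀)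
            (i.contDiffAt_paramVel hb hx) contDiffAt_fst
        have h2 : ContDiffAt ℝ ∞ (fun p : (ℝ × ℂ) × ℂ => i.radialCoeff b p.1) ((τ, x₀), a₀) :=
          ContDiffAt.comp (g := i.radialCoeff b) (f := fun p : (ℝ × ℂ) × ℂ => p.1) ((τ, x₀), a₀)
            (i.contDiffAt_radialCoeff hb hx) contDiffAt_fst
        exact ((contDiffAt_const.prodMk h1).prodMk (contDiffAt_snd.mul h2)).of_le (by simp)) τ
  have hτ : τ ∈ Ioo (τ - ε) (τ + ε) := ⟨by linarith, by linarith⟩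
  have hd1 : ∀ t ∈ Ioo (τ - ε) (τ + ε),
      HasDerivAt (fun t => (α t).1) ((1 : ℝ), i.paramVel b (α t).1) t := fun t ht => (hα t ht).fst
  have hd2 : ∀ t ∈ Ioo (τ - ε) (τ + ε),
      HasDerivAt (fun t => (α t).2) ((α t).2 * i.radialCoeff b (α t).1) t :=
    fun t ht => (hα t ht).snd
  have hs : ∀ t ∈ Ioo (τ - ε) (τ + ε), HasDerivAt (fun t => (α t).1.1 - t) 0 t := fun t ht => by
    have h1 : HasDerivAt (fun t => (α t).1.1) 1 t := (hd1 t ht).fst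
    exact (h1.sub (hasDerivAt_id t)).congr_deriv (sub_self _)
  have htime : ∀ t ∈ Ioo (τ - ε) (τ + ε), (α t).1.1 = t := fun t ht => by
    have h := isOpen_Ioo.is_const_of_deriv_eq_zero (isPreconnected_Ioo)
      (fun t ht => (hs t ht).differentiableAt.differentiableWithinAt)
      (fun t ht => (hs t ht).deriv) ht hτ
    simp only [h0, sub_self] at h
    linarith
  have heq : ∀ t ∈ Ioo (τ - ε) (τ + ε), (α t).1 = (t, (α t).1.2) := fun t ht =>
    Prod.ext (htime t ht) rfl
  have hreg : ∀ᶠ t in 𝓝 τ, (α t).1 ∈ i.regular b := by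
    refine (hd1 τ hτ).continuousAt.eventually ((i.isOpen_regular hb).mem_nhds ?_)
    change (α τ).1 ∈ i.regular b
    rwa [h0]
  obtain ⟨δ, hδ, hδr⟩ := Metric.eventually_nhds_iff.1 hreg
  refine ⟨min ε δ, lt_min hε hδ, fun t => (α t).1.2, fun t => (α t).2, congrArg (fun p => p.1.2) h0, congrArg Prod.snd h0,
    fun t ht => ?_⟩
  have ht1 : t ∈ Ioo (τ - ε) (τ + ε) :=
    ⟨by linarith [ht.1, min_le_left ε δ], by linarith [ht.2, min_le_left ε δ]⟩
  have htr : (α t).1 ∈ i.regular b := hδr (by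
    rw [Real.dist_eq, abs_lt]
    constructor <;> linarith [ht.1, ht.2, min_le_right ε δ])
  have hl := HasFDerivAt.comp_hasDerivAt (l := i.lift b) (f := fun t => (α t).1)
    (l' := i.dLift b (α t).1) t (i.hasFDerivAt_lift hb htr.1) (hd1 t ht1)
  rw [← normalVel_eq] at hl
  have hZ := (hd2 t ht1).smul hl
  rw [← heq t ht1]
  refine And.intro htr ?_
  have he : (fun t => (α t).2 • i.lift b (t, (α t).1.2)) =ᶠ[𝓝 t]
      fun t => (α t).2 • (i.lift b ∘ fun t => (α t).1) t := by
    filter_upwards [isOpen_Ioo.mem_nhds ht1] with u hu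
    rw [← heq u hu]
    rfl
  refine HasDerivAt.congr_of_eventuallyEq ?_ he
  refine hZ.congr_deriv ?_
  rw [horVel, smul_add, smul_smul]
  rfl

end ParamIndex

namespace IsHamLift

/-- The horizontal curve on the cone has unit length and solves the lifted Hamiltonian equation, so
it is the orbit. Times are restricted to [0, 1] because the Hamiltonian is adapted to the curve only
there. -/
lemma exists_forall_mem_smoothedFamily (hΦ : IsHamLift H Φ) (hb : IsGood b ε C)
    (hH : IsDeformHam b U H) {s τ : ℝ} (hτ : τ ∈ Icc (0 : ℝ) 1) {y : V3} (hy : hsq y = 1)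
    (h : toCP (Φ s τ y) ∈ smoothedFamily b τ) :
    ∃ δ > 0, ∀ t ∈ Icc (0 : ℝ) 1, |t - τ| < δ → toCP (Φ s t y) ∈ smoothedFamily b t := by
  obtain ⟨p, hp, hpe⟩ := h
  obtain ⟨i, x₀, c, hx₀, hc, hpx⟩ := exists_param p.rep_nonzero hp
  have hp' : p = toCP (i.param x₀) := by
    rw [← toCP_rep p, hpx, toCP_smul hc (i.param_ne_zero x₀)]
  rw [hp', i.deform_toCP_param hb.tr] at hpe
  obtain ⟨a₀, ha₀, hw⟩ := (toCP_eq_iff (i.lift_ne_zero hb.tr _) (hΦ.ne_zero s τ hy)).1 hpe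
  obtain ⟨δ, hδ, x, a, hxτ, haτ, hd⟩ :=
    i.exists_horizontal_curve hb.tr (i.mem_regular hb hτ hx₀) a₀
  obtain ⟨Z, hZ⟩ : ∃ Z : ℝ → V3, Z = fun t => a t • i.lift b (t, x t) := ⟨_, rfl⟩
  have hZt : ∀ t, Z t = a t • i.lift b (t, x t) := fun t => by rw [hZ]
  have hZτ : Z τ = Φ s τ y := by rw [hZt, hxτ, haτ, hw]
  have hτδ : τ ∈ Ioo (τ - δ) (τ + δ) := ⟨by linarith, by linarith⟩
  have hZd : ∀ t ∈ Ioo (τ - δ) (τ + δ), HasDerivAt Z (a t • i.horVel b (t, x t)) t := fun t ht => by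
    rw [hZ]
    exact (hd t ht).2
  have hn : ∀ t ∈ Ioo (τ - δ) (τ + δ), HasDerivAt (fun t => hsq (Z t)) 0 t := fun t ht => by
    have h1 := hasDerivAt_hsq (hZd t ht)
    rwa [hZt, herm_smul_left, herm_smul_right, i.herm_horVel hb.tr, mul_zero, mul_zero,
      Complex.zero_re, mul_zero] at h1
  have hZ1 : ∀ t ∈ Ioo (τ - δ) (τ + δ), hsq (Z t) = 1 := fun t ht => by
    have h := isOpen_Ioo.is_const_of_deriv_eq_zero (isPreconnected_Ioo)
      (fun t ht => (hn t ht).differentiableAt.differentiableWithinAt)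
      (fun t ht => (hn t ht).deriv) ht hτδ
    rw [h, hZτ, hΦ.hsq_eq, hy]
  have ha : ∀ t ∈ Ioo (τ - δ) (τ + δ), a t ≠ 0 := fun t ht h => by
    refine ne_zero_of_hsq (hZ1 t ht) ?_
    rw [hZt, h, zero_smul]
  refine ⟨δ, hδ, fun t ht htτ => ?_⟩
  have htδ : t ∈ Ioo (τ - δ) (τ + δ) := by
    rw [abs_lt] at htτ
    constructor <;> linarith [htτ.1, htτ.2]
  have hsub1 : Icc (min τ t) (max τ t) ⊆ Icc 0 1 :=
    Icc_subset_Icc (le_min hτ.1 ht.1) (max_le hτ.2 ht.2)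
  have hsub2 : Icc (min τ t) (max τ t) ⊆ Ioo (τ - δ) (τ + δ) :=
    Icc_subset_Ioo (lt_min hτδ.1 htδ.1) (max_lt hτδ.2 htδ.2)
  have heq := hΦ.eqOn s y Z (min τ t) (max τ t) τ ⟨min_le_left _ _, le_max_left _ _⟩
    (fun u hu => by
      rw [hZt, i.homField_smul_lift hb hH (hsub1 hu) (hd u (hsub2 hu)).1 (ha u (hsub2 hu))]
      exact hZd u (hsub2 hu))
    (fun u hu => hZ1 u (hsub2 hu)) hZτ t ⟨min_le_right _ _, le_max_right _ _⟩
  rw [← heq, hZt, toCP_smul (ha t htδ) (i.lift_ne_zero hb.tr _), ← i.deform_toCP_param hb.tr]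
  exact ⟨_, i.toCP_param_mem _, rfl⟩

/-- The good times form an open set by the local step, and a closed one because the family is
compact in space-time; [0, 1] is connected. -/
lemma toCP_mem_smoothedFamily (hΦ : IsHamLift H Φ) (hb : IsGood b ε C)
    (hH : IsDeformHam b U H) {s t : ℝ} (hs : s ∈ Icc (0 : ℝ) 1) (ht : t ∈ Icc (0 : ℝ) 1) {y : V3}
    (hy : hsq y = 1) (h : toCP y ∈ smoothedFamily b s) : toCP (Φ s t y) ∈ smoothedFamily b t := by
  obtain ⟨A, hA⟩ : ∃ A : Set (Icc (0 : ℝ) 1),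
      A = {τ : Icc (0 : ℝ) 1 | toCP (Φ s τ y) ∈ smoothedFamily b τ} := ⟨_, rfl⟩
  have hc : Continuous fun τ : Icc (0 : ℝ) 1 => ((τ : ℝ), toCP (Φ s τ y)) := by
    refine continuous_subtype_val.prodMk (continuous_iff_continuousAt.2 fun τ => ?_)
    have h1 : Continuous fun τ : Icc (0 : ℝ) 1 => Φ s τ y :=
      hΦ.smooth.continuous.comp (f := fun τ : Icc (0 : ℝ) 1 => (s, (τ : ℝ), y)) (by fun_prop)
    exact ContinuousAt.comp (g := toCP) (continuousAt_toCP (hΦ.ne_zero s τ hy)) h1.continuousAt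
  have hclosed : IsClosed A := by
    have hK : IsClosed ((fun q : ℝ × fermatQuintic => (q.1, deform b q.1 q.2)) ''
        (Icc (0 : ℝ) 1 ×ˢ univ)) :=
      ((isCompact_Icc.prod isCompact_univ).image
        (continuous_fst.prodMk (continuous_deform hb.tr))).isClosed
    have hAK := hK.preimage hc
    convert hAK using 1
    rw [hA]
    ext τ
    constructor
    · rintro ⟨p, hp, hpe⟩
      exact ⟨(τ, ⟨p, hp⟩), ⟨τ.2, mem_univ _⟩, Prod.ext rfl hpe⟩
    · rintro ⟨⟨u, p⟩, -, hpe⟩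
      rw [Prod.mk.injEq] at hpe
      obtain ⟨rfl, hpe⟩ := hpe
      exact ⟨p, p.2, hpe⟩
  have hopen : IsOpen A := by
    refine Metric.isOpen_iff.2 fun τ hτ => ?_
    rw [hA] at hτ
    obtain ⟨δ, hδ, hδA⟩ := hΦ.exists_forall_mem_smoothedFamily hb hH τ.2 hy hτ
    refine ⟨δ, hδ, fun u hu => ?_⟩
    rw [hA]
    exact hδA u u.2 (by rwa [Metric.mem_ball, Subtype.dist_eq, Real.dist_eq] at hu)
  have hne : A.Nonempty := ⟨⟨s, hs⟩, by
    rw [hA]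
    change toCP (Φ s s y) ∈ smoothedFamily b s
    rwa [hΦ.self]⟩
  have huniv : A = univ := IsClopen.eq_univ ⟨hclosed, hopen⟩ hne
  have htA : (⟨t, ht⟩ : Icc (0 : ℝ) 1) ∈ A := huniv ▸ mem_univ _
  rw [hA] at htA
  exact htA

lemma hamFlow_mem (hΦ : IsHamLift H Φ) (hb : IsGood b ε C) (hH : IsDeformHam b U H) {s t : ℝ}
    (hs : s ∈ Icc (0 : ℝ) 1) (ht : t ∈ Icc (0 : ℝ) 1) {p : CP2} (h : p ∈ smoothedFamily b s) :
    hamFlow Φ s t p ∈ smoothedFamily b t :=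
  hΦ.toCP_mem_smoothedFamily hb hH hs ht (hsq_unitRep p.rep_nonzero)
    (by rwa [toCP_unitRep p.rep_nonzero, toCP_rep])

lemma hamFlow_fixed (hΦ : IsHamLift H Φ) {p : CP2} (h : ∀ t, homDeriv H (t, unitRep p.rep) = 0)
    (s t : ℝ) : hamFlow Φ s t p = p := by
  rw [hamFlow, hΦ.fixed s t _ h, toCP_unitRep p.rep_nonzero, toCP_rep]

end IsHamLift

lemma exists_hamiltonianIsotopy (hb : IsGood b ε C) (U : Set CP2)
    (hU : IsOpen U) (hSU : ∀ t ∈ Icc (0 : ℝ) 1, smoothedFamily b t ⊆ U) :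
    ∃ h : ℝ → CP2 ≃ₘ⟮I4, I4⟯ CP2, IsHamiltonianIsotopy h ∧
      ∀ t ∈ Icc (0 : ℝ) 1, h t '' smoothedFamily b 0 = smoothedFamily b t ∧
        (∀ p, p ∉ U → h t p = p) ∧ ∀ k, h t '' coordLine k = coordLine k := by
  obtain ⟨H, hH⟩ := exists_isDeformHam hb hU hSU
  obtain ⟨Φ, hΦ⟩ := exists_isHamLift hH
  have hne : ∀ p : CP2, unitRep p.rep ≠ 0 := fun p => ne_zero_of_hsq (hsq_unitRep p.rep_nonzero)
  have h01 : (0 : ℝ) ∈ Icc (0 : ℝ) 1 := ⟨le_rfl, zero_le_one⟩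
  refine ⟨hΦ.diffeo, hΦ.isHamiltonianIsotopy hH.smooth, fun t ht => ⟨?_, fun p hp => ?_, fun k => ?_⟩⟩
  · refine Subset.antisymm ?_ fun p hp => ?_
    · rintro _ ⟨p, hp, rfl⟩
      exact hΦ.hamFlow_mem hb hH h01 ht hp
    -- The invariance holds in both directions of time, and flowing back to time 0 gives
    -- surjectivity.
    · refine ⟨hamFlow Φ t 0 p, hΦ.hamFlow_mem hb hH ht h01 hp, ?_⟩
      rw [hΦ.diffeo_apply, hΦ.hamFlow_comp, hΦ.hamFlow_self]
  · refine hΦ.hamFlow_fixed (fun t => hH.deriv_compl t _ (hne p) ?_) 0 t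
    rwa [toCP_unitRep p.rep_nonzero, toCP_rep]
  · have hfix : ∀ p ∈ coordLine k, hΦ.diffeo t p = p := fun p hp => by
      refine hΦ.hamFlow_fixed (fun t => hH.deriv_line k t _ (hne p) ?_) 0 t
      change unitRep p.rep k = 0
      rw [unitRep, Pi.smul_apply, smul_eq_mul, show p.rep k = 0 from hp, mul_zero]
    rw [image_congr hfix, image_id']

end QuinticSmoothing
end

noncomputable section

namespace QuinticSmoothing

/-- The constant 1000 serves both estimates: 20 C ε ≤ 1/50 for positivity and 1/(5ε) ≥ 200 C for
monotonicity. Both are stated for C ≥ 1, hence the maximum. -/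
lemma exists_isGood (C : ℝ) : ∃ ε₀ : ℝ, 0 < ε₀ ∧ ∀ ε : ℝ, 0 < ε → ε < ε₀ → ∀ b : ℝ → ℝ,
    IsTransition b ε → (∀ a, |b a + deriv b a * a| ≤ C) → IsGood b ε (max C 1) := by
  have hC : 0 < max C 1 := lt_max_of_lt_right one_pos
  refine ⟨1 / (1000 * max C 1), by positivity, fun ε h0 h1 b hb h => ?_⟩
  refine ⟨hb, le_max_right _ _, h0, ?_, fun a => (h a).trans (le_max_left _ _)⟩
  rw [lt_div_iff₀ (by positivity)] at h1
  linarith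

end QuinticSmoothing

end

theorem lemma9p2 (C : ℝ) :
    ∃ ε₀ : ℝ, 0 < ε₀ ∧ ∀ ε : ℝ, 0 < ε → ε < ε₀ → ∀ b : ℝ → ℝ,
      QuinticSmoothing.IsTransition b ε → (∀ a, |b a + deriv b a * a| ≤ C) →
      (∃ (_ : ChartedSpace ℂ QuinticSmoothing.fermatQuintic)
          (_ : IsManifold 𝓘(ℝ, ℂ) ∞ QuinticSmoothing.fermatQuintic),
        QuinticSmoothing.IsSymplecticIsotopy
          (fun (t : ℝ) (p : QuinticSmoothing.fermatQuintic) => QuinticSmoothing.deform b t p)) ∧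
      (∀ U : Set QuinticSmoothing.CP2, IsOpen U →
        (∀ t ∈ Set.Icc (0 : ℝ) 1, QuinticSmoothing.smoothedFamily b t ⊆ U) →
        ∃ h : ℝ → QuinticSmoothing.CP2 ≃ₘ⟮QuinticSmoothing.I4, QuinticSmoothing.I4⟯
            QuinticSmoothing.CP2,
          QuinticSmoothing.IsHamiltonianIsotopy h ∧
          ∀ t ∈ Set.Icc (0 : ℝ) 1,
            h t '' QuinticSmoothing.smoothedFamily b 0 = QuinticSmoothing.smoothedFamily b t ∧
            (∀ p, p ∉ U → h t p = p) ∧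
            ∀ k, h t '' QuinticSmoothing.coordLine k = QuinticSmoothing.coordLine k) := by
  obtain ⟨ε₀, h0, h⟩ := QuinticSmoothing.exists_isGood C
  refine ⟨ε₀, h0, fun ε hε hε₀ b hb hC => ?_⟩
  have hg := h ε hε hε₀ b hb hC
  exact ⟨⟨inferInstance, inferInstance, QuinticSmoothing.isSymplecticIsotopy_deform hg⟩,
    fun U hU hSU => QuinticSmoothing.exists_hamiltonianIsotopy hg U hU hSU⟩
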